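/- Work over $\mathbb C$. For an integral scheme $V$ over $\mathbb C$, let $\operatorname{Pic}(V)$ be the group of (Cartier) divisors modulo linear equivalence, $M_V\subset\operatorname{Pic}(V)$ the monoid of classes of effective divisors, $h^0(V,D)=\dim_{\mathbb C}H^0(V,\mathcal O_V(D))$, and $$E^1(V)=\sum_{D\in M_V}h^0(V,D)\,t^D\in\mathbb Z[[M_V]],$$ where $\mathbb Z[[M_V]]$ is the set of functions $M_V\to\mathbb Z$, with the convolution product. Let $p\ge 1$, let $r_1,\dots,r_p\ge 2$, and let $P\subset\mathbb P^{r_1}\times\cdots\times\mathbb P^{r_p}$ be the pull-back of a hyperplane $H\subset\mathbb P^{r_{j_0}}$. Let $\Lambda$ be a finite set of closed points lying on $P$; if $\Lambda\neq\emptyset$, assume moreover that $\dim P\geq 2$, i.e. $(p,r_1)\neq(1,2)$. Let $\pi:X\to\mathbb P^{r_1}\times\cdots\times\mathbb P^{r_p}$ be the blow-up at $\Lambda$ and let $i:\widehat P\hookrightarrow X$ be the proper transform of $P$, that is, the closure of $\pi^{-1}(P\setminus\Lambda)$ with its reduced structure. Then $\widehat P$ is an effective Cartier divisor on $X$, all the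 spaces $H^0$ of divisors on $X$ and on $\widehat P$ are finite-dimensional, and the following hold. 1. The pull-back $i^*:\operatorname{Pic}(X)\to\operatorname{Pic}(\widehat P)$ is an isomorphism. 2. The set $$L_{\widehat P}=\{D\in\operatorname{Pic}(X): h^0(X,D)>h^0(X,D-\widehat P)\}$$ is a submonoid of $\operatorname{Pic}(X)$ contained in $M_X$, and $i^*$ maps it isomorphically onto the effective monoid $M_{\widehat P}$. 3. If $\mathbb Z[[M_{\widehat P}]]$ is regarded as a subset of $\mathbb Z[[M_X]]$ (extension by zero) through the resulting embedding $(i^*)^{-1}:M_{\widehat P}\cong L_{\widehat P}\subset M_X$, then $$(1-t^{\widehat P})\,E^1(X)=E^1(\widehat P).$$ 4. For every $D\in L_{\widehat P}$, $$h^0(\widehat P,i^*D)=h^0(X,D)-h^0(X,D-\widehat P).$$ -/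

import Mathlib

namespace EulerChow

open AlgebraicGeometry CategoryTheory Limits TopologicalSpace

noncomputable section

/-! ### Cartier divisors and the Picard group of an integral scheme -/

section Divisors

variable (X : Scheme.{0}) [IsIntegral X]

/-- The inclusion of the units of the local ring at `x` into the nonzero rational functions. -/
def unitsIncl (x : X) : (X.presheaf.stalk x)ˣ →* (X.functionField)ˣ :=
  Units.map (algebraMap (X.presheaf.stalk x) X.functionField).toMonoidHom

/-- The stalk `K(X)ˣ / 𝒪_{X,x}ˣ` at `x` of the sheaf of Cartier divisors, written additively. -/
def LocalDivisor (x : X) : Type :=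
  Additive ((X.functionField)ˣ ⧸ (unitsIncl X x).range)

instance (x : X) : AddCommGroup (LocalDivisor X x) :=
  inferInstanceAs (AddCommGroup (Additive ((X.functionField)ˣ ⧸ (unitsIncl X x).range)))

variable {X}

/-- The germ at `x` of the divisor of the nonzero rational function `f`. -/
def divAt (x : X) (f : (X.functionField)ˣ) : LocalDivisor X x :=
  Additive.ofMul (QuotientGroup.mk f)

lemma divAt_one (x : X) : divAt x (1 : (X.functionField)ˣ) = 0 := rfl

lemma divAt_mul (x : X) (f g : (X.functionField)ˣ) :
    divAt x (f * g) = divAt x f + divAt x g := rfl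

lemma divAt_inv (x : X) (f : (X.functionField)ˣ) : divAt x f⁻¹ = -divAt x f := rfl

lemma divAt_eq_iff (x : X) (f g : (X.functionField)ˣ) :
    divAt x f = divAt x g ↔ ∃ u, f * unitsIncl X x u = g := by
  constructor
  · intro h
    obtain ⟨u, hu⟩ := QuotientGroup.eq.mp (Additive.ofMul.injective h)
    exact ⟨u, by rw [hu, mul_inv_cancel_left]⟩
  · rintro ⟨u, rfl⟩
    exact congrArg Additive.ofMul (QuotientGroup.eq.mpr ⟨u, by rw [inv_mul_cancel_left]⟩)

lemma divAt_surjective (x : X) : Function.Surjective (divAt x) := fun d => by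
  obtain ⟨f, hf⟩ := QuotientGroup.mk_surjective (Additive.toMul d)
  exact ⟨f, congrArg Additive.ofMul hf⟩

variable (X) in
/-- Cartier divisors on an integral scheme: the global sections of the sheaf `Kˣ / 𝒪ˣ`, that is,
the families of germs that are locally the divisor of one rational function (a local equation). -/
def CartierDivisor : AddSubgroup (∀ x : X, LocalDivisor X x) where
  carrier := {D | ∀ x : X, ∃ U : X.Opens, x ∈ U ∧ ∃ f : (X.functionField)ˣ,
    ∀ y ∈ U, D y = divAt y f}
  zero_mem' x := ⟨⊤, trivial, 1, fun _ _ => rfl⟩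
  add_mem' {D E} hD hE x := by
    obtain ⟨U, hxU, f, hf⟩ := hD x
    obtain ⟨V, hxV, g, hg⟩ := hE x
    refine ⟨U ⊓ V, ⟨hxU, hxV⟩, f * g, fun y hy => ?_⟩
    rw [Pi.add_apply, hf y hy.1, hg y hy.2, divAt_mul]
  neg_mem' {D} hD x := by
    obtain ⟨U, hxU, f, hf⟩ := hD x
    refine ⟨U, hxU, f⁻¹, fun y hy => ?_⟩
    rw [Pi.neg_apply, hf y hy, divAt_inv]

variable (X) in
/-- The principal divisor of a nonzero rational function. -/
def principal : Additive (X.functionField)ˣ →+ CartierDivisor X where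
  toFun f := ⟨fun x => divAt x f.toMul, fun _ => ⟨⊤, trivial, f.toMul, fun _ _ => rfl⟩⟩
  map_zero' := rfl
  map_add' _ _ := rfl

variable (X) in
/-- The Picard group of an integral scheme: Cartier divisors modulo linear equivalence
(`D ↦ 𝒪(D)` identifies it with the group of isomorphism classes of invertible sheaves). -/
def Pic : Type := CartierDivisor X ⧸ (principal X).range

instance : AddCommGroup (Pic X) :=
  inferInstanceAs (AddCommGroup (CartierDivisor X ⧸ (principal X).range))

/-- The class of a divisor in the Picard group. -/
def Pic.mk (D : CartierDivisor X) : Pic X := QuotientAddGroup.mk D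

lemma Pic.mk_surjective : Function.Surjective (Pic.mk : CartierDivisor X → Pic X) :=
  QuotientAddGroup.mk_surjective

lemma Pic.mk_eq_iff {D E : CartierDivisor X} :
    Pic.mk D = Pic.mk E ↔ ∃ f : (X.functionField)ˣ, ∀ x, E.1 x = D.1 x + divAt x f := by
  constructor
  · intro h
    obtain ⟨f, hf⟩ := QuotientAddGroup.eq.mp h
    refine ⟨f.toMul, fun x => ?_⟩
    have := congrFun (congrArg Subtype.val hf) x
    change divAt x f.toMul = -D.1 x + E.1 x at this
    rw [this, add_neg_cancel_left]
  · rintro ⟨f, hf⟩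
    refine QuotientAddGroup.eq.mpr ⟨Additive.ofMul f, Subtype.ext (funext fun x => ?_)⟩
    change divAt x f = -D.1 x + E.1 x
    rw [hf x, neg_add_cancel_left]

/-- A divisor is effective if all its local equations are regular. -/
def IsEffective (D : CartierDivisor X) : Prop :=
  ∀ x : X, ∃ g : (X.functionField)ˣ, D.1 x = divAt x g ∧
    (g : X.functionField) ∈ (algebraMap (X.presheaf.stalk x) X.functionField).range

variable (X) in
/-- The effective monoid `M_X`: effective divisors modulo linear equivalence. -/
def effMonoid : AddSubmonoid (Pic X) where
  carrier := {c | ∃ D : CartierDivisor X, IsEffective D ∧ Pic.mk D = c}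
  zero_mem' := ⟨0, fun _ => ⟨1, rfl, 1, map_one _⟩, rfl⟩
  add_mem' := by
    rintro _ _ ⟨D, hD, rfl⟩ ⟨E, hE, rfl⟩
    refine ⟨D + E, fun x => ?_, rfl⟩
    obtain ⟨f, hf, hf'⟩ := hD x
    obtain ⟨g, hg, hg'⟩ := hE x
    refine ⟨f * g, ?_, by simpa using mul_mem hf' hg'⟩
    rw [divAt_mul, ← hf, ← hg]
    rfl

/-- `D` is the effective Cartier divisor defined by the ideal sheaf `I`: locally `I` is generated
by one nonzero function, and that function is a local equation of `D`. -/
def IsDivisorOf (D : CartierDivisor X) (I : X.IdealSheafData) : Prop :=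
  ∀ x : X, ∃ (U : X.affineOpens) (hx : x ∈ U.1) (f : Γ(X, U.1)), f ≠ 0 ∧
    I.ideal U = Ideal.span {f} ∧
    ∃ g : (X.functionField)ˣ,
      (g : X.functionField) = algebraMap (X.presheaf.stalk x) X.functionField
        (X.presheaf.germ U.1 x hx f) ∧
      ∀ y ∈ U.1, D.1 y = divAt y g

end Divisors

/-! ### Global sections -/

section Sections

variable {X : Scheme.{0}} [IsIntegral X] (s : X ⟶ Spec (.of ℂ))

/-- The function field of an integral scheme over `ℂ` with structure morphism `s`, as a
`ℂ`-algebra. -/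
def FunctionField (_ : X ⟶ Spec (.of ℂ)) : Type := X.functionField

instance : Field (FunctionField s) := inferInstanceAs (Field X.functionField)

/-- The map `ℂ → Γ(X, 𝒪_X)` given by the structure morphism. -/
def constants : ℂ →+* Γ(X, ⊤) :=
  s.appTop.hom.comp (Scheme.ΓSpecIso (.of ℂ)).inv.hom

instance : Algebra ℂ (FunctionField s) :=
  ((X.presheaf.germ ⊤ (genericPoint X) trivial).hom.comp (constants s)).toAlgebra

lemma algebraMap_mem (x : X) (c : ℂ) :
    (algebraMap ℂ (FunctionField s) c : X.functionField) ∈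
      (algebraMap (X.presheaf.stalk x) X.functionField).range := by
  have : Nonempty (⊤ : X.Opens) := ⟨⟨x, trivial⟩⟩
  exact ⟨X.presheaf.germ ⊤ x trivial (constants s c),
    X.algebraMap_germ_eq_germToFunctionField (U := ⊤) (x := x) trivial _⟩

/-- The space `H⁰(X, 𝒪(D))` of the rational functions `φ` with `div φ + D ≥ 0`, and `φ = 0`:
`φ` times a local equation of `D` is regular at every point. -/
def H0 (D : CartierDivisor X) : Submodule ℂ (FunctionField s) where
  carrier := {φ | ∀ (x : X) (g : (X.functionField)ˣ), D.1 x = divAt x g →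
    (show X.functionField from φ) * g ∈
      (algebraMap (X.presheaf.stalk x) X.functionField).range}
  zero_mem' x g _ := by
    change (0 : X.functionField) * g ∈ _
    rw [zero_mul]
    exact zero_mem _
  add_mem' {φ ψ} hφ hψ x g hg := by
    have h := add_mem (hφ x g hg) (hψ x g hg)
    rw [← add_mul] at h
    exact h
  smul_mem' c φ hφ x g hg := by
    have h := mul_mem (algebraMap_mem s x c) (hφ x g hg)
    change (show X.functionField from algebraMap ℂ (FunctionField s) c) *
      ((show X.functionField from φ) * g) ∈ _ at h
    rw [← mul_assoc] at h
    rw [Algebra.smul_def]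
    exact h

lemma H0_mul_mem {D E : CartierDivisor X} (f : (X.functionField)ˣ)
    (h : ∀ x, D.1 x = E.1 x + divAt x f) {φ : FunctionField s} (hφ : φ ∈ H0 s D) :
    φ * (show FunctionField s from (f : X.functionField)) ∈ H0 s E := by
  intro x g hg
  have := hφ x (g * f) (by rw [divAt_mul, h x, hg])
  change (show X.functionField from φ) * f * g ∈ _
  rwa [Units.val_mul, mul_comm (g : X.functionField), ← mul_assoc] at this

/-- Linearly equivalent divisors have isomorphic spaces of sections. -/
def H0Equiv {D E : CartierDivisor X} (f : (X.functionField)ˣ)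
    (h : ∀ x, E.1 x = D.1 x + divAt x f) : H0 s E ≃ₗ[ℂ] H0 s D :=
  have h' : ∀ x, D.1 x = E.1 x + divAt x f⁻¹ := fun x => by
    rw [h x, divAt_inv, add_neg_cancel_right]
  { toFun := fun φ => ⟨_, H0_mul_mem s f h φ.2⟩
    invFun := fun φ => ⟨_, H0_mul_mem s f⁻¹ h' φ.2⟩
    map_add' := fun φ ψ => Subtype.ext (add_mul _ _ _)
    map_smul' := fun c φ => Subtype.ext (smul_mul_assoc _ _ _)
    left_inv := fun φ => Subtype.ext (by
      change (show X.functionField from φ.1) * f * ((f⁻¹ : (X.functionField)ˣ)) = φ.1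
      rw [mul_assoc, Units.mul_inv, mul_one])
    right_inv := fun φ => Subtype.ext (by
      change (show X.functionField from φ.1) * ((f⁻¹ : (X.functionField)ˣ)) * f = φ.1
      rw [mul_assoc, Units.inv_mul, mul_one]) }

/-- `h⁰(X, D)` for a divisor class `D`: the dimension of `H⁰(X, 𝒪(D))`. -/
def h0 (c : Pic X) : ℕ :=
  Quotient.liftOn' c (fun D => Module.finrank ℂ (H0 s D)) (by
    intro D E h
    obtain ⟨f, hf⟩ := Pic.mk_eq_iff.mp
      (show Pic.mk D = Pic.mk E from Quotient.sound' h)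
    exact (H0Equiv s f hf).finrank_eq.symm)

lemma h0_mk (D : CartierDivisor X) : h0 s (Pic.mk D) = Module.finrank ℂ (H0 s D) := rfl

end Sections

/-! ### Pull-back of divisor classes -/

section Pullback

variable {Z X : Scheme.{0}} [IsIntegral Z] [IsIntegral X] (i : Z ⟶ X)

/-- A unit of the local ring of `X` at the image of the generic point of `Z`, restricted to a
nonzero rational function on `Z`. -/
def resUnits : (X.presheaf.stalk (i (genericPoint Z)))ˣ →* (Z.functionField)ˣ :=
  Units.map (i.stalkMap (genericPoint Z)).hom.toMonoidHom

/-- `E = i^* D` as divisors: near each point of `i(Z)` the divisor `D` has a local equation that is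
invertible at the image of the generic point of `Z`, and its restriction to `Z` is a local equation
of `E`. (This says in particular that `i(Z)` is not contained in the support of `D`.) -/
def IsPullbackDivisor (D : CartierDivisor X) (E : CartierDivisor Z) : Prop :=
  ∀ z : Z, ∃ u : (X.presheaf.stalk (i (genericPoint Z)))ˣ,
    D.1 (i z) = divAt (i z) (unitsIncl X (i (genericPoint Z)) u) ∧
    E.1 z = divAt z (resUnits i u)

lemma specializes_generic {Z X : Scheme.{0}} [IsIntegral Z] (i : Z ⟶ X) (z : Z) : i (genericPoint Z) ⤳ i z :=
  ((genericPoint_spec Z).specializes trivial).map i.continuous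

lemma unitsIncl_specializes {x y : X} (h : x ⤳ y) (v : (X.presheaf.stalk y)ˣ) :
    unitsIncl X x (Units.map (X.presheaf.stalkSpecializes h).hom.toMonoidHom v) =
      unitsIncl X y v := by
  refine Units.ext ?_
  change (X.presheaf.stalkSpecializes h ≫ X.presheaf.stalkSpecializes _) (v : X.presheaf.stalk y) =
    X.presheaf.stalkSpecializes _ (v : X.presheaf.stalk y)
  rw [X.presheaf.stalkSpecializes_comp]

lemma unitsIncl_injective (x : X) : Function.Injective (unitsIncl X x) :=
  Units.map_injective (IsFractionRing.injective (X.presheaf.stalk x) X.functionField)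

/-- If two functions define the same germ of a divisor at `i z`, so do their restrictions. -/
lemma divAt_resUnits {z : Z} {u u' : (X.presheaf.stalk (i (genericPoint Z)))ˣ}
    (h : divAt (i z) (unitsIncl X _ u) = divAt (i z) (unitsIncl X _ u')) :
    divAt z (resUnits i u) = divAt z (resUnits i u') := by
  obtain ⟨v, hv⟩ := (divAt_eq_iff _ _ _).mp h
  rw [← unitsIncl_specializes (specializes_generic i z) v, ← map_mul] at hv
  have hv' := unitsIncl_injective _ hv
  refine (divAt_eq_iff _ _ _).mpr ⟨Units.map (i.stalkMap z).hom.toMonoidHom v, ?_⟩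
  rw [← hv', map_mul]
  congr 1
  refine Units.ext ?_
  exact (Scheme.Hom.stalkSpecializes_stalkMap_apply i (genericPoint Z) z
    ((genericPoint_spec Z).specializes trivial) v).symm

/-- A rational function whose divisor has trivial germ at `x` is a unit at `x`. -/
lemma exists_unit_of_divAt_eq_zero {x : X} {f : (X.functionField)ˣ} (h : divAt x f = 0) :
    ∃ u, unitsIncl X x u = f := by
  obtain ⟨u, hu⟩ := (divAt_eq_iff x 1 f).mp (by rw [h, divAt_one])
  exact ⟨u, by rw [← hu, one_mul]⟩

lemma exists_local {D : CartierDivisor X} (hD : D.1 (i (genericPoint Z)) = 0) (z : Z) :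
    ∃ U : Z.Opens, z ∈ U ∧ ∃ u : (X.presheaf.stalk (i (genericPoint Z)))ˣ,
      ∀ y ∈ U, D.1 (i y) = divAt (i y) (unitsIncl X _ u) := by
  obtain ⟨U, hzU, f, hf⟩ := D.2 (i z)
  have h0 : divAt (i (genericPoint Z)) f = 0 := by
    rw [← hf _ ((specializes_generic i z).mem_open U.2 hzU), hD]
  obtain ⟨u, rfl⟩ := exists_unit_of_divAt_eq_zero h0
  exact ⟨i ⁻¹ᵁ U, hzU, u, fun y hy => hf _ hy⟩

lemma exists_isPullbackDivisor_of_eq_zero {D : CartierDivisor X}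
    (hD : D.1 (i (genericPoint Z)) = 0) : ∃ E, IsPullbackDivisor i D E := by
  choose U hU u hu using exists_local i hD
  refine ⟨⟨fun z => divAt z (resUnits i (u z)), fun z => ⟨U z, hU z, resUnits i (u z),
    fun y hy => ?_⟩⟩, fun z => ⟨u z, hu z z (hU z), rfl⟩⟩
  exact divAt_resUnits i ((hu y y (hU y)).symm.trans (hu z y hy))

lemma exists_isPullbackDivisor (c : Pic X) :
    ∃ (D : CartierDivisor X) (E : CartierDivisor Z), Pic.mk D = c ∧ IsPullbackDivisor i D E := by
  obtain ⟨D, rfl⟩ := Pic.mk_surjective c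
  obtain ⟨g, hg⟩ := divAt_surjective _ (D.1 (i (genericPoint Z)))
  let D' : CartierDivisor X := D - principal X (Additive.ofMul g)
  have h0 : D'.1 (i (genericPoint Z)) = 0 := by
    change D.1 _ - divAt _ g = 0
    rw [hg, sub_self]
  obtain ⟨E, hE⟩ := exists_isPullbackDivisor_of_eq_zero i h0
  refine ⟨D', E, Pic.mk_eq_iff.mpr ⟨g, fun x => ?_⟩, hE⟩
  change D.1 x = D.1 x - divAt x g + divAt x g
  rw [sub_add_cancel]

lemma IsPullbackDivisor.add {D D' : CartierDivisor X} {E E' : CartierDivisor Z}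
    (h : IsPullbackDivisor i D E) (h' : IsPullbackDivisor i D' E') :
    IsPullbackDivisor i (D + D') (E + E') := by
  intro z
  obtain ⟨u, hu, hu'⟩ := h z
  obtain ⟨v, hv, hv'⟩ := h' z
  refine ⟨u * v, ?_, ?_⟩
  · rw [map_mul, divAt_mul, ← hu, ← hv]
    rfl
  · rw [map_mul, divAt_mul, ← hu', ← hv']
    rfl

lemma IsPullbackDivisor.apply_generic {D : CartierDivisor X} {E : CartierDivisor Z}
    (h : IsPullbackDivisor i D E) : D.1 (i (genericPoint Z)) = 0 := by
  obtain ⟨u, hu, -⟩ := h (genericPoint Z)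
  rw [hu, ← divAt_one, eq_comm, divAt_eq_iff]
  exact ⟨u, one_mul _⟩

/-- Pull-back respects linear equivalence. -/
lemma IsPullbackDivisor.mk_eq {D D' : CartierDivisor X} {E E' : CartierDivisor Z}
    (h : IsPullbackDivisor i D E) (h' : IsPullbackDivisor i D' E') (hDD' : Pic.mk D = Pic.mk D') :
    Pic.mk E = Pic.mk E' := by
  obtain ⟨f, hf⟩ := Pic.mk_eq_iff.mp hDD'
  have h0 : divAt (i (genericPoint Z)) f = 0 := by
    have := hf (i (genericPoint Z))
    rwa [h.apply_generic, h'.apply_generic, zero_add, eq_comm] at this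
  obtain ⟨w, rfl⟩ := exists_unit_of_divAt_eq_zero h0
  refine Pic.mk_eq_iff.mpr ⟨resUnits i w, fun z => ?_⟩
  obtain ⟨u, hu, hu'⟩ := h z
  obtain ⟨v, hv, hv'⟩ := h' z
  rw [hu', hv', ← divAt_mul, ← map_mul]
  refine divAt_resUnits i ?_
  rw [map_mul, divAt_mul, ← hu, ← hv, hf]

/-- The pull-back `i^* : Pic X → Pic Z`, the class of `i^* D` for any divisor `D` in the given class
whose support does not contain `i(Z)`. -/
def Pic.pullback : Pic X →+ Pic Z :=
  AddMonoidHom.mk' (fun c => Pic.mk (exists_isPullbackDivisor i c).choose_spec.choose) (by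
    intro c d
    have hc := (exists_isPullbackDivisor i c).choose_spec.choose_spec
    have hd := (exists_isPullbackDivisor i d).choose_spec.choose_spec
    have hcd := (exists_isPullbackDivisor i (c + d)).choose_spec.choose_spec
    refine hcd.2.mk_eq i (hc.2.add i hd.2) ?_
    rw [hcd.1]
    exact (congrArg₂ (· + ·) hc.1 hd.1).symm)

lemma Pic.pullback_mk {D : CartierDivisor X} {E : CartierDivisor Z}
    (h : IsPullbackDivisor i D E) : Pic.pullback i (Pic.mk D) = Pic.mk E := by
  have hD := (exists_isPullbackDivisor i (Pic.mk D)).choose_spec.choose_spec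
  exact hD.2.mk_eq i h hD.1

end Pullback

/-! ### Euler-Chow series -/

section Series

/-- `ℤ[[M]]`: the functions from the additive monoid `M` to `ℤ`; the function `a` stands for the
series `∑ a_D t^D`. -/
abbrev Series (M : Type) : Type := M → ℤ

/-- The monomial `t^D`. -/
def tpow {M : Type} (D : M) : Series M := Set.indicator {D} 1

/-- The convolution product of series. -/
def conv {M : Type} [AddMonoid M] (a b : Series M) : Series M :=
  fun D => ∑ᶠ q : {q : M × M // q.1 + q.2 = D}, a q.1.1 * b q.1.2

/-- The Euler-Chow series `E¹(X) = ∑_{D ∈ M_X} h⁰(X, 𝒪(D)) t^D` in `ℤ[[M_X]]`. -/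
def eulerChow {X : Scheme.{0}} [IsIntegral X] (s : X ⟶ Spec (.of ℂ)) : Series (effMonoid X) :=
  fun D => (h0 s D.1 : ℤ)

end Series

/-! ### Products of projective spaces, and blow-ups -/

section Geometry

/-- The grading of `ℂ[x₀, …, x_r]` by degree. -/
abbrev grading (r : ℕ) : ℕ → Submodule ℂ (MvPolynomial (Fin (r + 1)) ℂ) :=
  MvPolynomial.homogeneousSubmodule (Fin (r + 1)) ℂ

instance instGradedAlgebraGrading (r : ℕ) : GradedAlgebra (grading r) :=
  MvPolynomial.gradedAlgebra

/-- The projective space `ℙ^r = Proj ℂ[x₀, …, x_r]` over `ℂ`. -/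
def projectiveSpace (r : ℕ) : Over (Spec (.of ℂ)) :=
  Over.mk (Y := Proj (grading r)) (Proj.toSpecZero (grading r) ≫
    Spec.map (CommRingCat.ofHom (algebraMap ℂ (grading r 0))))

/-- The set of points of `ℙ^r` where the form `l` vanishes. -/
def vanishingLocus {r : ℕ} (l : MvPolynomial (Fin (r + 1)) ℂ) : Set (projectiveSpace r).left :=
  {x | l ∈ (show Proj (grading r) from x).asHomogeneousIdeal}

/-- The product `ℙ^{r₁} × ⋯ × ℙ^{r_p}` over `ℂ`. -/
def prodProj {p : ℕ} (r : Fin p → ℕ) : Over (Spec (.of ℂ)) :=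
  ∏ᶜ fun j => projectiveSpace (r j)

/-- The projections of the product. -/
def prodProjection {p : ℕ} (r : Fin p → ℕ) (j : Fin p) :
    (prodProj r).left ⟶ (projectiveSpace (r j)).left :=
  (Pi.π (fun j => projectiveSpace (r j)) j).left

/-- An ideal sheaf is invertible if it is locally generated by one nonzerodivisor. -/
def IsInvertibleIdeal {X : Scheme.{0}} (I : X.IdealSheafData) : Prop :=
  ∀ x : X, ∃ U : X.affineOpens, x ∈ U.1 ∧ ∃ f ∈ nonZeroDivisors Γ(X, U.1),
    I.ideal U = Ideal.span {f}

/-- `π : X ⟶ Y` is the blow-up of `Y` along the ideal sheaf `I`: the inverse image ideal sheaf of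
`I` is invertible, and `π` is universal with this property. -/
structure IsBlowup {X Y : Scheme.{0}} (π : X ⟶ Y) (I : Y.IdealSheafData) : Prop where
  invertible : IsInvertibleIdeal (I.comap π)
  existsUnique_lift : ∀ {T : Scheme.{0}} (f : T ⟶ Y), IsInvertibleIdeal (I.comap f) →
    ∃! g : T ⟶ X, g ≫ π = f

end Geometry

end

end EulerChow

/-! In each factor choose a basis of linear forms containing a form u_j that vanishes at no point of
Λ; in the factor j₀ the basis also contains the form l that cuts out P. The chart where all u_j are
nonzero is an affine space containing Λ. On the blow-up X, the hyperplanes at infinity u_j = 0 and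
the exceptional divisors form a boundary with index set J ⊕ Λ, whose complement is the affine space
minus Λ. The points of Λ have codimension at least two, so removing them loses no prime divisor. A
polynomial ring is factorial and its units are the nonzero constants. Hence Pic X is free on the
boundary divisors, and the sections of ∑ n_b D_b are the polynomials ψ with ord_b ψ + n_b ≥ 0 for
all b (`BoundaryModel`, `Atlas.boundaryModel`).

The proper transform is a space of the same kind with the coordinate l removed
(`IsTransform.atlas_restrict`). The numerical hypotheses say exactly what is needed for this: every
factor keeps a coordinate other than u_j, so that there is still a hyperplane at infinity, and if Λ
is nonempty at least two affine coordinates remain. So the Picard group of the proper transform is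
free on the same index set. Each boundary divisor of X restricts to the one with the same index,
with multiplicity one (`IsTransform.isPullbackDivisor`), which makes i^* bijective.

The heart of the matter is that sections lift (`IsTransform.exists_section`). A section on the
proper transform is a polynomial in the coordinates other than l. Reading the same polynomial on X
does not worsen its order along any boundary divisor; for the exceptional divisors this uses that
the centres lie on P, so that their l-coordinate is zero. Together with the description of the
kernel of restriction this gives h⁰(X, D) = h⁰(X, D - F) + h⁰(Z, i^*D) for every D, where Z is the
proper transform and F its class (`finrank_restrict`). The remaining assertions follow formally: a
class is effective exactly when its h⁰ is positive, and the coefficient of (1 - t^F) E¹(X) at D is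
h⁰(D) - h⁰(D - F), also when D - F is not effective (`eulerChow_restrict`).

These computations take place inside the function field: a point is handled through its local ring
there, usually presented as the localization of a polynomial ring at a prime (`Centered`, `IsChart`,
`Atlas`). The other half of the work is to find such charts on X, which is known only through its
universal property and is not assumed separated or of finite type. The candidates are the standard
affine charts away from Λ and the schemes given by x_v = c_v + x_v x_k over a centre c. The inverse
image ideal is invertible on them, so they map to X; finite type lets the local inverse spread out
to an open neighbourhood (`IsBlowup.exists_isChart`). These charts reach every point, because a
principal ideal in a local domain is generated by one member of any generating family
(`exists_dvd_of_span_eq`). -/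

namespace EulerChow
open AlgebraicGeometry CategoryTheory Limits TopologicalSpace
noncomputable section

/-! ### Local rings as subrings of the function field -/

section LocalRings

variable {X : Scheme.{0}} [IsIntegral X]

/-- The local ring at `x`, as a subring of the function field. -/
def ringAt (x : X) : Subring X.functionField :=
  (algebraMap (X.presheaf.stalk x) X.functionField).range

/-- The maximal ideal of the local ring at `x`, as a subset of the function field. -/
def idealAt (x : X) : Set X.functionField :=
  algebraMap (X.presheaf.stalk x) X.functionField ''
    (IsLocalRing.maximalIdeal (X.presheaf.stalk x) : Set (X.presheaf.stalk x))

lemma algebraMap_stalk_injective (x : X) :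
    Function.Injective (algebraMap (X.presheaf.stalk x) X.functionField) :=
  IsFractionRing.injective _ _

lemma algebraMap_mem_ringAt {x : X} (a : X.presheaf.stalk x) :
    algebraMap (X.presheaf.stalk x) X.functionField a ∈ ringAt x := ⟨a, rfl⟩

lemma algebraMap_mem_idealAt {x : X} {a : X.presheaf.stalk x} :
    algebraMap (X.presheaf.stalk x) X.functionField a ∈ idealAt x ↔
      a ∈ IsLocalRing.maximalIdeal (X.presheaf.stalk x) :=
  (algebraMap_stalk_injective x).mem_set_image

lemma idealAt_subset {x : X} {f : X.functionField} (h : f ∈ idealAt x) : f ∈ ringAt x := by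
  obtain ⟨a, -, rfl⟩ := h
  exact ⟨a, rfl⟩

lemma zero_mem_idealAt (x : X) : (0 : X.functionField) ∈ idealAt x :=
  ⟨0, zero_mem _, map_zero _⟩

lemma one_notMem_idealAt (x : X) : (1 : X.functionField) ∉ idealAt x := by
  rw [← map_one (algebraMap (X.presheaf.stalk x) X.functionField), algebraMap_mem_idealAt]
  exact (Ideal.ne_top_iff_one _).mp (IsLocalRing.maximalIdeal.isMaximal _).ne_top

lemma idealAt_add {x : X} {f g : X.functionField} (hf : f ∈ idealAt x) (hg : g ∈ idealAt x) :
    f + g ∈ idealAt x := by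
  obtain ⟨a, ha, rfl⟩ := hf
  obtain ⟨b, hb, rfl⟩ := hg
  exact ⟨a + b, add_mem ha hb, map_add _ _ _⟩

lemma idealAt_neg {x : X} {f : X.functionField} (hf : f ∈ idealAt x) : -f ∈ idealAt x := by
  obtain ⟨a, ha, rfl⟩ := hf
  exact ⟨-a, neg_mem ha, map_neg _ _⟩

lemma idealAt_sub {x : X} {f g : X.functionField} (hf : f ∈ idealAt x) (hg : g ∈ idealAt x) :
    f - g ∈ idealAt x := by
  rw [sub_eq_add_neg]
  exact idealAt_add hf (idealAt_neg hg)

lemma idealAt_mul {x : X} {f g : X.functionField} (hf : f ∈ ringAt x) (hg : g ∈ idealAt x) :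
    f * g ∈ idealAt x := by
  obtain ⟨a, rfl⟩ := hf
  obtain ⟨b, hb, rfl⟩ := hg
  exact ⟨a * b, Ideal.mul_mem_left _ _ hb, map_mul _ _ _⟩

lemma inv_mem_ringAt {x : X} {f : X.functionField} (hf : f ∈ ringAt x) (hf' : f ∉ idealAt x) :
    f⁻¹ ∈ ringAt x := by
  obtain ⟨a, rfl⟩ := hf
  rw [algebraMap_mem_idealAt, IsLocalRing.mem_maximalIdeal, mem_nonunits_iff, not_not] at hf'
  obtain ⟨u, rfl⟩ := hf'
  refine ⟨(u⁻¹ : (X.presheaf.stalk x)ˣ), eq_inv_of_mul_eq_one_left ?_⟩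
  rw [← map_mul, Units.inv_mul, map_one]

lemma notMem_idealAt_of_inv {x : X} {f : X.functionField} (hf0 : f ≠ 0) (hf : f⁻¹ ∈ ringAt x) :
    f ∉ idealAt x := fun h => one_notMem_idealAt x (by
  rw [← inv_mul_cancel₀ hf0]
  exact idealAt_mul hf h)

/-- The maximal ideal consists of the nonunits, so it is determined by the subring alone; this is
why points can later be compared by `ringAt`. -/
lemma mem_idealAt_iff {x : X} {f : X.functionField} :
    f ∈ idealAt x ↔ f ∈ ringAt x ∧ (f = 0 ∨ f⁻¹ ∉ ringAt x) := by
  constructor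
  · refine fun h => ⟨idealAt_subset h, ?_⟩
    by_contra! hc
    exact notMem_idealAt_of_inv hc.1 hc.2 h
  · rintro ⟨h, h'⟩
    by_contra hc
    rcases h' with rfl | h'
    · exact hc (zero_mem_idealAt x)
    · exact h' (inv_mem_ringAt h hc)

lemma idealAt_congr {x y : X} (h : ringAt x = ringAt y) : idealAt x = idealAt y := by
  ext f
  rw [mem_idealAt_iff, mem_idealAt_iff, h]

lemma ringAt_le_of_specializes {x y : X} (h : x ⤳ y) : ringAt y ≤ ringAt x := by
  rintro _ ⟨a, rfl⟩
  refine ⟨X.presheaf.stalkSpecializes h a, ?_⟩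
  change (X.presheaf.stalkSpecializes h ≫ X.presheaf.stalkSpecializes _) a =
    X.presheaf.stalkSpecializes _ a
  rw [X.presheaf.stalkSpecializes_comp]

lemma mem_range_unitsIncl {x : X} {f : (X.functionField)ˣ} :
    f ∈ (unitsIncl X x).range ↔
      (f : X.functionField) ∈ ringAt x ∧ (f : X.functionField)⁻¹ ∈ ringAt x := by
  constructor
  · rintro ⟨u, rfl⟩
    refine ⟨⟨u, rfl⟩, ?_⟩
    rw [← Units.val_inv_eq_inv_val, ← map_inv]
    exact ⟨_, rfl⟩
  · rintro ⟨⟨a, ha⟩, ⟨b, hb⟩⟩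
    have hab : a * b = 1 := algebraMap_stalk_injective x (by
      rw [map_mul, ha, hb, map_one, mul_inv_cancel₀ f.ne_zero])
    exact ⟨⟨a, b, hab, by rw [mul_comm, hab]⟩, Units.ext ha⟩

lemma divAt_eq_zero_iff {x : X} {f : (X.functionField)ˣ} :
    divAt x f = 0 ↔ (f : X.functionField) ∈ ringAt x ∧ (f : X.functionField)⁻¹ ∈ ringAt x := by
  rw [← mem_range_unitsIncl]
  constructor
  · intro h
    obtain ⟨u, hu⟩ := exists_unit_of_divAt_eq_zero h
    exact ⟨u, hu⟩
  · rintro ⟨u, rfl⟩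
    rw [← divAt_one, eq_comm, divAt_eq_iff]
    exact ⟨u, one_mul _⟩

lemma divAt_eq_iff_div {x : X} {f g : (X.functionField)ˣ} :
    divAt x f = divAt x g ↔ divAt x (f * g⁻¹) = 0 := by
  rw [divAt_mul, divAt_inv, ← sub_eq_add_neg, sub_eq_zero]

/-- `a : A → K(X)` presents the local ring at `x` as the localization of `A` at `𝔭`. -/
structure Centered {A : Type*} [CommRing A] (a : A →+* X.functionField) (x : X) (𝔭 : Ideal A) :
    Prop where
  prime : 𝔭.IsPrime
  mem : ∀ f, a f ∈ ringAt x
  van : ∀ f, a f ∈ idealAt x ↔ f ∈ 𝔭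
  frac : ∀ φ ∈ ringAt x, ∃ f h, h ∉ 𝔭 ∧ φ * a h = a f

namespace Centered

variable {A : Type*} [CommRing A] {a : A →+* X.functionField} {x y : X} {𝔭 : Ideal A}

lemma ne_zero (h : Centered a x 𝔭) {f : A} (hf : f ∉ 𝔭) : a f ≠ 0 := fun h0 =>
  hf ((h.van f).mp (h0 ▸ zero_mem_idealAt x))

lemma inv_mem (h : Centered a x 𝔭) {f : A} (hf : f ∉ 𝔭) : (a f)⁻¹ ∈ ringAt x :=
  inv_mem_ringAt (h.mem f) (fun h' => hf ((h.van f).mp h'))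

lemma mem_ringAt_iff (h : Centered a x 𝔭) {φ : X.functionField} :
    φ ∈ ringAt x ↔ ∃ f g, g ∉ 𝔭 ∧ φ * a g = a f := by
  refine ⟨h.frac φ, ?_⟩
  rintro ⟨f, g, hg, e⟩
  rw [(eq_mul_inv_iff_mul_eq₀ (h.ne_zero hg)).mpr e]
  exact mul_mem (h.mem f) (h.inv_mem hg)

lemma ringAt_eq (hx : Centered a x 𝔭) (hy : Centered a y 𝔭) : ringAt x = ringAt y := by
  ext φ
  rw [hx.mem_ringAt_iff, hy.mem_ringAt_iff]

end Centered

end LocalRings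


/-! ### Orders along points with discrete valuation ring -/

section PrimeDivisors

variable {X : Scheme.{0}} [IsIntegral X]

/-- The points of codimension one, as far as their local ring is regular. -/
def IsPrimeDiv (ξ : X) : Prop := IsDiscreteValuationRing (X.presheaf.stalk ξ)

/-- The order is minus the exponent of the multiplicative adic valuation, whose value at a
uniformizer is `exp (-1)`. Later arguments use only that the order is a homomorphism with these two
properties. -/
lemma exists_ordHom {ξ : X} (hξ : IsPrimeDiv ξ) :
    ∃ v : Additive (X.functionField)ˣ →+ ℤ,
      (∀ f : (X.functionField)ˣ, 0 ≤ v (.ofMul f) ↔ (f : X.functionField) ∈ ringAt ξ) ∧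
        Function.Surjective v := by
  have : IsDiscreteValuationRing (X.presheaf.stalk ξ) := hξ
  let w := (IsDiscreteValuationRing.maximalIdeal (X.presheaf.stalk ξ)).valuation X.functionField
  let v' : (X.functionField)ˣ →* Multiplicative ℤ :=
    (WithZero.unitsWithZeroEquiv (α := Multiplicative ℤ)).toMonoidHom.comp
      (Units.map (w : X.functionField →* _))
  have hv' (f : (X.functionField)ˣ) : ((v' f : Multiplicative ℤ) : WithZero (Multiplicative ℤ)) =
      w f := WithZero.coe_unitsWithZeroEquiv_eq_units_val _
  let v : Additive (X.functionField)ˣ →+ ℤ :=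
    { toFun := fun f => -(v' f.toMul).toAdd
      map_zero' := by simp
      map_add' := fun f g => by
        simp only [toMul_add, map_mul, toAdd_mul]
        ring }
  refine ⟨v, fun f => ?_, ?_⟩
  · have h1 : 0 ≤ v (.ofMul f) ↔ w f ≤ 1 := by
      rw [← hv', ← WithZero.coe_one, WithZero.coe_le_coe]
      change 0 ≤ -(v' f).toAdd ↔ _
      rw [Left.nonneg_neg_iff, ← toAdd_one, Multiplicative.toAdd_le]
    rw [h1]
    constructor
    · intro h
      obtain ⟨a, ha⟩ := IsDiscreteValuationRing.exists_lift_of_le_one h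
      exact ⟨a, ha⟩
    · rintro ⟨a, ha⟩
      rw [← ha]
      exact IsDedekindDomain.HeightOneSpectrum.valuation_le_one _ a
  · obtain ⟨π, hπ⟩ := IsDedekindDomain.HeightOneSpectrum.valuation_exists_uniformizer
      X.functionField (IsDiscreteValuationRing.maximalIdeal (X.presheaf.stalk ξ))
    have hπ0 : π ≠ 0 := by
      rintro rfl
      rw [map_zero] at hπ
      exact WithZero.exp_ne_zero hπ.symm
    have h1 : v (.ofMul (Units.mk0 π hπ0)) = 1 := by
      have h2 : ((v' (Units.mk0 π hπ0) : Multiplicative ℤ) : WithZero (Multiplicative ℤ)) =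
          WithZero.exp (-1) := (hv' _).trans hπ
      have h3 : v' (Units.mk0 π hπ0) = Multiplicative.ofAdd (-1) := WithZero.coe_injective h2
      change -(v' (Units.mk0 π hπ0)).toAdd = 1
      rw [h3]
      rfl
    intro n
    exact ⟨n • .ofMul (Units.mk0 π hπ0), by rw [map_zsmul, h1, smul_eq_mul, mul_one]⟩

open Classical in
/-- The order of a nonzero rational function at a point (zero unless the local ring is a discrete
valuation ring). -/
def ordHom (ξ : X) : Additive (X.functionField)ˣ →+ ℤ :=
  if h : IsPrimeDiv ξ then (exists_ordHom h).choose else 0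

/-- The order of a nonzero rational function at a point. -/
def ord (ξ : X) (f : (X.functionField)ˣ) : ℤ := ordHom ξ (.ofMul f)

lemma ord_nonneg_iff {ξ : X} (hξ : IsPrimeDiv ξ) {f : (X.functionField)ˣ} :
    0 ≤ ord ξ f ↔ (f : X.functionField) ∈ ringAt ξ := by
  rw [ord, ordHom, dif_pos hξ]
  exact (exists_ordHom hξ).choose_spec.1 f

lemma ord_surjective {ξ : X} (hξ : IsPrimeDiv ξ) (n : ℤ) : ∃ f, ord ξ f = n := by
  obtain ⟨f, hf⟩ := (exists_ordHom hξ).choose_spec.2 n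
  refine ⟨f.toMul, ?_⟩
  rw [ord, ordHom, dif_pos hξ]
  exact hf

lemma ord_mul (ξ : X) (f g : (X.functionField)ˣ) : ord ξ (f * g) = ord ξ f + ord ξ g :=
  map_add (ordHom ξ) (.ofMul f) (.ofMul g)

lemma ord_one (ξ : X) : ord ξ 1 = 0 := map_zero (ordHom ξ)

lemma ord_inv (ξ : X) (f : (X.functionField)ˣ) : ord ξ f⁻¹ = -ord ξ f :=
  map_neg (ordHom ξ) (.ofMul f)

lemma ord_zpow (ξ : X) (f : (X.functionField)ˣ) (n : ℤ) : ord ξ (f ^ n) = n * ord ξ f := by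
  have := map_zsmul (ordHom ξ) n (.ofMul f)
  rw [smul_eq_mul] at this
  exact this

lemma ord_prod {ι : Type*} (ξ : X) (s : Finset ι) (f : ι → (X.functionField)ˣ) :
    ord ξ (∏ j ∈ s, f j) = ∑ j ∈ s, ord ξ (f j) := by
  have := map_sum (ordHom ξ) (fun j => Additive.ofMul (f j)) s
  rw [← ofMul_prod] at this
  exact this

lemma ord_eq_zero_iff {ξ : X} (hξ : IsPrimeDiv ξ) {f : (X.functionField)ˣ} :
    ord ξ f = 0 ↔ (f : X.functionField) ∈ ringAt ξ ∧ (f : X.functionField)⁻¹ ∈ ringAt ξ := by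
  rw [← Units.val_inv_eq_inv_val, ← ord_nonneg_iff hξ, ← ord_nonneg_iff hξ, ord_inv]
  omega

lemma ord_pos_iff {ξ : X} (hξ : IsPrimeDiv ξ) {f : (X.functionField)ˣ} :
    0 < ord ξ f ↔ (f : X.functionField) ∈ idealAt ξ := by
  rw [mem_idealAt_iff, ← Units.val_inv_eq_inv_val, ← ord_nonneg_iff hξ, ← ord_nonneg_iff hξ,
    ord_inv, or_iff_right f.ne_zero]
  omega

lemma ord_of_isPrimeDiv_false {ξ : X} (hξ : ¬ IsPrimeDiv ξ) (f : (X.functionField)ˣ) :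
    ord ξ f = 0 := by
  rw [ord, ordHom, dif_neg hξ]
  rfl

/-- The order of the germ of a divisor. -/
def ordDiv (ξ : X) : LocalDivisor X ξ →+ ℤ :=
  MonoidHom.toAdditiveLeft (QuotientGroup.lift _ (AddMonoidHom.toMultiplicativeRight (ordHom ξ))
    (by
      rintro f hf
      change ord ξ f = 0
      by_cases hξ : IsPrimeDiv ξ
      · exact (ord_eq_zero_iff hξ).mpr (mem_range_unitsIncl.mp hf)
      · exact ord_of_isPrimeDiv_false hξ f))

lemma ordDiv_divAt (ξ : X) (f : (X.functionField)ˣ) : ordDiv ξ (divAt ξ f) = ord ξ f := rfl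

lemma ordDiv_injective {ξ : X} (hξ : IsPrimeDiv ξ) : Function.Injective (ordDiv ξ) := by
  rw [injective_iff_map_eq_zero]
  intro d hd
  obtain ⟨f, rfl⟩ := divAt_surjective ξ d
  rw [ordDiv_divAt, ord_eq_zero_iff hξ] at hd
  exact divAt_eq_zero_iff.mpr hd

/-- The factorization as power of ϖ times unit characterizes discrete valuation rings; here it is
tested in the function field instead of in the stalk. -/
lemma isPrimeDiv_of_uniformizer {ξ : X} {ϖ : X.functionField} (hϖ0 : ϖ ≠ 0) (hϖ : ϖ ∈ idealAt ξ)
    (h : ∀ f ∈ ringAt ξ, f ≠ 0 → ∃ n : ℕ, ∃ u ∈ ringAt ξ, u⁻¹ ∈ ringAt ξ ∧ f = ϖ ^ n * u) :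
    IsPrimeDiv ξ := by
  obtain ⟨p, hp, rfl⟩ := hϖ
  have hp0 : p ≠ 0 := by
    rintro rfl
    exact hϖ0 (map_zero _)
  have key : ∀ x : X.presheaf.stalk ξ, x ≠ 0 → ∃ n : ℕ, Associated (p ^ n) x := by
    intro x hx
    obtain ⟨n, u, ⟨u, rfl⟩, ⟨v, hv⟩, e⟩ := h _ (algebraMap_mem_ringAt x)
      ((map_ne_zero_iff _ (algebraMap_stalk_injective ξ)).mpr hx)
    rw [← map_pow, ← map_mul] at e
    have e' := algebraMap_stalk_injective ξ e
    have hu : u ≠ 0 := by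
      rintro rfl
      exact hx (by rw [e', mul_zero])
    have huv : u * v = 1 := algebraMap_stalk_injective ξ (by
      rw [map_mul, hv, map_one, mul_inv_cancel₀]
      exact (map_ne_zero_iff _ (algebraMap_stalk_injective ξ)).mpr hu)
    exact ⟨n, ⟨u, v, huv, by rw [mul_comm, huv]⟩, e'.symm⟩
  refine IsDiscreteValuationRing.ofHasUnitMulPowIrreducibleFactorization ⟨p, ⟨hp, ?_⟩, ?_⟩
  · intro a b hab
    have ha : a ≠ 0 := by
      rintro rfl
      exact hp0 (by rw [hab, zero_mul])
    have hb : b ≠ 0 := by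
      rintro rfl
      exact hp0 (by rw [hab, mul_zero])
    obtain ⟨n, u, hu⟩ := key a ha
    obtain ⟨m, v, hv⟩ := key b hb
    by_contra! hc
    have hn : n ≠ 0 := by
      rintro rfl
      exact hc.1 (by rw [← hu, pow_zero, one_mul]; exact u.isUnit)
    have hm : m ≠ 0 := by
      rintro rfl
      exact hc.2 (by rw [← hv, pow_zero, one_mul]; exact v.isUnit)
    obtain ⟨n, rfl⟩ := Nat.exists_eq_succ_of_ne_zero hn
    obtain ⟨m, rfl⟩ := Nat.exists_eq_succ_of_ne_zero hm
    -- If both factors of p were nonunits, each would be divisible by p, hence p by p², and p would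
    -- be a unit.
    have e : p * 1 = p * (p * (p ^ n * u * p ^ m * v)) := by
      calc p * 1 = a * b := by rw [mul_one, hab]
        _ = _ := by
          rw [← hu, ← hv]
          simp only [Nat.succ_eq_add_one, pow_succ]
          ring
    exact hp (IsUnit.of_mul_eq_one _ (mul_left_cancel₀ hp0 e).symm)
  · intro x hx
    exact key x hx

variable {A : Type*} [CommRing A] {a : A →+* X.functionField} {ξ : X} {𝔭 : Ideal A}

/-- A prime ideal whose local ring is a discrete valuation ring is generated by any prime element
that it contains. -/
lemma Centered.eq_span [IsDomain A] (h : Centered a ξ 𝔭) (ha : Function.Injective a)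
    (hξ : IsPrimeDiv ξ) {q : A} (hq : Prime q) (hq𝔭 : q ∈ 𝔭) : 𝔭 = Ideal.span {q} := by
  refine le_antisymm (fun f hf => ?_) ((Ideal.span_singleton_le_iff_mem _).mpr hq𝔭)
  rw [Ideal.mem_span_singleton]
  by_cases hf0 : f = 0
  · rw [hf0]; exact dvd_zero q
  have haf : a f ≠ 0 := (map_ne_zero_iff a ha).mpr hf0
  have haq : a q ≠ 0 := (map_ne_zero_iff a ha).mpr hq.ne_zero
  have h1 : 0 < ord ξ (Units.mk0 _ haf) := (ord_pos_iff hξ).mpr ((h.van f).mpr hf)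
  have h2 : 0 < ord ξ (Units.mk0 _ haq) := (ord_pos_iff hξ).mpr ((h.van q).mpr hq𝔭)
  -- For such n the quotient fⁿ / q is regular at ξ. Written as c / s with s outside the prime, it
  -- gives q ∣ fⁿ s, and q does not divide s.
  obtain ⟨n, hn⟩ : ∃ n : ℕ, ord ξ (Units.mk0 _ haq) ≤ n * ord ξ (Units.mk0 _ haf) :=
    ⟨(ord ξ (Units.mk0 _ haq)).toNat, by
      rw [Int.toNat_of_nonneg h2.le]
      nlinarith⟩
  have h3 : 0 ≤ ord ξ (Units.mk0 _ haf ^ (n : ℤ) * (Units.mk0 _ haq)⁻¹) := by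
    rw [ord_mul, ord_zpow, ord_inv]
    omega
  rw [ord_nonneg_iff hξ] at h3
  obtain ⟨c, s, hs, e⟩ := h.frac _ h3
  have e' : f ^ n * s = q * c := ha (by
    rw [map_mul, map_pow, map_mul, ← e]
    simp only [Units.val_mul, zpow_natCast, Units.val_pow_eq_pow_val, Units.val_mk0,
      Units.val_inv_eq_inv_val]
    field_simp)
  have hqs : ¬ q ∣ s := fun hd => hs (Ideal.mem_of_dvd _ hd hq𝔭)
  have h4 : q ∣ f ^ n * s := ⟨c, e'⟩
  exact hq.dvd_of_dvd_pow ((hq.dvd_or_dvd h4).resolve_right hqs)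

lemma exists_prime_mem [IsDomain A] [UniqueFactorizationMonoid A] (hprime : 𝔭.IsPrime) {f : A}
    (hf0 : f ≠ 0) (hf : f ∈ 𝔭) : ∃ q, Prime q ∧ q ∣ f ∧ q ∈ 𝔭 := by
  obtain ⟨s, hs, hsf⟩ := UniqueFactorizationMonoid.exists_prime_factors f hf0
  have h1 : s.prod ∈ 𝔭 := Ideal.mem_of_dvd _ hsf.dvd' hf
  obtain ⟨q, hqs, hq⟩ := (hprime.multiset_prod_mem_iff_exists_mem s).mp h1
  exact ⟨q, hs q hqs, (Multiset.dvd_prod hqs).trans hsf.dvd, hq⟩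

/-- The prime is nonzero, because the numerator of a uniformizer lies in it; and a nonzero element
of a prime of a factorial ring has a prime factor there. -/
lemma Centered.exists_prime_eq_span [IsDomain A] [UniqueFactorizationMonoid A]
    (h : Centered a ξ 𝔭) (ha : Function.Injective a) (hξ : IsPrimeDiv ξ) :
    ∃ q, Prime q ∧ 𝔭 = Ideal.span {q} := by
  have hne : 𝔭 ≠ ⊥ := by
    rintro rfl
    obtain ⟨ϖ, hϖ⟩ := ord_surjective hξ 1
    have hϖ' := (ord_pos_iff hξ).mp (hϖ ▸ one_pos)
    obtain ⟨f, s, hs, e⟩ := h.frac _ (idealAt_subset hϖ')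
    have hf : a f ∈ idealAt ξ := by
      rw [← e, mul_comm]
      exact idealAt_mul (h.mem s) hϖ'
    rw [h.van, Ideal.mem_bot] at hf
    rw [hf, map_zero] at e
    exact (mul_ne_zero ϖ.ne_zero (h.ne_zero hs)) e
  obtain ⟨f, hf, hf0⟩ := Submodule.exists_mem_ne_zero_of_ne_bot hne
  obtain ⟨q, hq, -, hq𝔭⟩ := exists_prime_mem h.prime hf0 hf
  exact ⟨q, hq, h.eq_span ha hξ hq hq𝔭⟩

lemma exists_eq_pow_mul [IsDomain A] [UniqueFactorizationMonoid A] {q : A} (hq : Prime q) {f : A}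
    (hf : f ≠ 0) : ∃ (n : ℕ) (g : A), ¬ q ∣ g ∧ f = q ^ n * g := by
  obtain ⟨g, e, hg⟩ := (FiniteMultiplicity.of_not_isUnit hq.not_isUnit
    hf).exists_eq_pow_mul_and_not_dvd
  exact ⟨_, g, hg, e⟩

/-- Splitting off the power of q from the numerator of a fraction shows that q is a uniformizer. -/
lemma Centered.isPrimeDiv [IsDomain A] [UniqueFactorizationMonoid A] {q : A}
    (h : Centered a ξ (Ideal.span {q})) (ha : Function.Injective a) (hq : Prime q) :
    IsPrimeDiv ξ := by
  refine isPrimeDiv_of_uniformizer ((map_ne_zero_iff a ha).mpr hq.ne_zero)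
    ((h.van q).mpr (Ideal.mem_span_singleton_self q)) fun φ hφ hφ0 => ?_
  obtain ⟨f, s, hs, e⟩ := h.frac φ hφ
  have hf0 : f ≠ 0 := by
    rintro rfl
    rw [map_zero] at e
    exact mul_ne_zero hφ0 (h.ne_zero hs) e
  obtain ⟨n, g, hg, rfl⟩ := exists_eq_pow_mul hq hf0
  rw [← Ideal.mem_span_singleton] at hg
  refine ⟨n, a g * (a s)⁻¹, mul_mem (h.mem g) (h.inv_mem hs), ?_, ?_⟩
  · rw [mul_inv, inv_inv]
    exact mul_mem (h.inv_mem hg) (h.mem s)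
  · rw [map_mul, map_pow] at e
    rw [← mul_assoc]
    exact (eq_mul_inv_iff_mul_eq₀ (h.ne_zero hs)).mpr e

lemma Centered.ord_eq_zero (h : Centered a ξ 𝔭) {f : A} (hf : f ∉ 𝔭) :
    ord ξ (Units.mk0 _ (h.ne_zero hf)) = 0 := by
  by_cases hξ : IsPrimeDiv ξ
  · exact (ord_eq_zero_iff hξ).mpr ⟨h.mem f, h.inv_mem hf⟩
  · exact ord_of_isPrimeDiv_false hξ _

lemma ord_eq_zero_of_mem {f : (X.functionField)ˣ} (h : (f : X.functionField) ∈ ringAt ξ)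
    (h' : (f : X.functionField) ∉ idealAt ξ) : ord ξ f = 0 := by
  by_cases hξ : IsPrimeDiv ξ
  · exact (ord_eq_zero_iff hξ).mpr ⟨h, inv_mem_ringAt h h'⟩
  · exact ord_of_isPrimeDiv_false hξ _

/-- A uniformizer has numerator divisible by q, so its quotient by q is regular and q has order at
most one; the order is positive since q lies in the prime. -/
lemma Centered.ord_eq_one [IsDomain A] [UniqueFactorizationMonoid A] {q : A}
    (h : Centered a ξ (Ideal.span {q})) (ha : Function.Injective a) (hq : Prime q)
    (u : (X.functionField)ˣ) (hu : (u : X.functionField) = a q) : ord ξ u = 1 := by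
  have hξ := h.isPrimeDiv ha hq
  have hpos : 0 < ord ξ u := by
    rw [ord_pos_iff hξ, hu, h.van]
    exact Ideal.mem_span_singleton_self q
  obtain ⟨ϖ, hϖ⟩ := ord_surjective hξ 1
  have hϖ' := (ord_pos_iff hξ).mp (hϖ ▸ one_pos)
  obtain ⟨f, s, hs, e⟩ := h.frac _ (idealAt_subset hϖ')
  have hf : a f ∈ idealAt ξ := by
    rw [← e, mul_comm]
    exact idealAt_mul (h.mem s) hϖ'
  rw [h.van, Ideal.mem_span_singleton] at hf
  obtain ⟨c, rfl⟩ := hf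
  have h1 : 0 ≤ ord ξ (ϖ * u⁻¹) := by
    rw [ord_nonneg_iff hξ, Units.val_mul, Units.val_inv_eq_inv_val, hu]
    rw [map_mul, mul_comm (a q)] at e
    rw [(eq_mul_inv_iff_mul_eq₀ (h.ne_zero hs)).mpr e]
    have haq : a q ≠ 0 := (map_ne_zero_iff a ha).mpr hq.ne_zero
    have : a c * a q * (a s)⁻¹ * (a q)⁻¹ = a c * (a s)⁻¹ := by field_simp
    rw [this]
    exact mul_mem (h.mem c) (h.inv_mem hs)
  rw [ord_mul, ord_inv, hϖ] at h1
  omega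

end PrimeDivisors


/-! ### Affine charts inside the function field -/

section Charts

variable {X : Scheme.{0}} [IsIntegral X]

lemma genericPoint_mem {U : X.Opens} {x : X} (hx : x ∈ U) : genericPoint X ∈ U :=
  ((genericPoint_spec X).specializes trivial).mem_open U.2 hx

/-- The germ of a section at the generic point. -/
def toK (U : X.Opens) (h : genericPoint X ∈ U) : Γ(X, U) →+* X.functionField :=
  (X.presheaf.germ U (genericPoint X) h).hom

lemma algebraMap_germ {U : X.Opens} {x : X} (hx : x ∈ U) (f : Γ(X, U)) :
    algebraMap (X.presheaf.stalk x) X.functionField (X.presheaf.germ U x hx f) =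
      toK U (genericPoint_mem hx) f := by
  change (X.presheaf.germ U x hx ≫ X.presheaf.stalkSpecializes _) f = _
  rw [X.presheaf.germ_stalkSpecializes]
  rfl

lemma toK_injective (U : X.Opens) (h : genericPoint X ∈ U) : Function.Injective (toK U h) := by
  have : Nonempty U := ⟨⟨_, h⟩⟩
  exact X.germToFunctionField_injective U

lemma toK_mem {U : X.Opens} {x : X} (hx : x ∈ U) (f : Γ(X, U)) :
    toK U (genericPoint_mem hx) f ∈ ringAt x := ⟨_, algebraMap_germ hx f⟩

lemma isDomain_section {U : X.Opens} (h : genericPoint X ∈ U) : IsDomain Γ(X, U) :=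
  (toK_injective U h).isDomain _

lemma IsAffineOpen.centered_fromSpec {U : X.Opens} (hU : IsAffineOpen U)
    (h : genericPoint X ∈ U) (y : PrimeSpectrum Γ(X, U)) :
    Centered (toK U h) (hU.fromSpec y) y.asIdeal := by
  have hy : hU.fromSpec y ∈ U := by
    have := Set.mem_range_self (f := hU.fromSpec) y
    rwa [hU.range_fromSpec] at this
  let _ := TopCat.Presheaf.algebra_section_stalk X.presheaf (⟨hU.fromSpec y, hy⟩ : U)
  have hloc : IsLocalization y.asIdeal.primeCompl (X.presheaf.stalk (hU.fromSpec y)) :=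
    hU.isLocalization_stalk' y hy
  have halg (f : Γ(X, U)) : algebraMap (X.presheaf.stalk (hU.fromSpec y)) X.functionField
      (algebraMap Γ(X, U) (X.presheaf.stalk (hU.fromSpec y)) f) = toK U h f :=
    algebraMap_germ hy f
  refine ⟨y.isPrime, fun f => toK_mem hy f, fun f => ?_, ?_⟩
  · rw [← halg, algebraMap_mem_idealAt]
    exact @IsLocalization.AtPrime.to_map_mem_maximal_iff _ _ _ _ _ _ _ hloc _ _
  · rintro _ ⟨a, rfl⟩
    obtain ⟨⟨f, s⟩, e⟩ := IsLocalization.surj y.asIdeal.primeCompl a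
    refine ⟨f, s, s.2, ?_⟩
    rw [← halg, ← halg, ← e, map_mul]

lemma IsAffineOpen.exists_centered {U : X.Opens} (hU : IsAffineOpen U) {x : X} (hx : x ∈ U) :
    ∃ 𝔭, Centered (toK U (genericPoint_mem hx)) x 𝔭 := by
  have := IsAffineOpen.centered_fromSpec hU (genericPoint_mem hx) (hU.primeIdealOf ⟨x, hx⟩)
  rw [hU.fromSpec_primeIdealOf] at this
  exact ⟨_, this⟩

lemma IsAffineOpen.exists_point {U : X.Opens} (hU : IsAffineOpen U) (h : genericPoint X ∈ U)
    {𝔭 : Ideal Γ(X, U)} (h𝔭 : 𝔭.IsPrime) : ∃ x ∈ U, Centered (toK U h) x 𝔭 := by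
  refine ⟨hU.fromSpec ⟨𝔭, h𝔭⟩, ?_, IsAffineOpen.centered_fromSpec hU h ⟨𝔭, h𝔭⟩⟩
  have := Set.mem_range_self (f := hU.fromSpec) (⟨𝔭, h𝔭⟩ : PrimeSpectrum Γ(X, U))
  rwa [hU.range_fromSpec] at this

/-- Being centred at a prime determines that prime as the set of functions vanishing at the point,
and in an affine scheme specialization is inclusion of primes. -/
lemma Centered.specializes {U : X.Opens} (hU : IsAffineOpen U) {x y : X} (hx : x ∈ U) (hy : y ∈ U)
    {𝔭 𝔮 : Ideal Γ(X, U)} (h𝔭 : Centered (toK U (genericPoint_mem hx)) x 𝔭)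
    (h𝔮 : Centered (toK U (genericPoint_mem hy)) y 𝔮) (hle : 𝔭 ≤ 𝔮) : x ⤳ y := by
  have key {z : X} (hz : z ∈ U) {𝔯 : Ideal Γ(X, U)}
      (h𝔯 : Centered (toK U (genericPoint_mem hz)) z 𝔯) : (hU.primeIdealOf ⟨z, hz⟩).asIdeal = 𝔯 := by
    have := IsAffineOpen.centered_fromSpec hU (genericPoint_mem hz) (hU.primeIdealOf ⟨z, hz⟩)
    rw [hU.fromSpec_primeIdealOf] at this
    ext f
    rw [← this.van, h𝔯.van]
  have h1 : hU.primeIdealOf ⟨x, hx⟩ ⤳ hU.primeIdealOf ⟨y, hy⟩ := by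
    rw [← PrimeSpectrum.le_iff_specializes]
    change (hU.primeIdealOf ⟨x, hx⟩).asIdeal ≤ (hU.primeIdealOf ⟨y, hy⟩).asIdeal
    rwa [key hx h𝔭, key hy h𝔮]
  have h2 := h1.map hU.fromSpec.continuous
  rwa [hU.fromSpec_primeIdealOf, hU.fromSpec_primeIdealOf] at h2

lemma Centered.eq_of_mem {U : X.Opens} (hU : IsAffineOpen U) {x y : X} (hx : x ∈ U) (hy : y ∈ U)
    {𝔭 : Ideal Γ(X, U)} (h𝔭 : Centered (toK U (genericPoint_mem hx)) x 𝔭)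
    (h𝔮 : Centered (toK U (genericPoint_mem hy)) y 𝔭) : x = y :=
  ((Centered.specializes hU hx hy h𝔭 h𝔮 le_rfl).antisymm
    (Centered.specializes hU hy hx h𝔮 h𝔭 le_rfl)).eq

/-- A function that is a unit at y keeps its inverse at x, so it cannot vanish there. -/
lemma idealAt_le_of_ringAt_le {x y : X} (h : ringAt y ≤ ringAt x) {f : X.functionField}
    (hf : f ∈ ringAt y) (hf' : f ∈ idealAt x) : f ∈ idealAt y := by
  by_contra hc
  rcases (mem_idealAt_iff.mp hf').2 with rfl | h'
  · exact hc (zero_mem_idealAt y)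
  · exact h' (h (inv_mem_ringAt hf hc))

/-- The affine open `U` has coordinate ring the localization of `A` at `g`, embedded in the
function field by `a`. -/
structure IsChart {A : Type} [CommRing A] (a : A →+* X.functionField) (g : A) (U : X.Opens) :
    Prop where
  affine : IsAffineOpen U
  mem : genericPoint X ∈ U
  exists_loc : ∃ α : A →+* Γ(X, U), (∀ f, toK U mem (α f) = a f) ∧
    @IsLocalization.Away _ _ g Γ(X, U) _ α.toAlgebra

variable {A : Type} [CommRing A] {a : A →+* X.functionField} {g : A} {U : X.Opens}

lemma IsChart.exists_centered (h : IsChart a g U) {x : X} (hx : x ∈ U) :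
    ∃ 𝔭, g ∉ 𝔭 ∧ Centered a x 𝔭 := by
  obtain ⟨α, hα, hloc⟩ := h.exists_loc
  let _ := α.toAlgebra
  obtain ⟨𝔓, h𝔓⟩ := IsAffineOpen.exists_centered h.affine hx
  have hg : α g ∉ 𝔓 := fun hg => h𝔓.prime.ne_top
    (Ideal.eq_top_of_isUnit_mem _ hg (IsLocalization.Away.algebraMap_isUnit g))
  refine ⟨𝔓.comap α, hg, h𝔓.prime.comap α, fun f => hα f ▸ h𝔓.mem _, fun f => ?_, ?_⟩
  · rw [← hα, h𝔓.van, Ideal.mem_comap]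
  · intro φ hφ
    obtain ⟨f, s, hs, e⟩ := h𝔓.frac φ hφ
    obtain ⟨n, f', hf'⟩ := IsLocalization.Away.surj g f
    obtain ⟨m, s', hs'⟩ := IsLocalization.Away.surj g s
    change f * α g ^ n = α f' at hf'
    change s * α g ^ m = α s' at hs'
    -- The powers of g in the denominators of f and s are moved across; g is outside the prime, so
    -- the new denominator stays outside it.
    refine ⟨f' * g ^ m, s' * g ^ n, ?_, ?_⟩
    · rw [Ideal.mem_comap, map_mul, map_pow, ← hs']
      have := h𝔓.prime
      exact fun hc => (this.mem_or_mem hc).elim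
        (fun hc => (this.mem_or_mem hc).elim hs (fun hc => hg (this.mem_of_pow_mem _ hc)))
        (fun hc => hg (this.mem_of_pow_mem _ hc))
    · rw [← hα, ← hα, map_mul α, map_mul α, map_pow, map_pow, ← hf', ← hs']
      simp only [map_mul, map_pow]
      rw [← e]
      ring

lemma IsChart.exists_point (h : IsChart a g U) {𝔭 : Ideal A} (h𝔭 : 𝔭.IsPrime) (hg : g ∉ 𝔭) :
    ∃ x ∈ U, Centered a x 𝔭 := by
  obtain ⟨α, hα, hloc⟩ := h.exists_loc
  let _ := α.toAlgebra
  have hdisj : Disjoint (Submonoid.powers g : Set A) 𝔭 := by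
    rw [Set.disjoint_left]
    rintro _ ⟨n, rfl⟩ hc
    exact hg (h𝔭.mem_of_pow_mem _ hc)
  have hprime := IsLocalization.isPrime_of_isPrime_disjoint (Submonoid.powers g) Γ(X, U) 𝔭 h𝔭 hdisj
  have hcomap := IsLocalization.under_map_of_isPrime_disjoint (Submonoid.powers g) Γ(X, U) h𝔭 hdisj
  obtain ⟨x, hx, hc⟩ := IsAffineOpen.exists_point h.affine h.mem hprime
  obtain ⟨𝔮, -, hq⟩ := h.exists_centered hx
  refine ⟨x, hx, ?_⟩
  have : 𝔮 = 𝔭 := by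
    ext f
    rw [← hq.van, ← hα, hc.van, ← SetLike.ext_iff.mp hcomap f]
    rfl
  rwa [this] at hq

lemma IsChart.ufd [IsDomain A] [UniqueFactorizationMonoid A] (h : IsChart a g U) :
    UniqueFactorizationMonoid Γ(X, U) := by
  obtain ⟨α, hα, hloc⟩ := h.exists_loc
  let _ := α.toAlgebra
  have := isDomain_section h.mem
  exact UniqueFactorizationMonoid.of_isLocalization (S := Submonoid.powers g) Γ(X, U)

lemma IsChart.ne_zero (h : IsChart a g U) : g ≠ 0 := by
  obtain ⟨𝔭, hg, -⟩ := h.exists_centered h.mem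
  rintro rfl
  exact hg (zero_mem _)

lemma IsChart.injective [IsDomain A] (h : IsChart a g U) : Function.Injective a := by
  obtain ⟨α, hα, hloc⟩ := h.exists_loc
  let _ := α.toAlgebra
  have h1 : Function.Injective (algebraMap A Γ(X, U)) :=
    IsLocalization.injective (M := Submonoid.powers g) _
      (powers_le_nonZeroDivisors_of_noZeroDivisors h.ne_zero)
  have : (a : A → X.functionField) = toK U h.mem ∘ α := funext fun f => (hα f).symm
  rw [this]
  exact (toK_injective U h.mem).comp h1

end Charts


/-! ### Divisors on locally factorial schemes -/

section Factorial

variable {X : Scheme.{0}} [IsIntegral X]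

variable (X) in
/-- Every point has an affine neighbourhood whose coordinate ring is factorial. -/
def LocallyFactorial : Prop :=
  ∀ x : X, ∃ U : X.Opens, IsAffineOpen U ∧ x ∈ U ∧ UniqueFactorizationMonoid Γ(X, U)

/-- D has some local equation valid near y, in particular at x; it differs from g by a unit at y,
which remains a unit at the generization x. -/
lemma CartierDivisor.eq_of_specializes (D : CartierDivisor X) {x y : X} (h : x ⤳ y)
    {g : (X.functionField)ˣ} (hg : D.1 y = divAt y g) : D.1 x = divAt x g := by
  obtain ⟨U, hyU, f, hf⟩ := D.2 y
  rw [hf x (h.mem_open U.2 hyU)]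
  have := hg.symm.trans (hf y hyU)
  rw [divAt_eq_iff_div, divAt_eq_zero_iff] at this ⊢
  have h1 := ringAt_le_of_specializes h this.1
  have h2 := ringAt_le_of_specializes h this.2
  simp only [Units.val_mul, Units.val_inv_eq_inv_val, mul_inv, inv_inv] at h1 h2 ⊢
  exact ⟨mul_comm (g : X.functionField)⁻¹ f ▸ h2, mul_comm (g : X.functionField) _ ▸ h1⟩

/-- A rational function that is regular in codimension one is regular. -/
lemma LocallyFactorial.mem_ringAt (hX : LocallyFactorial X) {x : X} {f : X.functionField}
    (hf : ∀ ξ, IsPrimeDiv ξ → ξ ⤳ x → f ∈ ringAt ξ) : f ∈ ringAt x := by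
  obtain ⟨U, hU, hx, hufd⟩ := hX x
  have h := genericPoint_mem hx
  have := isDomain_section h
  obtain ⟨𝔭, h𝔭⟩ := IsAffineOpen.exists_centered hU hx
  have : Nonempty U := ⟨⟨x, hx⟩⟩
  have : IsFractionRing Γ(X, U) X.functionField := functionField_isFractionRing_of_isAffineOpen X U hU
  have hden := (nonZeroDivisors.ne_zero (IsFractionRing.den Γ(X, U) f).2)
  have hrel := IsFractionRing.num_den_reduced Γ(X, U) f
  have hfr : f * toK U h (IsFractionRing.den Γ(X, U) f) = toK U h (IsFractionRing.num Γ(X, U) f) :=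
    (div_eq_iff ((map_ne_zero_iff _ (toK_injective U h)).mpr hden)).mp
      (IsFractionRing.mk'_num_den' Γ(X, U) f) |>.symm
  generalize (IsFractionRing.den Γ(X, U) f : Γ(X, U)) = d at *
  generalize IsFractionRing.num Γ(X, U) f = n at *
  rw [h𝔭.mem_ringAt_iff]
  refine ⟨n, d, fun hd => ?_, hfr⟩
  -- With f = n / d in lowest terms, a prime factor q of d in the ideal of x defines a
  -- codimension-one point specializing to x. Regularity of f there forces q to divide n as well.
  obtain ⟨q, hq, hqd, hq𝔭⟩ := exists_prime_mem h𝔭.prime hden hd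
  have hle : Ideal.span {q} ≤ 𝔭 := (Ideal.span_singleton_le_iff_mem _).mpr hq𝔭
  obtain ⟨ξ, hξ, hc⟩ := IsAffineOpen.exists_point hU h
    ((Ideal.span_singleton_prime hq.ne_zero).mpr hq)
  have hreg := hf ξ (hc.isPrimeDiv (toK_injective U h) hq)
    (Centered.specializes hU hξ hx hc h𝔭 hle)
  have hn : toK U h n ∈ idealAt ξ := by
    rw [← hfr]
    exact idealAt_mul hreg ((hc.van d).mpr (Ideal.mem_span_singleton.mpr hqd))
  rw [hc.van, Ideal.mem_span_singleton] at hn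
  exact hq.not_isUnit (hrel hn hqd)

lemma LocallyFactorial.divAt_eq (hX : LocallyFactorial X) {x : X} {f g : (X.functionField)ˣ}
    (h : ∀ ξ, IsPrimeDiv ξ → ξ ⤳ x → ord ξ f = ord ξ g) : divAt x f = divAt x g := by
  rw [divAt_eq_iff_div, divAt_eq_zero_iff, ← Units.val_inv_eq_inv_val]
  refine ⟨hX.mem_ringAt fun ξ hξ hx => ?_, hX.mem_ringAt fun ξ hξ hx => ?_⟩
  · rw [← ord_nonneg_iff hξ, ord_mul, ord_inv, h ξ hξ hx, add_neg_cancel]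
  · rw [← ord_nonneg_iff hξ, ord_inv, ord_mul, ord_inv, h ξ hξ hx, add_neg_cancel, neg_zero]

/-- The order of a divisor at a point. -/
def dOrd (ξ : X) : CartierDivisor X →+ ℤ :=
  (ordDiv ξ).comp ((Pi.evalAddMonoidHom _ ξ).comp (CartierDivisor X).subtype)

lemma dOrd_apply (ξ : X) (D : CartierDivisor X) : dOrd ξ D = ordDiv ξ (D.1 ξ) := rfl

lemma dOrd_principal (ξ : X) (f : (X.functionField)ˣ) :
    dOrd ξ (principal X (.ofMul f)) = ord ξ f := rfl

lemma dOrd_eq {ξ : X} {D : CartierDivisor X} {f : (X.functionField)ˣ} (h : D.1 ξ = divAt ξ f) :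
    dOrd ξ D = ord ξ f := by
  rw [dOrd_apply, h, ordDiv_divAt]

lemma LocallyFactorial.eq_divAt (hX : LocallyFactorial X) {D : CartierDivisor X} {x : X}
    {u : (X.functionField)ˣ} (h : ∀ ξ, IsPrimeDiv ξ → ξ ⤳ x → dOrd ξ D = ord ξ u) :
    D.1 x = divAt x u := by
  obtain ⟨f, hf⟩ := divAt_surjective x (D.1 x)
  rw [← hf]
  refine hX.divAt_eq fun ξ hξ hx => ?_
  rw [← h ξ hξ hx, dOrd_eq (CartierDivisor.eq_of_specializes D hx hf.symm)]

lemma LocallyFactorial.ext (hX : LocallyFactorial X) {D E : CartierDivisor X}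
    (h : ∀ ξ, IsPrimeDiv ξ → dOrd ξ D = dOrd ξ E) : D = E := by
  refine Subtype.ext (funext fun x => ?_)
  obtain ⟨f, hf⟩ := divAt_surjective x (E.1 x)
  rw [← hf]
  exact hX.eq_divAt fun ξ hξ hx => (h ξ hξ).trans (dOrd_eq (CartierDivisor.eq_of_specializes E hx hf.symm))

lemma Pic.mk_eq_of_dOrd (hX : LocallyFactorial X) {D E : CartierDivisor X}
    (f : (X.functionField)ˣ) (h : ∀ ξ, IsPrimeDiv ξ → dOrd ξ E = dOrd ξ D + ord ξ f) :
    Pic.mk D = Pic.mk E := by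
  have : E = D + principal X (.ofMul f) := hX.ext fun ξ hξ => by
    rw [h ξ hξ, map_add, dOrd_principal]
  exact Pic.mk_eq_iff.mpr ⟨f, fun x => by rw [this]; rfl⟩

lemma LocallyFactorial.mem_H0_iff (hX : LocallyFactorial X) (s : X ⟶ Spec (.of ℂ))
    {D : CartierDivisor X} (φ : (X.functionField)ˣ) :
    (show FunctionField s from (φ : X.functionField)) ∈ H0 s D ↔
      ∀ ξ, IsPrimeDiv ξ → 0 ≤ ord ξ φ + dOrd ξ D := by
  constructor
  · intro h ξ hξ
    obtain ⟨f, hf⟩ := divAt_surjective ξ (D.1 ξ)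
    have := h ξ f hf.symm
    change ((φ * f : (X.functionField)ˣ) : X.functionField) ∈ ringAt ξ at this
    rwa [← ord_nonneg_iff hξ, ord_mul, ← dOrd_eq hf.symm] at this
  · intro h x f hf
    change ((φ * f : (X.functionField)ˣ) : X.functionField) ∈ ringAt x
    refine hX.mem_ringAt fun ξ hξ hx => ?_
    rw [← ord_nonneg_iff hξ, ord_mul, ← dOrd_eq (CartierDivisor.eq_of_specializes D hx hf)]
    exact h ξ hξ

lemma LocallyFactorial.isEffective_iff (hX : LocallyFactorial X) {D : CartierDivisor X} :
    IsEffective D ↔ ∀ ξ, IsPrimeDiv ξ → 0 ≤ dOrd ξ D := by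
  constructor
  · intro h ξ hξ
    obtain ⟨g, hg, hg'⟩ := h ξ
    rw [dOrd_eq hg]
    exact (ord_nonneg_iff hξ).mpr hg'
  · intro h x
    obtain ⟨g, hg⟩ := divAt_surjective x (D.1 x)
    refine ⟨g, hg.symm, hX.mem_ringAt fun ξ hξ hx => ?_⟩
    rw [← ord_nonneg_iff hξ, ← dOrd_eq (CartierDivisor.eq_of_specializes D hx hg.symm)]
    exact h ξ hξ

open Classical in
/-- A local equation of the closure of a point of codimension one. -/
lemma exists_local_equation {U : X.Opens} (hU : IsAffineOpen U) (h : genericPoint X ∈ U)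
    [UniqueFactorizationMonoid Γ(X, U)] {ξ : X} (hξ : IsPrimeDiv ξ) :
    ∃ (f : Γ(X, U)) (u : (X.functionField)ˣ), (u : X.functionField) = toK U h f ∧
      (∀ ξ' ∈ U, IsPrimeDiv ξ' → ord ξ' u = if ξ' = ξ then 1 else 0) ∧
      (ξ ∈ U → ∀ g, toK U h g ∈ idealAt ξ ↔ g ∈ Ideal.span {f}) ∧ (ξ ∉ U → f = 1) := by
  have := isDomain_section h
  by_cases hξU : ξ ∈ U
  · obtain ⟨𝔭, h𝔭⟩ := IsAffineOpen.exists_centered hU hξU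
    obtain ⟨q, hq, rfl⟩ := h𝔭.exists_prime_eq_span (toK_injective U h) hξ
    have hq0 : toK U h q ≠ 0 := (map_ne_zero_iff _ (toK_injective U h)).mpr hq.ne_zero
    refine ⟨q, Units.mk0 _ hq0, rfl, fun ξ' hξ'U hξ' => ?_, fun _ g => h𝔭.van g,
      fun h => (h hξU).elim⟩
    split_ifs with e
    · subst e
      exact h𝔭.ord_eq_one (toK_injective U h) hq _ rfl
    · refine ord_eq_zero_of_mem (toK_mem hξ'U q) fun hc => e ?_
      obtain ⟨𝔮, h𝔮⟩ := IsAffineOpen.exists_centered hU hξ'U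
      change toK U h q ∈ _ at hc
      rw [h𝔮.van] at hc
      have := h𝔮.eq_span (toK_injective U h) hξ' hq hc
      subst this
      exact Centered.eq_of_mem hU hξ'U hξU h𝔮 h𝔭
  · refine ⟨1, 1, by rw [map_one]; rfl, fun ξ' hξ'U _ => ?_, fun h => (hξU h).elim, fun _ => rfl⟩
    rw [ord_one, if_neg]
    rintro rfl
    exact hξU hξ'U

open Classical in
/-- On a locally factorial scheme, the closure of a point of codimension one is a divisor. -/
lemma LocallyFactorial.exists_divisor (hX : LocallyFactorial X) {ξ : X} (hξ : IsPrimeDiv ξ) :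
    ∃ D : CartierDivisor X, ∀ ξ', IsPrimeDiv ξ' → dOrd ξ' D = if ξ' = ξ then 1 else 0 := by
  choose U hU hxU hufd using hX
  have (x : X) := @exists_local_equation X _ (U x) (hU x) (genericPoint_mem (hxU x)) (hufd x) ξ hξ
  choose f u hfu hu _ _ using this
  refine ⟨⟨fun x => divAt x (u x), fun x => ⟨U x, hxU x, u x, fun y hy => ?_⟩⟩, fun ξ' hξ' => ?_⟩
  · refine LocallyFactorial.divAt_eq (fun x => ⟨U x, hU x, hxU x, hufd x⟩) fun ξ' hξ' hs => ?_
    rw [hu x ξ' (hs.mem_open (U x).2 hy) hξ', hu y ξ' (hs.mem_open (U y).2 (hxU y)) hξ']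
  · exact hu ξ' ξ' (hxU ξ') hξ'

/-- The closure of a point of codimension one, as a divisor. -/
def LocallyFactorial.divisor (hX : LocallyFactorial X) {ξ : X} (hξ : IsPrimeDiv ξ) :
    CartierDivisor X := (hX.exists_divisor hξ).choose

open Classical in
lemma LocallyFactorial.dOrd_divisor (hX : LocallyFactorial X) {ξ : X} (hξ : IsPrimeDiv ξ) {ξ' : X}
    (hξ' : IsPrimeDiv ξ') : dOrd ξ' (hX.divisor hξ) = if ξ' = ξ then 1 else 0 :=
  (hX.exists_divisor hξ).choose_spec ξ' hξ'

/-- The prime of such a point is generated by one of the finitely many prime factors of f, and it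
determines the point. -/
lemma finite_zeros {U : X.Opens} (hU : IsAffineOpen U) (h : genericPoint X ∈ U)
    [UniqueFactorizationMonoid Γ(X, U)] {f : Γ(X, U)} (hf : f ≠ 0) :
    {ξ | ξ ∈ U ∧ IsPrimeDiv ξ ∧ toK U h f ∈ idealAt ξ}.Finite := by
  classical
  have := isDomain_section h
  obtain ⟨s, hs, hsf⟩ := UniqueFactorizationMonoid.exists_prime_factors f hf
  refine Set.Finite.subset (s := ⋃ q ∈ s.toFinset, {ξ | ξ ∈ U ∧ Centered (toK U h) ξ (Ideal.span {q})})
    (Set.Finite.biUnion s.toFinset.finite_toSet fun q _ => Set.Subsingleton.finite ?_) ?_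
  · rintro x ⟨hx, hx'⟩ y ⟨hy, hy'⟩
    exact Centered.eq_of_mem hU hx hy hx' hy'
  · rintro ξ ⟨hξU, hξ, hfξ⟩
    obtain ⟨𝔭, h𝔭⟩ := IsAffineOpen.exists_centered hU hξU
    rw [h𝔭.van] at hfξ
    obtain ⟨q, hqs, hq⟩ := (h𝔭.prime.multiset_prod_mem_iff_exists_mem s).mp
      (Ideal.mem_of_dvd _ hsf.dvd' hfξ)
    have := h𝔭.eq_span (toK_injective U h) hξ (hs q hqs) hq
    subst this
    simp only [Set.mem_iUnion]
    exact ⟨q, Multiset.mem_toFinset.mpr hqs, hξU, h𝔭⟩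

lemma finite_ord_ne_zero {U : X.Opens} (hU : IsAffineOpen U) (h : genericPoint X ∈ U)
    [UniqueFactorizationMonoid Γ(X, U)] (f : (X.functionField)ˣ) :
    {ξ | ξ ∈ U ∧ IsPrimeDiv ξ ∧ ord ξ f ≠ 0}.Finite := by
  have := isDomain_section h
  have : Nonempty U := ⟨⟨_, h⟩⟩
  have : IsFractionRing Γ(X, U) X.functionField := functionField_isFractionRing_of_isAffineOpen X U hU
  obtain ⟨n, d, hd, e⟩ := IsFractionRing.div_surjective (A := Γ(X, U)) (f : X.functionField)
  have hd0 : d ≠ 0 := nonZeroDivisors.ne_zero hd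
  change toK U h n / toK U h d = f at e
  have hdK : toK U h d ≠ 0 := (map_ne_zero_iff _ (toK_injective U h)).mpr hd0
  have hnK : toK U h n ≠ 0 := by
    intro h0
    rw [h0, zero_div] at e
    exact f.ne_zero e.symm
  have hn0 : n ≠ 0 := by
    rintro rfl
    exact hnK (map_zero _)
  refine Set.Finite.subset ((finite_zeros hU h hn0).union (finite_zeros hU h hd0)) ?_
  rintro ξ ⟨hξU, hξ, hne⟩
  by_contra hc
  simp only [Set.mem_union, Set.mem_ofPred_eq, not_or, not_and] at hc
  have e' : f = Units.mk0 _ hnK * (Units.mk0 _ hdK)⁻¹ := Units.ext (by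
    rw [← e, Units.val_mul, Units.val_inv_eq_inv_val, div_eq_mul_inv]
    rfl)
  apply hne
  rw [e', ord_mul, ord_inv, ord_eq_zero_of_mem (toK_mem hξU n) (hc.1 hξU hξ),
    ord_eq_zero_of_mem (toK_mem hξU d) (hc.2 hξU hξ)]
  rfl

/-- By compactness finitely many open sets suffice on which the coordinate ring is factorial and D
is given by one function. -/
lemma LocallyFactorial.finite_support [CompactSpace X] (hX : LocallyFactorial X)
    (D : CartierDivisor X) : {ξ | IsPrimeDiv ξ ∧ dOrd ξ D ≠ 0}.Finite := by
  choose U hU hxU hufd using hX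
  choose V hxV f hf using D.2
  obtain ⟨t, ht⟩ := isCompact_univ.elim_finite_subcover (fun x : X => (U x ⊓ V x : X.Opens).1)
    (fun x => (U x ⊓ V x).2) (fun x _ => Set.mem_iUnion.mpr ⟨x, hxU x, hxV x⟩)
  refine Set.Finite.subset (Set.Finite.biUnion t.finite_toSet fun x _ =>
    @finite_ord_ne_zero X _ (U x) (hU x) (genericPoint_mem (hxU x)) (hufd x) (f x)) ?_
  rintro ξ ⟨hξ, hne⟩
  obtain ⟨x, hx, hξx⟩ := Set.mem_iUnion₂.mp (ht (Set.mem_univ ξ))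
  refine Set.mem_iUnion₂.mpr ⟨x, hx, hξx.1, hξ, ?_⟩
  rwa [← dOrd_eq (hf x ξ hξx.2)]

end Factorial


/-! ### Affine space with a boundary: Picard group and sections -/

section Model

variable {X : Scheme.{0}} [IsIntegral X]

/-- A locally factorial scheme whose prime divisors are those of an affine space with coordinates
indexed by `τ`, together with finitely many further ones, indexed by `B`. -/
structure BoundaryModel {τ B : Type} (a : MvPolynomial τ ℂ →+* X.functionField) (η : B → X) :
    Prop where
  factorial : LocallyFactorial X
  isPrimeDiv : ∀ b, IsPrimeDiv (η b)
  injective : Function.Injective η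
  const : ∀ c x, a (MvPolynomial.C c) ∈ ringAt x
  map_injective : Function.Injective a
  fraction : ∀ f : X.functionField, ∃ n d, d ≠ 0 ∧ f * a d = a n
  cases : ∀ ξ, IsPrimeDiv ξ → (∃ b, ξ = η b) ∨ ∃ q, Prime q ∧ Centered a ξ (Ideal.span {q})
  exists_point : ∀ q, Prime q → ∃ ξ, Centered a ξ (Ideal.span {q})
  unique : ∀ ξ ξ' q, Centered a ξ (Ideal.span {q}) → Centered a ξ' (Ideal.span {q}) → ξ = ξ'
  disjoint : ∀ b q, Prime q → ¬ Centered a (η b) (Ideal.span {q})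

namespace BoundaryModel

variable {τ B : Type} {a : MvPolynomial τ ℂ →+* X.functionField} {η : B → X}
  (M : BoundaryModel a η)
include M

lemma map_ne_zero {φ : MvPolynomial τ ℂ} (h : φ ≠ 0) : a φ ≠ 0 :=
  (map_ne_zero_iff a M.map_injective).mpr h

/-- In lowest terms, a denominator that is not a unit has a prime factor, and f would have a pole at
the point centred there. -/
lemma mem_range {f : X.functionField}
    (h : ∀ ξ q, Prime q → Centered a ξ (Ideal.span {q}) → f ∈ ringAt ξ) : ∃ φ, a φ = f := by
  obtain ⟨n, d, hd, e⟩ := M.fraction f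
  obtain ⟨d', n', c, hrel, rfl, rfl⟩ := UniqueFactorizationMonoid.exists_reduced_factors d hd n
  have hc : c ≠ 0 := left_ne_zero_of_mul hd
  have e' : f * a d' = a n' := by
    rw [map_mul, map_mul] at e
    exact mul_left_cancel₀ (M.map_ne_zero hc) (by rw [← e]; ring)
  have hunit : IsUnit d' := by
    by_contra hu
    obtain ⟨q, hq, hqd⟩ := WfDvdMonoid.exists_irreducible_factor hu (right_ne_zero_of_mul hd)
    have hq' := hq.prime
    obtain ⟨ξ, hξ⟩ := M.exists_point q hq'
    have : a n' ∈ idealAt ξ := by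
      rw [← e']
      exact idealAt_mul (h ξ q hq' hξ) ((hξ.van _).mpr (Ideal.mem_span_singleton.mpr hqd))
    rw [hξ.van, Ideal.mem_span_singleton] at this
    exact hq.not_isUnit (hrel hqd this)
  obtain ⟨u, rfl⟩ := hunit
  refine ⟨n' * (u⁻¹ : (MvPolynomial τ ℂ)ˣ), ?_⟩
  rw [map_mul, ← e', mul_assoc, ← map_mul, Units.mul_inv, map_one, mul_one]

lemma ord_const (ξ : X) {c : ℂ} (u : (X.functionField)ˣ)
    (hu : (u : X.functionField) = a (MvPolynomial.C c)) : ord ξ u = 0 := by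
  by_cases hξ : IsPrimeDiv ξ
  · rw [ord_eq_zero_iff hξ, hu]
    refine ⟨M.const c ξ, ?_⟩
    have hc : c ≠ 0 := by
      rintro rfl
      rw [MvPolynomial.C_0, map_zero] at hu
      exact u.ne_zero hu
    convert M.const c⁻¹ ξ using 1
    refine inv_eq_of_mul_eq_one_left ?_
    rw [← map_mul, ← MvPolynomial.C_mul, inv_mul_cancel₀ hc, MvPolynomial.C_1, map_one]
  · exact ord_of_isPrimeDiv_false hξ u

/-- A rational function without zeros and poles on the affine space is constant. -/
lemma eq_const {f : (X.functionField)ˣ}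
    (h : ∀ ξ q, Prime q → Centered a ξ (Ideal.span {q}) → ord ξ f = 0) :
    ∃ c : ℂ, (f : X.functionField) = a (MvPolynomial.C c) := by
  obtain ⟨φ, hφ⟩ := M.mem_range (f := f) fun ξ q hq hξ =>
    ((ord_eq_zero_iff (hξ.isPrimeDiv M.map_injective hq)).mp (h ξ q hq hξ)).1
  obtain ⟨ψ, hψ⟩ := M.mem_range (f := (f : X.functionField)⁻¹) fun ξ q hq hξ =>
    ((ord_eq_zero_iff (hξ.isPrimeDiv M.map_injective hq)).mp (h ξ q hq hξ)).2
  have hu : IsUnit φ := IsUnit.of_mul_eq_one ψ (M.map_injective (by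
    rw [map_mul, hφ, hψ, map_one, mul_inv_cancel₀ f.ne_zero]))
  obtain ⟨c, -, hc⟩ := MvPolynomial.isUnit_iff_eq_C_of_isReduced.mp hu
  exact ⟨c, by rw [← hφ, hc]⟩

variable [Fintype B]

/-- The divisor on the boundary with given multiplicities. -/
def divisor (n : B → ℤ) : CartierDivisor X := ∑ b, n b • M.factorial.divisor (M.isPrimeDiv b)

lemma dOrd_divisor_boundary (n : B → ℤ) (b : B) : dOrd (η b) (M.divisor n) = n b := by
  classical
  rw [divisor, map_sum, Finset.sum_eq_single b]
  · rw [map_zsmul, M.factorial.dOrd_divisor _ (M.isPrimeDiv b), if_pos rfl, smul_eq_mul, mul_one]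
  · intro b' _ hb'
    rw [map_zsmul, M.factorial.dOrd_divisor _ (M.isPrimeDiv b),
      if_neg (fun h => hb' (M.injective h).symm), smul_zero]
  · exact fun h => (h (Finset.mem_univ b)).elim

lemma dOrd_divisor_of_ne (n : B → ℤ) {ξ : X} (hξ : IsPrimeDiv ξ) (h : ∀ b, ξ ≠ η b) :
    dOrd ξ (M.divisor n) = 0 := by
  classical
  rw [divisor, map_sum]
  refine Finset.sum_eq_zero fun b _ => ?_
  rw [map_zsmul, M.factorial.dOrd_divisor _ hξ, if_neg (h b), smul_zero]

lemma dOrd_divisor_affine (n : B → ℤ) {ξ : X} {q : MvPolynomial τ ℂ} (hq : Prime q)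
    (h : Centered a ξ (Ideal.span {q})) : dOrd ξ (M.divisor n) = 0 :=
  M.dOrd_divisor_of_ne n (h.isPrimeDiv M.map_injective hq) fun b e => M.disjoint b q hq (e ▸ h)

/-- A function whose divisor is supported on the boundary has no zeros and poles on the affine
space. It is therefore constant and has order zero along the boundary too. -/
lemma mk_divisor_injective : Function.Injective fun n => Pic.mk (M.divisor n) := by
  intro n m h
  obtain ⟨f, hf⟩ := Pic.mk_eq_iff.mp h
  have hord (ξ : X) : dOrd ξ (M.divisor m) = dOrd ξ (M.divisor n) + ord ξ f := by
    rw [dOrd_apply, hf, map_add]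
    rfl
  obtain ⟨c, hc⟩ := M.eq_const (f := f) fun ξ q hq hξ => by
    have := hord ξ
    rw [M.dOrd_divisor_affine _ hq hξ, M.dOrd_divisor_affine _ hq hξ] at this
    omega
  funext b
  have := hord (η b)
  rw [M.dOrd_divisor_boundary, M.dOrd_divisor_boundary, M.ord_const _ f hc] at this
  omega

/-- On the affine space every prime divisor is principal; the function is the product of the
equations of the finitely many components of D that meet it. -/
lemma exists_ord_eq [CompactSpace X] (D : CartierDivisor X) :
    ∃ f : (X.functionField)ˣ, ∀ ξ q, Prime q → Centered a ξ (Ideal.span {q}) →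
      ord ξ f = dOrd ξ D := by
  classical
  have hfin : {ξ | IsPrimeDiv ξ ∧ dOrd ξ D ≠ 0 ∧ ∃ q, Prime q ∧ Centered a ξ (Ideal.span {q})}.Finite :=
    (M.factorial.finite_support D).subset fun ξ h => ⟨h.1, h.2.1⟩
  let S := hfin.toFinset
  have hS (ξ : S) : ∃ q, Prime q ∧ Centered a ξ.1 (Ideal.span {q}) :=
    ((hfin.mem_toFinset).mp ξ.2).2.2
  choose q hq hc using hS
  refine ⟨∏ ξ : S, Units.mk0 _ (M.map_ne_zero (hq ξ).ne_zero) ^ dOrd ξ.1 D, fun ξ q' hq' hξ => ?_⟩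
  have key (ζ : S) : ord ξ (Units.mk0 _ (M.map_ne_zero (hq ζ).ne_zero)) =
      if ζ.1 = ξ then 1 else 0 := by
    split_ifs with e
    · exact (e ▸ hc ζ).ord_eq_one M.map_injective (hq ζ) _ rfl
    · refine ord_eq_zero_of_mem (hξ.mem _) fun h => e ?_
      rw [Units.val_mk0, hξ.van] at h
      have := hξ.eq_span M.map_injective (hξ.isPrimeDiv M.map_injective hq') (hq ζ) h
      exact M.unique _ _ _ (hc ζ) (this ▸ hξ)
  simp only [ord_prod, ord_zpow, key, mul_ite, mul_one, mul_zero]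
  by_cases h0 : dOrd ξ D = 0
  · rw [h0]
    refine Finset.sum_eq_zero fun ζ _ => ?_
    split_ifs with e
    · rw [e, h0]
    · rfl
  · have hξS : ξ ∈ S := hfin.mem_toFinset.mpr
      ⟨hξ.isPrimeDiv M.map_injective hq', h0, q', hq', hξ⟩
    rw [Finset.sum_eq_single (⟨ξ, hξS⟩ : S)]
    · rw [if_pos rfl]
    · intro ζ _ hζ
      rw [if_neg fun e => hζ (Subtype.ext e)]
    · exact fun h => (h (Finset.mem_univ _)).elim

/-- Subtracting the divisor of a function that agrees with D on the affine space moves D into the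
boundary. -/
lemma mk_divisor_surjective [CompactSpace X] : Function.Surjective fun n => Pic.mk (M.divisor n) := by
  intro c
  obtain ⟨D, rfl⟩ := Pic.mk_surjective c
  obtain ⟨f, hf⟩ := M.exists_ord_eq D
  refine ⟨fun b => dOrd (η b) D - ord (η b) f, Pic.mk_eq_of_dOrd M.factorial f fun ξ hξ => ?_⟩
  rcases M.cases ξ hξ with ⟨b, rfl⟩ | ⟨q, hq, h⟩
  · rw [M.dOrd_divisor_boundary]
    ring
  · rw [M.dOrd_divisor_affine _ hq h, hf ξ q hq h, zero_add]

/-- The sections of a boundary divisor are polynomials. -/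
lemma mem_H0_iff (s : X ⟶ Spec (.of ℂ)) (n : B → ℤ) (φ : FunctionField s) :
    φ ∈ H0 s (M.divisor n) ↔ ∃ ψ, (a ψ : X.functionField) = φ ∧
      ∀ u : (X.functionField)ˣ, (u : X.functionField) = a ψ → ∀ b, 0 ≤ ord (η b) u + n b := by
  constructor
  · intro h
    by_cases h0 : (show X.functionField from φ) = 0
    · exact ⟨0, (map_zero a).trans h0.symm, fun u hu => (u.ne_zero (hu.trans (map_zero a))).elim⟩
    · have h' := (M.factorial.mem_H0_iff s (Units.mk0 _ h0)).mp h
      obtain ⟨ψ, hψ⟩ := M.mem_range (f := φ) fun ξ q hq hξ => by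
        have := h' ξ (hξ.isPrimeDiv M.map_injective hq)
        rw [M.dOrd_divisor_affine _ hq hξ, add_zero] at this
        exact (ord_nonneg_iff (hξ.isPrimeDiv M.map_injective hq)).mp this
      refine ⟨ψ, hψ, fun u hu b => ?_⟩
      have := h' (η b) (M.isPrimeDiv b)
      rw [M.dOrd_divisor_boundary] at this
      have e : u = Units.mk0 _ h0 := Units.ext (hu.trans hψ)
      rwa [e]
  · rintro ⟨ψ, hψ, h⟩
    by_cases h0 : (show X.functionField from φ) = 0
    · have : φ = 0 := h0
      rw [this]
      exact zero_mem _
    · refine (M.factorial.mem_H0_iff s (Units.mk0 _ h0)).mpr fun ξ hξ => ?_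
      rcases M.cases ξ hξ with ⟨b, rfl⟩ | ⟨q, hq, hc⟩
      · rw [M.dOrd_divisor_boundary]
        exact h _ hψ.symm b
      · rw [M.dOrd_divisor_affine _ hq hc, add_zero]
        refine (ord_nonneg_iff hξ).mpr ?_
        change (show X.functionField from φ) ∈ _
        rw [← hψ]
        exact hc.mem ψ

end BoundaryModel

end Model


/-! ### Restricting functions, sections and divisors to a subscheme -/

section Restriction

variable {Z X : Scheme.{0}} [IsIntegral Z] [IsIntegral X] (i : Z ⟶ X)

/-- The rational function `f` on `X` restricts to the rational function `g` on `Z`. -/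
def Res (f : X.functionField) (g : Z.functionField) : Prop :=
  ∃ m : X.presheaf.stalk (i (genericPoint Z)),
    algebraMap _ X.functionField m = f ∧ (i.stalkMap (genericPoint Z)).hom m = g

variable {i}

namespace Res

variable {f f' : X.functionField} {g g' : Z.functionField}

lemma mem (h : Res i f g) : f ∈ ringAt (i (genericPoint Z)) := by
  obtain ⟨m, rfl, -⟩ := h
  exact ⟨m, rfl⟩

lemma unique (h : Res i f g) (h' : Res i f g') : g = g' := by
  obtain ⟨m, hm, rfl⟩ := h
  obtain ⟨m', hm', rfl⟩ := h'
  rw [algebraMap_stalk_injective _ (hm.trans hm'.symm)]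

lemma add (h : Res i f g) (h' : Res i f' g') : Res i (f + f') (g + g') := by
  obtain ⟨m, rfl, rfl⟩ := h
  obtain ⟨m', rfl, rfl⟩ := h'
  exact ⟨m + m', map_add _ _ _, map_add _ _ _⟩

lemma mul (h : Res i f g) (h' : Res i f' g') : Res i (f * f') (g * g') := by
  obtain ⟨m, rfl, rfl⟩ := h
  obtain ⟨m', rfl, rfl⟩ := h'
  exact ⟨m * m', map_mul _ _ _, map_mul _ _ _⟩

lemma sub (h : Res i f g) (h' : Res i f' g') : Res i (f - f') (g - g') := by
  obtain ⟨m, rfl, rfl⟩ := h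
  obtain ⟨m', rfl, rfl⟩ := h'
  exact ⟨m - m', map_sub _ _ _, map_sub _ _ _⟩

lemma one : Res i (1 : X.functionField) (1 : Z.functionField) := ⟨1, map_one _, map_one _⟩

/-- The stalk map at the generic point of Z is a local homomorphism into a field. -/
lemma mem_idealAt_iff (h : Res i f g) : f ∈ idealAt (i (genericPoint Z)) ↔ g = 0 := by
  obtain ⟨m, rfl, rfl⟩ := h
  rw [algebraMap_mem_idealAt, IsLocalRing.mem_maximalIdeal, mem_nonunits_iff,
    ← isUnit_map_iff (i.stalkMap (genericPoint Z)).hom, isUnit_iff_ne_zero, not_not]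

lemma ne_zero (h : Res i f g) (hg : g ≠ 0) : f ≠ 0 := by
  rintro rfl
  exact hg (h.mem_idealAt_iff.mp (zero_mem_idealAt _))

lemma exists_of_mem (h : f ∈ ringAt (i (genericPoint Z))) : ∃ g, Res i f g := by
  obtain ⟨m, rfl⟩ := h
  exact ⟨_, m, rfl, rfl⟩

lemma inv (h : Res i f g) (hg : g ≠ 0) : Res i f⁻¹ g⁻¹ := by
  obtain ⟨g', h'⟩ := exists_of_mem (i := i) (inv_mem_ringAt h.mem (h.mem_idealAt_iff.not.mpr hg))
  have h1 := h.mul h'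
  rw [mul_inv_cancel₀ (h.ne_zero hg)] at h1
  rwa [inv_eq_of_mul_eq_one_right (h1.unique one)]

lemma div (h : Res i f g) (h' : Res i f' g') (hg : g' ≠ 0) : Res i (f / f') (g / g') := by
  rw [div_eq_mul_inv, div_eq_mul_inv]
  exact h.mul (h'.inv hg)

lemma stalk {z : Z} (m : X.presheaf.stalk (i z)) :
    Res i (algebraMap _ X.functionField m) (algebraMap _ Z.functionField ((i.stalkMap z).hom m)) := by
  refine ⟨X.presheaf.stalkSpecializes (specializes_generic i z) m, ?_, ?_⟩
  · change (X.presheaf.stalkSpecializes _ ≫ X.presheaf.stalkSpecializes _) m =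
      X.presheaf.stalkSpecializes _ m
    rw [X.presheaf.stalkSpecializes_comp]
  · exact Scheme.Hom.stalkSpecializes_stalkMap_apply i (genericPoint Z) z
      ((genericPoint_spec Z).specializes trivial) m

lemma mem_ringAt (h : Res i f g) {z : Z} (hf : f ∈ ringAt (i z)) : g ∈ ringAt z := by
  obtain ⟨m, rfl⟩ := hf
  exact ⟨_, (stalk m).unique h⟩

lemma mem_idealAt (h : Res i f g) {z : Z} (hf : f ∈ ringAt (i z)) :
    g ∈ idealAt z ↔ f ∈ idealAt (i z) := by
  obtain ⟨m, rfl⟩ := hf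
  rw [← (stalk m).unique h, algebraMap_mem_idealAt, algebraMap_mem_idealAt,
    IsLocalRing.mem_maximalIdeal, IsLocalRing.mem_maximalIdeal, mem_nonunits_iff, mem_nonunits_iff,
    isUnit_map_iff]

end Res

lemma Res.resUnits (u : (X.presheaf.stalk (i (genericPoint Z)))ˣ) :
    Res i (unitsIncl X _ u : X.functionField) (resUnits i u : Z.functionField) := ⟨u, rfl, rfl⟩

lemma Res.exists_unit {f : (X.functionField)ˣ} {g : (Z.functionField)ˣ}
    (h : Res i (f : X.functionField) (g : Z.functionField)) :
    ∃ u, unitsIncl X (i (genericPoint Z)) u = f ∧ EulerChow.resUnits i u = g := by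
  have := mem_range_unitsIncl (x := i (genericPoint Z)) (f := f)
  obtain ⟨u, rfl⟩ := this.mpr ⟨h.mem, (h.inv g.ne_zero).mem⟩
  exact ⟨u, rfl, Units.ext ((Res.resUnits u).unique h)⟩

lemma Res.const (s : X ⟶ Spec (.of ℂ)) (c : ℂ) :
    Res i (show X.functionField from algebraMap ℂ (FunctionField s) c)
      (show Z.functionField from algebraMap ℂ (FunctionField (i ≫ s)) c) := by
  refine ⟨X.presheaf.germ ⊤ (i (genericPoint Z)) trivial (constants s c), ?_, ?_⟩
  · exact algebraMap_germ (U := ⊤) trivial _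
  · refine (Scheme.Hom.germ_stalkMap_apply i ⊤ (genericPoint Z) trivial (constants s c)).trans ?_
    rfl

/-- Restriction of sections to a closed subscheme. -/
lemma IsPullbackDivisor.mem_H0 (s : X ⟶ Spec (.of ℂ)) {D : CartierDivisor X}
    {E : CartierDivisor Z} (h : IsPullbackDivisor i D E) {φ : FunctionField s}
    (hφ : φ ∈ H0 s D) : ∃ ψ, Res i (show X.functionField from φ) ψ ∧
      (show FunctionField (i ≫ s) from ψ) ∈ H0 (i ≫ s) E := by
  have hreg : (show X.functionField from φ) ∈ ringAt (i (genericPoint Z)) := by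
    have := hφ (i (genericPoint Z)) 1 (by rw [h.apply_generic, divAt_one])
    rwa [Units.val_one, mul_one] at this
  obtain ⟨ψ, hψ⟩ := Res.exists_of_mem hreg
  refine ⟨ψ, hψ, fun z g hg => ?_⟩
  obtain ⟨u, hu, hu'⟩ := h z
  have h1 := hφ (i z) _ hu
  have h2 := (hψ.mul (Res.resUnits u)).mem_ringAt (z := z) h1
  rw [hg] at hu'
  obtain ⟨v, hv⟩ := (divAt_eq_iff _ _ _).mp hu'.symm
  change ψ * g ∈ ringAt z
  rw [← hv, Units.val_mul, ← mul_assoc]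
  exact mul_mem h2 ⟨_, rfl⟩

variable (s : X ⟶ Spec (.of ℂ)) {D : CartierDivisor X} {E : CartierDivisor Z}

/-- Restriction of sections, as a linear map. -/
def restrictH0 (h : IsPullbackDivisor i D E) : H0 s D →ₗ[ℂ] H0 (i ≫ s) E where
  toFun φ := ⟨_, (h.mem_H0 s φ.2).choose_spec.2⟩
  map_add' φ ψ := Subtype.ext ((h.mem_H0 s (φ + ψ).2).choose_spec.1.unique
    ((h.mem_H0 s φ.2).choose_spec.1.add (h.mem_H0 s ψ.2).choose_spec.1))
  map_smul' c φ := Subtype.ext (by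
    refine ((h.mem_H0 s (c • φ).2).choose_spec.1.unique ?_)
    have := (Res.const (i := i) s c).mul (h.mem_H0 s φ.2).choose_spec.1
    exact (congrArg₂ (Res i) (Algebra.smul_def c φ.1)
      (Algebra.smul_def (R := ℂ) (A := FunctionField (i ≫ s)) c _)).mpr this)

lemma restrictH0_spec (h : IsPullbackDivisor i D E) (φ : H0 s D) :
    Res i (show X.functionField from φ.1) (show Z.functionField from (restrictH0 s h φ).1) :=
  (h.mem_H0 s φ.2).choose_spec.1

-- The pull-back of D is defined, so D has order zero along the prime divisor F; subtracting F
-- demands just one extra zero there.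
open Classical in
lemma mem_H0_sub_iff (hX : LocallyFactorial X) (h : IsPullbackDivisor i D E)
    (hP : IsPrimeDiv (i (genericPoint Z))) {F : CartierDivisor X}
    (hF : ∀ ξ, IsPrimeDiv ξ → dOrd ξ F = if ξ = i (genericPoint Z) then 1 else 0)
    (φ : FunctionField s) : φ ∈ H0 s (D - F) ↔
      φ ∈ H0 s D ∧ (show X.functionField from φ) ∈ idealAt (i (genericPoint Z)) := by
  by_cases h0 : (show X.functionField from φ) = 0
  · have h0' : φ = 0 := h0
    subst h0'
    exact ⟨fun _ => ⟨zero_mem _, zero_mem_idealAt _⟩, fun _ => zero_mem _⟩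
  have hD : dOrd (i (genericPoint Z)) D = 0 := by
    rw [dOrd_apply, h.apply_generic, map_zero]
  have h1 := hX.mem_H0_iff s (D := D) (Units.mk0 _ h0)
  have h2 := hX.mem_H0_iff s (D := D - F) (Units.mk0 _ h0)
  have h3 := ord_pos_iff hP (f := Units.mk0 _ h0)
  change φ ∈ _ ↔ _ at h1 h2
  change _ ↔ (show X.functionField from φ) ∈ _ at h3
  rw [h1, h2, ← h3]
  simp only [map_sub]
  constructor
  · refine fun H => ⟨fun ξ hξ => ?_, ?_⟩
    · have := H ξ hξ
      rw [hF ξ hξ] at this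
      split_ifs at this <;> omega
    · have := H _ hP
      rw [hF _ hP, if_pos rfl, hD] at this
      omega
  · rintro ⟨H, H'⟩ ξ hξ
    rw [hF ξ hξ]
    split_ifs with e
    · subst e
      omega
    · have := H ξ hξ
      omega

open Classical in
/-- The dimension formula for restriction to a prime divisor, when all sections lift. -/
lemma finrank_restrict (hX : LocallyFactorial X) (h : IsPullbackDivisor i D E)
    (hP : IsPrimeDiv (i (genericPoint Z))) {F : CartierDivisor X}
    (hF : ∀ ξ, IsPrimeDiv ξ → dOrd ξ F = if ξ = i (genericPoint Z) then 1 else 0)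
    [FiniteDimensional ℂ (H0 s D)]
    (hsurj : ∀ ψ ∈ H0 (i ≫ s) E, ∃ φ ∈ H0 s D, Res i (show X.functionField from φ)
      (show Z.functionField from ψ)) :
    FiniteDimensional ℂ (H0 (i ≫ s) E) ∧ Module.finrank ℂ (H0 s D) =
      Module.finrank ℂ (H0 s (D - F)) + Module.finrank ℂ (H0 (i ≫ s) E) := by
  have hs : Function.Surjective (restrictH0 s h) := fun ψ => by
    obtain ⟨φ, hφ, hr⟩ := hsurj ψ.1 ψ.2
    exact ⟨⟨φ, hφ⟩, Subtype.ext ((restrictH0_spec s h ⟨φ, hφ⟩).unique hr)⟩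
  have hle : H0 s (D - F) ≤ H0 s D := fun φ hφ => ((mem_H0_sub_iff s hX h hP hF φ).mp hφ).1
  -- Left exactness of the restriction sequence: the sections of D that vanish on Z are those of D -
  -- F.
  have hker : LinearMap.ker (restrictH0 s h) = (H0 s (D - F)).comap (H0 s D).subtype := by
    ext φ
    rw [LinearMap.mem_ker, Submodule.mem_comap, Submodule.subtype_apply,
      mem_H0_sub_iff s hX h hP hF, (restrictH0_spec s h φ).mem_idealAt_iff]
    exact ⟨fun e => ⟨φ.2, congrArg Subtype.val e⟩, fun e => Subtype.ext e.2⟩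
  refine ⟨Module.Finite.of_surjective _ hs, ?_⟩
  rw [← LinearMap.finrank_range_add_finrank_ker (restrictH0 s h), LinearMap.range_eq_top.mpr hs,
    finrank_top, hker, (Submodule.comapSubtypeEquivOfLe hle).finrank_eq, add_comm]

/-- Pull-back of divisors can be checked in codimension one on the subscheme. -/
lemma isPullbackDivisor_of_ord (hZ : LocallyFactorial Z) (hD : D.1 (i (genericPoint Z)) = 0)
    (h : ∀ ζ, IsPrimeDiv ζ → ∃ (f : (X.functionField)ˣ) (g : (Z.functionField)ˣ),
      Res i (f : X.functionField) (g : Z.functionField) ∧ D.1 (i ζ) = divAt (i ζ) f ∧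
        dOrd ζ E = ord ζ g) : IsPullbackDivisor i D E := by
  obtain ⟨E', hE'⟩ := exists_isPullbackDivisor_of_eq_zero i hD
  have : E = E' := hZ.ext fun ζ hζ => by
    obtain ⟨f, g, hfg, hf, hg⟩ := h ζ hζ
    obtain ⟨u, hu, hu'⟩ := hE' ζ
    obtain ⟨v, rfl, rfl⟩ := hfg.exists_unit
    rw [hg, dOrd_eq hu', ← ordDiv_divAt, ← ordDiv_divAt,
      divAt_resUnits i (hf.symm.trans hu)]
  rwa [this]

open Classical in
/-- An integral closed subscheme of codimension one is an effective Cartier divisor. -/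
lemma isDivisorOf_ker [IsClosedImmersion i] (hX : LocallyFactorial X)
    (hP : IsPrimeDiv (i (genericPoint Z))) {F : CartierDivisor X}
    (hF : ∀ ξ, IsPrimeDiv ξ → dOrd ξ F = if ξ = i (genericPoint Z) then 1 else 0) :
    IsDivisorOf F i.ker := by
  intro x
  obtain ⟨U, hU, hx, hufd⟩ := hX x
  obtain ⟨f, u, huf, hord, hmem, hone⟩ := exists_local_equation hU (genericPoint_mem hx) hP
  have hf0 : f ≠ 0 := by
    rintro rfl
    rw [map_zero] at huf
    exact u.ne_zero huf
  refine ⟨⟨U, hU⟩, hx, f, hf0, ?_, u, huf.trans (algebraMap_germ hx f).symm, fun y hy => ?_⟩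
  · rw [Scheme.Hom.ker_apply]
    -- If U meets Z, a section vanishes on Z exactly when it vanishes at the generic point of Z.
    -- Otherwise the local equation is 1 and the ideal is the unit ideal.
    by_cases hη : i (genericPoint Z) ∈ U
    · ext g
      rw [← hmem hη g]
      change (i.app U).hom g = 0 ↔ _
      have hr : Res i (toK U (genericPoint_mem hx) g)
          (toK (i ⁻¹ᵁ U) hη ((i.app U).hom g)) := by
        refine ⟨X.presheaf.germ U (i (genericPoint Z)) hη g, algebraMap_germ hη g, ?_⟩
        exact Scheme.Hom.germ_stalkMap_apply i U (genericPoint Z) hη g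
      rw [hr.mem_idealAt_iff]
      exact (map_eq_zero_iff _ (toK_injective (i ⁻¹ᵁ U) hη)).symm
    · rw [hone hη, Ideal.span_singleton_one]
      have hempty : i ⁻¹ᵁ U = ⊥ := by
        rw [eq_bot_iff]
        exact fun z hz => hη ((specializes_generic i z).mem_open U.2 hz)
      have : Subsingleton Γ(Z, i ⁻¹ᵁ U) := by
        rw [hempty]
        infer_instance
      exact (RingHom.ker_eq_top_of_subsingleton _)
  · refine hX.eq_divAt fun ξ hξ hs => ?_
    rw [hF ξ hξ, hord ξ (hs.mem_open U.2 hy) hξ]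

end Restriction


/-! ### The series identity, from lifting of sections -/

section Conclusion

/-- Convolving with a monomial leaves at most one nonzero term, by cancellation. The second case is
that of D - F outside the monoid. -/
lemma conv_one_sub {M : Type} [AddMonoid M] [IsLeftCancelAdd M] (F : M) (E : Series M) (D : M) :
    (∀ G, F + G = D → conv (tpow 0 - tpow F) E D = E D - E G) ∧
      ((¬ ∃ G, F + G = D) → conv (tpow 0 - tpow F) E D = E D) := by
  classical
  have h1 : conv (tpow 0 - tpow F) E D =
      (∑ᶠ q : {q : M × M // q.1 + q.2 = D}, tpow 0 q.1.1 * E q.1.2) -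
        ∑ᶠ q : {q : M × M // q.1 + q.2 = D}, tpow F q.1.1 * E q.1.2 := by
    rw [← finsum_sub_distrib]
    · exact finsum_congr fun q => sub_mul _ _ _
    -- Splitting the sum requires finite supports; each has at most one element.
    all_goals
      refine Set.Subsingleton.finite fun q hq q' hq' => ?_
      have hq1 := Set.indicator_apply_ne_zero.mp (left_ne_zero_of_mul hq)
      have hq2 := Set.indicator_apply_ne_zero.mp (left_ne_zero_of_mul hq')
      have e1 : q.1.1 = q'.1.1 := hq1.1.trans hq2.1.symm
      have e2 : q.1.2 = q'.1.2 := by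
        have := q.2.trans q'.2.symm
        rw [e1] at this
        exact add_left_cancel this
      exact Subtype.ext (Prod.ext e1 e2)
  have key (A G : M) (h : A + G = D) :
      ∑ᶠ q : {q : M × M // q.1 + q.2 = D}, tpow A q.1.1 * E q.1.2 = E G := by
    rw [finsum_eq_single _ (⟨(A, G), h⟩ : {q : M × M // q.1 + q.2 = D})]
    · simp [tpow]
    · intro q hq
      by_cases e : q.1.1 = A
      · refine (hq (Subtype.ext (Prod.ext e ?_))).elim
        have := q.2.trans h.symm
        rw [e] at this
        exact add_left_cancel this
      · simp [tpow, e]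
  rw [h1, key 0 D (zero_add D)]
  refine ⟨fun G hG => by rw [key F G hG], fun h => ?_⟩
  rw [finsum_eq_zero_of_forall_eq_zero, sub_zero]
  intro q
  have : q.1.1 ≠ F := fun e => h ⟨q.1.2, e ▸ q.2⟩
  simp [tpow, this]

variable {X : Scheme.{0}} [IsIntegral X]

/-- A nonzero section φ gives the effective divisor D + div φ, and conversely. Finite-dimensionality
matters because `finrank` of an infinite-dimensional space is zero. -/
lemma mem_effMonoid_iff (hX : LocallyFactorial X) (s : X ⟶ Spec (.of ℂ)) (D : CartierDivisor X)
    [FiniteDimensional ℂ (H0 s D)] : Pic.mk D ∈ effMonoid X ↔ 0 < h0 s (Pic.mk D) := by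
  rw [h0_mk, Module.finrank_pos_iff]
  constructor
  · rintro ⟨E, hE, hED⟩
    obtain ⟨f, hf⟩ := Pic.mk_eq_iff.mp hED
    have hmem := (hX.mem_H0_iff s (D := D) f⁻¹).mpr fun ξ hξ => by
      have h1 := hX.isEffective_iff.mp hE ξ hξ
      have h2 : dOrd ξ D = dOrd ξ E + ord ξ f := by
        rw [dOrd_apply, hf, map_add]
        rfl
      rw [ord_inv]
      omega
    exact nontrivial_of_ne ⟨_, hmem⟩ 0 fun h =>
      (f⁻¹ : (X.functionField)ˣ).ne_zero (congrArg Subtype.val h)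
  · intro h
    obtain ⟨φ, hφ⟩ := exists_ne (0 : H0 s D)
    have hφ0 : (show X.functionField from φ.1) ≠ 0 := fun h => hφ (Subtype.ext h)
    refine ⟨D + principal X (.ofMul (Units.mk0 _ hφ0)), hX.isEffective_iff.mpr fun ξ hξ => ?_, ?_⟩
    · rw [map_add, dOrd_principal, add_comm]
      exact (hX.mem_H0_iff s (Units.mk0 _ hφ0)).mp φ.2 ξ hξ
    · refine Pic.mk_eq_of_dOrd hX (Units.mk0 _ hφ0)⁻¹ fun ξ _ => ?_
      rw [map_add, dOrd_principal, ord_inv]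
      ring

open Classical in
/-- The conclusion of the theorem, for a prime divisor `Z` on `X` such that the boundary divisors of
`X` restrict to those of `Z` and all sections of these divisors lift from `Z` to `X`. -/
theorem eulerChow_restrict {Z : Scheme.{0}} [IsIntegral Z] (i : Z ⟶ X) [IsClosedImmersion i]
    [CompactSpace X] [CompactSpace Z] {τ τ' B : Type} [Fintype B]
    {a : MvPolynomial τ ℂ →+* X.functionField} {η : B → X}
    {a' : MvPolynomial τ' ℂ →+* Z.functionField} {η' : B → Z}
    (M : BoundaryModel a η) (M' : BoundaryModel a' η') (hP : IsPrimeDiv (i (genericPoint Z)))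
    (hpull : ∀ n, IsPullbackDivisor i (M.divisor n) (M'.divisor n)) (sX : X ⟶ Spec (.of ℂ))
    (hfin : ∀ n, FiniteDimensional ℂ (H0 sX (M.divisor n)))
    (hsurj : ∀ n, ∀ ψ ∈ H0 (i ≫ sX) (M'.divisor n), ∃ φ ∈ H0 sX (M.divisor n),
      Res i (show X.functionField from φ) (show Z.functionField from ψ)) :
    let sP : Z ⟶ Spec (.of ℂ) := i ≫ sX
    (∀ D : CartierDivisor X, FiniteDimensional ℂ (H0 sX D)) ∧
    (∀ D : CartierDivisor Z, FiniteDimensional ℂ (H0 sP D)) ∧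
    Function.Bijective (Pic.pullback i) ∧
    ∃ (F₀ : CartierDivisor X) (F : effMonoid X) (L : AddSubmonoid (Pic X))
      (e : effMonoid Z →+ effMonoid X),
      IsDivisorOf F₀ i.ker ∧ (F : Pic X) = Pic.mk F₀ ∧
      (L : Set (Pic X)) = {D | h0 sX (D - F) < h0 sX D} ∧
      L.map (Pic.pullback i) = effMonoid Z ∧
      Function.Injective e ∧ (∀ D, Pic.pullback i (e D : Pic X) = D) ∧
      (∀ D : effMonoid X, D ∈ Set.range e ↔ (D : Pic X) ∈ L) ∧
      (∀ D ∈ L, D ∈ effMonoid X) ∧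
      conv (tpow 0 - tpow F) (eulerChow sX) = Function.extend e (eulerChow sP) 0 ∧
      ∀ D ∈ L, (h0 sP (Pic.pullback i D) : ℤ) = h0 sX D - h0 sX (D - F) := by
  intro sP
  have hX := M.factorial
  have hZ := M'.factorial
  have hF₀ (ξ : X) (hξ : IsPrimeDiv ξ) := hX.dOrd_divisor hP hξ
  have hdim (n : _) : FiniteDimensional ℂ (H0 sP (M'.divisor n)) ∧ _ :=
    have := hfin n
    finrank_restrict sX hX (hpull n) hP hF₀ (hsurj n)
  have hfinX (D : CartierDivisor X) : FiniteDimensional ℂ (H0 sX D) := by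
    obtain ⟨n, hn⟩ := M.mk_divisor_surjective (Pic.mk D)
    obtain ⟨f, hf⟩ := Pic.mk_eq_iff.mp hn
    have := hfin n
    exact Module.Finite.equiv (H0Equiv sX f hf).symm
  have hfinZ (D : CartierDivisor Z) : FiniteDimensional ℂ (H0 sP D) := by
    obtain ⟨n, hn⟩ := M'.mk_divisor_surjective (Pic.mk D)
    obtain ⟨f, hf⟩ := Pic.mk_eq_iff.mp hn
    have := (hdim n).1
    exact Module.Finite.equiv (H0Equiv sP f hf).symm
  have hpb (n) : Pic.pullback i (Pic.mk (M.divisor n)) = Pic.mk (M'.divisor n) :=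
    Pic.pullback_mk i (hpull n)
  have hbij : Function.Bijective (Pic.pullback i) := by
    constructor
    · intro c d hcd
      obtain ⟨n, rfl⟩ := M.mk_divisor_surjective c
      obtain ⟨m, rfl⟩ := M.mk_divisor_surjective d
      simp only [hpb] at hcd
      rw [M'.mk_divisor_injective hcd]
    · intro c
      obtain ⟨n, rfl⟩ := M'.mk_divisor_surjective c
      exact ⟨_, hpb n⟩
  have heffX (c : Pic X) : c ∈ effMonoid X ↔ 0 < h0 sX c := by
    obtain ⟨D, rfl⟩ := Pic.mk_surjective c
    have := hfinX D
    exact mem_effMonoid_iff hX sX D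
  have heffZ (c : Pic Z) : c ∈ effMonoid Z ↔ 0 < h0 sP c := by
    obtain ⟨D, rfl⟩ := Pic.mk_surjective c
    have := hfinZ D
    exact mem_effMonoid_iff hZ sP D
  let F₀ := hX.divisor hP
  have hF₀eff : IsEffective F₀ := hX.isEffective_iff.mpr fun ξ hξ => by
    rw [hF₀ ξ hξ]
    split_ifs <;> omega
  let F : effMonoid X := ⟨Pic.mk F₀, F₀, hF₀eff, rfl⟩
  -- The dimension formula was proved for boundary divisors only, but every class contains one. All
  -- remaining claims are read off from it.
  have hmain (c : Pic X) : h0 sX c = h0 sX (c - F) + h0 sP (Pic.pullback i c) := by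
    obtain ⟨n, rfl⟩ := M.mk_divisor_surjective c
    rw [hpb]
    exact (hdim n).2
  -- Defined as a preimage, L is a submonoid without further argument; `hmain` turns membership into
  -- the strict inequality.
  let L := (effMonoid Z).comap (Pic.pullback i)
  have hL (c : Pic X) : c ∈ L ↔ 0 < h0 sP (Pic.pullback i c) := heffZ _
  have hLeff (c : Pic X) (hc : c ∈ L) : c ∈ effMonoid X := by
    rw [heffX, hmain]
    have := (hL c).mp hc
    omega
  let ε : Pic X ≃+ Pic Z := AddEquiv.ofBijective (Pic.pullback i) hbij
  have hε (c : Pic Z) : Pic.pullback i (ε.symm c) = c := ε.apply_symm_apply c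
  have hε' (c : Pic X) : ε.symm (Pic.pullback i c) = c := ε.symm_apply_apply c
  let e : effMonoid Z →+ effMonoid X :=
    { toFun := fun D => ⟨ε.symm D, hLeff _ (by
        change Pic.pullback i _ ∈ effMonoid Z
        rw [hε]
        exact D.2)⟩
      map_zero' := Subtype.ext (map_zero ε.symm)
      map_add' := fun D D' => Subtype.ext (map_add ε.symm _ _) }
  have : IsLeftCancelAdd (effMonoid X) :=
    ⟨fun a b c h => Subtype.ext (add_left_cancel (congrArg Subtype.val h))⟩
  have he (D : effMonoid Z) : Pic.pullback i (e D : Pic X) = D := hε _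
  have hinj : Function.Injective e := fun D D' h => Subtype.ext (by rw [← he D, h, he])
  have hrange (D : effMonoid X) : D ∈ Set.range e ↔ (D : Pic X) ∈ L := by
    constructor
    · rintro ⟨D, rfl⟩
      change Pic.pullback i _ ∈ effMonoid Z
      rw [he]
      exact D.2
    · intro h
      exact ⟨⟨_, h⟩, Subtype.ext (hε' D)⟩
  refine ⟨hfinX, hfinZ, hbij, F₀, F, L, e, isDivisorOf_ker hX hP hF₀, rfl, ?_, ?_, hinj, he, hrange,
    hLeff, ?_, ?_⟩
  · ext c
    have := hmain c
    refine (hL c).trans ?_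
    change _ ↔ h0 sX (c - F) < h0 sX c
    omega
  · exact AddSubmonoid.map_comap_eq_of_surjective hbij.2 _
  · funext D
    have h1 : conv (tpow 0 - tpow F) (eulerChow sX) D =
        (h0 sX (D : Pic X) : ℤ) - h0 sX ((D : Pic X) - F) := by
      by_cases h : ∃ G, F + G = D
      · obtain ⟨G, rfl⟩ := h
        rw [(conv_one_sub F _ _).1 G rfl]
        have : ((F + G : effMonoid X) : Pic X) - F = G := by
          rw [AddSubmonoid.coe_add, add_sub_cancel_left]
        rw [this]
        rfl
      · rw [(conv_one_sub F _ _).2 h]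
        -- If D - F is not effective, its h⁰ is zero, so the formula for the coefficient is the same
        -- in both cases.
        have : h0 sX ((D : Pic X) - F) = 0 := by
          by_contra hne
          exact h ⟨⟨_, (heffX _).mpr (Nat.pos_of_ne_zero hne)⟩, Subtype.ext (add_sub_cancel _ _)⟩
        rw [this, Nat.cast_zero, sub_zero]
        rfl
    rw [h1, hmain, Nat.cast_add, add_sub_cancel_left]
    by_cases h : D ∈ Set.range e
    · obtain ⟨D, rfl⟩ := h
      rw [hinj.extend_apply, he]
      rfl
    · rw [Function.extend_apply' _ _ _ h]
      rw [hrange, hL] at h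
      have : h0 sP (Pic.pullback i (D : Pic X)) = 0 := by omega
      rw [this]
      rfl
  · intro D _
    rw [hmain D, Nat.cast_add, add_sub_cancel_left]

end Conclusion


/-! ### Coordinate rings of standard charts and of blow-up charts -/

section Coordinates

variable {J σ : Type} (pr : σ → J) (κ : J → σ)

/-- The coordinates of the chart of a product of projective spaces where the homogeneous coordinates
chosen by `κ` do not vanish. -/
abbrev ChartVar : Type := {v : σ // v ≠ κ (pr v)}

open Classical in
/-- The homogeneous coordinate `v`, divided by the one chosen by `κ`. -/
def coord (v : σ) : MvPolynomial (ChartVar pr κ) ℂ :=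
  if h : v = κ (pr v) then 1 else MvPolynomial.X ⟨v, h⟩

variable {pr κ}

lemma coord_of_eq {v : σ} (h : v = κ (pr v)) : coord pr κ v = 1 := dif_pos h

lemma coord_of_ne {v : σ} (h : v ≠ κ (pr v)) : coord pr κ v = MvPolynomial.X ⟨v, h⟩ := dif_neg h

variable {K : Type} [Field K] (ι : ℂ →+* K) (T : σ → K)

variable (pr κ) in
/-- The embedding of the coordinate ring of a chart. -/
def chartMap : MvPolynomial (ChartVar pr κ) ℂ →+* K :=
  MvPolynomial.eval₂Hom ι fun v => T v / T (κ (pr v))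

variable {ι T}

lemma chartMap_C (c : ℂ) : chartMap pr κ ι T (MvPolynomial.C c) = ι c :=
  MvPolynomial.eval₂Hom_C _ _ _

lemma chartMap_X (v : ChartVar pr κ) :
    chartMap pr κ ι T (MvPolynomial.X v) = T v / T (κ (pr v)) :=
  MvPolynomial.eval₂Hom_X' _ _ _

lemma chartMap_coord (hT : ∀ v, T v ≠ 0) (v : σ) :
    chartMap pr κ ι T (coord pr κ v) = T v / T (κ (pr v)) := by
  by_cases h : v = κ (pr v)
  · rw [coord_of_eq h, map_one, ← h, div_self (hT v)]
  · rw [coord_of_ne h, chartMap_X]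

variable (pr κ ι T) in
open Classical in
/-- The embedding of the coordinate ring of the `k`-th chart of the blow-up at the point `c`. -/
def blowMap (c : σ → ℂ) (k : σ) : MvPolynomial (ChartVar pr κ) ℂ →+* K :=
  MvPolynomial.eval₂Hom ι fun v =>
    if (v : σ) = k then T k - ι (c k) else (T v - ι (c v)) / (T k - ι (c k))

lemma blowMap_C (c : σ → ℂ) (k : σ) (b : ℂ) : blowMap pr κ ι T c k (MvPolynomial.C b) = ι b :=
  MvPolynomial.eval₂Hom_C _ _ _

lemma blowMap_X_self (c : σ → ℂ) {k : σ} (hk : k ≠ κ (pr k)) :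
    blowMap pr κ ι T c k (MvPolynomial.X ⟨k, hk⟩) = T k - ι (c k) :=
  (MvPolynomial.eval₂Hom_X' _ _ _).trans (if_pos rfl)

lemma blowMap_X_of_ne (c : σ → ℂ) {k : σ} (v : ChartVar pr κ) (hv : (v : σ) ≠ k) :
    blowMap pr κ ι T c k (MvPolynomial.X v) = (T v - ι (c v)) / (T k - ι (c k)) :=
  (MvPolynomial.eval₂Hom_X' _ _ _).trans (if_neg hv)

/-- Degrees in each variable add up in products, so a common factor involves no variable at all and
is a nonzero constant. This is how codimension at least two of the centres enters. -/
lemma not_dvd_both {τ : Type} {v w : τ} (hvw : v ≠ w) (b c : ℂ) {q : MvPolynomial τ ℂ}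
    (hq : Prime q) (h : q ∣ MvPolynomial.X v - MvPolynomial.C b) :
    ¬ q ∣ MvPolynomial.X w - MvPolynomial.C c := by
  classical
  intro h'
  have hdeg {u x : τ} (hux : u ≠ x) (b : ℂ) (h : q ∣ MvPolynomial.X u - MvPolynomial.C b) :
      q.degreeOf x = 0 := by
    have hne : (MvPolynomial.X u - MvPolynomial.C b : MvPolynomial τ ℂ) ≠ 0 := by
      intro h0
      have := congrArg (MvPolynomial.eval fun _ => b + 1) h0
      simp at this
    obtain ⟨r, hr⟩ := h
    have h1 : (MvPolynomial.X u - MvPolynomial.C b : MvPolynomial τ ℂ).degreeOf x = 0 := by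
      refine Nat.le_zero.mp ((MvPolynomial.degreeOf_sub_le x _ _).trans ?_)
      rw [MvPolynomial.degreeOf_X, if_neg hux.symm, MvPolynomial.degreeOf_C, max_self]
    rw [hr, MvPolynomial.degreeOf_mul_eq (left_ne_zero_of_mul (hr ▸ hne))
      (right_ne_zero_of_mul (hr ▸ hne))] at h1
    omega
  have hz (x : τ) : q.degreeOf x = 0 := by
    by_cases e : v = x
    · exact hdeg (e ▸ hvw.symm) c h'
    · exact hdeg e b h
  have hC : q = MvPolynomial.C (q.coeff 0) := by
    rw [← MvPolynomial.totalDegree_eq_zero_iff_eq_C, MvPolynomial.totalDegree_eq_zero_iff]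
    intro m hm x
    have := MvPolynomial.degreeOf_le_iff.mp (hz x).le m hm
    omega
  have h0 : q.coeff 0 ≠ 0 := by
    intro h0
    rw [h0, MvPolynomial.C_0] at hC
    exact hq.ne_zero hC
  refine hq.not_isUnit ?_
  rw [hC]
  exact (isUnit_iff_ne_zero.mpr h0).map MvPolynomial.C

end Coordinates


/-! ### Atlases of blown-up products of projective spaces -/

section Atlas

variable {X : Scheme.{0}} [IsIntegral X] {J σ Λ : Type}

/-- `x` lies in the chart `κ`. -/
def IsFin (pr : σ → J) (T : σ → X.functionField) (κ : J → σ) (x : X) : Prop :=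
  ∀ v, T v / T (κ (pr v)) ∈ ringAt x

/-- `x` lies over the point with coordinates `c`. -/
def IsAt (ι : ℂ →+* X.functionField) (T : σ → X.functionField) (c : σ → ℂ) (x : X) : Prop :=
  ∀ v, T v - ι (c v) ∈ idealAt x

/-- `x` lies in the `k`-th chart of the blow-up at the point with coordinates `c`. -/
def IsBlowFin (ι : ℂ →+* X.functionField) (T : σ → X.functionField) (c : σ → ℂ) (k : σ) (x : X) :
    Prop := ∀ v, (T v - ι (c v)) / (T k - ι (c k)) ∈ ringAt x

/-- The ratios `T v` of homogeneous coordinates on `X` make it the blow-up of a product of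
projective spaces, with homogeneous coordinates `pr⁻¹ j` in the `j`-th factor, in the points with
affine coordinates `pt l`. -/
structure Atlas (pr : σ → J) (o : J → σ) (ι : ℂ →+* X.functionField) (T : σ → X.functionField)
    (pt : Λ → σ → ℂ) : Prop where
  pr_o : ∀ j, pr (o j) = j
  T_ne : ∀ v, T v ≠ 0
  T_o : ∀ j, T (o j) = 1
  pt_o : ∀ l j, pt l (o j) = 1
  pt_inj : Function.Injective pt
  two : ∀ _ : Λ, ∃ v w, v ≠ w ∧ v ≠ o (pr v) ∧ w ≠ o (pr w)
  const : ∀ c x, ι c ∈ ringAt x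
  exists_fin : ∀ x, ∃ κ : J → σ, (∀ j, pr (κ j) = j) ∧ IsFin pr T κ x
  chart : ∀ κ x, (∀ j, pr (κ j) = j) → IsFin pr T κ x → (∀ l, ¬ IsAt ι T (pt l) x) →
    ∃ U g, x ∈ U ∧ IsChart (chartMap pr κ ι T) g U
  exists_blowFin : ∀ l x, IsAt ι T (pt l) x → ∃ k, k ≠ o (pr k) ∧ IsBlowFin ι T (pt l) k x
  blow : ∀ l k x, k ≠ o (pr k) → IsAt ι T (pt l) x → IsBlowFin ι T (pt l) k x →
    ∃ U g, x ∈ U ∧ IsChart (blowMap pr o ι T (pt l) k) g U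
  point : ∀ (κ : J → σ) (𝔭 : Ideal (MvPolynomial (ChartVar pr κ) ℂ)), (∀ j, pr (κ j) = j) →
    𝔭.IsPrime → (∀ l, ∃ v, coord pr κ v - MvPolynomial.C (pt l v) * coord pr κ (o (pr v)) ∉ 𝔭) →
    ∃ x, Centered (chartMap pr κ ι T) x 𝔭
  blow_point : ∀ l k (𝔭 : Ideal (MvPolynomial (ChartVar pr o) ℂ)) (hk : k ≠ o (pr k)),
    𝔭.IsPrime → MvPolynomial.X ⟨k, hk⟩ ∈ 𝔭 → ∃ x, Centered (blowMap pr o ι T (pt l) k) x 𝔭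
  ext : ∀ x y : X, ringAt x = ringAt y → x = y

namespace Atlas

variable {pr : σ → J} {o : J → σ} {ι : ℂ →+* X.functionField} {T : σ → X.functionField}
  {pt : Λ → σ → ℂ} (A : Atlas pr o ι T pt)
include A

lemma const_notMem {c : ℂ} (hc : c ≠ 0) (x : X) : ι c ∉ idealAt x := by
  refine notMem_idealAt_of_inv ((map_ne_zero ι).mpr hc) ?_
  rw [← map_inv₀]
  exact A.const _ x

lemma isAt_unique {l l' : Λ} {x : X} (h : IsAt ι T (pt l) x) (h' : IsAt ι T (pt l') x) :
    l = l' := by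
  refine A.pt_inj (funext fun v => ?_)
  by_contra hne
  refine A.const_notMem (sub_ne_zero.mpr hne) x ?_
  have := idealAt_sub (h' v) (h v)
  rwa [sub_sub_sub_cancel_left, ← map_sub] at this

lemma isFin_of_isAt {l : Λ} {x : X} (h : IsAt ι T (pt l) x) (v : σ) : T v ∈ ringAt x := by
  have := add_mem (idealAt_subset (h v)) (A.const (pt l v) x)
  rwa [sub_add_cancel] at this

lemma isAt_of_specializes {l : Λ} {x y : X} (hle : ringAt y ≤ ringAt x) (h : IsAt ι T (pt l) x)
    (hy : ∀ v, T v ∈ ringAt y) : IsAt ι T (pt l) y := fun v =>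
  idealAt_le_of_ringAt_le hle (sub_mem (hy v) (A.const _ y)) (h v)

lemma isFin_o_iff {x : X} : IsFin pr T o x ↔ ∀ v, T v ∈ ringAt x := by
  simp only [IsFin, A.T_o, div_one]

lemma chartMap_o (v : ChartVar pr o) : chartMap pr o ι T (MvPolynomial.X v) = T v := by
  rw [chartMap_X, A.T_o, div_one]

lemma isFin_of_centered {κ : J → σ} {x : X} {𝔭 : Ideal (MvPolynomial (ChartVar pr κ) ℂ)}
    (h : Centered (chartMap pr κ ι T) x 𝔭) : IsFin pr T κ x := fun v => by
  rw [← chartMap_coord (ι := ι) A.T_ne]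
  exact h.mem _

/-- Two charts at a point differ by units. -/
lemma isFin_of_notMem {κ κ' : J → σ} (hκ' : ∀ j, pr (κ' j) = j) {x : X} (h : IsFin pr T κ x)
    (h' : ∀ j, T (κ' j) / T (κ j) ∉ idealAt x) : IsFin pr T κ' x := fun v => by
  have h1 : T (κ' (pr v)) / T (κ (pr v)) ∈ ringAt x := by
    have := h (κ' (pr v))
    rwa [hκ'] at this
  have h2 := mul_mem (h v) (inv_mem_ringAt h1 (h' _))
  have e : T v / T (κ (pr v)) * (T (κ' (pr v)) / T (κ (pr v)))⁻¹ = T v / T (κ' (pr v)) := by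
    have := A.T_ne (κ (pr v))
    have := A.T_ne (κ' (pr v))
    field_simp
  rwa [e] at h2

/-- No hypersurface is contained in a centre: with two free coordinates, their differences from the
values at the centre have no common prime factor. -/
lemma exists_notMem_of_prime {q : MvPolynomial (ChartVar pr o) ℂ} (hq : Prime q) (l : Λ) :
    ∃ v : ChartVar pr o, MvPolynomial.X v - MvPolynomial.C (pt l v) ∉ Ideal.span {q} := by
  obtain ⟨v, w, hvw, hv, hw⟩ := A.two l
  by_contra! hc
  simp only [Ideal.mem_span_singleton] at hc
  exact not_dvd_both (fun e => hvw (congrArg Subtype.val e)) _ _ hq (hc ⟨v, hv⟩) (hc ⟨w, hw⟩)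

lemma not_isAt_of_centered {q : MvPolynomial (ChartVar pr o) ℂ} (hq : Prime q) {x : X}
    (h : Centered (chartMap pr o ι T) x (Ideal.span {q})) (l : Λ) : ¬ IsAt ι T (pt l) x := by
  intro hat
  obtain ⟨v, hv⟩ := A.exists_notMem_of_prime hq l
  refine hv ((h.van _).mp ?_)
  rw [map_sub, A.chartMap_o, chartMap_C]
  exact hat v

lemma exists_point_of_prime {q : MvPolynomial (ChartVar pr o) ℂ} (hq : Prime q) :
    ∃ x, Centered (chartMap pr o ι T) x (Ideal.span {q}) := by
  refine A.point o _ A.pr_o ((Ideal.span_singleton_prime hq.ne_zero).mpr hq) fun l => ?_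
  obtain ⟨v, hv⟩ := A.exists_notMem_of_prime hq l
  refine ⟨v, ?_⟩
  rwa [coord_of_eq (v := o (pr v)) (by rw [A.pr_o]), mul_one, coord_of_ne v.2]

/-- The zero prime is not a centre. If κ differs from o in the factor j, the equation of the centre
for `κ j` has constant term 1; if κ = o, a free coordinate minus its value at the centre is nonzero.
-/
lemma exists_point_bot {κ : J → σ} (hκ : ∀ j, pr (κ j) = j) :
    ∃ x, Centered (chartMap pr κ ι T) x ⊥ := by
  refine A.point κ _ hκ Ideal.isPrime_bot fun l => ?_
  by_cases h : ∃ j, o j ≠ κ j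
  · obtain ⟨j, hj⟩ := h
    have hj' : o j ≠ κ (pr (o j)) := by rwa [A.pr_o]
    refine ⟨κ j, fun h0 => ?_⟩
    rw [Ideal.mem_bot, hκ, coord_of_eq (by rw [hκ]), coord_of_ne hj'] at h0
    have := congrArg (MvPolynomial.eval fun _ => 0) h0
    simp at this
  · push Not at h
    obtain ⟨v, w, hvw, hv, hw⟩ := A.two l
    refine ⟨v, fun h0 => ?_⟩
    rw [Ideal.mem_bot, coord_of_eq (v := o (pr v)) (by rw [A.pr_o, h]),
      coord_of_ne (by rwa [← h])] at h0
    have := congrArg (MvPolynomial.eval fun _ => pt l v + 1) h0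
    simp at this

lemma chartMap_injective {κ : J → σ} (hκ : ∀ j, pr (κ j) = j) :
    Function.Injective (chartMap pr κ ι T) := by
  obtain ⟨x, hx⟩ := A.exists_point_bot hκ
  rw [injective_iff_map_eq_zero]
  intro f hf
  rw [← Ideal.mem_bot, ← hx.van, hf]
  exact zero_mem_idealAt x

/-- In the k-th blow-up chart every coordinate difference is a regular ratio times the k-th one, so
all vanish where the k-th one does. -/
lemma isAt_of_blow_centered {l : Λ} {k : σ} (hk : k ≠ o (pr k)) {x : X}
    {𝔭 : Ideal (MvPolynomial (ChartVar pr o) ℂ)} (h : Centered (blowMap pr o ι T (pt l) k) x 𝔭)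
    (hk𝔭 : MvPolynomial.X ⟨k, hk⟩ ∈ 𝔭) : IsAt ι T (pt l) x ∧ IsBlowFin ι T (pt l) k x := by
  have h0 : T k - ι (pt l k) ∈ idealAt x := by
    rw [← blowMap_X_self (pr := pr) (κ := o) (ι := ι) (T := T) (pt l) hk]
    exact (h.van _).mpr hk𝔭
  have hT (v : σ) (hv : v ≠ o (pr v)) : T v - ι (pt l v) ≠ 0 := by
    have hne : (MvPolynomial.X ⟨v, hv⟩ - MvPolynomial.C (pt l v) :
        MvPolynomial (ChartVar pr o) ℂ) ≠ 0 := fun h0 => by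
      have := congrArg (MvPolynomial.eval fun _ => pt l v + 1) h0
      simp at this
    have := (map_ne_zero_iff _ (A.chartMap_injective A.pr_o)).mpr hne
    rwa [map_sub, A.chartMap_o, chartMap_C] at this
  have hfin : IsBlowFin ι T (pt l) k x := fun v => by
    by_cases hv : v = o (pr v)
    · rw [hv, A.T_o, A.pt_o, map_one, sub_self, zero_div]
      exact zero_mem _
    · by_cases hvk : v = k
      · rw [hvk, div_self (hT k hk)]
        exact one_mem _
      · rw [← blowMap_X_of_ne (pr := pr) (κ := o) (ι := ι) (T := T) (pt l) ⟨v, hv⟩ hvk]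
        exact h.mem _
  refine ⟨fun v => ?_, hfin⟩
  rw [← div_mul_cancel₀ (T v - ι (pt l v)) (hT k hk)]
  exact idealAt_mul (hfin v) h0

lemma blowMap_injective (l : Λ) {k : σ} (hk : k ≠ o (pr k)) :
    Function.Injective (blowMap pr o ι T (pt l) k) := by
  have hX : Prime (MvPolynomial.X ⟨k, hk⟩ : MvPolynomial (ChartVar pr o) ℂ) :=
    MvPolynomial.X_prime
  have hmem := Ideal.mem_span_singleton_self
    (MvPolynomial.X ⟨k, hk⟩ : MvPolynomial (ChartVar pr o) ℂ)
  obtain ⟨x, hx⟩ := A.blow_point l k _ hk ((Ideal.span_singleton_prime hX.ne_zero).mpr hX) hmem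
  have hxc := A.isAt_of_blow_centered hk hx hmem
  obtain ⟨U, g, -, hU⟩ := A.blow l k x hk hxc.1 hxc.2
  exact hU.injective

/-- All charts, over the centres and away from them, have localizations of polynomial rings as
coordinate rings. -/
lemma locallyFactorial : LocallyFactorial X := fun x => by
  by_cases h : ∃ l, IsAt ι T (pt l) x
  · obtain ⟨l, hl⟩ := h
    obtain ⟨k, hk, hk'⟩ := A.exists_blowFin l x hl
    obtain ⟨U, g, hx, hU⟩ := A.blow l k x hk hl hk'
    exact ⟨U, hU.affine, hx, hU.ufd⟩
  · push Not at h
    obtain ⟨κ, hκ, hfin⟩ := A.exists_fin x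
    obtain ⟨U, g, hx, hU⟩ := A.chart κ x hκ hfin h
    exact ⟨U, hU.affine, hx, hU.ufd⟩

end Atlas

end Atlas


/-! ### Hyperplanes at infinity and exceptional divisors -/

section Boundary

variable {X : Scheme.{0}} [IsIntegral X] {J σ Λ : Type}

open Classical in
/-- The chart `o`, with the coordinate on the `j`-th factor replaced by `w`. -/
def moved (o : J → σ) (j : J) (w : σ) : J → σ := Function.update o j w

open Classical in
lemma moved_self (o : J → σ) (j : J) (w : σ) : moved o j w j = w := by
  rw [moved, Function.update_self]

open Classical in
lemma moved_of_ne (o : J → σ) {j j' : J} (w : σ) (h : j' ≠ j) : moved o j w j' = o j' := by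
  rw [moved, Function.update_of_ne h]

lemma pr_moved {pr : σ → J} {o : J → σ} (ho : ∀ j, pr (o j) = j) {j : J} {w : σ} (hw : pr w = j)
    (j' : J) : pr (moved o j w j') = j' := by
  by_cases h : j' = j
  · rw [h, moved_self, hw]
  · rw [moved_of_ne o w h, ho]

lemma prime_coord {pr : σ → J} {κ : J → σ} {v : σ} (h : v ≠ κ (pr v)) : Prime (coord pr κ v) := by
  rw [coord_of_ne h]
  exact MvPolynomial.X_prime

/-- A choice of coordinates that are infinite along the hyperplanes at infinity, respectively
generate the ideal of the exceptional divisors. -/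
structure IsFrame (pr : σ → J) (o c : J → σ) (k : Λ → σ) : Prop where
  pr_c : ∀ j, pr (c j) = j
  c_ne : ∀ j, c j ≠ o j
  k_ne : ∀ l, k l ≠ o (pr (k l))

/-- The points `η` are the generic points of the hyperplanes at infinity and of the exceptional
divisors. -/
structure IsBoundary (pr : σ → J) (o : J → σ) (ι : ℂ →+* X.functionField)
    (T : σ → X.functionField) (pt : Λ → σ → ℂ) (c : J → σ) (k : Λ → σ) (η : J ⊕ Λ → X) :
    Prop where
  infinity : ∀ j, Centered (chartMap pr (moved o j (c j)) ι T) (η (Sum.inl j))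
    (Ideal.span {coord pr (moved o j (c j)) (o j)})
  exceptional : ∀ l, Centered (blowMap pr o ι T (pt l) (k l)) (η (Sum.inr l))
    (Ideal.span {coord pr o (k l)})

variable {pr : σ → J} {o : J → σ} {ι : ℂ →+* X.functionField} {T : σ → X.functionField}
  {pt : Λ → σ → ℂ} {c : J → σ} {k : Λ → σ} {η : J ⊕ Λ → X}

namespace Atlas

variable (A : Atlas pr o ι T pt)
include A

lemma o_ne_moved (F : IsFrame pr o c k) (j : J) : o j ≠ moved o j (c j) (pr (o j)) := by
  rw [A.pr_o, moved_self]
  exact (F.c_ne j).symm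

lemma exists_isBoundary (F : IsFrame pr o c k) :
    ∃ η, IsBoundary pr o ι T pt c k (η : J ⊕ Λ → X) := by
  have h1 (j : J) : ∃ x, Centered (chartMap pr (moved o j (c j)) ι T) x
      (Ideal.span {coord pr (moved o j (c j)) (o j)}) := by
    have hp := prime_coord (A.o_ne_moved F j)
    have hprime := (Ideal.span_singleton_prime hp.ne_zero).mpr hp
    -- In the moved chart the coordinate `c j` is 1, so the corresponding equation of a centre is 1
    -- modulo the coordinate of `o j`: the hyperplane at infinity is not contained in a centre.
    refine A.point _ _ (pr_moved A.pr_o (F.pr_c j)) hprime fun l => ⟨c j, fun hc => ?_⟩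
    rw [F.pr_c, coord_of_eq (v := c j) (by rw [F.pr_c, moved_self])] at hc
    refine hprime.ne_top ((Ideal.eq_top_iff_one _).mpr ?_)
    have := add_mem hc (Ideal.mul_mem_left _ (MvPolynomial.C (pt l (c j)))
      (Ideal.mem_span_singleton_self (coord pr (moved o j (c j)) (o j))))
    rwa [sub_add_cancel] at this
  have h2 (l : Λ) : ∃ x, Centered (blowMap pr o ι T (pt l) (k l)) x
      (Ideal.span {coord pr o (k l)}) := by
    have hp := prime_coord (pr := pr) (F.k_ne l)
    refine A.blow_point l (k l) _ (F.k_ne l) ((Ideal.span_singleton_prime hp.ne_zero).mpr hp) ?_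
    rw [coord_of_ne (F.k_ne l)]
    exact Ideal.mem_span_singleton_self _
  choose η1 hη1 using h1
  choose η2 hη2 using h2
  exact ⟨Sum.elim η1 η2, hη1, hη2⟩

variable (F : IsFrame pr o c k) (H : IsBoundary pr o ι T pt c k η)
include F H

lemma exceptional_isAt (l : Λ) :
    IsAt ι T (pt l) (η (Sum.inr l)) ∧ IsBlowFin ι T (pt l) (k l) (η (Sum.inr l)) :=
  A.isAt_of_blow_centered (F.k_ne l) (H.exceptional l)
    (by rw [coord_of_ne (F.k_ne l)]; exact Ideal.mem_span_singleton_self _)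

omit F in
lemma T_inv_mem (j : J) : (T (c j))⁻¹ ∈ idealAt (η (Sum.inl j)) := by
  have := ((H.infinity j).van _).mpr (Ideal.mem_span_singleton_self _)
  rwa [chartMap_coord A.T_ne, A.T_o, A.pr_o, moved_self, one_div] at this

omit F in
lemma T_notMem (j : J) : T (c j) ∉ ringAt (η (Sum.inl j)) := fun h =>
  notMem_idealAt_of_inv (inv_ne_zero (A.T_ne _)) (by rwa [inv_inv]) (A.T_inv_mem H j)

lemma T_mem_of_ne {j j' : J} (h : j' ≠ j) : T (c j') ∈ ringAt (η (Sum.inl j)) := by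
  have := (H.infinity j).mem (coord pr _ (c j'))
  rwa [chartMap_coord A.T_ne, F.pr_c, moved_of_ne _ _ h, A.T_o, div_one] at this

lemma isPrimeDiv_boundary (b : J ⊕ Λ) : IsPrimeDiv (η b) := by
  rcases b with j | l
  · exact (H.infinity j).isPrimeDiv (A.chartMap_injective (pr_moved A.pr_o (F.pr_c j)))
      (prime_coord (A.o_ne_moved F j))
  · exact (H.exceptional l).isPrimeDiv (A.blowMap_injective l (F.k_ne l)) (prime_coord (F.k_ne l))

/-- The function `T (c j)` has a pole along the j-th hyperplane at infinity and along no other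
boundary divisor, while exceptional divisors lie over different points. -/
lemma boundary_injective : Function.Injective η := by
  have hne (j : J) (l : Λ) : η (Sum.inl j) ≠ η (Sum.inr l) := fun e =>
    A.T_notMem H j (e ▸ A.isFin_of_isAt (A.exceptional_isAt F H l).1 _)
  rintro (j | l) (j' | l') e
  · by_contra hjj
    have : j ≠ j' := fun h => hjj (congrArg _ h)
    exact A.T_notMem H j (e ▸ A.T_mem_of_ne F H this)
  · exact (hne j l' e).elim
  · exact (hne j' l e.symm).elim
  · exact congrArg _ (A.isAt_unique (A.exceptional_isAt F H l).1
      (e ▸ (A.exceptional_isAt F H l').1))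

/-- In any blow-up chart containing ξ, its prime is generated by the coordinate of that chart's
index. The coordinate `k l` is then a unit at ξ, so ξ also lies in the chart `k l`, with the same
centre as the chosen exceptional point. -/
lemma eq_exceptional {ξ : X} (hξ : IsPrimeDiv ξ) {l : Λ} (hl : IsAt ι T (pt l) ξ) :
    ξ = η (Sum.inr l) := by
  obtain ⟨k', hk', hfin'⟩ := A.exists_blowFin l ξ hl
  obtain ⟨U, g, hx, hU⟩ := A.blow l k' ξ hk' hl hfin'
  obtain ⟨𝔭, -, h𝔭⟩ := hU.exists_centered hx
  have hT (v : σ) (hv : v ≠ o (pr v)) : T v - ι (pt l v) ≠ 0 := by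
    have hne : (MvPolynomial.X ⟨v, hv⟩ - MvPolynomial.C (pt l v) :
        MvPolynomial (ChartVar pr o) ℂ) ≠ 0 := fun h0 => by
      have := congrArg (MvPolynomial.eval fun _ => pt l v + 1) h0
      simp at this
    have := (map_ne_zero_iff _ (A.chartMap_injective A.pr_o)).mpr hne
    rwa [map_sub, A.chartMap_o, chartMap_C] at this
  have hmem : coord pr o k' ∈ 𝔭 := by
    rw [coord_of_ne hk', ← h𝔭.van, blowMap_X_self]
    exact hl k'
  have hspan := h𝔭.eq_span hU.injective hξ (prime_coord hk') hmem
  have hfin : IsBlowFin ι T (pt l) (k l) ξ := by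
    by_cases e : k l = k'
    · rwa [e]
    have hnot : coord pr o (k l) ∉ 𝔭 := by
      rw [hspan, coord_of_ne hk', coord_of_ne (F.k_ne l), Ideal.mem_span_singleton,
        MvPolynomial.X_dvd_X]
      exact fun e' => e (congrArg Subtype.val e').symm
    intro v
    have h1 := mul_mem (hfin' v) (h𝔭.inv_mem hnot)
    rw [coord_of_ne (F.k_ne l), blowMap_X_of_ne _ _ e] at h1
    have e2 : (T v - ι (pt l v)) / (T k' - ι (pt l k')) *
        ((T (k l) - ι (pt l (k l))) / (T k' - ι (pt l k')))⁻¹ =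
        (T v - ι (pt l v)) / (T (k l) - ι (pt l (k l))) := by
      have := hT _ hk'
      have := hT _ (F.k_ne l)
      field_simp
    rwa [e2] at h1
  obtain ⟨U, g, hx, hU⟩ := A.blow l (k l) ξ (F.k_ne l) hl hfin
  obtain ⟨𝔮, -, h𝔮⟩ := hU.exists_centered hx
  have hmem : coord pr o (k l) ∈ 𝔮 := by
    rw [coord_of_ne (F.k_ne l), ← h𝔮.van, blowMap_X_self]
    exact hl (k l)
  have hspan := h𝔮.eq_span hU.injective hξ (prime_coord (F.k_ne l)) hmem
  rw [hspan] at h𝔮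
  exact A.ext _ _ (h𝔮.ringAt_eq (H.exceptional l))

/-- Away from the centres ξ lies in a standard chart. Either the coordinate of some `o j` vanishes
on it, and ξ is a hyperplane at infinity, or ξ meets the chart o, whose coordinate ring is
factorial. -/
lemma boundary_cases {ξ : X} (hξ : IsPrimeDiv ξ) :
    (∃ b, ξ = η b) ∨ ∃ q, Prime q ∧ Centered (chartMap pr o ι T) ξ (Ideal.span {q}) := by
  by_cases h : ∃ l, IsAt ι T (pt l) ξ
  · obtain ⟨l, hl⟩ := h
    exact .inl ⟨_, A.eq_exceptional F H hξ hl⟩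
  push Not at h
  obtain ⟨κ, hκ, hfin⟩ := A.exists_fin ξ
  obtain ⟨U, g, hx, hU⟩ := A.chart κ ξ hκ hfin h
  obtain ⟨𝔭, -, h𝔭⟩ := hU.exists_centered hx
  by_cases hj : ∃ j, coord pr κ (o j) ∈ 𝔭
  · left
    obtain ⟨j, hj⟩ := hj
    have hne : o j ≠ κ (pr (o j)) := fun e => h𝔭.prime.ne_top ((Ideal.eq_top_iff_one _).mpr
      (coord_of_eq e ▸ hj))
    have hspan := h𝔭.eq_span hU.injective hξ (prime_coord hne) hj
    have hκ' := pr_moved A.pr_o (F.pr_c j)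
    -- The prime of ξ is generated by the coordinate of `o j`, which the moved chart does not use;
    -- its own distinguished coordinates are therefore units at ξ.
    have hfin' : IsFin pr T (moved o j (c j)) ξ := by
      refine A.isFin_of_notMem hκ' hfin fun j' => ?_
      have hne' : moved o j (c j) j' ≠ o j := by
        intro e
        have : j' = j := by rw [← hκ' j', e, A.pr_o]
        rw [this, moved_self] at e
        exact F.c_ne j e
      have h1 : coord pr κ (moved o j (c j) j') ∉ 𝔭 := by
        by_cases e : moved o j (c j) j' = κ (pr (moved o j (c j) j'))
        · rw [coord_of_eq e]
          exact fun h1 => h𝔭.prime.ne_top ((Ideal.eq_top_iff_one _).mpr h1)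
        · rw [hspan, coord_of_ne e, coord_of_ne hne, Ideal.mem_span_singleton,
            MvPolynomial.X_dvd_X]
          exact fun e' => hne' (congrArg Subtype.val e').symm
      rwa [← h𝔭.van, chartMap_coord A.T_ne, hκ'] at h1
    obtain ⟨U', g', hx', hU'⟩ := A.chart _ ξ hκ' hfin' h
    obtain ⟨𝔮, -, h𝔮⟩ := hU'.exists_centered hx'
    have hmem : coord pr (moved o j (c j)) (o j) ∈ 𝔮 := by
      rw [← h𝔮.van, chartMap_coord A.T_ne, A.pr_o, moved_self]
      have h1 := (h𝔭.van _).mpr hj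
      rw [chartMap_coord A.T_ne, A.pr_o] at h1
      have h2 := hfin' (κ j)
      rw [hκ, moved_self] at h2
      have h3 := idealAt_mul h2 h1
      have e : T (κ j) / T (c j) * (T (o j) / T (κ j)) = T (o j) / T (c j) := by
        have := A.T_ne (κ j)
        have := A.T_ne (c j)
        field_simp
      rwa [e] at h3
    have hspan' := h𝔮.eq_span hU'.injective hξ (prime_coord (A.o_ne_moved F j)) hmem
    rw [hspan'] at h𝔮
    exact ⟨_, A.ext _ _ (h𝔮.ringAt_eq (H.infinity j))⟩
  · right
    push Not at hj
    have hfin' : IsFin pr T o ξ := by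
      refine A.isFin_of_notMem A.pr_o hfin fun j => ?_
      have := hj j
      rwa [← h𝔭.van, chartMap_coord A.T_ne, A.pr_o] at this
    obtain ⟨U', g', hx', hU'⟩ := A.chart o ξ A.pr_o hfin' h
    obtain ⟨𝔮, -, h𝔮⟩ := hU'.exists_centered hx'
    obtain ⟨q, hq, hspan⟩ := h𝔮.exists_prime_eq_span hU'.injective hξ
    exact ⟨q, hq, hspan ▸ h𝔮⟩

omit F H in
-- At the point centred at the zero prime every nonzero function is a unit, so its local ring is the
-- whole function field and consists of fractions of polynomials.
lemma exists_fraction (f : X.functionField) :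
    ∃ n d, d ≠ 0 ∧ f * chartMap pr o ι T d = chartMap pr o ι T n := by
  obtain ⟨x, hx⟩ := A.exists_point_bot A.pr_o
  have htop (g : X.functionField) (hg : g ∈ ringAt x) (h0 : g ≠ 0) : g⁻¹ ∈ ringAt x := by
    refine inv_mem_ringAt hg fun hg' => h0 ?_
    obtain ⟨n, d, hd, e⟩ := hx.frac g hg
    have h1 : chartMap pr o ι T n ∈ idealAt x := by
      rw [← e, mul_comm]
      exact idealAt_mul (hx.mem d) hg'
    rw [hx.van, Ideal.mem_bot] at h1
    rw [h1, map_zero] at e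
    exact (mul_eq_zero.mp e).resolve_right (hx.ne_zero hd)
  have hf : f ∈ ringAt x := by
    obtain ⟨a, b, hb, rfl⟩ := IsFractionRing.div_surjective (X.presheaf.stalk x) f
    rw [div_eq_mul_inv]
    refine mul_mem (algebraMap_mem_ringAt a) (htop _ (algebraMap_mem_ringAt b) ?_)
    exact IsFractionRing.to_map_ne_zero_of_mem_nonZeroDivisors hb
  obtain ⟨n, d, hd, e⟩ := hx.frac f hf
  exact ⟨n, d, fun h => hd (h ▸ zero_mem _), e⟩

theorem boundaryModel : BoundaryModel (chartMap pr o ι T) η where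
  factorial := A.locallyFactorial
  isPrimeDiv := A.isPrimeDiv_boundary F H
  injective := A.boundary_injective F H
  const c x := by
    rw [chartMap_C]
    exact A.const c x
  map_injective := A.chartMap_injective A.pr_o
  fraction := A.exists_fraction
  cases _ hξ := A.boundary_cases F H hξ
  exists_point _ hq := A.exists_point_of_prime hq
  unique _ _ _ h h' := A.ext _ _ (h.ringAt_eq h')
  disjoint b q hq h := by
    rcases b with j | l
    · have hc : c j ≠ o (pr (c j)) := by
        rw [F.pr_c]
        exact F.c_ne j
      have := h.mem (MvPolynomial.X ⟨c j, hc⟩)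
      rw [A.chartMap_o] at this
      exact A.T_notMem H j this
    · exact A.not_isAt_of_centered hq h l (A.exceptional_isAt F H l).1

end Atlas

end Boundary


/-! ### Pole orders at infinity are degrees; finiteness of sections -/

section Degree

variable {X : Scheme.{0}} [IsIntegral X] {J σ Λ : Type} {pr : σ → J} {o : J → σ}
  {ι : ℂ →+* X.functionField} {T : σ → X.functionField}
  {pt : Λ → σ → ℂ} {c : J → σ} {k : Λ → σ} {η : J ⊕ Λ → X}

open Classical in
/-- The degree of a monomial in the coordinates on the `j`-th factor. -/
def blockDegree (j : J) (m : ChartVar pr o →₀ ℕ) : ℕ :=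
  ∑ v ∈ m.support, if pr v = j then m v else 0

lemma le_blockDegree (m : ChartVar pr o →₀ ℕ) (v : ChartVar pr o) :
    m v ≤ blockDegree (pr v) m := by
  classical
  by_cases hv : v ∈ m.support
  · have := Finset.single_le_sum (f := fun w : ChartVar pr o => if pr w = pr v then m w else 0)
      (fun _ _ => Nat.zero_le _) hv
    rw [if_pos rfl] at this
    rw [blockDegree]
    convert this
  · rw [Finsupp.notMem_support_iff.mp hv]
    exact Nat.zero_le _

namespace Atlas

variable (A : Atlas pr o ι T pt) (F : IsFrame pr o c k)
include A

/-- The monomial `m` in the coordinates of the chart around the `j`-th hyperplane at infinity. -/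
lemma chartMap_moved_prod (j : J) (m : ChartVar pr o →₀ ℕ) :
    chartMap pr (moved o j (c j)) ι T (∏ v ∈ m.support, coord pr (moved o j (c j)) v ^ m v) =
      (T (c j))⁻¹ ^ blockDegree j m * chartMap pr o ι T (MvPolynomial.monomial m 1) := by
  classical
  rw [MvPolynomial.monomial_eq, map_one, one_mul, Finsupp.prod, map_prod, map_prod, blockDegree,
    ← Finset.prod_pow_eq_pow_sum, ← Finset.prod_mul_distrib]
  refine Finset.prod_congr rfl fun v _ => ?_
  rw [map_pow, map_pow, chartMap_coord A.T_ne, A.chartMap_o]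
  by_cases h : pr v = j
  · rw [if_pos h, h, moved_self, ← mul_pow, div_eq_inv_mul]
  · rw [if_neg h, moved_of_ne _ _ h, A.T_o, div_one, pow_zero, one_mul]

/-- Homogenization in the block j: multiplying by the d-th power of `(T (c j))⁻¹` supplies every
monomial of smaller degree with the missing power of the equation of infinity. -/
lemma chartMap_moved_sum (j : J) (d : ℕ) (S : Finset (ChartVar pr o →₀ ℕ))
    (hS : ∀ m ∈ S, blockDegree j m ≤ d) (f : (ChartVar pr o →₀ ℕ) → ℂ) :
    chartMap pr (moved o j (c j)) ι T (∑ m ∈ S, MvPolynomial.C (f m) *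
      (coord pr (moved o j (c j)) (o j) ^ (d - blockDegree j m) *
        ∏ v ∈ m.support, coord pr (moved o j (c j)) v ^ m v)) =
      (T (c j))⁻¹ ^ d * chartMap pr o ι T (∑ m ∈ S, MvPolynomial.monomial m (f m)) := by
  rw [map_sum, map_sum, Finset.mul_sum]
  refine Finset.sum_congr rfl fun m hm => ?_
  rw [map_mul, map_mul, A.chartMap_moved_prod, map_pow, chartMap_coord A.T_ne, A.T_o, A.pr_o,
    moved_self, one_div, chartMap_C, ← mul_assoc ((T (c j))⁻¹ ^ _), ← pow_add,
    Nat.sub_add_cancel (hS m hm)]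
  conv_rhs => rw [← mul_one (f m), ← MvPolynomial.C_mul_monomial, map_mul, chartMap_C]
  ring

include F

/-- The order of pole of a polynomial at the `j`-th hyperplane at infinity is its degree in the
coordinates on the `j`-th factor. -/
lemma blockDegree_le (H : IsBoundary pr o ι T pt c k η) (j : J)
    {ψ : MvPolynomial (ChartVar pr o) ℂ} (u : (X.functionField)ˣ)
    (hu : (u : X.functionField) = chartMap pr o ι T ψ) {m : ChartVar pr o →₀ ℕ}
    (hm : m ∈ ψ.support) : (blockDegree j m : ℤ) ≤ -ord (η (Sum.inl j)) u := by
  classical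
  obtain ⟨m₀, hm₀, hmax⟩ := ψ.support.exists_max_image (blockDegree j) ⟨m, hm⟩
  set d := blockDegree j m₀ with hd
  set κ := moved o j (c j) with hκ
  have ho : o j ≠ κ (pr (o j)) := A.o_ne_moved F j
  have hpX : Prime (coord pr κ (o j)) := prime_coord ho
  have hinj' := A.chartMap_injective (pr_moved A.pr_o (F.pr_c j))
  have hinj := A.chartMap_injective A.pr_o
  let term (m : ChartVar pr o →₀ ℕ) : MvPolynomial (ChartVar pr κ) ℂ :=
    MvPolynomial.C (ψ.coeff m) * (coord pr κ (o j) ^ (d - blockDegree j m) *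
        ∏ v ∈ m.support, coord pr κ v ^ m v)
  have hsum := A.chartMap_moved_sum j (c := c) d ψ.support hmax ψ.coeff
  have htop := A.chartMap_moved_sum j (c := c) d (ψ.support.filter fun m => blockDegree j m = d)
    (fun m hm => (Finset.mem_filter.mp hm).2.le) ψ.coeff
  rw [MvPolynomial.support_sum_monomial_coeff] at hsum
  have hT0 : (T (c j))⁻¹ ≠ 0 := inv_ne_zero (A.T_ne _)
  -- Modulo the equation of infinity only the terms of top degree d survive, and these do not
  -- cancel.
  have hnd : ∑ m ∈ ψ.support, term m ∉ Ideal.span {coord pr κ (o j)} := by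
    intro hmem
    have h1 : ∑ m ∈ ψ.support.filter (fun m => ¬ blockDegree j m = d), term m ∈
        Ideal.span {coord pr κ (o j)} := by
      refine Ideal.sum_mem _ fun m hm => Ideal.mul_mem_left _ _ (Ideal.mul_mem_right _ _ ?_)
      obtain ⟨hm1, hm2⟩ := Finset.mem_filter.mp hm
      have := hmax m hm1
      exact Ideal.pow_mem_of_mem _ (Ideal.mem_span_singleton_self _) _ (by omega)
    have h2 : ∑ m ∈ ψ.support.filter (fun m => blockDegree j m = d), term m ∈
        Ideal.span {coord pr κ (o j)} := by
      rw [← Finset.sum_filter_add_sum_filter_not _ fun m => blockDegree j m = d] at hmem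
      exact (Ideal.add_mem_iff_left _ h1).mp hmem
    -- Setting the equation of infinity to zero kills its multiples but fixes the top-degree part,
    -- which does not involve it. If divisible, that part would be zero, contradicting the nonzero
    -- coefficient at m₀.
    let ε : MvPolynomial (ChartVar pr κ) ℂ →+* MvPolynomial (ChartVar pr κ) ℂ :=
      MvPolynomial.eval₂Hom MvPolynomial.C fun v => if (v : σ) = o j then 0 else MvPolynomial.X v
    have hε0 : ε (coord pr κ (o j)) = 0 := by
      rw [coord_of_ne ho]
      exact (MvPolynomial.eval₂Hom_X' _ _ _).trans (if_pos rfl)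
    have hε (v : σ) (hv : v ≠ o (pr v)) : ε (coord pr κ v) = coord pr κ v := by
      by_cases e : v = κ (pr v)
      · rw [coord_of_eq e, map_one]
      · rw [coord_of_ne e]
        refine (MvPolynomial.eval₂Hom_X' _ _ _).trans (if_neg fun e' : v = o j => hv ?_)
        rw [e', A.pr_o]
    have h3 : ε (∑ m ∈ ψ.support.filter (fun m => blockDegree j m = d), term m) =
        ∑ m ∈ ψ.support.filter (fun m => blockDegree j m = d), term m := by
      rw [map_sum]
      refine Finset.sum_congr rfl fun m hm => ?_
      simp only [term]
      rw [(Finset.mem_filter.mp hm).2, Nat.sub_self, pow_zero, one_mul, map_mul, map_prod]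
      congr 1
      · exact MvPolynomial.eval₂Hom_C _ _ _
      · exact Finset.prod_congr rfl fun v _ => by rw [map_pow, hε v v.2]
    have h4 : ∑ m ∈ ψ.support.filter (fun m => blockDegree j m = d), term m = 0 := by
      rw [← h3]
      obtain ⟨q, hq⟩ := Ideal.mem_span_singleton.mp h2
      rw [hq, map_mul, hε0, zero_mul]
    rw [h4, map_zero] at htop
    have h5 := (map_eq_zero_iff _ hinj).mp
      ((mul_eq_zero.mp htop.symm).resolve_left (pow_ne_zero _ hT0))
    have h6 := congrArg (MvPolynomial.coeff m₀) h5
    rw [MvPolynomial.coeff_sum] at h6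
    simp only [MvPolynomial.coeff_monomial, MvPolynomial.coeff_zero, Finset.sum_ite_eq'] at h6
    rw [if_pos (Finset.mem_filter.mpr ⟨hm₀, hd.symm⟩)] at h6
    exact MvPolynomial.mem_support_iff.mp hm₀ h6
  have hord := (H.infinity j).ord_eq_zero hnd
  have hs := (H.infinity j).ord_eq_one hinj' hpX (Units.mk0 _ hT0) (by
    rw [chartMap_coord A.T_ne, A.T_o, A.pr_o, moved_self, one_div]; rfl)
  -- The homogenized polynomial has order zero and `(T (c j))⁻¹` has order one, so u has order -d.
  have e : Units.mk0 _ ((H.infinity j).ne_zero hnd) = (Units.mk0 _ hT0) ^ (d : ℤ) * u := by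
    refine Units.ext ?_
    rw [Units.val_mul, hu, zpow_natCast, Units.val_pow_eq_pow_val]
    exact hsum
  rw [e, ord_mul, ord_zpow, hs] at hord
  have := hmax m hm
  omega

variable [Fintype J] [Fintype Λ] [Finite σ]

/-- The multiplicities at infinity bound the degree in each block, so sections lie in the span of
finitely many monomials; the exceptional divisors are not needed for this. -/
theorem finiteDimensional_H0 (H : IsBoundary pr o ι T pt c k η) (s : X ⟶ Spec (.of ℂ))
    (hι : ∀ z, (show X.functionField from algebraMap ℂ (FunctionField s) z) = ι z)
    (n : J ⊕ Λ → ℤ) :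
    FiniteDimensional ℂ (H0 s ((A.boundaryModel F H).divisor n)) := by
  classical
  have := Fintype.ofFinite (ChartVar pr o)
  let N : ChartVar pr o →₀ ℕ := Finsupp.equivFunOnFinite.symm fun v => (n (Sum.inl (pr v))).toNat
  have hN : (Set.Iic N).Finite := by
    refine (Set.finite_Icc (0 : ChartVar pr o →₀ ℕ) N).subset fun m hm => ⟨zero_le, hm⟩
  let e (m : ChartVar pr o →₀ ℕ) : FunctionField s := chartMap pr o ι T (MvPolynomial.monomial m 1)
  have hfin : FiniteDimensional ℂ (Submodule.span ℂ (e '' Set.Iic N)) :=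
    FiniteDimensional.span_of_finite ℂ (hN.image e)
  refine Submodule.finiteDimensional_of_le (S₂ := Submodule.span ℂ (e '' Set.Iic N)) fun φ hφ => ?_
  obtain ⟨ψ, rfl, hψ⟩ := ((A.boundaryModel F H).mem_H0_iff s n φ).mp hφ
  have key : ∀ m ∈ ψ.support, m ≤ N := fun m hm v => by
    have h0 : chartMap pr o ι T ψ ≠ 0 :=
      (map_ne_zero_iff _ (A.chartMap_injective A.pr_o)).mpr fun h0 => by simp [h0] at hm
    have h1 := hψ (Units.mk0 _ h0) rfl (Sum.inl (pr v))
    have h2 := A.blockDegree_le F H (pr v) (Units.mk0 _ h0) rfl hm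
    have h3 := le_blockDegree m v
    change m v ≤ (n (Sum.inl (pr v))).toNat
    omega
  have : (show FunctionField s from chartMap pr o ι T ψ) =
      ∑ m ∈ ψ.support, ψ.coeff m • e m := by
    conv_lhs => rw [← MvPolynomial.support_sum_monomial_coeff ψ]
    refine (map_sum (chartMap pr o ι T) _ _).trans (Finset.sum_congr rfl fun m _ => ?_)
    rw [Algebra.smul_def, ← mul_one (ψ.coeff m), ← MvPolynomial.C_mul_monomial, mul_one]
    refine (map_mul (chartMap pr o ι T) _ _).trans ?_
    rw [chartMap_C, ← hι]
    rfl
  change (show FunctionField s from chartMap pr o ι T ψ) ∈ _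
  rw [this]
  exact Submodule.sum_mem _ fun m hm => Submodule.smul_mem _ _
    (Submodule.subset_span ⟨m, key m hm, rfl⟩)

end Atlas

end Degree


/-! ### Restricting charts to a closed subscheme -/

section RestrictChart

lemma specializes_of_ringAt_le {X : Scheme.{0}} [IsIntegral X] {U : X.Opens} (hU : IsAffineOpen U)
    {x y : X} (hx : x ∈ U) (hy : y ∈ U) (h : ringAt y ≤ ringAt x) : x ⤳ y := by
  obtain ⟨𝔭, h𝔭⟩ := IsAffineOpen.exists_centered hU hx
  obtain ⟨𝔮, h𝔮⟩ := IsAffineOpen.exists_centered hU hy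
  refine Centered.specializes hU hx hy h𝔭 h𝔮 fun f hf => ?_
  rw [← h𝔮.van]
  exact idealAt_le_of_ringAt_le h (h𝔮.mem f) ((h𝔭.van f).mpr hf)

lemma Centered.ringAt_le {X : Scheme.{0}} [IsIntegral X] {A : Type*} [CommRing A]
    {a : A →+* X.functionField} {x y : X} {𝔭 𝔮 : Ideal A} (hx : Centered a x 𝔭)
    (hy : Centered a y 𝔮) (h : 𝔭 ≤ 𝔮) : ringAt y ≤ ringAt x := fun φ hφ => by
  obtain ⟨f, g, hg, e⟩ := hy.frac φ hφ
  exact hx.mem_ringAt_iff.mpr ⟨f, g, fun hc => hg (h hc), e⟩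

variable {Z X : Scheme.{0}} [IsIntegral Z] [IsIntegral X] {i : Z ⟶ X}

lemma Res.toK {U : X.Opens} (h : i (genericPoint Z) ∈ U) (f : Γ(X, U)) :
    Res i (toK U (genericPoint_mem h) f) (toK (i ⁻¹ᵁ U) h (i.app U f)) :=
  ⟨X.presheaf.germ U (i (genericPoint Z)) h f, algebraMap_germ h f,
    Scheme.Hom.germ_stalkMap_apply i U (genericPoint Z) h f⟩

/-- The restriction of a chart to a closed subscheme whose ideal is the kernel of `ρ`. -/
lemma IsChart.restrict [IsClosedImmersion i] {A A' : Type} [CommRing A] [CommRing A']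
    {a : A →+* X.functionField} {a' : A' →+* Z.functionField} {g : A} {U : X.Opens}
    (hU : IsChart a g U) (hmem : i (genericPoint Z) ∈ U) {ρ : A →+* A'}
    (hρ : Function.Surjective ρ) (ha' : Function.Injective a')
    (hres : ∀ f, Res i (a f) (a' (ρ f))) : IsChart a' (ρ g) (i ⁻¹ᵁ U) := by
  obtain ⟨α, hα, hloc⟩ := hU.exists_loc
  have hψ (f : A) : EulerChow.toK (i ⁻¹ᵁ U) hmem (i.app U (α f)) = a' (ρ f) := by
    have := Res.toK hmem (α f)
    rw [hα] at this
    exact this.unique (hres f)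
  let ψ : A →+* Γ(Z, i ⁻¹ᵁ U) := (i.app U).hom.comp α
  have hker : RingHom.ker ρ ≤ RingHom.ker ψ := fun f hf => by
    refine toK_injective (i ⁻¹ᵁ U) hmem ?_
    rw [map_zero]
    refine (hψ f).trans ?_
    rw [RingHom.mem_ker.mp hf, map_zero]
  -- The restriction to Z of a function from A depends only on its image under ρ, because this can
  -- be tested in the function field of Z.
  let β : A' →+* Γ(Z, i ⁻¹ᵁ U) := RingHom.liftOfSurjective ρ hρ ⟨ψ, hker⟩
  have hβ (f : A) : β (ρ f) = i.app U (α f) :=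
    RingHom.liftOfRightInverse_comp_apply ρ _ (Function.rightInverse_surjInv hρ) ⟨ψ, hker⟩ f
  have hβK (f : A') : EulerChow.toK (i ⁻¹ᵁ U) hmem (β f) = a' f := by
    obtain ⟨f, rfl⟩ := hρ f
    rw [hβ, hψ]
  have hβinj : Function.Injective β := fun f f' e => ha' (by rw [← hβK, ← hβK, e])
  refine ⟨hU.affine.preimage i, hmem, β, hβK, ?_⟩
  let _ := α.toAlgebra
  let _ := β.toAlgebra
  have hsurj := i.app_surjective U hU.affine
  refine ⟨?_, ?_, ?_⟩
  · rintro ⟨_, n, rfl⟩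
    change IsUnit (β (ρ g ^ n))
    rw [map_pow, hβ]
    exact ((IsLocalization.Away.algebraMap_isUnit (S := Γ(X, U)) g).map (i.app U).hom).pow n
  · intro z
    obtain ⟨s, rfl⟩ := hsurj z
    obtain ⟨n, f, hf⟩ := IsLocalization.Away.surj g s
    refine ⟨⟨ρ f, ⟨_, n, rfl⟩⟩, ?_⟩
    change i.app U s * β (ρ g ^ n) = β (ρ f)
    rw [map_pow, hβ, hβ]
    change _ = i.app U (algebraMap A Γ(X, U) f)
    rw [← hf, map_mul, map_pow]
    rfl
  · intro f f' e
    exact ⟨1, by rw [hβinj e]⟩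

end RestrictChart


/-! ### Setting one homogeneous coordinate to zero -/

section OmitCoordinate

variable {J σ Λ : Type} (pr : σ → J) {one : σ}

variable (one) in
/-- The homogeneous coordinates other than `one`. -/
abbrev Rest : Type := {v : σ // v ≠ one}

/-- The index of the factor of a coordinate. -/
abbrev prRest (v : Rest one) : J := pr v

/-- The choice of coordinates `κ`, among all coordinates. -/
abbrev under (κ : J → Rest one) : J → σ := fun j => κ j

lemma under_moved (o : J → Rest one) (j : J) (w : Rest one) :
    under (moved o j w) = moved (under o) j w := by
  funext j'
  by_cases h : j' = j
  · rw [h, under, moved_self, moved_self]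
  · rw [under, moved_of_ne _ _ h, moved_of_ne _ _ h]

variable (κ : J → Rest one)

/-- Polynomials not involving the coordinate `one`, as polynomials. -/
def inclPoly : MvPolynomial (ChartVar (prRest pr) κ) ℂ →+* MvPolynomial (ChartVar pr (under κ)) ℂ :=
  (MvPolynomial.rename fun v : ChartVar (prRest pr) κ =>
    (⟨v.1.1, fun e => v.2 (Subtype.ext e)⟩ : ChartVar pr (under κ))).toRingHom

open Classical in
/-- Setting the coordinate `one` to zero. -/
def restrPoly : MvPolynomial (ChartVar pr (under κ)) ℂ →+* MvPolynomial (ChartVar (prRest pr) κ) ℂ :=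
  MvPolynomial.eval₂Hom MvPolynomial.C fun v => if h : v.1 = one then 0 else
    MvPolynomial.X ⟨⟨v.1, h⟩, fun e => v.2 (congrArg Subtype.val e)⟩

variable {pr κ}

lemma inclPoly_C (c : ℂ) : inclPoly pr κ (MvPolynomial.C c) = MvPolynomial.C c :=
  MvPolynomial.rename_C _ _

lemma inclPoly_X (v : ChartVar (prRest pr) κ) : inclPoly pr κ (MvPolynomial.X v) =
    MvPolynomial.X ⟨v.1.1, fun e => v.2 (Subtype.ext e)⟩ :=
  MvPolynomial.rename_X _ _

lemma restrPoly_C (c : ℂ) : restrPoly pr κ (MvPolynomial.C c) = MvPolynomial.C c :=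
  MvPolynomial.eval₂Hom_C _ _ _

lemma restrPoly_X_one (h : one ≠ under κ (pr one)) :
    restrPoly pr κ (MvPolynomial.X ⟨one, h⟩) = 0 :=
  (MvPolynomial.eval₂Hom_X' _ _ _).trans (dif_pos rfl)

lemma restrPoly_X {v : ChartVar pr (under κ)} (h : v.1 ≠ one) :
    restrPoly pr κ (MvPolynomial.X v) =
      MvPolynomial.X ⟨⟨v.1, h⟩, fun e => v.2 (congrArg Subtype.val e)⟩ :=
  (MvPolynomial.eval₂Hom_X' _ _ _).trans (dif_neg h)

lemma one_ne_under (κ : J → Rest one) (j : J) : one ≠ under κ j := fun e => (κ j).2 e.symm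

lemma restrPoly_coord (v : Rest one) :
    restrPoly pr κ (coord pr (under κ) v) = coord (prRest pr) κ v := by
  by_cases h : v = κ (pr v)
  · rw [coord_of_eq (κ := κ) h, coord_of_eq (κ := under κ) (congrArg Subtype.val h), map_one]
  · rw [coord_of_ne (κ := κ) h, coord_of_ne fun e => h (Subtype.ext e), restrPoly_X v.2]

lemma restrPoly_coord_one : restrPoly pr κ (coord pr (under κ) one) = 0 := by
  rw [coord_of_ne (one_ne_under κ _), restrPoly_X_one]

lemma inclPoly_coord (v : Rest one) :
    inclPoly pr κ (coord (prRest pr) κ v) = coord pr (under κ) v := by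
  by_cases h : v = κ (pr v)
  · rw [coord_of_eq (κ := κ) h, coord_of_eq (κ := under κ) (congrArg Subtype.val h), map_one]
  · rw [coord_of_ne (κ := κ) h, coord_of_ne fun e => h (Subtype.ext e), inclPoly_X]

lemma restrPoly_inclPoly (f : MvPolynomial (ChartVar (prRest pr) κ) ℂ) :
    restrPoly pr κ (inclPoly pr κ f) = f := by
  have : (restrPoly pr κ).comp (inclPoly pr κ) = RingHom.id _ := by
    refine MvPolynomial.ringHom_ext (fun c => ?_) fun v => ?_
    · rw [RingHom.comp_apply, inclPoly_C, restrPoly_C, RingHom.id_apply]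
    · rw [RingHom.comp_apply, inclPoly_X, restrPoly_X v.1.2, RingHom.id_apply]
  exact RingHom.congr_fun this f

lemma restrPoly_surjective : Function.Surjective (restrPoly pr κ) := fun f =>
  ⟨_, restrPoly_inclPoly f⟩

end OmitCoordinate

/-! ### The proper transform of a coordinate hyperplane -/

section Transform

variable {Z X : Scheme.{0}} [IsIntegral Z] [IsIntegral X] {J σ Λ : Type} {one : σ}

/-- `Z` is the proper transform in `X` of the hyperplane where the coordinate `one` vanishes. -/
structure IsTransform (i : Z ⟶ X) (pr : σ → J) (o : J → Rest one) (ι : ℂ →+* X.functionField)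
    (T : σ → X.functionField) (pt : Λ → σ → ℂ) (ι' : ℂ →+* Z.functionField)
    (T' : Rest one → Z.functionField) : Prop where
  atlas : Atlas pr (under o) ι T pt
  pt_one : ∀ l, pt l one = 0
  two : ∀ _ : Λ, ∃ v w : Rest one, v ≠ w ∧ v ≠ o (pr v) ∧ w ≠ o (pr w)
  gen : Centered (chartMap pr (under o) ι T) (i (genericPoint Z))
    (Ideal.span {coord pr (under o) one})
  res_const : ∀ c, Res i (ι c) (ι' c)
  res_T : ∀ v : Rest one, Res i (T v) (T' v)

namespace IsTransform

variable {i : Z ⟶ X} {pr : σ → J} {o : J → Rest one} {ι : ℂ →+* X.functionField}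
  {T : σ → X.functionField} {pt : Λ → σ → ℂ} {ι' : ℂ →+* Z.functionField}
  {T' : Rest one → Z.functionField} (W : IsTransform i pr o ι T pt ι' T')
include W

lemma isPrimeDiv : IsPrimeDiv (i (genericPoint Z)) :=
  W.gen.isPrimeDiv (W.atlas.chartMap_injective W.atlas.pr_o) (prime_coord (one_ne_under o _))

lemma res_one : Res i (T one) 0 := by
  have h := (W.gen.van _).mpr (Ideal.mem_span_singleton_self _)
  rw [chartMap_coord W.atlas.T_ne, W.atlas.T_o, div_one] at h
  obtain ⟨g, hg⟩ := Res.exists_of_mem (idealAt_subset h)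
  rwa [hg.mem_idealAt_iff.mp h] at hg

/-- The coordinates other than `one` generate a polynomial ring on the proper transform. -/
lemma sub_const_ne_zero (v : Rest one) (hv : v ≠ o (pr v)) (c : ℂ) : T' v - ι' c ≠ 0 := by
  rw [Ne, ← ((W.res_T v).sub (W.res_const c)).mem_idealAt_iff]
  have hv' : (v : σ) ≠ under o (pr v) := fun e => hv (Subtype.ext e)
  have := W.gen.van (MvPolynomial.X ⟨v, hv'⟩ - MvPolynomial.C c)
  rw [map_sub, W.atlas.chartMap_o, chartMap_C] at this
  rw [this, Ideal.mem_span_singleton]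
  rintro ⟨q, hq⟩
  have := congrArg (restrPoly pr o) hq
  rw [map_mul, restrPoly_coord_one, zero_mul, map_sub, restrPoly_C, restrPoly_X v.2] at this
  have := congrArg (MvPolynomial.eval fun _ => c + 1) this
  simp at this

lemma T'_o (j : J) : T' (o j) = 1 := by
  have h := W.res_T (o j)
  rw [show T (o j) = 1 from W.atlas.T_o j] at h
  exact h.unique Res.one

lemma T'_ne (v : Rest one) : T' v ≠ 0 := by
  by_cases hv : v = o (pr v)
  · rw [hv, W.T'_o]
    exact one_ne_zero
  · have := W.sub_const_ne_zero v hv 0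
    rwa [map_zero, sub_zero] at this

lemma res_chart (κ : J → Rest one) (f : MvPolynomial (ChartVar pr (under κ)) ℂ) :
    Res i (chartMap pr (under κ) ι T f) (chartMap (prRest pr) κ ι' T' (restrPoly pr κ f)) := by
  induction f using MvPolynomial.induction_on with
  | C c =>
    rw [restrPoly_C, chartMap_C, chartMap_C]
    exact W.res_const c
  | add f g hf hg =>
    simp only [map_add]
    exact hf.add hg
  | mul_X f v hf =>
    rw [map_mul, map_mul, map_mul]
    refine hf.mul ?_
    rw [chartMap_X]
    obtain ⟨v, hv⟩ := v
    by_cases h : v = one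
    · subst h
      rw [restrPoly_X_one, map_zero]
      have := W.res_one.div (W.res_T (κ (pr v))) (W.T'_ne _)
      rwa [zero_div] at this
    · rw [restrPoly_X h, chartMap_X]
      exact (W.res_T ⟨v, h⟩).div (W.res_T (κ (pr v))) (W.T'_ne _)

/-- The coordinates of a point other than `one`. -/
abbrev ptRest (pt : Λ → σ → ℂ) : Λ → Rest one → ℂ := fun l v => pt l v

/-- The centres lie on the hyperplane, so the ratio belonging to `one` is `T one` over the k-th
difference, with no constant subtracted, and restricts to zero. In blow-up charts too the proper
transform is thus a coordinate hyperplane. -/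
lemma res_blow (l : Λ) {k : Rest one} (hk : k ≠ o (pr k))
    (f : MvPolynomial (ChartVar pr (under o)) ℂ) :
    Res i (blowMap pr (under o) ι T (pt l) k f)
      (blowMap (prRest pr) o ι' T' (ptRest pt l) k (restrPoly pr o f)) := by
  have hsub (v : Rest one) : Res i (T v - ι (pt l v)) (T' v - ι' (pt l v)) :=
    (W.res_T v).sub (W.res_const _)
  induction f using MvPolynomial.induction_on with
  | C c =>
    rw [restrPoly_C, blowMap_C, blowMap_C]
    exact W.res_const c
  | add f g hf hg =>
    simp only [map_add]
    exact hf.add hg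
  | mul_X f v hf =>
    rw [map_mul, map_mul, map_mul]
    refine hf.mul ?_
    obtain ⟨v, hv⟩ := v
    by_cases h : v = one
    · subst h
      rw [restrPoly_X_one, map_zero, blowMap_X_of_ne _ _ (fun e => k.2 e.symm)]
      have := (W.res_one.sub (W.res_const (pt l v))).div (hsub k) (W.sub_const_ne_zero k hk _)
      rw [W.pt_one, map_zero, map_zero, sub_zero, sub_zero, zero_div] at this
      rwa [W.pt_one, map_zero, sub_zero]
    · rw [restrPoly_X h]
      by_cases e : v = k
      · subst e
        rw [blowMap_X_self, blowMap_X_self]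
        exact hsub k
      · rw [blowMap_X_of_ne _ _ e, blowMap_X_of_ne _ _ fun e' => e (congrArg Subtype.val e')]
        exact (hsub ⟨v, h⟩).div (hsub k) (W.sub_const_ne_zero k hk _)

/-- The centre of a chart that meets `Z`, at the generic point of `Z`. -/
lemma restrict_injective {κ : J → Rest one} {a : MvPolynomial (ChartVar pr (under κ)) ℂ →+*
    X.functionField} {a' : MvPolynomial (ChartVar (prRest pr) κ) ℂ →+* Z.functionField}
    {g : MvPolynomial (ChartVar pr (under κ)) ℂ} {U : X.Opens} (hU : IsChart a g U)
    (hmem : i (genericPoint Z) ∈ U) (hres : ∀ f, Res i (a f) (a' (restrPoly pr κ f))) :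
    Centered a (i (genericPoint Z)) (Ideal.span {coord pr (under κ) one}) ∧
      g ∉ Ideal.span {coord pr (under κ) one} ∧ Function.Injective a' := by
  obtain ⟨𝔭, hg, h𝔭⟩ := hU.exists_centered hmem
  have h1 : coord pr (under κ) one ∈ 𝔭 := by
    rw [← h𝔭.van, (hres _).mem_idealAt_iff, restrPoly_coord_one, map_zero]
  have := h𝔭.eq_span hU.injective W.isPrimeDiv (prime_coord (one_ne_under κ _)) h1
  subst this
  refine ⟨h𝔭, hg, (injective_iff_map_eq_zero _).mpr fun f hf => ?_⟩
  obtain ⟨f, rfl⟩ := restrPoly_surjective f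
  rw [← (hres _).mem_idealAt_iff, h𝔭.van] at hf
  obtain ⟨q, rfl⟩ := Ideal.mem_span_singleton.mp hf
  rw [map_mul, restrPoly_coord_one, zero_mul]

lemma isChart [IsClosedImmersion i] {κ : J → Rest one}
    {a : MvPolynomial (ChartVar pr (under κ)) ℂ →+*
    X.functionField} {a' : MvPolynomial (ChartVar (prRest pr) κ) ℂ →+* Z.functionField}
    {g : MvPolynomial (ChartVar pr (under κ)) ℂ} {U : X.Opens} (hU : IsChart a g U)
    (hmem : i (genericPoint Z) ∈ U) (hres : ∀ f, Res i (a f) (a' (restrPoly pr κ f))) :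
    IsChart a' (restrPoly pr κ g) (i ⁻¹ᵁ U) :=
  hU.restrict hmem restrPoly_surjective (W.restrict_injective hU hmem hres).2.2 hres

end IsTransform

end Transform


/-! ### The proper transform inherits an atlas -/

section TransformAtlas

variable {Z X : Scheme.{0}} [IsIntegral Z] [IsIntegral X] {J σ Λ : Type} {one : σ}

namespace IsTransform

variable {i : Z ⟶ X} {pr : σ → J} {o : J → Rest one} {ι : ℂ →+* X.functionField}
  {T : σ → X.functionField} {pt : Λ → σ → ℂ} {ι' : ℂ →+* Z.functionField}
  {T' : Rest one → Z.functionField} (W : IsTransform i pr o ι T pt ι' T')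
include W

lemma res_div (v w : Rest one) : Res i (T v / T w) (T' v / T' w) :=
  (W.res_T v).div (W.res_T w) (W.T'_ne w)

lemma res_sub (l : Λ) (v : Rest one) : Res i (T v - ι (pt l v)) (T' v - ι' (ptRest pt l v)) :=
  (W.res_T v).sub (W.res_const _)

lemma T_gen_ne (v : Rest one) : T v ∉ idealAt (i (genericPoint Z)) := fun h =>
  W.T'_ne v ((W.res_T v).mem_idealAt_iff.mp h)

/-- A chart at a point of Z cannot use the coordinate `one`: its inverse would be regular at the
generic point of Z, where `T one` vanishes. -/
lemma exists_fin_under (z : Z) :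
    ∃ κ : J → Rest one, (∀ j, pr (κ j) = j) ∧ IsFin pr T (under κ) (i z) := by
  obtain ⟨κ, hκ, hfin⟩ := W.atlas.exists_fin (i z)
  have hne (j : J) : κ j ≠ one := fun e => by
    have h := hfin (o j)
    have hoj : pr (o j) = j := W.atlas.pr_o j
    rw [hoj, e, show T (o j) = 1 from W.atlas.T_o j, one_div] at h
    exact notMem_idealAt_of_inv (W.atlas.T_ne one)
      (ringAt_le_of_specializes (specializes_generic i z) h) (W.res_one.mem_idealAt_iff.mpr rfl)
  exact ⟨fun j => ⟨κ j, hne j⟩, hκ, hfin⟩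

lemma isFin_restrict {κ : J → Rest one} {z : Z} (h : IsFin pr T (under κ) (i z)) :
    IsFin (prRest pr) T' κ z := fun v =>
  (W.res_div v (κ (pr v))).mem_ringAt (h v)

/-- Some chart of X contains the point. The transition functions from it to κ do not vanish at z,
because their inverses are regular on Z, and vanishing at a point of Z can be tested after
restriction. -/
lemma isFin_of_restrict {κ : J → Rest one} (hκ : ∀ j, pr (κ j) = j) {z : Z}
    (h : IsFin (prRest pr) T' κ z) : IsFin pr T (under κ) (i z) := by
  obtain ⟨κ₂, hκ₂, hfin⟩ := W.exists_fin_under z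
  refine W.atlas.isFin_of_notMem hκ hfin fun j hj => ?_
  have h1 := hfin (κ j)
  rw [hκ] at h1
  have h2 := ((W.res_div (κ j) (κ₂ j)).mem_idealAt h1).mpr hj
  have h3 := h (κ₂ j)
  rw [prRest, hκ₂] at h3
  refine notMem_idealAt_of_inv (div_ne_zero (W.T'_ne _) (W.T'_ne _)) ?_ h2
  rwa [inv_div]

lemma isAt_iff {l : Λ} {z : Z} : IsAt ι' T' (ptRest pt l) z ↔ IsAt ι T (pt l) (i z) := by
  constructor
  · intro h
    have hfin : IsFin pr T (under o) (i z) := by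
      refine W.isFin_of_restrict W.atlas.pr_o fun v => ?_
      rw [W.T'_o, div_one]
      rw [← sub_add_cancel (T' v) (ι' (pt l v))]
      exact add_mem (idealAt_subset (h v)) ((W.res_const _).mem_ringAt (W.atlas.const _ _))
    have hmem := W.atlas.isFin_o_iff.mp hfin
    intro v
    by_cases hv : v = one
    · subst hv
      rw [W.pt_one, map_zero, sub_zero]
      -- If `T one` were a unit at the point, it would still be one at the generic point of Z, where
      -- it vanishes.
      by_contra hc
      refine notMem_idealAt_of_inv (W.atlas.T_ne v) ?_ (W.res_one.mem_idealAt_iff.mpr rfl)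
      exact ringAt_le_of_specializes (specializes_generic i z) (inv_mem_ringAt (hmem v) hc)
    · exact ((W.res_sub l ⟨v, hv⟩).mem_idealAt
        (sub_mem (hmem v) (W.atlas.const _ _))).mp (h ⟨v, hv⟩)
  · exact fun h v => ((W.res_sub l v).mem_idealAt (idealAt_subset (h v))).mpr (h v)

lemma res_blow_div (l : Λ) (v : Rest one) {k : Rest one} (hk : k ≠ o (pr k)) :
    Res i ((T v - ι (pt l v)) / (T k - ι (pt l k)))
      ((T' v - ι' (ptRest pt l v)) / (T' k - ι' (ptRest pt l k))) :=
  (W.res_sub l v).div (W.res_sub l k) (W.sub_const_ne_zero k hk _)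

/-- In the blow-up chart of index `one` all coordinate differences would be multiples of `T one` and
hence vanish on Z, which a remaining affine coordinate does not. -/
lemma exists_blowFin_under {l : Λ} {z : Z} (h : IsAt ι T (pt l) (i z)) :
    ∃ k : Rest one, k ≠ o (pr k) ∧ IsBlowFin ι T (pt l) k (i z) := by
  obtain ⟨k, hk, hfin⟩ := W.atlas.exists_blowFin l (i z) h
  refine ⟨⟨k, fun e => ?_⟩, fun e => hk (congrArg Subtype.val e), hfin⟩
  obtain ⟨v, -, -, hv, -⟩ := W.two l
  refine W.sub_const_ne_zero v hv (pt l v) ((W.res_sub l v).mem_idealAt_iff.mp ?_)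
  have h1 := ringAt_le_of_specializes (specializes_generic i z) (hfin v)
  rw [e, W.pt_one, map_zero, sub_zero] at h1
  have h2 := idealAt_mul h1 (W.res_one.mem_idealAt_iff.mpr rfl)
  rwa [div_mul_cancel₀ _ (W.atlas.T_ne one)] at h2

lemma isBlowFin_restrict {l : Λ} {k : Rest one} (hk : k ≠ o (pr k)) {z : Z}
    (h : IsBlowFin ι T (pt l) k (i z)) : IsBlowFin ι' T' (ptRest pt l) k z := fun v =>
  (W.res_blow_div l v hk).mem_ringAt (h v)

lemma isBlowFin_of_restrict {l : Λ} {k : Rest one} (hk : k ≠ o (pr k)) {z : Z}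
    (hat : IsAt ι T (pt l) (i z)) (h : IsBlowFin ι' T' (ptRest pt l) k z) :
    IsBlowFin ι T (pt l) k (i z) := by
  obtain ⟨k₂, hk₂, hfin⟩ := W.exists_blowFin_under hat
  have hne {w : Rest one} (hw : w ≠ o (pr w)) := (W.res_sub l w).ne_zero (W.sub_const_ne_zero w hw _)
  have hinv : ((T k - ι (pt l k)) / (T k₂ - ι (pt l k₂)))⁻¹ ∈ ringAt (i z) := by
    refine inv_mem_ringAt (hfin k) fun hc => ?_
    have h2 := ((W.res_blow_div l k hk₂).mem_idealAt (hfin k)).mpr hc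
    refine notMem_idealAt_of_inv (div_ne_zero (W.sub_const_ne_zero k hk _)
      (W.sub_const_ne_zero k₂ hk₂ _)) ?_ h2
    rw [inv_div]
    exact h k₂
  intro v
  have h1 := mul_mem (hfin v) hinv
  have e : (T v - ι (pt l v)) / (T k₂ - ι (pt l k₂)) *
      ((T k - ι (pt l k)) / (T k₂ - ι (pt l k₂)))⁻¹ =
      (T v - ι (pt l v)) / (T k - ι (pt l k)) := by
    have := hne hk
    have := hne hk₂
    field_simp
  rwa [e] at h1

lemma exists_chart {κ : J → Rest one} (hκ : ∀ j, pr (κ j) = j) {z : Z}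
    (hfin : IsFin pr T (under κ) (i z)) (hat : ∀ l, ¬ IsAt ι T (pt l) (i z)) :
    ∃ U g, i z ∈ U ∧ i (genericPoint Z) ∈ U ∧ IsChart (chartMap pr (under κ) ι T) g U := by
  obtain ⟨U, g, hz, hU⟩ := W.atlas.chart (under κ) (i z) hκ hfin hat
  exact ⟨U, g, hz, (specializes_generic i z).mem_open U.2 hz, hU⟩

lemma exists_blow {l : Λ} {k : Rest one} (hk : k ≠ o (pr k)) {z : Z}
    (hat : IsAt ι T (pt l) (i z)) (hfin : IsBlowFin ι T (pt l) k (i z)) :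
    ∃ U g, i z ∈ U ∧ i (genericPoint Z) ∈ U ∧ IsChart (blowMap pr (under o) ι T (pt l) k) g U := by
  obtain ⟨U, g, hz, hU⟩ := W.atlas.blow l k (i z) (fun e => hk (Subtype.ext e)) hat hfin
  exact ⟨U, g, hz, (specializes_generic i z).mem_open U.2 hz, hU⟩

/-- The generic point of `Z` lies in every affine chart. -/
lemma gen_chart {κ : J → Rest one} (hκ : ∀ j, pr (κ j) = j) :
    Centered (chartMap pr (under κ) ι T) (i (genericPoint Z))
      (Ideal.span {coord pr (under κ) one}) := by
  have hfin : IsFin pr T (under κ) (i (genericPoint Z)) := by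
    refine W.atlas.isFin_of_notMem hκ (W.atlas.isFin_of_centered W.gen) fun j => ?_
    rw [W.atlas.T_o, div_one]
    exact W.T_gen_ne (κ j)
  have hat := W.atlas.not_isAt_of_centered (prime_coord (one_ne_under o _)) W.gen
  obtain ⟨U, g, -, hmem, hU⟩ := W.exists_chart hκ (z := genericPoint Z) hfin hat
  exact (W.restrict_injective hU hmem (W.res_chart κ)).1

omit W in
/-- A point of a chart where `one` vanishes lies on `Z`. -/
lemma exists_preimage [IsClosedImmersion i] {κ : J → Rest one}
    {a : MvPolynomial (ChartVar pr (under κ)) ℂ →+* X.functionField}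
    {g : MvPolynomial (ChartVar pr (under κ)) ℂ} {U : X.Opens} (hU : IsChart a g U) {x : X}
    (hx : x ∈ U) {𝔭 : Ideal (MvPolynomial (ChartVar pr (under κ)) ℂ)} (h : Centered a x 𝔭)
    (hone : coord pr (under κ) one ∈ 𝔭)
    (hgen : ∀ y, Centered a y (Ideal.span {coord pr (under κ) one}) → y = i (genericPoint Z)) :
    ∃ z, i z = x := by
  have hle : Ideal.span {coord pr (under κ) one} ≤ 𝔭 :=
    (Ideal.span_singleton_le_iff_mem _).mpr hone
  have hp := prime_coord (pr := pr) (one_ne_under κ (pr one))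
  obtain ⟨𝔮, hg, h𝔮⟩ := hU.exists_centered hx
  have he : 𝔮 = 𝔭 := by
    ext f
    rw [← h𝔮.van, h.van]
  subst he
  -- The point of U centred at the ideal of the hyperplane specializes to x and is the generic point
  -- of Z; since Z is closed, x belongs to it.
  obtain ⟨y, hy, hyc⟩ := hU.exists_point ((Ideal.span_singleton_prime hp.ne_zero).mpr hp)
    (fun hc => hg (hle hc))
  have hspec := specializes_of_ringAt_le hU.affine hy hx (hyc.ringAt_le h hle)
  rw [hgen y hyc] at hspec
  exact hspec.mem_closed i.isClosedEmbedding.isClosed_range ⟨_, rfl⟩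

omit W in
lemma centered_restrict {κ : J → Rest one}
    {a : MvPolynomial (ChartVar pr (under κ)) ℂ →+* X.functionField}
    {a' : MvPolynomial (ChartVar (prRest pr) κ) ℂ →+* Z.functionField}
    (hres : ∀ f, Res i (a f) (a' (restrPoly pr κ f))) {z : Z}
    {𝔭 : Ideal (MvPolynomial (ChartVar (prRest pr) κ) ℂ)}
    (h : Centered a (i z) (𝔭.comap (restrPoly pr κ)))
    {𝔮 : Ideal (MvPolynomial (ChartVar (prRest pr) κ) ℂ)} (h𝔮 : Centered a' z 𝔮) : 𝔮 = 𝔭 := by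
  ext f
  obtain ⟨f, rfl⟩ := restrPoly_surjective f
  rw [← h𝔮.van, (hres f).mem_idealAt (h.mem f), h.van, Ideal.mem_comap]

omit W in
lemma ringAt_eq_of_charts {κ : J → Rest one}
    {a : MvPolynomial (ChartVar pr (under κ)) ℂ →+* X.functionField}
    {a' : MvPolynomial (ChartVar (prRest pr) κ) ℂ →+* Z.functionField}
    (hres : ∀ f, Res i (a f) (a' (restrPoly pr κ f))) {z z' : Z} (e : ringAt z = ringAt z')
    {𝔭 𝔮 : Ideal (MvPolynomial (ChartVar pr (under κ)) ℂ)} (h : Centered a (i z) 𝔭)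
    (h' : Centered a (i z') 𝔮) : ringAt (i z) = ringAt (i z') := by
  have : 𝔭 = 𝔮 := by
    ext f
    rw [← h.van, ← h'.van, ← (hres f).mem_idealAt (h.mem f), ← (hres f).mem_idealAt (h'.mem f),
      idealAt_congr e]
  subst this
  exact h.ringAt_eq h'

/-- Charts of Z are charts of X with the coordinate `one` set to zero. Points of Z with a given
centre come from points of X centred at the preimage prime, which contains the coordinate `one` and
so forces the point onto Z. -/
theorem atlas_restrict [IsClosedImmersion i] : Atlas (prRest pr) o ι' T' (ptRest pt : Λ → _) where
  pr_o := W.atlas.pr_o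
  T_ne := W.T'_ne
  T_o := W.T'_o
  pt_o l j := W.atlas.pt_o l j
  pt_inj l l' e := W.atlas.pt_inj <| funext fun v => by
    by_cases hv : v = one
    · rw [hv, W.pt_one, W.pt_one]
    · exact congrFun e ⟨v, hv⟩
  two := W.two
  const c z := (W.res_const c).mem_ringAt (W.atlas.const c (i z))
  exists_fin z := by
    obtain ⟨κ, hκ, hfin⟩ := W.exists_fin_under z
    exact ⟨κ, hκ, W.isFin_restrict hfin⟩
  chart κ z hκ hfin hat := by
    obtain ⟨U, g, hz, hmem, hU⟩ := W.exists_chart hκ (W.isFin_of_restrict hκ hfin)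
      fun l h => hat l (W.isAt_iff.mpr h)
    exact ⟨_, _, hz, W.isChart hU hmem (W.res_chart κ)⟩
  exists_blowFin l z h := by
    obtain ⟨k, hk, hfin⟩ := W.exists_blowFin_under (W.isAt_iff.mp h)
    exact ⟨k, hk, W.isBlowFin_restrict hk hfin⟩
  blow l k z hk hat hfin := by
    have hat' := W.isAt_iff.mp hat
    obtain ⟨U, g, hz, hmem, hU⟩ := W.exists_blow hk hat' (W.isBlowFin_of_restrict hk hat' hfin)
    exact ⟨_, _, hz, W.isChart hU hmem (W.res_blow l hk)⟩
  point κ 𝔭 hκ h𝔭 hpt := by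
    have hpt' : ∀ l, ∃ v, coord pr (under κ) v -
        MvPolynomial.C (pt l v) * coord pr (under κ) (under o (pr v)) ∉ 𝔭.comap (restrPoly pr κ) := by
      intro l
      obtain ⟨v, hv⟩ := hpt l
      refine ⟨v, fun hc => hv ?_⟩
      rwa [Ideal.mem_comap, map_sub, map_mul, restrPoly_C, restrPoly_coord,
        restrPoly_coord] at hc
    obtain ⟨x, hx⟩ := W.atlas.point (under κ) _ hκ (h𝔭.comap (restrPoly pr κ)) hpt'
    have hfin := W.atlas.isFin_of_centered hx
    have hat (l : Λ) : ¬ IsAt ι T (pt l) x := fun h => by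
      obtain ⟨v, hv⟩ := hpt' l
      refine hv ((hx.van _).mp ?_)
      rw [map_sub, map_mul, chartMap_C, chartMap_coord W.atlas.T_ne, chartMap_coord W.atlas.T_ne,
        show pr (under o (pr v)) = pr v from W.atlas.pr_o _, W.atlas.T_o, mul_one_div, ← sub_div,
        div_eq_mul_one_div, mul_comm]
      refine idealAt_mul ?_ (h v)
      have := hfin (o (pr v))
      rwa [show pr (o (pr v)) = pr v from W.atlas.pr_o _,
        show T (o (pr v)) = 1 from W.atlas.T_o _] at this
    obtain ⟨U, g, hxU, hU⟩ := W.atlas.chart _ x hκ hfin hat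
    obtain ⟨z, rfl⟩ := exists_preimage hU hxU hx
      (by rw [Ideal.mem_comap, restrPoly_coord_one]; exact zero_mem _)
      fun y hy => W.atlas.ext _ _ (hy.ringAt_eq (W.gen_chart hκ))
    have hmem := (specializes_generic i z).mem_open U.2 hxU
    obtain ⟨𝔮, -, h𝔮⟩ := (W.isChart hU hmem (W.res_chart κ)).exists_centered (x := z) hxU
    rw [centered_restrict (W.res_chart κ) hx h𝔮] at h𝔮
    exact ⟨z, h𝔮⟩
  blow_point l k 𝔭 hk h𝔭 hk𝔭 := by
    have hk' : (k : σ) ≠ under o (pr k) := fun e => hk (Subtype.ext e)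
    have hkmem : MvPolynomial.X ⟨k, hk'⟩ ∈ 𝔭.comap (restrPoly pr o) := by
      rwa [Ideal.mem_comap, restrPoly_X k.2]
    obtain ⟨x, hx⟩ := W.atlas.blow_point l k _ hk' (h𝔭.comap (restrPoly pr o)) hkmem
    have hxc := W.atlas.isAt_of_blow_centered hk' hx hkmem
    obtain ⟨U, g, hxU, hU⟩ := W.atlas.blow l k x hk' hxc.1 hxc.2
    have hp := prime_coord (pr := pr) (one_ne_under o (pr one))
    obtain ⟨z, rfl⟩ := exists_preimage hU hxU hx
      (by rw [Ideal.mem_comap, restrPoly_coord_one]; exact zero_mem _) fun y hy => by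
        -- It must be shown that the hyperplane `one` of the blow-up chart has generic point y equal
        -- to that of Z. As y is off the exceptional divisor, it lies in the standard chart o, and
        -- there the vanishing of `T one` determines it.
        have hXk : MvPolynomial.X ⟨k, hk'⟩ ∉ Ideal.span {coord pr (under o) one} := by
          rw [coord_of_ne (one_ne_under o _), Ideal.mem_span_singleton, MvPolynomial.X_dvd_X]
          exact fun e => k.2 (congrArg Subtype.val e).symm
        have hk0 : T k - ι (pt l k) ∉ idealAt y := by
          rw [← blowMap_X_self (pr := pr) (κ := under o) (pt l) hk', hy.van]
          exact hXk
        have hk00 : T k - ι (pt l k) ≠ 0 := fun h0 => hk0 (by rw [h0]; exact zero_mem_idealAt y)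
        have hkr : T k - ι (pt l k) ∈ ringAt y := by
          rw [← blowMap_X_self (pr := pr) (κ := under o) (pt l) hk']
          exact hy.mem _
        have hfin : IsFin pr T (under o) y := W.atlas.isFin_o_iff.mpr fun v => by
          rw [← sub_add_cancel (T v) (ι (pt l v))]
          refine add_mem ?_ (W.atlas.const _ _)
          by_cases hv : v = under o (pr v)
          · rw [hv, W.atlas.T_o, W.atlas.pt_o, map_one, sub_self]
            exact zero_mem _
          by_cases hvk : v = k
          · rwa [hvk]
          · have h1 := mul_mem (hy.mem (MvPolynomial.X ⟨v, hv⟩)) hkr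
            rw [blowMap_X_of_ne _ _ hvk, div_mul_cancel₀ _
              hk00] at h1
            exact h1
        have hone : T one ∈ idealAt y := by
          have h1 := idealAt_mul hkr ((hy.van _).mpr (Ideal.mem_span_singleton_self _))
          rwa [coord_of_ne (one_ne_under o _), blowMap_X_of_ne _ _ fun e => k.2 e.symm,
            mul_div_cancel₀ _ hk00, W.pt_one, map_zero,
            sub_zero] at h1
        have hat (l' : Λ) : ¬ IsAt ι T (pt l') y := by
          intro hl'
          -- Over a centre l' the k-th coordinate would be a constant on the hyperplane `one`, but
          -- it is a free variable there.
          have h1 : MvPolynomial.X ⟨k, hk'⟩ + MvPolynomial.C (pt l k - pt l' k) ∈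
              Ideal.span {coord pr (under o) one} := by
            rw [← hy.van, map_add, blowMap_X_self, blowMap_C, map_sub, sub_add_sub_cancel]
            exact hl' k
          obtain ⟨q, hq⟩ := Ideal.mem_span_singleton.mp h1
          have h2 := congrArg (restrPoly pr o) hq
          rw [map_mul, restrPoly_coord_one, zero_mul, map_add, restrPoly_C, restrPoly_X k.2] at h2
          have h3 := congrArg (MvPolynomial.eval fun _ => 1 - (pt l k - pt l' k)) h2
          simp at h3
        obtain ⟨V, g', hyV, hV⟩ := W.atlas.chart (under o) y W.atlas.pr_o hfin hat
        obtain ⟨𝔮, -, h𝔮⟩ := hV.exists_centered hyV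
        have h1 : coord pr (under o) one ∈ 𝔮 := by
          rw [← h𝔮.van, chartMap_coord W.atlas.T_ne, W.atlas.T_o, div_one]
          exact hone
        rw [h𝔮.eq_span hV.injective (hy.isPrimeDiv hU.injective hp) hp h1] at h𝔮
        exact W.atlas.ext _ _ (h𝔮.ringAt_eq W.gen)
    have hmem := (specializes_generic i z).mem_open U.2 hxU
    obtain ⟨𝔮, -, h𝔮⟩ := (W.isChart hU hmem (W.res_blow l hk)).exists_centered (x := z) hxU
    rw [centered_restrict (W.res_blow l hk) hx h𝔮] at h𝔮
    exact ⟨z, h𝔮⟩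
  ext z z' e := by
    -- The local ring on Z decides which charts contain the point and which functions vanish there,
    -- hence the centre on X; equal centres in a common chart give equal local rings on X.
    refine i.isEmbedding.injective (W.atlas.ext _ _ ?_)
    have hcongr (l : Λ) : IsAt ι T (pt l) (i z) ↔ IsAt ι T (pt l) (i z') := by
      rw [← W.isAt_iff, ← W.isAt_iff]
      simp only [IsAt, idealAt_congr e]
    by_cases h : ∃ l, IsAt ι T (pt l) (i z)
    · obtain ⟨l, hl⟩ := h
      obtain ⟨k, hk, hfin⟩ := W.exists_blowFin_under hl
      have hl' := (hcongr l).mp hl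
      have hfin' : IsBlowFin ι T (pt l) k (i z') := W.isBlowFin_of_restrict hk hl' fun v =>
        e ▸ W.isBlowFin_restrict hk hfin v
      obtain ⟨U, g, hz, -, hU⟩ := W.exists_blow hk hl hfin
      obtain ⟨U', g', hz', -, hU'⟩ := W.exists_blow hk hl' hfin'
      obtain ⟨𝔭, -, h𝔭⟩ := hU.exists_centered hz
      obtain ⟨𝔮, -, h𝔮⟩ := hU'.exists_centered hz'
      exact ringAt_eq_of_charts (W.res_blow l hk) e h𝔭 h𝔮
    · push Not at h
      obtain ⟨κ, hκ, hfin⟩ := W.exists_fin_under z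
      have hfin' : IsFin pr T (under κ) (i z') := W.isFin_of_restrict hκ fun v =>
        e ▸ W.isFin_restrict hfin v
      obtain ⟨U, g, hz, -, hU⟩ := W.exists_chart hκ hfin h
      obtain ⟨U', g', hz', -, hU'⟩ := W.exists_chart hκ hfin' fun l hl => h l ((hcongr l).mpr hl)
      obtain ⟨𝔭, -, h𝔭⟩ := hU.exists_centered hz
      obtain ⟨𝔮, -, h𝔮⟩ := hU'.exists_centered hz'
      exact ringAt_eq_of_charts (W.res_chart κ) e h𝔭 h𝔮

end IsTransform

end TransformAtlas


/-! ### Local equations of the boundary -/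

section Uniformizers

variable {X : Scheme.{0}} [IsIntegral X] {J σ Λ : Type}

/-- Local equations of the boundary divisors at their generic points. -/
def unif (ι : ℂ →+* X.functionField) (T : σ → X.functionField) (pt : Λ → σ → ℂ) (c : J → σ)
    (k : Λ → σ) : J ⊕ Λ → X.functionField :=
  Sum.elim (fun j => (T (c j))⁻¹) fun l => T (k l) - ι (pt l (k l))

/-- The point `x` lies on the boundary divisor `b`, in the chart given by `c` and `k`. -/
def OnBoundary (ι : ℂ →+* X.functionField) (T : σ → X.functionField)
    (pt : Λ → σ → ℂ) (c : J → σ) (k : Λ → σ) (x : X) : J ⊕ Λ → Prop :=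
  Sum.elim (fun j => (T (c j))⁻¹ ∈ idealAt x ∧ ∀ j', j' ≠ j → T (c j') ∈ ringAt x)
    fun l => IsAt ι T (pt l) x ∧ IsBlowFin ι T (pt l) (k l) x

variable {pr : σ → J} {o : J → σ} {ι : ℂ →+* X.functionField} {T : σ → X.functionField}
  {pt : Λ → σ → ℂ} {c : J → σ} {k : Λ → σ} {η : J ⊕ Λ → X}

namespace Atlas

variable (A : Atlas pr o ι T pt) (F : IsFrame pr o c k) (H : IsBoundary pr o ι T pt c k η)
include A F H

lemma ord_unif (b : J ⊕ Λ) (u : (X.functionField)ˣ)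
    (hu : (u : X.functionField) = unif ι T pt c k b) : ord (η b) u = 1 := by
  rcases b with j | l
  · refine (H.infinity j).ord_eq_one (A.chartMap_injective (pr_moved A.pr_o (F.pr_c j)))
      (prime_coord (A.o_ne_moved F j)) u ?_
    rw [hu, chartMap_coord A.T_ne, A.T_o, A.pr_o, moved_self, one_div]
    rfl
  · refine (H.exceptional l).ord_eq_one (A.blowMap_injective l (F.k_ne l))
      (prime_coord (F.k_ne l)) u ?_
    rw [hu, coord_of_ne (F.k_ne l), blowMap_X_self]
    rfl

omit H in
lemma unif_ne_zero (b : J ⊕ Λ) : unif ι T pt c k b ≠ 0 := by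
  rcases b with j | l
  · exact inv_ne_zero (A.T_ne _)
  · have h := (map_ne_zero_iff _ (A.blowMap_injective l (F.k_ne l))).mpr
      (prime_coord (pr := pr) (F.k_ne l)).ne_zero
    rwa [coord_of_ne (F.k_ne l), blowMap_X_self] at h

/-- In the given charts the function `unif` is a local equation at x of the boundary divisor b, and
no other boundary divisor passes through x. Consequently its `n b`-th power is a local equation of
the boundary divisor with multiplicities n. -/
lemma boundary_of_specializes {x ξ : X} {b : J ⊕ Λ} (hb : OnBoundary ι T pt c k x b)
    (hξ : IsPrimeDiv ξ) (hx : ξ ⤳ x) (u : (X.functionField)ˣ)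
    (hu : (u : X.functionField) = unif ι T pt c k b) :
    ξ = η b ∨ ord ξ u = 0 ∧ ∀ b', ξ ≠ η b' := by
  have hle := ringAt_le_of_specializes hx
  rcases A.boundary_cases F H hξ with ⟨b', rfl⟩ | ⟨q, hq, hc⟩
  · left
    congr 1
    rcases b with j | l
    · obtain ⟨h1, h2⟩ := hb
      rcases b' with j' | l'
      · by_contra hne
        exact A.T_notMem H j' (hle (h2 j' fun e => hne (congrArg _ e)))
      · exfalso
        have hat := (A.exceptional_isAt F H l').1
        -- On the exceptional divisor `T (c j)` takes the value of the centre, so this difference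
        -- vanishes there and hence at x. But the inverse of `T (c j)` vanishes at x too, so 1 would
        -- vanish.
        have h3 : 1 - ι (pt l' (c j)) * (T (c j))⁻¹ ∈ idealAt (η (Sum.inr l')) := by
          have h4 := idealAt_mul (hle (idealAt_subset h1)) (hat (c j))
          rwa [mul_sub, inv_mul_cancel₀ (A.T_ne _), mul_comm _ (ι _)] at h4
        have h5 := idealAt_mul (A.const (pt l' (c j)) x) h1
        have h6 := idealAt_le_of_ringAt_le hle
          (sub_mem (one_mem _) (idealAt_subset h5)) h3
        have h7 := idealAt_add h6 h5
        rw [sub_add_cancel] at h7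
        exact one_notMem_idealAt x h7
    · obtain ⟨h1, -⟩ := hb
      have hT := A.isFin_of_isAt h1
      rcases b' with j' | l'
      · exact (A.T_notMem H j' (hle (hT _))).elim
      · exact congrArg _ (A.isAt_unique
          (A.isAt_of_specializes hle (A.exceptional_isAt F H l').1 hT) h1)
  · right
    refine ⟨?_, fun b' e => (A.boundaryModel F H).disjoint b' q hq (e ▸ hc)⟩
    have hT := A.isFin_o_iff.mp (A.isFin_of_centered hc)
    rcases b with j | l
    · obtain ⟨h1, h2⟩ := hb
      have hu' : (u : X.functionField) = (T (c j))⁻¹ := hu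
      refine ord_eq_zero_of_mem (hu' ▸ hle (idealAt_subset h1)) ?_
      rw [hu']
      exact notMem_idealAt_of_inv (inv_ne_zero (A.T_ne _)) (by rw [inv_inv]; exact hT _)
    · obtain ⟨h1, h2⟩ := hb
      have hu' : (u : X.functionField) = T (k l) - ι (pt l (k l)) := hu
      refine ord_eq_zero_of_mem (hu' ▸ sub_mem (hT _) (A.const _ _)) fun hmem => ?_
      refine A.not_isAt_of_centered hq hc l fun v => ?_
      rw [hu'] at hmem
      have h3 := idealAt_mul (hle (h2 v)) hmem
      rwa [div_mul_cancel₀ _ (hu' ▸ u.ne_zero)] at h3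

lemma ne_boundary_of_specializes {x ξ : X} (hx : ξ ⤳ x) (hT : ∀ v, T v ∈ ringAt x)
    (hat : ∀ l, ¬ IsAt ι T (pt l) x) (b : J ⊕ Λ) : ξ ≠ η b := by
  rintro rfl
  have hle := ringAt_le_of_specializes hx
  rcases b with j | l
  · exact A.T_notMem H j (hle (hT _))
  · exact hat l (A.isAt_of_specializes hle (A.exceptional_isAt F H l).1 hT)

end Atlas

end Uniformizers

/-! ### Extending rational functions from the proper transform -/

section Extension

variable {Z X : Scheme.{0}} [IsIntegral Z] [IsIntegral X] {J σ Λ : Type} {one : σ}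

namespace IsTransform

variable {i : Z ⟶ X} {pr : σ → J} {o : J → Rest one} {ι : ℂ →+* X.functionField}
  {T : σ → X.functionField} {pt : Λ → σ → ℂ} {ι' : ℂ →+* Z.functionField}
  {T' : Rest one → Z.functionField} (W : IsTransform i pr o ι T pt ι' T')
  [IsClosedImmersion i]
include W

/-- Rational functions on `Z` extend to rational functions on `X` not involving `one`. -/
lemma exists_extension : ∃ θ : Z.functionField →+* X.functionField,
    ∀ f, θ (chartMap (prRest pr) o ι' T' f) = chartMap pr (under o) ι T (inclPoly pr o f) := by
  let a' := chartMap (prRest pr) o ι' T'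
  have hinj' : Function.Injective a' := W.atlas_restrict.chartMap_injective W.atlas.pr_o
  have hinj : Function.Injective ((chartMap pr (under o) ι T).comp (inclPoly pr o)) :=
    (W.atlas.chartMap_injective W.atlas.pr_o).comp
      (Function.LeftInverse.injective restrPoly_inclPoly)
  let _ := a'.toAlgebra
  -- The function field of Z is the fraction field of the polynomials not involving `one`, so an
  -- injection of the latter into the function field of X extends.
  have hfrac : IsFractionRing (MvPolynomial (ChartVar (prRest pr) o) ℂ) Z.functionField := by
    refine ⟨?_, ?_, ?_⟩
    · rintro ⟨d, hd⟩
      exact isUnit_iff_ne_zero.mpr ((map_ne_zero_iff a' hinj').mpr (nonZeroDivisors.ne_zero hd))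
    · intro f
      obtain ⟨n, d, hd, e⟩ := W.atlas_restrict.exists_fraction f
      exact ⟨⟨n, d, mem_nonZeroDivisors_of_ne_zero hd⟩, e⟩
    · intro f f' e
      exact ⟨1, by rw [hinj' e]⟩
  exact ⟨IsFractionRing.lift hinj, fun f => IsFractionRing.lift_algebraMap hinj f⟩

variable {θ : Z.functionField →+* X.functionField}
  (hθ : ∀ f, θ (chartMap (prRest pr) o ι' T' f) = chartMap pr (under o) ι T (inclPoly pr o f))
include hθ

omit [IsClosedImmersion i] in
lemma extension_T (v : Rest one) : θ (T' v) = T v := by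
  have h := hθ (coord (prRest pr) o v)
  rw [inclPoly_coord, chartMap_coord W.T'_ne, chartMap_coord W.atlas.T_ne] at h
  rwa [W.T'_o, div_one, show T (under o (pr v)) = 1 from W.atlas.T_o _, div_one] at h

omit [IsClosedImmersion i] W in
lemma extension_const (c : ℂ) : θ (ι' c) = ι c := by
  have h := hθ (MvPolynomial.C c)
  rwa [chartMap_C, inclPoly_C, chartMap_C] at h

omit [IsClosedImmersion i] in
lemma extension_chartMap (κ : J → Rest one) (f : MvPolynomial (ChartVar (prRest pr) κ) ℂ) :
    θ (chartMap (prRest pr) κ ι' T' f) = chartMap pr (under κ) ι T (inclPoly pr κ f) := by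
  have : θ.comp (chartMap (prRest pr) κ ι' T') =
      (chartMap pr (under κ) ι T).comp (inclPoly pr κ) := by
    refine MvPolynomial.ringHom_ext (fun c => ?_) fun v => ?_
    · simp only [RingHom.comp_apply, chartMap_C, inclPoly_C]
      exact extension_const hθ c
    · simp only [RingHom.comp_apply, chartMap_X, inclPoly_X, map_div₀, W.extension_T hθ]
  exact RingHom.congr_fun this f

omit [IsClosedImmersion i] in
lemma extension_blowMap (l : Λ) (k : Rest one) (f : MvPolynomial (ChartVar (prRest pr) o) ℂ) :
    θ (blowMap (prRest pr) o ι' T' (ptRest pt l) k f) =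
      blowMap pr (under o) ι T (pt l) k (inclPoly pr o f) := by
  have : θ.comp (blowMap (prRest pr) o ι' T' (ptRest pt l) k) =
      (blowMap pr (under o) ι T (pt l) k).comp (inclPoly pr o) := by
    refine MvPolynomial.ringHom_ext (fun c => ?_) fun v => ?_
    · simp only [RingHom.comp_apply, blowMap_C, inclPoly_C]
      exact extension_const hθ c
    · simp only [RingHom.comp_apply, inclPoly_X]
      obtain ⟨v, hv⟩ := v
      by_cases e : v = k
      · subst e
        rw [blowMap_X_self, blowMap_X_self, map_sub, W.extension_T hθ, extension_const hθ]
      · rw [blowMap_X_of_ne _ _ e, blowMap_X_of_ne _ _ fun e' => e (Subtype.ext e'), map_div₀,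
          map_sub, map_sub, W.extension_T hθ, W.extension_T hθ, extension_const hθ,
          extension_const hθ]
  exact RingHom.congr_fun this f

-- A denominator outside the prime of a coordinate v stays outside it when read as a polynomial not
-- involving `one`, since setting `one` to zero undoes the inclusion and fixes v. Thus θ respects
-- regularity along corresponding boundary divisors.
omit [IsClosedImmersion i] W hθ in
lemma extension_mem {κ : J → Rest one}
    {a : MvPolynomial (ChartVar pr (under κ)) ℂ →+* X.functionField}
    {a' : MvPolynomial (ChartVar (prRest pr) κ) ℂ →+* Z.functionField}
    (h : ∀ f, θ (a' f) = a (inclPoly pr κ f)) {z : Z} {x : X} {v : Rest one}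
    (hz : Centered a' z (Ideal.span {coord (prRest pr) κ v}))
    (hx : Centered a x (Ideal.span {coord pr (under κ) v})) {g : Z.functionField}
    (hg : g ∈ ringAt z) : θ g ∈ ringAt x := by
  obtain ⟨n, d, hd, e⟩ := hz.frac g hg
  refine hx.mem_ringAt_iff.mpr ⟨inclPoly pr κ n, inclPoly pr κ d, fun hc => hd ?_, ?_⟩
  · obtain ⟨q, hq⟩ := Ideal.mem_span_singleton.mp hc
    refine Ideal.mem_span_singleton.mpr ⟨restrPoly pr κ q, ?_⟩
    rw [← restrPoly_inclPoly d, hq, map_mul, restrPoly_coord]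
  · rw [← h, ← h, ← map_mul, e]

end IsTransform

end Extension


/-! ### Boundary divisors restrict, and sections lift -/

section Conclusion

variable {Z X : Scheme.{0}} [IsIntegral Z] [IsIntegral X] {J σ Λ : Type} {one : σ}

namespace IsTransform

variable {i : Z ⟶ X} {pr : σ → J} {o : J → Rest one} {ι : ℂ →+* X.functionField}
  {T : σ → X.functionField} {pt : Λ → σ → ℂ} {ι' : ℂ →+* Z.functionField}
  {T' : Rest one → Z.functionField} (W : IsTransform i pr o ι T pt ι' T')
  [IsClosedImmersion i] {c : J → Rest one} {k : Λ → Rest one}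
  (F : IsFrame (prRest pr) o c k)

omit [IsClosedImmersion i] in
include F in
lemma frame_under : IsFrame pr (under o) (under c) (fun l => (k l : σ)) where
  pr_c := F.pr_c
  c_ne j e := F.c_ne j (Subtype.ext e)
  k_ne l e := F.k_ne l (Subtype.ext e)

variable {η : J ⊕ Λ → X} {η' : J ⊕ Λ → Z}
  (H : IsBoundary pr (under o) ι T pt (under c) (fun l => (k l : σ)) η)
  (H' : IsBoundary (prRest pr) o ι' T' (ptRest pt) c k η')

include W

omit [IsClosedImmersion i] in
lemma res_unif (b : J ⊕ Λ) : Res i (unif ι T pt (under c) (fun l => (k l : σ)) b)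
    (unif ι' T' (ptRest pt) c k b) := by
  rcases b with j | l
  · exact (W.res_T (c j)).inv (W.T'_ne _)
  · exact W.res_sub l (k l)

include F H'

/-- This makes the local description of the boundary of X available at the generic points of the
boundary divisors of Z. -/
lemma onBoundary (b : J ⊕ Λ) :
    OnBoundary ι T pt (under c) (fun l => (k l : σ)) (i (η' b)) b := by
  have A' := W.atlas_restrict
  rcases b with j | l
  · have hfin := W.isFin_of_restrict (pr_moved A'.pr_o (F.pr_c j))
      (A'.isFin_of_centered (H'.infinity j))
    rw [under_moved] at hfin
    have hT : (T (c j))⁻¹ ∈ ringAt (i (η' (Sum.inl j))) := by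
      have := hfin (o j)
      rwa [show pr (o j) = j from W.atlas.pr_o j, moved_self, show T (o j) = 1 from W.atlas.T_o j,
        one_div] at this
    refine ⟨?_, fun j' hj' => ?_⟩
    · exact (((W.res_T (c j)).inv (W.T'_ne _)).mem_idealAt hT).mp (A'.T_inv_mem H' j)
    · have := hfin (c j')
      rwa [show pr (c j') = j' from F.pr_c j', moved_of_ne _ _ hj', W.atlas.T_o, div_one] at this
  · have h := A'.exceptional_isAt F H' l
    have hat := W.isAt_iff.mp h.1
    exact ⟨hat, W.isBlowFin_of_restrict (F.k_ne l) hat h.2⟩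

include H

/-- It suffices to compare in codimension one on Z. At a boundary point both divisors are given by
the `n b`-th power of `unif`, which restricts from X to Z; at other points no boundary divisor of X
is present and the equation is 1. -/
theorem isPullbackDivisor [Fintype J] [Fintype Λ] (n : J ⊕ Λ → ℤ) :
    IsPullbackDivisor i ((W.atlas.boundaryModel (frame_under F) H).divisor n)
      ((W.atlas_restrict.boundaryModel F H').divisor n) := by
  set M := W.atlas.boundaryModel (frame_under F) H
  set M' := W.atlas_restrict.boundaryModel F H'
  refine isPullbackDivisor_of_ord M'.factorial ?_ fun ζ hζ => ?_
  -- The generic point of Z is a prime divisor of the affine part, so the boundary does not contain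
  -- Z.
  · refine ordDiv_injective W.isPrimeDiv ?_
    rw [map_zero]
    exact M.dOrd_divisor_affine n (prime_coord (one_ne_under o _)) W.gen
  · rcases M'.cases ζ hζ with ⟨b, rfl⟩ | ⟨q, hq, hc⟩
    · let f := Units.mk0 _ (W.atlas.unif_ne_zero (frame_under F) b)
      let g := Units.mk0 _ (W.atlas_restrict.unif_ne_zero F b)
      have hfg : Res i (f : X.functionField) (g : Z.functionField) := W.res_unif b
      obtain ⟨u, hu, hu'⟩ := hfg.exists_unit
      refine ⟨f ^ n b, g ^ n b, ?_, ?_, ?_⟩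
      · rw [← hu, ← hu', ← map_zpow, ← map_zpow]
        exact Res.resUnits _
      · refine M.factorial.eq_divAt fun ξ hξ hx => ?_
        rw [ord_zpow]
        rcases W.atlas.boundary_of_specializes (frame_under F) H (W.onBoundary F H' b) hξ hx f rfl
          with rfl | ⟨h0, hne⟩
        · rw [M.dOrd_divisor_boundary, W.atlas.ord_unif (frame_under F) H b f rfl, mul_one]
        · rw [M.dOrd_divisor_of_ne n hξ hne, h0, mul_zero]
      · rw [ord_zpow, M'.dOrd_divisor_boundary, W.atlas_restrict.ord_unif F H' b g rfl, mul_one]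
    · refine ⟨1, 1, Res.one, ?_, ?_⟩
      · refine M.factorial.eq_divAt fun ξ hξ hx => ?_
        rw [ord_one]
        refine M.dOrd_divisor_of_ne n hξ fun b => W.atlas.ne_boundary_of_specializes
          (frame_under F) H hx (W.atlas.isFin_o_iff.mp ?_) (fun l hl => ?_) b
        · exact W.isFin_of_restrict W.atlas.pr_o (W.atlas_restrict.isFin_of_centered hc)
        · exact W.atlas_restrict.not_isAt_of_centered hq hc l (W.isAt_iff.mpr hl)
      · rw [ord_one, M'.dOrd_divisor_affine n hq hc]

/-- The lift is the same polynomial, viewed as one not involving `one`. Since θ maps local rings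
along the boundary to local rings and local equations to local equations, the conditions on orders
carry over; setting `one` to zero recovers the given section. -/
theorem exists_section [Fintype J] [Fintype Λ] (s : X ⟶ Spec (.of ℂ)) (n : J ⊕ Λ → ℤ)
    (ψ : FunctionField (i ≫ s))
    (hψ : ψ ∈ H0 (i ≫ s) ((W.atlas_restrict.boundaryModel F H').divisor n)) :
    ∃ φ ∈ H0 s ((W.atlas.boundaryModel (frame_under F) H).divisor n),
      Res i (show X.functionField from φ) (show Z.functionField from ψ) := by
  have A' := W.atlas_restrict
  set M := W.atlas.boundaryModel (frame_under F) H
  set M' := W.atlas_restrict.boundaryModel F H'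
  obtain ⟨θ, hθ⟩ := W.exists_extension
  obtain ⟨f, rfl, hf⟩ := (M'.mem_H0_iff _ n ψ).mp hψ
  refine ⟨chartMap pr (under o) ι T (inclPoly pr o f),
    (M.mem_H0_iff s n _).mpr ⟨_, rfl, fun u hu b => ?_⟩, ?_⟩
  · have hθu : (u : X.functionField) = θ (chartMap (prRest pr) o ι' T' f) := hu.trans (hθ f).symm
    have h0 : chartMap (prRest pr) o ι' T' f ≠ 0 := fun h0 => u.ne_zero (by
      rw [hθu, h0, map_zero])
    have hmem (g : Z.functionField) (hg : g ∈ ringAt (η' b)) : θ g ∈ ringAt (η b) := by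
      rcases b with j | l
      · have h1 := H.infinity j
        have e := under_moved o j (c j)
        rw [← e] at h1
        exact extension_mem (W.extension_chartMap hθ _) (H'.infinity j) h1 hg
      · exact extension_mem (W.extension_blowMap hθ l (k l)) (H'.exceptional l)
          (H.exceptional l) hg
    let v := Units.mk0 _ h0
    let t := Units.mk0 _ (W.atlas.unif_ne_zero (frame_under F) b)
    let t' := Units.mk0 _ (W.atlas_restrict.unif_ne_zero F b)
    have ht : θ t' = t := by
      rcases b with j | l
      · exact (map_inv₀ θ _).trans (congrArg _ (W.extension_T hθ _))
      · refine (map_sub θ _ _).trans ?_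
        rw [W.extension_T hθ, extension_const hθ]
        rfl
    have h1 := hf v rfl b
    -- The order condition is rephrased as regularity of a product with a power of the local
    -- equation, a form that θ preserves.
    have h2 : 0 ≤ ord (η' b) (v * t' ^ n b) := by
      rwa [ord_mul, ord_zpow, W.atlas_restrict.ord_unif F H' b t' rfl, mul_one]
    have h3 := hmem _ ((ord_nonneg_iff (M'.isPrimeDiv b)).mp h2)
    have h4 : θ ((v * t' ^ n b : (Z.functionField)ˣ) : Z.functionField) =
        ((u * t ^ n b : (X.functionField)ˣ) : X.functionField) := by
      rw [Units.val_mul, map_mul, Units.val_zpow_eq_zpow_val, map_zpow₀, ht, Units.val_mul,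
        Units.val_zpow_eq_zpow_val, hθu]
      rfl
    rw [h4] at h3
    have h5 := (ord_nonneg_iff (M.isPrimeDiv b)).mpr h3
    rwa [ord_mul, ord_zpow, W.atlas.ord_unif (frame_under F) H b t rfl, mul_one] at h5
  · have := W.res_chart o (inclPoly pr o f)
    rwa [restrPoly_inclPoly] at this

end IsTransform

/-- The identity of Euler-Chow series for the proper transform of a hyperplane. -/
theorem IsTransform.eulerChow {i : Z ⟶ X} {pr : σ → J} {o : J → Rest one}
    {ι : ℂ →+* X.functionField} {T : σ → X.functionField} {pt : Λ → σ → ℂ}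
    {ι' : ℂ →+* Z.functionField} {T' : Rest one → Z.functionField}
    (W : IsTransform i pr o ι T pt ι' T') [IsClosedImmersion i] [CompactSpace X]
    [Fintype J] [Fintype Λ] [Finite σ] (sX : X ⟶ Spec (.of ℂ))
    (hι : ∀ z, (show X.functionField from algebraMap ℂ (FunctionField sX) z) = ι z)
    (hJ : ∀ j, ∃ v : Rest one, pr v = j ∧ v ≠ o j) :
    let sP : Z ⟶ Spec (.of ℂ) := i ≫ sX
    (∀ D : CartierDivisor X, FiniteDimensional ℂ (H0 sX D)) ∧
    (∀ D : CartierDivisor Z, FiniteDimensional ℂ (H0 sP D)) ∧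
    Function.Bijective (Pic.pullback i) ∧
    ∃ (F₀ : CartierDivisor X) (F : effMonoid X) (L : AddSubmonoid (Pic X))
      (e : effMonoid Z →+ effMonoid X),
      IsDivisorOf F₀ i.ker ∧ (F : Pic X) = Pic.mk F₀ ∧
      (L : Set (Pic X)) = {D | h0 sX (D - F) < h0 sX D} ∧
      L.map (Pic.pullback i) = effMonoid Z ∧
      Function.Injective e ∧ (∀ D, Pic.pullback i (e D : Pic X) = D) ∧
      (∀ D : effMonoid X, D ∈ Set.range e ↔ (D : Pic X) ∈ L) ∧
      (∀ D ∈ L, D ∈ effMonoid X) ∧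
      conv (tpow 0 - tpow F) (EulerChow.eulerChow sX) =
        Function.extend e (EulerChow.eulerChow sP) 0 ∧
      ∀ D ∈ L, (h0 sP (Pic.pullback i D) : ℤ) = h0 sX D - h0 sX (D - F) := by
  choose c hc using hJ
  have hk (l : Λ) : ∃ v : Rest one, v ≠ o (pr v) := by
    obtain ⟨v, -, -, hv, -⟩ := W.two l
    exact ⟨v, hv⟩
  choose k hk using hk
  have F : IsFrame (prRest pr) o c k := ⟨fun j => (hc j).1, fun j => (hc j).2, hk⟩
  obtain ⟨η, H⟩ := W.atlas.exists_isBoundary (IsTransform.frame_under F)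
  obtain ⟨η', H'⟩ := W.atlas_restrict.exists_isBoundary F
  have : CompactSpace Z := i.isClosedEmbedding.compactSpace
  exact eulerChow_restrict i (W.atlas.boundaryModel (IsTransform.frame_under F) H)
    (W.atlas_restrict.boundaryModel F H') W.isPrimeDiv (W.isPullbackDivisor F H H') sX
    (W.atlas.finiteDimensional_H0 (IsTransform.frame_under F) H sX hι)
    (W.exists_section F H H' sX)

end Conclusion


/-! ### Ideal sheaves in affine charts -/

section IdealOn

variable {X Y : Scheme.{0}}

/-- On affine schemes the inverse image is the extended ideal: both inclusions come from the
adjunction between inverse and direct image of ideal sheaves. -/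
lemma ideal_comap_top [IsAffine X] [IsAffine Y] (f : X ⟶ Y) (I : Y.IdealSheafData) :
    (I.comap f).ideal ⟨⊤, isAffineOpen_top X⟩ =
      (I.ideal ⟨⊤, isAffineOpen_top Y⟩).map f.appTop.hom := by
  refine le_antisymm ?_ ?_
  · have h : I.comap f ≤ Scheme.IdealSheafData.ofIdealTop
        ((I.ideal ⟨⊤, isAffineOpen_top Y⟩).map f.appTop.hom) := by
      refine Scheme.IdealSheafData.le_map_iff_comap_le.mp (Scheme.IdealSheafData.le_of_isAffine ?_)
      rw [Scheme.IdealSheafData.ideal_map_of_isAffineHom]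
      refine Ideal.map_le_iff_le_comap.mp ?_
      exact (Scheme.IdealSheafData.equivOfIsAffine.apply_symm_apply _).ge
    exact (h _).trans (Scheme.IdealSheafData.equivOfIsAffine.apply_symm_apply _).le
  · have h := Scheme.IdealSheafData.le_map_comap I f ⟨⊤, isAffineOpen_top Y⟩
    rw [Scheme.IdealSheafData.ideal_map_of_isAffineHom] at h
    exact Ideal.map_le_iff_le_comap.mpr h

/-- The ideal that an ideal sheaf induces on an affine scheme. -/
def idealOn {R : CommRingCat.{0}} (j : Spec R ⟶ X) (I : X.IdealSheafData) : Ideal R :=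
  ((I.comap j).ideal ⟨⊤, isAffineOpen_top _⟩).comap (Scheme.ΓSpecIso R).inv.hom

lemma idealOn_comap {R : CommRingCat.{0}} (j : Spec R ⟶ X) (f : X ⟶ Y) (I : Y.IdealSheafData) :
    idealOn j (I.comap f) = idealOn (j ≫ f) I := by
  rw [idealOn, idealOn, Scheme.IdealSheafData.comap_comp]

lemma comap_inv_eq_map {R S : CommRingCat.{0}} (e : R ≅ S) (I : Ideal R) :
    I.comap e.inv.hom = I.map e.hom.hom :=
  (Ideal.map_comap_of_equiv (I := I) e.commRingCatIsoToRingEquiv).symm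

lemma idealOn_map {R S : CommRingCat.{0}} (φ : R ⟶ S) (j : Spec R ⟶ X) (I : X.IdealSheafData) :
    idealOn (Spec.map φ ≫ j) I = (idealOn j I).map φ.hom := by
  rw [idealOn, Scheme.IdealSheafData.comap_comp, ideal_comap_top, idealOn, comap_inv_eq_map,
    comap_inv_eq_map, Ideal.map_map, Ideal.map_map]
  congr 1
  exact congrArg CommRingCat.Hom.hom (Scheme.ΓSpecIso_naturality φ)

/-- The coordinate ring of an affine chart. -/
def chartIso {R : CommRingCat.{0}} (j : Spec R ⟶ X) [IsOpenImmersion j] : Γ(X, j ''ᵁ ⊤) ≅ R :=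
  j.appIso ⊤ ≪≫ Scheme.ΓSpecIso R

lemma chartIso_fromSpec {R : CommRingCat.{0}} (j : Spec R ⟶ X) [IsOpenImmersion j] :
    Spec.map (chartIso j).hom ≫ ((isAffineOpen_top _).image_of_isOpenImmersion j).fromSpec = j := by
  have h := IsAffineOpen.SpecMap_appLE_fromSpec j
    ((isAffineOpen_top _).image_of_isOpenImmersion j) (isAffineOpen_top _)
    (j.preimage_image_eq ⊤).ge
  rw [chartIso, Iso.trans_hom, Spec.map_comp, Category.assoc, Scheme.Hom.appIso_hom', h,
    IsAffineOpen.fromSpec_top, ← Category.assoc, Scheme.isoSpec_Spec_inv, ← Spec.map_comp,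
    Iso.inv_hom_id, Spec.map_id, Category.id_comp]

lemma fromSpec_chartIso {R : CommRingCat.{0}} (j : Spec R ⟶ X) [IsOpenImmersion j]
    (q : Spec R) : ((isAffineOpen_top _).image_of_isOpenImmersion j).fromSpec
      (Spec.map (chartIso j).hom q) = j q := by
  rw [← Scheme.Hom.comp_apply, chartIso_fromSpec]

lemma chartIso_inv_apply {R : CommRingCat.{0}} (j : Spec R ⟶ X) [IsOpenImmersion j]
    (p : Spec Γ(X, j ''ᵁ ⊤)) : j (Spec.map (chartIso j).inv p) =
      ((isAffineOpen_top _).image_of_isOpenImmersion j).fromSpec p := by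
  have h : Spec.map (chartIso j).hom (Spec.map (chartIso j).inv p) = p := by
    rw [← Scheme.Hom.comp_apply, ← Spec.map_comp, Iso.hom_inv_id, Spec.map_id]
    rfl
  rw [← fromSpec_chartIso, h]

lemma idealOn_eq_map {R : CommRingCat.{0}} (j : Spec R ⟶ X) [IsOpenImmersion j]
    (I : X.IdealSheafData) : idealOn j I =
      (I.ideal ⟨j ''ᵁ ⊤, (isAffineOpen_top _).image_of_isOpenImmersion j⟩).map
        (chartIso j).hom.hom := by
  rw [idealOn, Scheme.IdealSheafData.ideal_comap_of_isOpenImmersion, Ideal.comap_comap,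
    ← comap_inv_eq_map]
  rfl

lemma chartIso_mem {R S : CommRingCat.{0}} (e : R ≅ S) {f : R} (hf : f ∈ nonZeroDivisors R) :
    e.hom f ∈ nonZeroDivisors S := by
  rw [← MulEquivClass.map_nonZeroDivisors e.commRingCatIsoToRingEquiv]
  exact Submonoid.mem_map_of_mem _ hf

lemma isInvertibleIdeal_of {I : X.IdealSheafData} (h : ∀ x : X, ∃ (R : CommRingCat.{0})
    (j : Spec R ⟶ X) (_ : IsOpenImmersion j), x ∈ Set.range j ∧
      ∃ f ∈ nonZeroDivisors R, idealOn j I = Ideal.span {f}) : IsInvertibleIdeal I := by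
  intro x
  obtain ⟨R, j, hj, ⟨y, rfl⟩, f, hf, e⟩ := h x
  refine ⟨⟨j ''ᵁ ⊤, (isAffineOpen_top _).image_of_isOpenImmersion j⟩, ⟨y, trivial, rfl⟩,
    (chartIso j).inv f, chartIso_mem (chartIso j).symm hf, ?_⟩
  rw [idealOn_eq_map] at e
  have h1 := congrArg (Ideal.map (chartIso j).inv.hom) e
  rw [Ideal.map_map, Ideal.map_span, Set.image_singleton] at h1
  refine Eq.trans ?_ h1
  rw [← CommRingCat.hom_comp, Iso.hom_inv_id, CommRingCat.hom_id, Ideal.map_id]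

lemma IsInvertibleIdeal.exists_chart {I : X.IdealSheafData} (h : IsInvertibleIdeal I) (x : X) :
    ∃ (R : CommRingCat.{0}) (j : Spec R ⟶ X) (_ : IsOpenImmersion j), x ∈ Set.range j ∧
      ∃ f ∈ nonZeroDivisors R, idealOn j I = Ideal.span {f} := by
  obtain ⟨U, hx, hU⟩ := h x
  have hU' : IsOpenImmersion U.2.fromSpec := IsAffineOpen.isOpenImmersion_fromSpec U.2
  have hrange := U.2.opensRange_fromSpec
  rw [← Scheme.Hom.image_top_eq_opensRange] at hrange
  have e : (⟨U.2.fromSpec ''ᵁ ⊤, (isAffineOpen_top _).image_of_isOpenImmersion U.2.fromSpec⟩ :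
      X.affineOpens) = U := Subtype.ext hrange
  rw [← e] at hU
  obtain ⟨f, hf, hfe⟩ := hU
  refine ⟨_, U.2.fromSpec, inferInstance, by rwa [U.2.range_fromSpec], _,
    chartIso_mem (chartIso U.2.fromSpec) hf, ?_⟩
  rw [idealOn_eq_map, hfe, Ideal.map_span, Set.image_singleton]

lemma idealOn_vanishingIdeal {R : CommRingCat.{0}} (j : Spec R ⟶ X) [IsOpenImmersion j]
    (Z : Closeds X) : idealOn j (Scheme.IdealSheafData.vanishingIdeal Z) =
      PrimeSpectrum.vanishingIdeal (j ⁻¹' (Z : Set X)) := by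
  ext f
  rw [idealOn_eq_map, ← comap_inv_eq_map, Ideal.mem_comap,
    Scheme.IdealSheafData.vanishingIdeal_ideal, PrimeSpectrum.mem_vanishingIdeal,
    PrimeSpectrum.mem_vanishingIdeal]
  constructor
  · intro h q hq
    have h1 := h (Spec.map (chartIso j).hom q) ((congrArg (· ∈ (Z : Set X))
      (fromSpec_chartIso j q)).mpr hq)
    change (chartIso j).hom ((chartIso j).inv f) ∈ q.asIdeal at h1
    rwa [← CommRingCat.comp_apply, Iso.inv_hom_id] at h1
  · intro h p hp
    exact h (Spec.map (chartIso j).inv p) ((congrArg (· ∈ (Z : Set X))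
      (chartIso_inv_apply j p)).mpr hp)

end IdealOn


/-- Morphisms from the spectra of domains to `Y` are determined generically. -/
class SeparatesDomains (Y : Scheme.{0}) : Prop where
  eq_of_injective : ∀ {R S : CommRingCat.{0}} [IsDomain R] (φ : R ⟶ S), Function.Injective φ →
    ∀ u v : Spec R ⟶ Y, Spec.map φ ≫ u = Spec.map φ ≫ v → u = v

/-! ### Morphisms expressed in the function field -/

section RationalMaps

variable {X Y : Scheme.{0}} [IsIntegral X]

variable (X) in
/-- The generic point, as a morphism from the spectrum of the function field. -/
abbrev genericMap : Spec X.functionField ⟶ X := X.fromSpecStalk (genericPoint X)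

/-- The inclusion of a local ring in the function field. -/
abbrev stalkToK (x : X) : X.presheaf.stalk x ⟶ X.functionField :=
  X.presheaf.stalkSpecializes ((genericPoint_spec X).specializes trivial)

lemma map_stalkToK (x : X) :
    Spec.map (stalkToK x) ≫ X.fromSpecStalk x = genericMap X :=
  Scheme.SpecMap_stalkSpecializes_fromSpecStalk _

lemma genericMap_apply (p : Spec X.functionField) : genericMap X p = genericPoint X := by
  have : p = IsLocalRing.closedPoint X.functionField := Subsingleton.elim (α := PrimeSpectrum _) _ _
  rw [this]
  exact Scheme.fromSpecStalk_closedPoint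

/-- The closed point of the spectrum of a local ring. -/
def closedPt (L : CommRingCat.{0}) [IsLocalRing L] : Spec L := IsLocalRing.closedPoint L

lemma fromSpecStalk_closedPt {W : Scheme.{0}} (x : W) :
    W.fromSpecStalk x (closedPt (W.presheaf.stalk x)) = x :=
  Scheme.fromSpecStalk_closedPoint

/-- Every point of the spectrum of a local ring specializes to the closed point, so an open set
containing the image of the latter contains the whole image. -/
lemma exists_lift_of_apply_mem {L : CommRingCat.{0}} [IsLocalRing L] {A : CommRingCat.{0}}
    (c : Spec A ⟶ Y) [IsOpenImmersion c] (f : Spec L ⟶ Y)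
    (h : f (closedPt L) ∈ Set.range c) : ∃ β : A ⟶ L, Spec.map β ≫ c = f := by
  have h1 : Set.range f ⊆ Set.range c := by
    rintro _ ⟨p, rfl⟩
    exact ((IsLocalRing.specializes_closedPoint (R := L) p).map f.continuous).mem_open
      c.isOpenEmbedding.isOpen_range h
  refine ⟨Spec.preimage (IsOpenImmersion.lift c f h1), ?_⟩
  rw [Spec.map_preimage, IsOpenImmersion.lift_fac]

/-- `a` is the pull-back of functions from the chart `c` of `Y` along the rational map `f`. -/
def IsRat {A : CommRingCat.{0}} (f : X ⟶ Y) (c : Spec A ⟶ Y) (a : A ⟶ X.functionField) : Prop :=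
  Spec.map a ≫ c = genericMap X ≫ f

variable {A : CommRingCat.{0}} {f : X ⟶ Y} {c : Spec A ⟶ Y} {a : A ⟶ X.functionField}

lemma exists_isRat (f : X ⟶ Y) (c : Spec A ⟶ Y) [IsOpenImmersion c]
    (h : f (genericPoint X) ∈ Set.range c) : ∃ a, IsRat f c a := by
  refine exists_lift_of_apply_mem c _ ?_
  rwa [Scheme.Hom.comp_apply, genericMap_apply]

lemma IsRat.exists_stalk [IsOpenImmersion c] (h : IsRat f c a) {x : X}
    (hx : f x ∈ Set.range c) :
    ∃ β : A ⟶ X.presheaf.stalk x, β ≫ stalkToK x = a ∧ Spec.map β ≫ c = X.fromSpecStalk x ≫ f := by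
  obtain ⟨β, hβ⟩ := exists_lift_of_apply_mem c (X.fromSpecStalk x ≫ f) (by
    rwa [Scheme.Hom.comp_apply, fromSpecStalk_closedPt])
  refine ⟨β, Spec.map_injective ?_, hβ⟩
  rw [← cancel_mono c, h, Spec.map_comp, Category.assoc, hβ, ← Category.assoc, map_stalkToK]

lemma IsRat.mem [IsOpenImmersion c] (h : IsRat f c a) {x : X} (hx : f x ∈ Set.range c) (r : A) :
    a r ∈ ringAt x := by
  obtain ⟨β, rfl, -⟩ := h.exists_stalk hx
  exact ⟨β r, rfl⟩

lemma closedPoint_mem_iff {L : CommRingCat.{0}} [IsLocalRing L] (β : A ⟶ L) (r : A) :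
    r ∈ (Spec.map β (closedPt L)).asIdeal ↔ β r ∈ IsLocalRing.maximalIdeal L :=
  Iff.rfl

lemma IsRat.van [IsOpenImmersion c] (h : IsRat f c a) {x : X} {q : Spec A} (hx : f x = c q)
    (r : A) : a r ∈ idealAt x ↔ r ∈ q.asIdeal := by
  obtain ⟨β, rfl, hβ⟩ := h.exists_stalk ⟨q, hx.symm⟩
  have hq : Spec.map β (closedPt _) = q := by
    apply c.isOpenEmbedding.injective
    rw [← Scheme.Hom.comp_apply, hβ, Scheme.Hom.comp_apply, fromSpecStalk_closedPt, hx]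
  rw [← hq, closedPoint_mem_iff]
  exact algebraMap_mem_idealAt

lemma exists_stalk_of_mem {x : X} (h : ∀ r, a r ∈ ringAt x) :
    ∃ β : A ⟶ X.presheaf.stalk x, β ≫ stalkToK x = a := by
  let e := RingEquiv.ofBijective (algebraMap (X.presheaf.stalk x) X.functionField).rangeRestrict
    ⟨fun u v huv => algebraMap_stalk_injective x (congrArg Subtype.val huv),
      RingHom.rangeRestrict_surjective _⟩
  refine ⟨CommRingCat.ofHom (e.symm.toRingHom.comp (a.hom.codRestrict (ringAt x) h)), ?_⟩
  ext r
  exact congrArg Subtype.val (e.apply_symm_apply ⟨a r, h r⟩)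

lemma map_eq_of_separated [SeparatesDomains Y] {x : X} {u v : Spec (X.presheaf.stalk x) ⟶ Y}
    (h : Spec.map (stalkToK x) ≫ u = Spec.map (stalkToK x) ≫ v) : u = v :=
  SeparatesDomains.eq_of_injective (stalkToK x) (algebraMap_stalk_injective x) u v h

lemma IsRat.stalk_eq [SeparatesDomains Y] (h : IsRat f c a) {x : X} {β : A ⟶ X.presheaf.stalk x}
    (hβ : β ≫ stalkToK x = a) : Spec.map β ≫ c = X.fromSpecStalk x ≫ f := by
  apply map_eq_of_separated
  rw [← Category.assoc, ← Spec.map_comp, hβ, h, ← Category.assoc, map_stalkToK]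

/-- If all functions of the chart are regular at x, they define a morphism from the spectrum of the
local ring to the chart. It agrees generically with f, hence everywhere. -/
lemma IsRat.mem_range [SeparatesDomains Y] (h : IsRat f c a) {x : X}
    (hx : ∀ r, a r ∈ ringAt x) : f x ∈ Set.range c := by
  obtain ⟨β, hβ⟩ := exists_stalk_of_mem hx
  refine ⟨Spec.map β (closedPt _), ?_⟩
  rw [← Scheme.Hom.comp_apply, h.stalk_eq hβ, Scheme.Hom.comp_apply,
    fromSpecStalk_closedPt]

end RationalMaps

/-! ### Charts given by open immersions -/

section OpenCharts

variable {X : Scheme.{0}} [IsIntegral X]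

lemma genericPoint_mem_range {W : Scheme.{0}} (j : W ⟶ X) [IsOpenImmersion j] (w : W) :
    genericPoint X ∈ Set.range j :=
  ((genericPoint_spec X).specializes trivial).mem_open j.isOpenEmbedding.isOpen_range ⟨w, rfl⟩

variable {S : CommRingCat.{0}} {j : Spec S ⟶ X} [IsOpenImmersion j] {b : S ⟶ X.functionField}

lemma IsRat.eq_toK (h : IsRat (𝟙 X) j b) (hU : genericPoint X ∈ j ''ᵁ ⊤) (s : S) :
    b s = toK (j ''ᵁ ⊤) hU ((chartIso j).inv s) := by
  have h1 : Spec.map (CommRingCat.ofHom ((toK (j ''ᵁ ⊤) hU).comp (chartIso j).inv.hom)) ≫ j =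
      Spec.map b ≫ j := by
    rw [h, Category.comp_id, genericMap]
    have h2 := ((isAffineOpen_top _).image_of_isOpenImmersion j).fromSpecStalk_eq_fromSpecStalk hU
    rw [← h2, IsAffineOpen.fromSpecStalk]
    refine (congrArg (_ ≫ ·) (chartIso_fromSpec j)).symm.trans ?_
    rw [← Category.assoc, ← Spec.map_comp]
    congr 2
    ext s
    change toK _ hU ((chartIso j).inv ((chartIso j).hom s)) = toK _ hU s
    rw [← CommRingCat.comp_apply, Iso.hom_inv_id]
    rfl
  rw [cancel_mono] at h1
  exact congrArg (fun φ => φ.hom s) (Spec.map_injective h1.symm)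

/-- An affine open subscheme whose coordinate ring is a localization of `A` is a chart. -/
lemma IsRat.isChart {R : Type} [CommRing R] {g : R} (α : R →+* S)
    (hα : @IsLocalization.Away _ _ g S _ α.toAlgebra) (h : IsRat (𝟙 X) j b) (s : Spec S) :
    IsChart (b.hom.comp α) g (j ''ᵁ ⊤) := by
  have hU : genericPoint X ∈ j ''ᵁ ⊤ := by
    obtain ⟨p, hp⟩ := genericPoint_mem_range j s
    exact ⟨p, trivial, hp⟩
  refine ⟨(isAffineOpen_top _).image_of_isOpenImmersion j, hU,
    (chartIso j).inv.hom.comp α, fun r => (h.eq_toK hU _).symm, ?_⟩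
  let _ := α.toAlgebra
  let _ := ((chartIso j).inv.hom.comp α).toAlgebra
  exact IsLocalization.isLocalization_of_algEquiv _
    { (chartIso j).symm.commRingCatIsoToRingEquiv with commutes' := fun _ => rfl }

lemma IsRat.injective [IsDomain S] (h : IsRat (𝟙 X) j b) (s : Spec S) : Function.Injective b := by
  have h1 := h.isChart (g := (1 : S)) (RingHom.id S) (IsLocalization.away_of_isUnit_of_bijective S
    isUnit_one Function.bijective_id) s
  exact h1.injective

end OpenCharts


/-! ### Consequences of the universal property -/

section Blowup

lemma isDomain_of_isOpenImmersion {X : Scheme.{0}} [IsIntegral X] {R : CommRingCat.{0}}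
    (j : Spec R ⟶ X) [IsOpenImmersion j] (p : Spec R) : IsDomain R := by
  have : Nonempty (Spec R) := ⟨p⟩
  have := isIntegral_of_isOpenImmersion j
  exact (affine_isIntegral_iff R).mp this

/-- The generic point of the spectrum of a domain. -/
def botPt (R : CommRingCat.{0}) [IsDomain R] : Spec R := (⊥ : PrimeSpectrum R)

lemma genericPoint_Spec (R : CommRingCat.{0}) [IsDomain R] : genericPoint (Spec R) = botPt R :=
  genericPoint_eq_bot_of_affine R

lemma map_botPt {R S : CommRingCat.{0}} [IsDomain R] [IsDomain S] {φ : R ⟶ S}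
    (h : Function.Injective φ) : Spec.map φ (botPt S) = botPt R :=
  PrimeSpectrum.ext ((RingHom.injective_iff_ker_eq_bot _).mp h)

lemma apply_bot_of_isOpenImmersion {X : Scheme.{0}} [IsIntegral X] {R : CommRingCat.{0}}
    [IsDomain R] (j : Spec R ⟶ X) [IsOpenImmersion j] :
    j (botPt R) = genericPoint X := by
  rw [← genericPoint_eq_of_isOpenImmersion j, genericPoint_Spec]

/-- The morphism sends generic point to generic point, so a nonzero local generator pulls back to a
nonzero function on an integral scheme. -/
lemma isInvertibleIdeal_comap {T X : Scheme.{0}} [IsIntegral T] [IsIntegral X] (f : T ⟶ X)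
    (hf : f (genericPoint T) = genericPoint X) {I : X.IdealSheafData} (hI : IsInvertibleIdeal I) :
    IsInvertibleIdeal (I.comap f) := by
  refine isInvertibleIdeal_of fun t => ?_
  obtain ⟨R, j, hj, ⟨p, hp⟩, a, ha, e⟩ := hI.exists_chart (f t)
  obtain ⟨_, ⟨W, hW, rfl⟩, htW, hWj⟩ := T.isBasis_affineOpens.exists_subset_of_mem_open
    (show t ∈ f ⁻¹ᵁ j.opensRange from ⟨p, hp⟩) (f ⁻¹ᵁ j.opensRange).2
  have hk : IsOpenImmersion hW.fromSpec := IsAffineOpen.isOpenImmersion_fromSpec hW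
  have ht : t ∈ Set.range hW.fromSpec := by rwa [hW.range_fromSpec]
  have hrange : Set.range (hW.fromSpec ≫ f) ⊆ Set.range j := by
    rintro _ ⟨s, rfl⟩
    rw [Scheme.Hom.comp_apply]
    refine hWj ?_
    rw [← hW.range_fromSpec]
    exact ⟨s, rfl⟩
  obtain ⟨φ, hφ⟩ : ∃ φ : R ⟶ Γ(T, W), Spec.map φ ≫ j = hW.fromSpec ≫ f :=
    ⟨Spec.preimage (IsOpenImmersion.lift j _ hrange), by
      rw [Spec.map_preimage, IsOpenImmersion.lift_fac]⟩
  obtain ⟨s, hs⟩ := ht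
  have := isDomain_of_isOpenImmersion j p
  have := isDomain_of_isOpenImmersion hW.fromSpec s
  refine ⟨_, hW.fromSpec, hk, ⟨s, hs⟩, φ a, ?_, ?_⟩
  · rw [mem_nonZeroDivisors_iff_ne_zero]
    intro h0
    have hbot : Spec.map φ (botPt Γ(T, W)) = botPt R := by
      apply j.isOpenEmbedding.injective
      rw [apply_bot_of_isOpenImmersion j]
      rw [← Scheme.Hom.comp_apply, hφ, Scheme.Hom.comp_apply, apply_bot_of_isOpenImmersion, hf]
    have h1 : a ∈ (Spec.map φ (botPt Γ(T, W))).asIdeal := h0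
    rw [hbot] at h1
    exact nonZeroDivisors.ne_zero ha h1
  · rw [idealOn_comap, ← hφ, idealOn_map, e, Ideal.map_span, Set.image_singleton]

variable {X Y : Scheme.{0}} [IsIntegral X] {π : X ⟶ Y} {I : Y.IdealSheafData}

/-- A morphism to a blow-up is determined by its composite with the projection. -/
lemma IsBlowup.hom_ext (hπ : IsBlowup π I) {T : Scheme.{0}} [IsIntegral T] {u v : T ⟶ X}
    (hu : u (genericPoint T) = genericPoint X) (h : u ≫ π = v ≫ π) : u = v := by
  refine (hπ.existsUnique_lift (u ≫ π) ?_).unique rfl h.symm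
  rw [Scheme.IdealSheafData.comap_comp]
  exact isInvertibleIdeal_comap u hu hπ.invertible

instance (x : X) : IsDomain (X.presheaf.stalk x) := inferInstance

lemma fromSpecStalk_genericPoint (x : X) :
    X.fromSpecStalk x (genericPoint (Spec (X.presheaf.stalk x))) = genericPoint X := by
  rw [genericPoint_Spec, ← map_botPt (φ := stalkToK x) (algebraMap_stalk_injective x),
    ← Scheme.Hom.comp_apply, map_stalkToK, genericMap_apply]

/-- The inclusion of local rings yields a second morphism from the spectrum of the local ring at x
to X. Both agree over Y, where generic agreement suffices, and then on X by uniqueness in the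
universal property; this replaces separatedness of X. -/
lemma IsBlowup.specializes [SeparatesDomains Y] (hπ : IsBlowup π I) {x y : X} (h : ringAt y ≤ ringAt x)
    : x ⤳ y := by
  obtain ⟨β, hβ⟩ := exists_stalk_of_mem (a := stalkToK y) (x := x) fun r => h ⟨r, rfl⟩
  have h1 : X.fromSpecStalk x = Spec.map β ≫ X.fromSpecStalk y := by
    refine hπ.hom_ext (fromSpecStalk_genericPoint x) (map_eq_of_separated ?_)
    rw [← Category.assoc, map_stalkToK, ← Category.assoc, ← Category.assoc, ← Spec.map_comp, hβ,
      map_stalkToK]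
  have h2 : x ∈ Set.range (X.fromSpecStalk y) := by
    refine ⟨Spec.map β (closedPt _), ?_⟩
    rw [← Scheme.Hom.comp_apply, ← h1, fromSpecStalk_closedPt]
  rwa [Scheme.range_fromSpecStalk] at h2

lemma IsBlowup.eq_of_ringAt_eq [SeparatesDomains Y] (hπ : IsBlowup π I) {x y : X}
    (h : ringAt x = ringAt y) : x = y :=
  ((hπ.specializes h.ge).antisymm (hπ.specializes h.le)).eq

-- Over N the morphism h has the two-sided inverse g, so it restricts to an isomorphism there.
omit [IsIntegral X] in
lemma isOpenImmersion_comp_of_local_inverse {T W : Scheme.{0}} {h : T ⟶ X} {N : X.Opens}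
    {g : N.toScheme ⟶ T} (e1 : g ≫ h = N.ι) (e2 : h ∣_ N ≫ g = (h ⁻¹ᵁ N).ι) (k : W ⟶ T)
    [IsOpenImmersion k] (hk : Set.range k ⊆ h ⁻¹ᵁ N) : IsOpenImmersion (k ≫ h) := by
  have hg : Set.range g ⊆ Set.range (h ⁻¹ᵁ N).ι := by
    rw [Scheme.Opens.range_ι]
    rintro _ ⟨n, rfl⟩
    change h (g n) ∈ N
    rw [← Scheme.Hom.comp_apply, e1]
    exact n.2
  have hiso : IsIso (h ∣_ N) := by
    refine ⟨IsOpenImmersion.lift (h ⁻¹ᵁ N).ι g hg, ?_, ?_⟩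
    · rw [← cancel_mono (h ⁻¹ᵁ N).ι, Category.assoc, IsOpenImmersion.lift_fac, e2, Category.id_comp]
    · rw [← cancel_mono N.ι, Category.assoc, morphismRestrict_ι, ← Category.assoc,
        IsOpenImmersion.lift_fac, e1, Category.id_comp]
  have hk' : Set.range k ⊆ Set.range (h ⁻¹ᵁ N).ι := by rwa [Scheme.Opens.range_ι]
  have : IsOpenImmersion (IsOpenImmersion.lift (h ⁻¹ᵁ N).ι k hk') := by
    have h1 := IsOpenImmersion.lift_fac (h ⁻¹ᵁ N).ι k hk'
    have : IsOpenImmersion (IsOpenImmersion.lift (h ⁻¹ᵁ N).ι k hk' ≫ (h ⁻¹ᵁ N).ι) := by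
      rwa [h1]
    exact IsOpenImmersion.of_comp _ (h ⁻¹ᵁ N).ι
  have e : k ≫ h = IsOpenImmersion.lift (h ⁻¹ᵁ N).ι k hk' ≫ h ∣_ N ≫ N.ι := by
    rw [morphismRestrict_ι, ← Category.assoc, IsOpenImmersion.lift_fac]
  rw [e]
  infer_instance

lemma exists_localization_lift {A : CommRingCat.{0}} {T : (Spec A).Opens} {V : T.toScheme.Opens}
    {t : T.toScheme} (ht : t ∈ V) : ∃ (g : A) (k : Spec (.of (Localization.Away g)) ⟶ T.toScheme)
      (_ : IsOpenImmersion k),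
      k ≫ T.ι = Spec.map (CommRingCat.ofHom (algebraMap A (Localization.Away g))) ∧
      t ∈ Set.range k ∧ Set.range k ⊆ V := by
  obtain ⟨_, ⟨_, ⟨g, rfl⟩, rfl⟩, htg, hgV⟩ := PrimeSpectrum.isBasis_basic_opens.exists_subset_of_mem_open
    (show T.ι t ∈ (T.ι ''ᵁ V : (Spec A).Opens) from ⟨t, ht, rfl⟩) (T.ι ''ᵁ V).2
  have hrange : Set.range (Spec.map (CommRingCat.ofHom (algebraMap A (Localization.Away g)))) =
      ((PrimeSpectrum.basicOpen g : Opens (PrimeSpectrum A)) : Set (PrimeSpectrum A)) := PrimeSpectrum.localization_away_comap_range _ g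
  have hsub : Set.range (Spec.map (CommRingCat.ofHom (algebraMap A (Localization.Away g)))) ⊆
      Set.range T.ι := by
    rw [hrange]
    exact hgV.trans (Set.image_subset_range _ _)
  have hop : IsOpenImmersion (Spec.map (CommRingCat.ofHom (algebraMap A (Localization.Away g)))) :=
    inferInstance
  have e := IsOpenImmersion.lift_fac T.ι _ hsub
  have hk : IsOpenImmersion (IsOpenImmersion.lift T.ι _ hsub) := by
    have : IsOpenImmersion (IsOpenImmersion.lift T.ι _ hsub ≫ T.ι) := by rwa [e]
    exact IsOpenImmersion.of_comp _ T.ι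
  refine ⟨g, IsOpenImmersion.lift T.ι _ hsub, hk, e, ?_, ?_⟩
  · have : T.ι t ∈ Set.range (Spec.map (CommRingCat.ofHom (algebraMap A (Localization.Away g)))) := by
      rw [hrange]
      exact htg
    obtain ⟨s, hs⟩ := this
    refine ⟨s, T.ι.isOpenEmbedding.injective ?_⟩
    rw [← Scheme.Hom.comp_apply, e, hs]
  · rintro _ ⟨s, rfl⟩
    have h1 : Spec.map (CommRingCat.ofHom (algebraMap A (Localization.Away g))) s ∈
        (T.ι ''ᵁ V : (Spec A).Opens) := hgV (by rw [← hrange]; exact ⟨s, rfl⟩)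
    obtain ⟨v, hv, hve⟩ := h1
    rw [← e, Scheme.Hom.comp_apply] at hve
    rwa [← T.ι.isOpenEmbedding.injective hve]

end Blowup


/-! ### From birational affine schemes to charts of the blow-up -/

section BirationalCharts

/-- Morphisms to an integral affine scheme that hit its generic point are determined by their
composites with `F`. -/
def IsGenericallyMono {Y : Scheme.{0}} {A : CommRingCat.{0}} [IsDomain A] (F : Spec A ⟶ Y) : Prop :=
  ∀ {W : Scheme.{0}} [IsIntegral W] (u v : W ⟶ Spec A), u (genericPoint W) = botPt A →
    u ≫ F = v ≫ F → u = v

lemma isGenericallyMono_of_mono {Y : Scheme.{0}} {A : CommRingCat.{0}} [IsDomain A] (F : Spec A ⟶ Y)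
    [Mono F] : IsGenericallyMono F := fun _ _ _ h => (cancel_mono F).mp h

variable {X Y : Scheme.{0}} [IsIntegral X] [SeparatesDomains Y] {π : X ⟶ Y} {I : Y.IdealSheafData}
  {A : CommRingCat.{0}} [IsDomain A] {F : Spec A ⟶ Y} {T : (Spec A).Opens}
  {a : A ⟶ X.functionField}

lemma lift_range_of_closedPt {L : CommRingCat.{0}} [IsLocalRing L] {W : Scheme.{0}} (U : W.Opens)
    (f : Spec L ⟶ W) (h : f (closedPt L) ∈ U) : Set.range f ⊆ Set.range U.ι := by
  rw [Scheme.Opens.range_ι]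
  rintro _ ⟨p, rfl⟩
  exact ((IsLocalRing.specializes_closedPoint (R := L) p).map f.continuous).mem_open U.2 h

/-- A birational affine scheme over the base on which the inverse image ideal is invertible gives
charts of the blow-up. -/
lemma IsBlowup.exists_isChart (hπ : IsBlowup π I) [LocallyOfFiniteType F]
    (hF : IsGenericallyMono F) (hT : IsInvertibleIdeal (I.comap (T.ι ≫ F))) (ha : IsRat π F a)
    {x : X} (hx : ∀ r, a r ∈ ringAt x) {q : Spec A} (hq : q ∈ T)
    (hqa : ∀ r, a r ∈ idealAt x ↔ r ∈ q.asIdeal) : ∃ U g, x ∈ U ∧ IsChart a.hom g U := by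
  obtain ⟨h, hh, -⟩ := hπ.existsUnique_lift (T.ι ≫ F) hT
  replace hh : h ≫ π = T.ι ≫ F := hh
  obtain ⟨β, hβ⟩ := exists_stalk_of_mem hx
  have hβq : Spec.map β (closedPt _) = q := by
    refine PrimeSpectrum.ext (SetLike.ext fun r => ?_)
    rw [← hqa, ← hβ]
    exact (closedPoint_mem_iff β r).trans algebraMap_mem_idealAt.symm
  have hr := lift_range_of_closedPt T (Spec.map β) (by rwa [hβq])
  -- The morphism from the spectrum of the local ring at x into T spreads out to a neighbourhood N,
  -- because F is locally of finite type. This gives a candidate g for the inverse of h near x.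
  obtain ⟨N, hxN, g, -, hg⟩ := spread_out_of_isGermInjective' π (T.ι ≫ F)
    (IsOpenImmersion.lift T.ι (Spec.map β) hr) (by
      rw [← Category.assoc, IsOpenImmersion.lift_fac, ha.stalk_eq hβ])
  have : Nonempty N := ⟨⟨x, hxN⟩⟩
  have e1 : g ≫ h = N.ι := by
    refine (hπ.hom_ext (genericPoint_eq_of_isOpenImmersion N.ι) ?_).symm
    rw [Category.assoc, hh, hg]
  obtain ⟨n, hn⟩ : ∃ n : N.toScheme, N.ι n = x := ⟨⟨x, hxN⟩, rfl⟩
  have hxt : h (g n) = x := by rw [← Scheme.Hom.comp_apply, e1, hn]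
  have ht : g n ∈ h ⁻¹ᵁ N := by
    change h (g n) ∈ N
    rwa [hxt]
  have : Nonempty T := ⟨g n⟩
  -- One composite of g and h is the inclusion by uniqueness for the blow-up; the other is so
  -- because F is generically a monomorphism.
  have : Nonempty (h ⁻¹ᵁ N).toScheme := ⟨⟨_, ht⟩⟩
  have e2 : h ∣_ N ≫ g = (h ⁻¹ᵁ N).ι := by
    rw [← cancel_mono T.ι]
    refine (hF _ _ ?_ ?_).symm
    · rw [genericPoint_eq_of_isOpenImmersion, genericPoint_Spec]
    · rw [Category.assoc, Category.assoc, Category.assoc, hg, ← Category.assoc (h ∣_ N),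
        morphismRestrict_ι, Category.assoc, hh]
  -- Shrinking to a basic open set of the spectrum of A makes the coordinate ring a localization at
  -- one element, as a chart requires.
  obtain ⟨g', k, hk, hkT, ⟨s, hs⟩, hkV⟩ := exists_localization_lift ht
  have hj := isOpenImmersion_comp_of_local_inverse e1 e2 k hkV
  have := isDomain_of_isOpenImmersion (k ≫ h) s
  obtain ⟨b, hb⟩ := exists_isRat (𝟙 X) (k ≫ h) (genericPoint_mem_range (k ≫ h) s)
  have hab : CommRingCat.ofHom (algebraMap A (Localization.Away g')) ≫ b = a := by
    refine Spec.map_injective (hF _ _ ?_ ?_)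
    · rw [genericPoint_Spec, Spec.map_comp, Scheme.Hom.comp_apply, map_botPt (hb.injective s),
        ← genericPoint_Spec, ← genericPoint_Spec, ← hkT]
      exact genericPoint_eq_of_isOpenImmersion (k ≫ T.ι)
    · rw [ha, Spec.map_comp, Category.assoc, ← hkT, Category.assoc, ← hh]
      have := congrArg (· ≫ π) hb
      simpa only [Category.assoc, Category.comp_id, Category.id_comp] using this
  refine ⟨(k ≫ h) ''ᵁ ⊤, g', ⟨s, trivial, ?_⟩, ?_⟩
  · refine (Scheme.Hom.comp_apply k h s).trans ?_
    rw [hs, hxt]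
  · rw [← hab]
    refine hb.isChart (algebraMap A (Localization.Away g')) ?_ s
    have e : (algebraMap A (Localization.Away g')).toAlgebra =
        (inferInstance : Algebra A (Localization.Away g')) := Algebra.algebra_ext _ _ fun _ => rfl
    change @IsLocalization.Away A _ g' (Localization.Away g') _ (RingHom.toAlgebra _)
    rw [e]
    infer_instance

/-- The functions on a birational affine scheme vanishing at the image of a point. -/
lemma IsRat.van_of_lift (hF : IsGenericallyMono F) (ha : IsRat π F a) {h : T.toScheme ⟶ X}
    (hh : h ≫ π = T.ι ≫ F) (t : T.toScheme) (hx : ∀ r, a r ∈ ringAt (h t)) (r : A) :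
    a r ∈ idealAt (h t) ↔ r ∈ (T.ι t).asIdeal := by
  obtain ⟨β, hβ⟩ := exists_stalk_of_mem hx
  have : Nonempty T := ⟨t⟩
  let γ : A ⟶ T.toScheme.presheaf.stalk t := Spec.preimage (T.toScheme.fromSpecStalk t ≫ T.ι)
  have hγ : Spec.map γ = T.toScheme.fromSpecStalk t ≫ T.ι := Spec.map_preimage _
  have e : β ≫ h.stalkMap t = γ := by
    refine Spec.map_injective (hF _ _ ?_ ?_).symm
    · rw [hγ, Scheme.Hom.comp_apply, fromSpecStalk_genericPoint, genericPoint_eq_of_isOpenImmersion,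
        genericPoint_Spec]
    · rw [hγ, Category.assoc, ← hh, Spec.map_comp, Category.assoc, ha.stalk_eq hβ,
        ← Category.assoc, ← Category.assoc, Scheme.SpecMap_stalkMap_fromSpecStalk]
  have h1 : Spec.map γ (closedPt _) = T.ι t := by
    rw [hγ, Scheme.Hom.comp_apply, fromSpecStalk_closedPt]
  rw [← h1, closedPoint_mem_iff, ← e, ← hβ]
  refine (algebraMap_mem_idealAt (x := h t) (a := β r)).trans ?_
  rw [CommRingCat.comp_apply, IsLocalRing.mem_maximalIdeal, IsLocalRing.mem_maximalIdeal,
    mem_nonunits_iff, mem_nonunits_iff, not_iff_not]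
  exact (isUnit_map_iff (h.stalkMap t).hom (β r)).symm

end BirationalCharts


/-! ### Ideals of finite sets and local generators -/

section Ideals

variable {A B : Type} [CommRing A] [CommRing B] (χ : A →+* B) {S : Set (PrimeSpectrum A)}

lemma exists_mem_vanishingIdeal (hS : IsClosed S) {q : PrimeSpectrum A} (hq : q ∉ S) :
    ∃ r ∈ PrimeSpectrum.vanishingIdeal S, r ∉ q.asIdeal := by
  rw [← hS.closure_eq, ← PrimeSpectrum.zeroLocus_vanishingIdeal_eq_closure,
    PrimeSpectrum.mem_zeroLocus, Set.not_subset] at hq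
  exact hq

lemma map_vanishingIdeal_eq_top (hS : IsClosed S)
    (h : ∀ p : PrimeSpectrum B, PrimeSpectrum.comap χ p ∉ S) :
    (PrimeSpectrum.vanishingIdeal S).map χ = ⊤ := by
  by_contra hne
  obtain ⟨m, hm, hle⟩ := Ideal.exists_le_maximal _ hne
  obtain ⟨r, hr, hr'⟩ := exists_mem_vanishingIdeal hS (h ⟨m, hm.isPrime⟩)
  exact hr' (hle (Ideal.mem_map_of_mem χ hr))

/-- The product of the ideals of p₀ and of the rest of S lies in the ideal of S, and the second
factor extends to the unit ideal of B. -/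
lemma map_vanishingIdeal_of_isolated {p₀ : PrimeSpectrum A} (hp₀ : p₀ ∈ S)
    (hS : IsClosed (S \ {p₀})) (h : ∀ p : PrimeSpectrum B, PrimeSpectrum.comap χ p ∉ S \ {p₀}) :
    (PrimeSpectrum.vanishingIdeal S).map χ = p₀.asIdeal.map χ := by
  refine le_antisymm (Ideal.map_mono fun r hr => (PrimeSpectrum.mem_vanishingIdeal _ _).mp hr p₀ hp₀) ?_
  have hle : p₀.asIdeal * PrimeSpectrum.vanishingIdeal (S \ {p₀}) ≤
      PrimeSpectrum.vanishingIdeal S := by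
    refine Ideal.mul_le.mpr fun r hr s hs => ?_
    rw [PrimeSpectrum.mem_vanishingIdeal]
    intro p hp
    by_cases e : p = p₀
    · exact e ▸ Ideal.mul_mem_right _ _ hr
    · exact Ideal.mul_mem_left _ _ ((PrimeSpectrum.mem_vanishingIdeal _ _).mp hs p ⟨hp, e⟩)
  have := Ideal.map_mono (f := χ) hle
  rwa [Ideal.map_mul, map_vanishingIdeal_eq_top χ hS h, Ideal.mul_top] at this

/-- A family generating a principal ideal of a local domain contains a generator. -/
lemma exists_dvd_of_span_eq {L : Type} [CommRing L] [IsDomain L] [IsLocalRing L] {ι : Type}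
    {s : ι → L} {p : L} (hp : p ≠ 0) (h : Ideal.span (Set.range s) = Ideal.span {p}) :
    ∃ m, ∀ v, s m ∣ s v := by
  have hd (v : ι) : p ∣ s v := by
    rw [← Ideal.mem_span_singleton, ← h]
    exact Ideal.subset_span ⟨v, rfl⟩
  choose d hd using hd
  by_cases hu : ∃ m, IsUnit (d m)
  · obtain ⟨m, hm⟩ := hu
    refine ⟨m, fun v => ?_⟩
    rw [hd m, hd v]
    exact mul_dvd_mul_left p (hm.dvd)
  -- If no quotient by p were a unit, the ideal (p) would be contained in its product with the
  -- maximal ideal, which is impossible for p ≠ 0.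
  · push Not at hu
    exfalso
    have hle : Ideal.span (Set.range s) ≤ IsLocalRing.maximalIdeal L * Ideal.span {p} := by
      rw [Ideal.span_le]
      rintro _ ⟨v, rfl⟩
      rw [hd v, mul_comm p]
      exact Ideal.mul_mem_mul ((IsLocalRing.mem_maximalIdeal _).mpr (hu v))
        (Ideal.mem_span_singleton_self p)
    have hp' := hle (h ▸ Ideal.mem_span_singleton_self p)
    obtain ⟨z, hz, e⟩ := Ideal.mem_mul_span_singleton.mp hp'
    have : z = 1 := mul_right_cancel₀ hp (by rw [e, one_mul])
    exact (Ideal.ne_top_iff_one _).mp (IsLocalRing.maximalIdeal.isMaximal L).ne_top (this ▸ hz)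

end Ideals

/-! ### The blow-up away from the centre -/

section OffCentre

variable {X Y : Scheme.{0}} {π : X ⟶ Y} {A : CommRingCat.{0}}

lemma isInvertibleIdeal_comap_opens [IsDomain A] {I : Y.IdealSheafData} {F : Spec A ⟶ Y} {U : (Spec A).Opens}
    {f : A} (hf : f ≠ 0) (h : ∀ {B : CommRingCat.{0}} (φ : A ⟶ B), (∀ p, Spec.map φ p ∈ U) →
      (idealOn F I).map φ.hom = Ideal.span {φ f}) : IsInvertibleIdeal (I.comap (U.ι ≫ F)) := by
  refine isInvertibleIdeal_of fun t => ?_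
  obtain ⟨g, k, hk, e, ht, -⟩ := exists_localization_lift (V := ⊤) (t := t) trivial
  have : Nonempty U := ⟨t⟩
  have hdom : IsDomain (Localization.Away g) := by
    obtain ⟨s, -⟩ := ht
    exact isDomain_of_isOpenImmersion k s
  refine ⟨_, k, hk, ht, algebraMap A (Localization.Away g) f, ?_, ?_⟩
  · refine mem_nonZeroDivisors_of_ne_zero ?_
    have hg : g ≠ 0 := by
      have hu := (IsLocalization.Away.algebraMap_isUnit (S := Localization.Away g) g).ne_zero
      exact fun h0 => hu ((congrArg (algebraMap A (Localization.Away g)) h0).trans (map_zero _))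
    exact (map_ne_zero_iff _ (IsLocalization.injective (Localization.Away g)
      (powers_le_nonZeroDivisors_of_noZeroDivisors hg))).mpr hf
  · rw [idealOn_comap, ← Category.assoc, e, idealOn_map]
    refine h _ fun p => ?_
    rw [← e]
    exact (k p).2

variable {Z : Closeds Y}

/-- The complement of the centre, in an affine chart. -/
def offCentre (c : Spec A ⟶ Y) (Z : Closeds Y) : (Spec A).Opens :=
  ⟨(c ⁻¹' (Z : Set Y))ᶜ, (Z.2.preimage c.continuous).isOpen_compl⟩

lemma mem_offCentre {c : Spec A ⟶ Y} {q : Spec A} : q ∈ offCentre c Z ↔ c q ∉ Z := Iff.rfl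

lemma isInvertibleIdeal_offCentre [IsDomain A] (c : Spec A ⟶ Y) [IsOpenImmersion c] : IsInvertibleIdeal
    ((Scheme.IdealSheafData.vanishingIdeal Z).comap ((offCentre c Z).ι ≫ c)) := by
  refine isInvertibleIdeal_comap_opens (f := (1 : A)) one_ne_zero fun φ hφ => ?_
  rw [idealOn_vanishingIdeal, map_one, Ideal.span_singleton_one]
  exact map_vanishingIdeal_eq_top _ (Z.2.preimage c.continuous) hφ

lemma isCompact_range_of_opens [IsNoetherianRing A] {U : (Spec A).Opens} (h : U.toScheme ⟶ X) :
    IsCompact (Set.range h) := by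
  have : NoetherianSpace (Spec A) := inferInstanceAs (NoetherianSpace (PrimeSpectrum A))
  have : CompactSpace U.toScheme := isCompact_iff_compactSpace.mp (NoetherianSpace.isCompact (U : Set (Spec A)))
  exact isCompact_range h.continuous

/-- Off the centre the ideal is the unit ideal, so the chart lifts to X. The compact set is recorded
because compactness of X has to be derived; open subsets of Noetherian spectra are compact. -/
lemma IsBlowup.exists_isCompact_offCentre [IsDomain A] [IsNoetherianRing A]
    (hπ : IsBlowup π (Scheme.IdealSheafData.vanishingIdeal Z)) (c : Spec A ⟶ Y)
    [IsOpenImmersion c] :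
    ∃ K : Set X, IsCompact K ∧ ∀ q : Spec A, c q ∉ Z → ∃ x ∈ K, π x = c q := by
  obtain ⟨h, hh, -⟩ := hπ.existsUnique_lift _ (isInvertibleIdeal_offCentre (Z := Z) c)
  refine ⟨Set.range h, isCompact_range_of_opens h, fun q hq => ⟨_, ⟨⟨q, hq⟩, rfl⟩, ?_⟩⟩
  exact congrArg (fun f => f.base (⟨q, hq⟩ : (offCentre c Z).toScheme)) hh

lemma IsBlowup.exists_isChart_offCentre [IsIntegral X] [IsDomain A] [SeparatesDomains Y]
    (hπ : IsBlowup π (Scheme.IdealSheafData.vanishingIdeal Z)) {c : Spec A ⟶ Y} [IsOpenImmersion c]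
    {a : A ⟶ X.functionField} (ha : IsRat π c a) {x : X} (hx : π x ∈ Set.range c) (hxZ : π x ∉ Z) :
    ∃ U g, x ∈ U ∧ IsChart a.hom g U := by
  obtain ⟨q, hq⟩ := hx
  refine hπ.exists_isChart (q := q) (isGenericallyMono_of_mono c) (isInvertibleIdeal_offCentre c) ha
    (ha.mem ⟨q, hq⟩) ?_ (ha.van hq.symm)
  rw [mem_offCentre, hq]
  exact hxZ

/-- Invertibility of the inverse image ideal, read in the local ring at x. -/
lemma IsBlowup.exists_generator [IsIntegral X] {I : Y.IdealSheafData} (hπ : IsBlowup π I) {x : X}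
    {c : Spec A ⟶ Y} {β : A ⟶ X.presheaf.stalk x} (hβ : Spec.map β ≫ c = X.fromSpecStalk x ≫ π) :
    ∃ p ≠ 0, (idealOn c I).map β.hom = Ideal.span {p} := by
  obtain ⟨R, j, hj, hx, f, hf, e⟩ := hπ.invertible.exists_chart x
  obtain ⟨ρ, hρ⟩ := exists_lift_of_apply_mem j (X.fromSpecStalk x) (by
    rwa [fromSpecStalk_closedPt])
  obtain ⟨p, hp⟩ := hx
  have := isDomain_of_isOpenImmersion j p
  refine ⟨ρ f, ?_, ?_⟩
  · have h1 : IsRat (𝟙 X) j (ρ ≫ stalkToK x) := by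
      rw [IsRat, Spec.map_comp, Category.assoc, hρ, map_stalkToK, Category.comp_id]
    intro h0
    refine nonZeroDivisors.ne_zero hf (h1.injective p ?_)
    rw [CommRingCat.comp_apply, h0, map_zero, map_zero]
  · rw [← idealOn_map, hβ, ← hρ, Category.assoc, idealOn_map, ← idealOn_comap, e, Ideal.map_span,
      Set.image_singleton]

end OffCentre


lemma isUnit_of_eq_mul_mul {L : Type} [CommRing L] [IsDomain L] {x y z : L} (hx : x ≠ 0)
    (h : x = y * x * z) : IsUnit z := by
  refine IsUnit.of_mul_eq_one y (mul_left_cancel₀ hx ?_)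
  rw [mul_one]
  nth_rw 2 [h]
  ring

/-! ### The substitution defining a blow-up chart of affine space -/

section BlowSubst

variable {τ : Type}

open Classical in
/-- The coordinate change of the `k`-th chart of the blow-up at the point `c` of affine space. -/
def blowSubst (c : τ → ℂ) (k : τ) : MvPolynomial τ ℂ →+* MvPolynomial τ ℂ :=
  MvPolynomial.eval₂Hom MvPolynomial.C fun v => MvPolynomial.C (c v) +
    if v = k then MvPolynomial.X k else MvPolynomial.X v * MvPolynomial.X k

variable (c : τ → ℂ) (k : τ)

lemma blowSubst_C (b : ℂ) : blowSubst c k (MvPolynomial.C b) = MvPolynomial.C b :=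
  MvPolynomial.eval₂Hom_C _ _ _

lemma blowSubst_self :
    blowSubst c k (MvPolynomial.X k - MvPolynomial.C (c k)) = MvPolynomial.X k := by
  rw [map_sub, blowSubst_C, blowSubst, MvPolynomial.eval₂Hom_X', if_pos rfl, add_sub_cancel_left]

lemma blowSubst_of_ne {v : τ} (h : v ≠ k) :
    blowSubst c k (MvPolynomial.X v - MvPolynomial.C (c v)) =
      MvPolynomial.X v * MvPolynomial.X k := by
  rw [map_sub, blowSubst_C, blowSubst, MvPolynomial.eval₂Hom_X', if_neg h, add_sub_cancel_left]

/-- All coordinate differences become multiples of the k-th variable, and the k-th one becomes that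
variable itself. -/
lemma map_blowSubst {B : Type} [CommRing B] (φ : MvPolynomial τ ℂ →+* B) :
    (Ideal.span (Set.range fun v => (MvPolynomial.X v - MvPolynomial.C (c v) :
      MvPolynomial τ ℂ))).map (φ.comp (blowSubst c k)) = Ideal.span {φ (MvPolynomial.X k)} := by
  rw [Ideal.map_span]
  refine le_antisymm (Ideal.span_le.mpr ?_) (Ideal.span_le.mpr ?_)
  · rintro _ ⟨_, ⟨v, rfl⟩, rfl⟩
    rw [RingHom.comp_apply, SetLike.mem_coe, Ideal.mem_span_singleton]
    by_cases h : v = k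
    · rw [h, blowSubst_self]
    · rw [blowSubst_of_ne c k h, map_mul]
      exact dvd_mul_left _ _
  · rintro _ rfl
    refine Ideal.subset_span ⟨_, ⟨k, rfl⟩, ?_⟩
    rw [RingHom.comp_apply, blowSubst_self]

/-- Where the k-th variable is invertible, the other variables are recovered by dividing by it. -/
lemma blowSubst_hom_ext {K : Type} [Field K] {f g : MvPolynomial τ ℂ →+* K}
    (hf : f (MvPolynomial.X k) ≠ 0) (h : f.comp (blowSubst c k) = g.comp (blowSubst c k)) :
    f = g := by
  have hk : f (MvPolynomial.X k) = g (MvPolynomial.X k) := by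
    rw [← blowSubst_self c k]
    exact RingHom.congr_fun h _
  refine MvPolynomial.ringHom_ext (fun b => ?_) fun v => ?_
  · rw [← blowSubst_C c k]
    exact RingHom.congr_fun h _
  · by_cases hv : v = k
    · rw [hv, hk]
    · have := RingHom.congr_fun h (MvPolynomial.X v - MvPolynomial.C (c v))
      rw [RingHom.comp_apply, RingHom.comp_apply, blowSubst_of_ne c k hv, map_mul, map_mul,
        ← hk] at this
      exact mul_right_cancel₀ hf this

lemma blowSubst_finiteType [Finite τ] : (blowSubst c k).FiniteType := by
  refine RingHom.FiniteType.of_comp_finiteType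
    (f := (MvPolynomial.C : ℂ →+* MvPolynomial τ ℂ)) ?_
  rw [show (blowSubst c k).comp MvPolynomial.C = MvPolynomial.C from
    RingHom.ext fun b => blowSubst_C c k b]
  have : (algebraMap ℂ (MvPolynomial τ ℂ)).FiniteType :=
    RingHom.finiteType_algebraMap.mpr inferInstance
  exact this

end BlowSubst

/-! ### The blow-up over a centre -/

section BlowChart

variable {X Y : Scheme.{0}} [IsIntegral X] [SeparatesDomains Y] {π : X ⟶ Y} {τ : Type}
  {c₀ : Spec (.of (MvPolynomial τ ℂ)) ⟶ Y} [IsOpenImmersion c₀] {c : τ → ℂ} {k : τ} {Z : Closeds Y}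
  {p₀ : Spec (.of (MvPolynomial τ ℂ))}

variable (c₀ c k) in
/-- The `k`-th chart of a blow-up, as a scheme over the base. -/
def blowChart : Spec (.of (MvPolynomial τ ℂ)) ⟶ Y :=
  Spec.map (CommRingCat.ofHom (blowSubst c k)) ≫ c₀

instance [Finite τ] : LocallyOfFiniteType (blowChart c₀ c k) := by
  have h : LocallyOfFiniteType (Spec.map (CommRingCat.ofHom (blowSubst c k))) :=
    HasRingHomProperty.Spec_iff.mpr (blowSubst_finiteType c k)
  rw [blowChart]
  infer_instance

lemma isDominant_genericMap (W : Scheme.{0}) [IsIntegral W] : IsDominant (genericMap W) := by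
  refine ⟨?_⟩
  rw [DenseRange, dense_iff_closure_eq, Set.eq_univ_iff_forall]
  intro w
  refine closure_mono (s := {genericPoint W}) ?_ ((genericPoint_spec W).symm ▸ trivial)
  rw [Set.singleton_subset_iff]
  exact ⟨closedPt _, genericMap_apply _⟩

-- Two morphisms from an integral scheme may be compared at its generic point, where the k-th
-- variable does not vanish and the substitution can be cancelled.
omit [SeparatesDomains Y] in
lemma isGenericallyMono_blowChart : IsGenericallyMono (blowChart c₀ c k) := by
  intro W _ u v hu h
  rw [blowChart, ← Category.assoc, ← Category.assoc, cancel_mono] at h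
  have := isDominant_genericMap W
  refine ext_of_isDominant (genericMap W) ?_
  obtain ⟨f, hf⟩ := Spec.map_surjective (genericMap W ≫ u)
  obtain ⟨g, hg⟩ := Spec.map_surjective (genericMap W ≫ v)
  rw [← hf, ← hg]
  congr 1
  ext1
  refine blowSubst_hom_ext c k ?_ ?_
  · have h1 : Spec.map f (closedPt _) = botPt _ := by
      rw [hf, Scheme.Hom.comp_apply, genericMap_apply, hu]
    intro h0
    have h2 : (MvPolynomial.X k : MvPolynomial τ ℂ) ∈ (Spec.map f (closedPt _)).asIdeal := by
      rw [closedPoint_mem_iff]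
      refine (congrArg (· ∈ IsLocalRing.maximalIdeal W.functionField) h0).mpr (zero_mem _)
    rw [h1] at h2
    exact MvPolynomial.X_ne_zero k h2
  · have h3 : CommRingCat.ofHom (blowSubst c k) ≫ f = CommRingCat.ofHom (blowSubst c k) ≫ g := by
      refine Spec.map_injective ?_
      rw [Spec.map_comp, Spec.map_comp, hf, hg, Category.assoc, h, Category.assoc]
    exact congrArg CommRingCat.Hom.hom h3

omit [SeparatesDomains Y] [IsOpenImmersion c₀] in
lemma isRat_blowChart {α a : .of (MvPolynomial τ ℂ) ⟶ X.functionField} (hα : IsRat π c₀ α)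
    (h : CommRingCat.ofHom (blowSubst c k) ≫ a = α) : IsRat π (blowChart c₀ c k) a := by
  rw [IsRat, blowChart, ← Category.assoc, ← Spec.map_comp, h]
  exact hα

variable (c k) in
/-- The part of the `k`-th chart of the blow-up at `c₀ p₀` that avoids the other points. -/
def blowOpens (hZ : IsClosed ((Z : Set Y) \ {c₀ p₀})) : (Spec (.of (MvPolynomial τ ℂ))).Opens :=
  offCentre (blowChart c₀ c k) ⟨_, hZ⟩

variable (hZ : IsClosed ((Z : Set Y) \ {c₀ p₀})) (hp₀Z : c₀ p₀ ∈ Z)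
  (hp₀ : p₀.asIdeal = Ideal.span (Set.range fun v => MvPolynomial.X v - MvPolynomial.C (c v)))

omit [SeparatesDomains Y] in
lemma preimage_diff : c₀ ⁻¹' (Z : Set Y) \ {p₀} = c₀ ⁻¹' ((Z : Set Y) \ {c₀ p₀}) := by
  ext p
  simp only [Set.mem_sdiff, Set.mem_preimage, Set.mem_singleton_iff,
    c₀.isOpenEmbedding.injective.eq_iff]

include hZ hp₀Z in
omit [SeparatesDomains Y] in
lemma map_idealOn_centre {B : Type} [CommRing B] (χ : MvPolynomial τ ℂ →+* B)
    (h : ∀ p : PrimeSpectrum B, c₀ (PrimeSpectrum.comap χ p) ∉ (Z : Set Y) \ {c₀ p₀}) :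
    (idealOn c₀ (Scheme.IdealSheafData.vanishingIdeal Z)).map χ = p₀.asIdeal.map χ := by
  rw [idealOn_vanishingIdeal]
  refine map_vanishingIdeal_of_isolated χ hp₀Z ?_ fun p => ?_
  · exact (congrArg IsClosed preimage_diff).mpr (hZ.preimage c₀.continuous)
  · exact fun hp => h p ((congrArg (_ ∈ ·) preimage_diff).mp hp)

include hZ hp₀Z hp₀ in
omit [SeparatesDomains Y] in
lemma isInvertibleIdeal_blowOpens : IsInvertibleIdeal
    ((Scheme.IdealSheafData.vanishingIdeal Z).comap ((blowOpens c k hZ).ι ≫ blowChart c₀ c k)) := by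
  refine isInvertibleIdeal_comap_opens (f := (MvPolynomial.X k : MvPolynomial τ ℂ))
    (MvPolynomial.X_ne_zero k) fun {B} φ hφ => ?_
  rw [blowChart, idealOn_map, Ideal.map_map]
  have h1 := map_idealOn_centre hZ hp₀Z (φ.hom.comp (blowSubst c k)) fun p => hφ p
  rw [hp₀, map_blowSubst] at h1
  exact h1

include hZ hp₀Z hp₀ in
lemma IsBlowup.exists_isChart_blow [Finite τ]
    (hπ : IsBlowup π (Scheme.IdealSheafData.vanishingIdeal Z))
    {a : .of (MvPolynomial τ ℂ) ⟶ X.functionField} (ha : IsRat π (blowChart c₀ c k) a)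
    {x : X} (hx : ∀ r, a r ∈ ringAt x) (hxp : π x = c₀ p₀) :
    ∃ U g, x ∈ U ∧ IsChart a.hom g U := by
  obtain ⟨β, hβ⟩ := exists_stalk_of_mem hx
  refine hπ.exists_isChart (q := Spec.map β (closedPt _)) isGenericallyMono_blowChart
    (isInvertibleIdeal_blowOpens hZ hp₀Z hp₀) ha hx ?_ fun r => ?_
  · change blowChart c₀ c k (Spec.map β (closedPt _)) ∉ (Z : Set Y) \ {c₀ p₀}
    rw [← Scheme.Hom.comp_apply, ha.stalk_eq hβ, Scheme.Hom.comp_apply, fromSpecStalk_closedPt, hxp]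
    exact fun h => h.2 rfl
  · rw [closedPoint_mem_iff, ← hβ]
    exact algebraMap_mem_idealAt

-- At a point over p₀ the ideal of p₀ becomes principal and is generated by the coordinate
-- differences, so one of these already generates it. Its index names the blow-up chart containing
-- x.
include hZ hp₀Z hp₀ in
omit [SeparatesDomains Y] in
lemma IsBlowup.exists_dvd (hπ : IsBlowup π (Scheme.IdealSheafData.vanishingIdeal Z))
    {x : X} (hxp : π x = c₀ p₀) {β : .of (MvPolynomial τ ℂ) ⟶ X.presheaf.stalk x}
    (hβ : Spec.map β ≫ c₀ = X.fromSpecStalk x ≫ π) :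
    ∃ m : τ, ∀ v : τ, β (MvPolynomial.X m - MvPolynomial.C (c m)) ∣
      β (MvPolynomial.X v - MvPolynomial.C (c v)) := by
  obtain ⟨p, hp, e⟩ := hπ.exists_generator hβ
  have h1 := map_idealOn_centre hZ hp₀Z β.hom fun p hp => by
    have h2 : c₀ (Spec.map β (closedPt _)) = c₀ p₀ := by
      rw [← Scheme.Hom.comp_apply, hβ, Scheme.Hom.comp_apply, fromSpecStalk_closedPt, hxp]
    have h3 := ((IsLocalRing.specializes_closedPoint (R := X.presheaf.stalk x) p).map
      (Spec.map β ≫ c₀).continuous).mem_closed hZ hp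
    exact h3.2 h2
  rw [h1, hp₀, Ideal.map_span, ← Set.range_comp] at e
  exact exists_dvd_of_span_eq hp e

-- The universal property lifts the chart to X. It remains to see that the chart's functions are
-- regular at the image, that is, that the k-th difference divides all others there and not only on
-- the chart.
include hZ hp₀Z hp₀ in
lemma IsBlowup.exists_isCompact_blow [Finite τ]
    (hπ : IsBlowup π (Scheme.IdealSheafData.vanishingIdeal Z))
    (hmax : p₀.asIdeal.IsMaximal) {α a : .of (MvPolynomial τ ℂ) ⟶ X.functionField}
    (hα : IsRat π c₀ α) (hinj : Function.Injective α)
    (hαa : CommRingCat.ofHom (blowSubst c k) ≫ a = α) :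
    ∃ K : Set X, IsCompact K ∧ ∀ q : Spec (.of (MvPolynomial τ ℂ)),
      (MvPolynomial.X k : MvPolynomial τ ℂ) ∈ q.asIdeal → ∃ x ∈ K, π x = c₀ p₀ ∧
        (∀ r, a r ∈ ringAt x) ∧ ∀ r, a r ∈ idealAt x ↔ r ∈ q.asIdeal := by
  obtain ⟨h, hh, -⟩ := hπ.existsUnique_lift _ (isInvertibleIdeal_blowOpens (k := k) hZ hp₀Z hp₀)
  replace hh : h ≫ π = (blowOpens c k hZ).ι ≫ blowChart c₀ c k := hh
  have : IsNoetherianRing (CommRingCat.of (MvPolynomial τ ℂ)) :=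
    inferInstanceAs (IsNoetherianRing (MvPolynomial τ ℂ))
  refine ⟨Set.range h, isCompact_range_of_opens h, fun q hq => ?_⟩
  have hqp : blowChart c₀ c k q = c₀ p₀ := by
    rw [blowChart, Scheme.Hom.comp_apply]
    congr 1
    refine (PrimeSpectrum.ext (hmax.eq_of_le (PrimeSpectrum.isPrime _).ne_top ?_)).symm
    rw [hp₀, Ideal.span_le]
    rintro _ ⟨v, rfl⟩
    change blowSubst c k (MvPolynomial.X v - MvPolynomial.C (c v)) ∈ q.asIdeal
    by_cases hv : v = k
    · rw [hv, blowSubst_self]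
      exact hq
    · rw [blowSubst_of_ne c k hv]
      exact Ideal.mul_mem_left _ _ hq
  obtain ⟨t, ht⟩ : ∃ t : (blowOpens c k hZ).toScheme, (blowOpens c k hZ).ι t = q := by
    refine ⟨⟨q, ?_⟩, rfl⟩
    change blowChart c₀ c k q ∉ (Z : Set Y) \ {c₀ p₀}
    rw [hqp]
    exact fun h => h.2 rfl
  have ha := isRat_blowChart hα hαa
  have hx : π (h t) = c₀ p₀ := by
    rw [← Scheme.Hom.comp_apply, hh, Scheme.Hom.comp_apply, ht, hqp]
  suffices hmem : ∀ r, a r ∈ ringAt (h t) by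
    refine ⟨h t, ⟨t, rfl⟩, hx, hmem, fun r => ?_⟩
    rw [← ht]
    exact ha.van_of_lift isGenericallyMono_blowChart hh t hmem r
  obtain ⟨β, hβ, hβ'⟩ := hα.exists_stalk ⟨p₀, hx.symm⟩
  have : Nonempty (blowOpens c k hZ) := ⟨t⟩
  obtain ⟨γ, hγ⟩ := Spec.map_surjective ((blowOpens c k hZ).toScheme.fromSpecStalk t ≫
    (blowOpens c k hZ).ι)
  have e : β ≫ h.stalkMap t = CommRingCat.ofHom (blowSubst c k) ≫ γ := by
    refine Spec.map_injective ?_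
    rw [← cancel_mono c₀, Spec.map_comp, Category.assoc, hβ', ← Category.assoc,
      Scheme.SpecMap_stalkMap_fromSpecStalk, Category.assoc, hh, Spec.map_comp, hγ]
    simp only [Category.assoc, blowChart]
  have hγ0 : γ (MvPolynomial.X k : MvPolynomial τ ℂ) ≠ 0 := by
    intro h0
    have h1 : Spec.map γ (botPt _) = botPt _ := by
      rw [hγ, Scheme.Hom.comp_apply, ← genericPoint_Spec, fromSpecStalk_genericPoint,
        genericPoint_eq_of_isOpenImmersion, genericPoint_Spec]
    have h2 : (MvPolynomial.X k : MvPolynomial τ ℂ) ∈ (Spec.map γ (botPt _)).asIdeal := h0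
    rw [h1] at h2
    exact MvPolynomial.X_ne_zero k h2
  have e' (r : MvPolynomial τ ℂ) : h.stalkMap t (β r) = γ (blowSubst c k r) :=
    congrArg (fun f => f.hom r) e
  obtain ⟨m, hm⟩ := hπ.exists_dvd hZ hp₀Z hp₀ hx hβ'
  -- Some difference m divides all others in the local ring of X. Pulled back to the chart it is a
  -- multiple of the k-th variable, so the quotient u of the k-th difference by it becomes a unit;
  -- by locality u is already a unit on X.
  have hk : β (MvPolynomial.X k - MvPolynomial.C (c k)) ∣
      β (MvPolynomial.X m - MvPolynomial.C (c m)) := by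
    by_cases hmk : m = k
    · rw [hmk]
    · obtain ⟨u, hu⟩ := hm k
      have h1 := congrArg (h.stalkMap t) hu
      rw [map_mul, e', e', blowSubst_self, blowSubst_of_ne c k hmk] at h1
      rw [map_mul] at h1
      have h3 : IsUnit u :=
        (isUnit_map_iff (h.stalkMap t).hom u).mp (isUnit_of_eq_mul_mul hγ0 h1)
      obtain ⟨u, rfl⟩ := h3
      exact ⟨(u⁻¹ : _ˣ), by rw [hu, mul_assoc, Units.mul_inv, mul_one]⟩
  have hα' (r : MvPolynomial τ ℂ) : α r = a (blowSubst c k r) := by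
    rw [← hαa]
    rfl
  have haC (b : ℂ) : a (MvPolynomial.C b : MvPolynomial τ ℂ) ∈ ringAt (h t) := by
    rw [← blowSubst_C c k, ← hα', ← hβ]
    exact algebraMap_mem_ringAt _
  have haX (v : τ) : a (MvPolynomial.X v : MvPolynomial τ ℂ) ∈ ringAt (h t) := by
    by_cases hv : v = k
    · rw [hv, ← blowSubst_self c k, ← hα', ← hβ]
      exact algebraMap_mem_ringAt _
    · obtain ⟨w, hw⟩ := hk.trans (hm v)
      have h1 := congrArg (stalkToK (h t)) hw
      rw [map_mul, ← CommRingCat.comp_apply, ← CommRingCat.comp_apply, hβ, hα', hα', blowSubst_self,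
        blowSubst_of_ne c k hv, map_mul, mul_comm] at h1
      have h2 : a (MvPolynomial.X k : MvPolynomial τ ℂ) ≠ 0 := by
        rw [← blowSubst_self c k, ← hα', map_ne_zero_iff _ hinj]
        intro h0
        have := congrArg (MvPolynomial.eval fun _ => c k + 1) h0
        simp at this
      rw [mul_left_cancel₀ h2 h1]
      exact algebraMap_mem_ringAt _
  intro r
  change r ∈ (ringAt (h t)).comap a.hom
  induction r using MvPolynomial.induction_on with
  | C b => exact haC b
  | add p q hp hq => exact add_mem hp hq
  | mul_X p v hp => exact mul_mem hp (haX v)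

end BlowChart


/-! ### Rational coordinates on the blow-up -/

section ProductCharts

variable {J σ : Type}

/-- The affine space with coordinate ring the polynomials in the coordinates of a chart. -/
abbrev ChartSpec (pr : σ → J) (κ : J → σ) : Scheme.{0} :=
  Spec (.of (MvPolynomial (ChartVar pr κ) ℂ))

/-- The sections of `pr`: a choice of one homogeneous coordinate in each factor. -/
abbrev Choice (pr : σ → J) : Type := {κ : J → σ // ∀ j, pr (κ j) = j}

/-- `Y` is covered by affine spaces `c κ`, glued like the standard charts of a product of projective
spaces. -/
structure IsProductCharts {Y : Scheme.{0}} (pr : σ → J) (s : Y ⟶ Spec (.of ℂ))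
    (c : ∀ κ : Choice pr, ChartSpec pr κ.1 ⟶ Y) : Prop where
  isOpenImmersion : ∀ κ, IsOpenImmersion (c κ)
  cover : ∀ y, ∃ κ, y ∈ Set.range (c κ)
  const : ∀ κ, c κ ≫ s = Spec.map (CommRingCat.ofHom MvPolynomial.C)
  ratio : ∀ (κ κ' : Choice pr) {K : CommRingCat.{0}} (_ : IsField K)
    (f : .of (MvPolynomial (ChartVar pr κ.1) ℂ) ⟶ K)
    (f' : .of (MvPolynomial (ChartVar pr κ'.1) ℂ) ⟶ K), Spec.map f ≫ c κ = Spec.map f' ≫ c κ' →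
    ∀ v, f (coord pr κ.1 v) * f' (coord pr κ'.1 (κ.1 (pr v))) = f' (coord pr κ'.1 v)
  mem_range : ∀ (κ κ' : Choice pr) (q : ChartSpec pr κ'.1),
    (∀ j, coord pr κ'.1 (κ.1 j) ∉ q.asIdeal) → c κ' q ∈ Set.range (c κ)

variable {X Y : Scheme.{0}} [IsIntegral X] [SeparatesDomains Y] {π : X ⟶ Y} {pr : σ → J}
  {s : Y ⟶ Spec (.of ℂ)} {c : ∀ κ : Choice pr, ChartSpec pr κ.1 ⟶ Y}

/-- The homogeneous coordinates of `Y`, as rational functions on `X`. -/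
structure IsRatCoord (π : X ⟶ Y) (c : ∀ κ : Choice pr, ChartSpec pr κ.1 ⟶ Y)
    (ι : ℂ →+* X.functionField) (T : σ → X.functionField) : Prop where
  ne_zero : ∀ v, T v ≠ 0
  isRat : ∀ κ, IsRat π (c κ) (CommRingCat.ofHom (chartMap pr κ.1 ι T))

variable {o : Choice pr} {Z : Closeds Y}

lemma coord_ne_zero (κ : J → σ) (v : σ) : coord pr κ v ≠ 0 := by
  by_cases h : v = κ (pr v)
  · rw [coord_of_eq h]
    exact one_ne_zero
  · rw [coord_of_ne h]
    exact MvPolynomial.X_ne_zero _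

/-- The generic point of the chart o is not in the centre, so it is the image of a point of X, near
which X looks like the chart. The coordinates of o thus embed in the function field, and `ratio`
expresses those of all other charts through them. -/
lemma IsProductCharts.exists_isRatCoord (C : IsProductCharts pr s c) [Finite σ]
    (hπ : IsBlowup π (Scheme.IdealSheafData.vanishingIdeal Z)) (o : Choice pr)
    (hbot : c o (botPt _) ∉ Z) :
    ∃ ι T, IsRatCoord π c ι T ∧ (∀ j, T (o.1 j) = 1) ∧
      Function.Injective (chartMap pr o.1 ι T) := by
  have hop := C.isOpenImmersion
  have hnoeth : IsNoetherianRing (CommRingCat.of (MvPolynomial (ChartVar pr o.1) ℂ)) :=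
    inferInstanceAs (IsNoetherianRing (MvPolynomial (ChartVar pr o.1) ℂ))
  obtain ⟨K, -, hK⟩ := hπ.exists_isCompact_offCentre (c o)
  obtain ⟨x, -, hx⟩ := hK _ hbot
  have hgo : π (genericPoint X) ∈ Set.range (c o) :=
    (((genericPoint_spec X).specializes (Set.mem_univ x)).map π.continuous).mem_open
      (c o).isOpenEmbedding.isOpen_range ⟨_, hx.symm⟩
  obtain ⟨a, ha⟩ := exists_isRat π (c o) hgo
  obtain ⟨U, g, -, hU⟩ := hπ.exists_isChart_offCentre ha ⟨_, hx.symm⟩ (hx ▸ hbot)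
  have hinj : Function.Injective a := hU.injective
  have hgen : π (genericPoint X) = c o (botPt _) := by
    rw [← map_botPt hinj, ← Scheme.Hom.comp_apply, ha, Scheme.Hom.comp_apply, genericMap_apply]
  let ι : ℂ →+* X.functionField := a.hom.comp MvPolynomial.C
  let T (v : σ) : X.functionField := a (coord pr o.1 v)
  have hT (v : σ) : T v ≠ 0 := (map_ne_zero_iff _ hinj).mpr (coord_ne_zero _ v)
  have hrat (κ : Choice pr) : IsRat π (c κ) (CommRingCat.ofHom (chartMap pr κ.1 ι T)) := by
    obtain ⟨b, hb⟩ := exists_isRat π (c κ) (by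
      rw [hgen]
      exact C.mem_range κ o _ fun j => coord_ne_zero _ _)
    have e : b = CommRingCat.ofHom (chartMap pr κ.1 ι T) := by
      ext1
      refine MvPolynomial.ringHom_ext (fun z => ?_) fun v => ?_
      · have h1 : CommRingCat.ofHom MvPolynomial.C ≫ b = CommRingCat.ofHom MvPolynomial.C ≫ a := by
          refine Spec.map_injective ?_
          rw [Spec.map_comp, Spec.map_comp, ← C.const κ, ← C.const o, ← Category.assoc,
            ← Category.assoc, ha, hb]
        refine Eq.trans ?_ (chartMap_C z).symm
        exact congrArg (fun f => f.hom z) h1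
      · have h1 := C.ratio κ o (Field.toIsField X.functionField) b a (hb.trans ha.symm) v
        rw [coord_of_ne v.2] at h1
        refine Eq.trans ?_ (chartMap_X v).symm
        exact eq_div_of_mul_eq (hT _) h1
    exact (congrArg (IsRat π (c κ)) e).mp hb
  refine ⟨ι, T, ⟨hT, hrat⟩, fun j => ?_, ?_⟩
  · change a (coord pr o.1 (o.1 j)) = 1
    rw [coord_of_eq (by rw [o.2]), map_one]
  · have e : CommRingCat.ofHom (chartMap pr o.1 ι T) = a := by
      refine Spec.map_injective ?_
      rw [← cancel_mono (c o)]
      exact (hrat o).trans ha.symm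
    exact (congrArg (fun f => Function.Injective f.hom) e).mpr hinj

namespace IsRatCoord

variable {ι : ℂ →+* X.functionField} {T : σ → X.functionField} (H : IsRatCoord π c ι T)
  (C : IsProductCharts pr s c)
include H C

omit [SeparatesDomains Y] in
lemma const_mem (b : ℂ) (x : X) : ι b ∈ ringAt x := by
  obtain ⟨κ, hκ⟩ := C.cover (π x)
  have := C.isOpenImmersion κ
  have h1 := (H.isRat κ).mem hκ (MvPolynomial.C b)
  rwa [← chartMap_C (pr := pr) (κ := κ.1) (ι := ι) (T := T)]

omit [SeparatesDomains Y] in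
lemma chartMap_mem {κ : J → σ} {x : X} (h : IsFin pr T κ x)
    (r : MvPolynomial (ChartVar pr κ) ℂ) : chartMap pr κ ι T r ∈ ringAt x := by
  change r ∈ (ringAt x).comap (chartMap pr κ ι T)
  induction r using MvPolynomial.induction_on with
  | C b =>
    rw [Subring.mem_comap, chartMap_C]
    exact H.const_mem C b x
  | add p q hp hq => exact add_mem hp hq
  | mul_X p v hp =>
    refine mul_mem hp ?_
    rw [Subring.mem_comap, chartMap_X]
    exact h v

lemma isFin_iff (κ : Choice pr) (x : X) : IsFin pr T κ.1 x ↔ π x ∈ Set.range (c κ) := by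
  have := C.isOpenImmersion κ
  constructor
  · exact fun h => (H.isRat κ).mem_range (H.chartMap_mem C h)
  · intro h v
    rw [← chartMap_coord (ι := ι) H.ne_zero]
    exact (H.isRat κ).mem h _

variable (hTo : ∀ j, T (o.1 j) = 1) {p : ChartSpec pr o.1} {pt : σ → ℂ}
  (hp : p.asIdeal = Ideal.span (Set.range fun v : ChartVar pr o.1 =>
    MvPolynomial.X v - MvPolynomial.C (pt v))) (hmax : p.asIdeal.IsMaximal)
  (hpt : ∀ j, pt (o.1 j) = 1)

include hTo hp hmax hpt in
lemma isAt_iff (x : X) : IsAt ι T pt x ↔ π x = c o p := by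
  have := C.isOpenImmersion o
  have hX (v : ChartVar pr o.1) : chartMap pr o.1 ι T (MvPolynomial.X v - MvPolynomial.C (pt v)) =
      T v - ι (pt v) := by
    rw [map_sub, chartMap_X, chartMap_C, hTo, div_one]
  constructor
  · intro h
    have hfin : IsFin pr T o.1 x := fun v => by
      rw [hTo, div_one]
      have := add_mem (idealAt_subset (h v)) (H.const_mem C (pt v) x)
      rwa [sub_add_cancel] at this
    obtain ⟨q, hq⟩ := (H.isFin_iff C o x).mp hfin
    rw [← hq]
    congr 1
    refine (PrimeSpectrum.ext (hmax.eq_of_le q.isPrime.ne_top ?_)).symm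
    rw [hp, Ideal.span_le]
    rintro _ ⟨v, rfl⟩
    refine ((H.isRat o).van hq.symm _).mp ?_
    change chartMap pr o.1 ι T _ ∈ _
    rw [hX]
    exact h v
  · intro h v
    by_cases hv : v = o.1 (pr v)
    · rw [hv, hTo, hpt, map_one, sub_self]
      exact zero_mem_idealAt x
    · rw [← hX ⟨v, hv⟩]
      refine ((H.isRat o).van h _).mpr ?_
      rw [hp]
      exact Ideal.subset_span ⟨_, rfl⟩

end IsRatCoord

end ProductCharts


/-! ### The blow-up has an atlas and is compact -/

section ProductAtlas

variable {J σ Λ : Type} {X Y : Scheme.{0}} [IsIntegral X] [SeparatesDomains Y] {π : X ⟶ Y} {pr : σ → J}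
  {s : Y ⟶ Spec (.of ℂ)} {c : ∀ κ : Choice pr, ChartSpec pr κ.1 ⟶ Y} {o : Choice pr}
  {Z : Closeds Y} {P : Λ → ChartSpec pr o.1} {pt : Λ → σ → ℂ} {ι : ℂ →+* X.functionField}
  {T : σ → X.functionField}

/-- `Z` consists of the closed points in the chart `o` with coordinates `pt l`. -/
structure IsCentre (c : ∀ κ : Choice pr, ChartSpec pr κ.1 ⟶ Y) (o : Choice pr) (Z : Closeds Y)
    (P : Λ → ChartSpec pr o.1) (pt : Λ → σ → ℂ) : Prop where
  mem_iff : ∀ y, y ∈ Z ↔ ∃ l, y = c o (P l)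
  closed : ∀ l, IsClosed {c o (P l)}
  ideal : ∀ l, (P l).asIdeal = Ideal.span (Set.range fun v : ChartVar pr o.1 =>
    MvPolynomial.X v - MvPolynomial.C (pt l v))
  one : ∀ l j, pt l (o.1 j) = 1
  inj : Function.Injective pt
  two : ∀ _ : Λ, ∃ v w, v ≠ w ∧ v ≠ o.1 (pr v) ∧ w ≠ o.1 (pr w)

lemma X_sub_C_ne_zero {τ : Type} (v : τ) (b : ℂ) :
    (MvPolynomial.X v - MvPolynomial.C b : MvPolynomial τ ℂ) ≠ 0 := fun h0 => by
  have := congrArg (MvPolynomial.eval fun _ => b + 1) h0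
  simp at this

namespace IsCentre

variable (E : IsCentre c o Z P pt)
include E

omit [SeparatesDomains Y] in
lemma isMaximal [IsOpenImmersion (c o)] (l : Λ) : (P l).asIdeal.IsMaximal := by
  refine (PrimeSpectrum.isClosed_singleton_iff_isMaximal (P l)).mp ?_
  have h := (E.closed l).preimage (c o).continuous
  rwa [← Set.image_singleton, Set.preimage_image_eq _ (c o).isOpenEmbedding.injective] at h

omit [SeparatesDomains Y] in
lemma isClosed_diff [Finite Λ] (y : Y) : IsClosed ((Z : Set Y) \ {y}) := by
  have e : (Z : Set Y) \ {y} = ⋃ l : {l // c o (P l) ≠ y}, {c o (P l)} := by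
    ext z
    simp only [Set.mem_sdiff, SetLike.mem_coe, E.mem_iff, Set.mem_singleton_iff, Set.mem_iUnion,
      Subtype.exists, exists_prop]
    constructor
    · rintro ⟨⟨l, rfl⟩, h⟩
      exact ⟨l, h, rfl⟩
    · rintro ⟨l, h, rfl⟩
      exact ⟨⟨l, rfl⟩, h⟩
  rw [e]
  exact isClosed_iUnion_of_finite fun l => E.closed l

omit [SeparatesDomains Y] in
lemma bot_notMem [IsOpenImmersion (c o)] : c o (botPt _) ∉ Z := by
  rw [E.mem_iff]
  rintro ⟨l, hl⟩
  have h := congrArg PrimeSpectrum.asIdeal ((c o).isOpenEmbedding.injective hl)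
  obtain ⟨v, -, -, hv, -⟩ := E.two l
  have h1 : (MvPolynomial.X ⟨v, hv⟩ - MvPolynomial.C (pt l v) :
      MvPolynomial (ChartVar pr o.1) ℂ) ∈ (P l).asIdeal := by
    rw [E.ideal]
    exact Ideal.subset_span ⟨⟨v, hv⟩, rfl⟩
  rw [← h] at h1
  exact X_sub_C_ne_zero _ _ h1

variable (C : IsProductCharts pr s c) (H : IsRatCoord π c ι T) (hTo : ∀ j, T (o.1 j) = 1)
  (hπ : IsBlowup π (Scheme.IdealSheafData.vanishingIdeal Z))

-- If the point were a centre, the ratio relations over its residue field would express each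
-- coordinate of κ as its value at the centre times the coordinate of o in the same factor.
include C in
omit [SeparatesDomains Y] in
lemma notMem_of_coord {κ : Choice pr} {q : ChartSpec pr κ.1} (h : ∀ l, ∃ v, coord pr κ.1 v -
    MvPolynomial.C (pt l v) * coord pr κ.1 (o.1 (pr v)) ∉ q.asIdeal) : c κ q ∉ Z := by
  have := C.isOpenImmersion o
  rw [E.mem_iff]
  rintro ⟨l, hl⟩
  obtain ⟨v, hv⟩ := h l
  have hprime : q.asIdeal.IsPrime := PrimeSpectrum.isPrime q
  let f : CommRingCat.of (MvPolynomial (ChartVar pr κ.1) ℂ) ⟶ .of q.asIdeal.ResidueField :=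
    CommRingCat.ofHom (algebraMap _ _)
  have hfq (r) : f r = 0 ↔ r ∈ q.asIdeal := by
    exact SetLike.ext_iff.mp q.asIdeal.ker_algebraMap_residueField r
  have hf : Spec.map f (closedPt _) = q := by
    refine PrimeSpectrum.ext (SetLike.ext fun r => ?_)
    rw [closedPoint_mem_iff, ← hfq]
    refine (IsLocalRing.mem_maximalIdeal (R := q.asIdeal.ResidueField) _).trans ?_
    rw [mem_nonunits_iff, isUnit_iff_ne_zero, not_not]
  obtain ⟨f', hf'⟩ := exists_lift_of_apply_mem (c o) (Spec.map f ≫ c κ) (by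
    rw [Scheme.Hom.comp_apply, hf, hl]
    exact ⟨_, rfl⟩)
  have hf'P : Spec.map f' (closedPt _) = P l := by
    apply (c o).isOpenEmbedding.injective
    rw [← Scheme.Hom.comp_apply, hf', Scheme.Hom.comp_apply, hf, hl]
  have hC (b : ℂ) : f (MvPolynomial.C b : MvPolynomial _ ℂ) =
      f' (MvPolynomial.C b : MvPolynomial _ ℂ) := by
    have h1 : CommRingCat.ofHom MvPolynomial.C ≫ f = CommRingCat.ofHom MvPolynomial.C ≫ f' := by
      refine Spec.map_injective ?_
      rw [Spec.map_comp, Spec.map_comp, ← C.const κ, ← C.const o, ← Category.assoc,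
        ← Category.assoc, hf']
    exact congrArg (fun f => f.hom b) h1
  have hv' : f' (coord pr o.1 v - MvPolynomial.C (pt l v)) = 0 := by
    have hmem : coord pr o.1 v - MvPolynomial.C (pt l v) ∈ (P l).asIdeal := by
      by_cases hvo : v = o.1 (pr v)
      · rw [coord_of_eq hvo, hvo, E.one, map_one, sub_self]
        exact zero_mem _
      · rw [coord_of_ne hvo, E.ideal]
        exact Ideal.subset_span ⟨⟨v, hvo⟩, rfl⟩
    rw [← hf'P, closedPoint_mem_iff] at hmem
    by_contra h0
    exact (IsLocalRing.mem_maximalIdeal _).mp hmem (isUnit_iff_ne_zero.mpr h0)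
  refine hv ((hfq _).mp ?_)
  rw [map_sub, sub_eq_zero] at hv'
  rw [map_sub, map_mul, hC, ← hv', sub_eq_zero]
  exact (C.ratio o κ (Field.toIsField q.asIdeal.ResidueField) f' f hf' v).symm

include C H hTo in
lemma isAt_iff (l : Λ) (x : X) : IsAt ι T (pt l) x ↔ π x = c o (P l) :=
  have := C.isOpenImmersion o
  H.isAt_iff C hTo (E.ideal l) (E.isMaximal l) (E.one l) x

omit E in
include C H hπ in
lemma centered_chartMap {κ : Choice pr} {x : X} {q : ChartSpec pr κ.1} (hx : π x = c κ q)
    (hq : c κ q ∉ Z) : Centered (chartMap pr κ.1 ι T) x q.asIdeal := by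
  have := C.isOpenImmersion κ
  obtain ⟨U, g, hxU, hU⟩ := hπ.exists_isChart_offCentre (H.isRat κ) ⟨q, hx.symm⟩ (hx ▸ hq)
  obtain ⟨𝔭, -, h𝔭⟩ := IsChart.exists_centered (a := chartMap pr κ.1 ι T) hU hxU
  have e : 𝔭 = q.asIdeal := by
    ext r
    rw [← h𝔭.van]
    exact (H.isRat κ).van hx r
  rwa [e] at h𝔭

variable (hinj : Function.Injective (chartMap pr o.1 ι T))

omit [SeparatesDomains Y] E in
include hTo in
lemma chartMap_sub (v : ChartVar pr o.1) (b : ℂ) :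
    chartMap pr o.1 ι T (MvPolynomial.X v - MvPolynomial.C b) = T v - ι b := by
  rw [map_sub, chartMap_X, chartMap_C, hTo, div_one]

omit [SeparatesDomains Y] E in
include hTo hinj in
lemma sub_ne_zero' (v : ChartVar pr o.1) (b : ℂ) : T v - ι b ≠ 0 := by
  rw [← chartMap_sub hTo]
  exact (map_ne_zero_iff _ hinj).mpr (X_sub_C_ne_zero v b)

omit [SeparatesDomains Y] E in
include hTo hinj in
lemma blowMap_comp_blowSubst (d : σ → ℂ) (k : ChartVar pr o.1) :
    (blowMap pr o.1 ι T d k).comp (blowSubst (fun v => d v) k) = chartMap pr o.1 ι T := by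
  have hk := sub_ne_zero' hTo hinj k (d k)
  refine MvPolynomial.ringHom_ext (fun b => ?_) fun v => ?_
  · rw [RingHom.comp_apply, blowSubst_C, blowMap_C, chartMap_C]
  · rw [← sub_left_inj (a := ι (d v))]
    trans (blowMap pr o.1 ι T d k).comp (blowSubst (fun v => d v) k)
      (MvPolynomial.X v - MvPolynomial.C (d v))
    · rw [map_sub, RingHom.comp_apply _ _ (MvPolynomial.C _), blowSubst_C, blowMap_C]
    · rw [chartMap_X, hTo, div_one, RingHom.comp_apply]
      by_cases h : v = k
      · rw [h, blowSubst_self (fun v : ChartVar pr o.1 => d v), blowMap_X_self]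
      · rw [blowSubst_of_ne (fun v : ChartVar pr o.1 => d v) k h, map_mul, blowMap_X_self,
          blowMap_X_of_ne _ _ fun e => h (Subtype.ext e), div_mul_cancel₀ _ hk]

include C H hTo hπ hinj in
lemma exists_isChart_blow [Finite σ] [Finite Λ] (l : Λ) (k : ChartVar pr o.1) {x : X}
    (hx : ∀ r, blowMap pr o.1 ι T (pt l) k r ∈ ringAt x) (hxp : π x = c o (P l)) :
    ∃ U g, x ∈ U ∧ IsChart (blowMap pr o.1 ι T (pt l) k) g U := by
  have := C.isOpenImmersion o
  have ha : IsRat π (blowChart (c o) (fun v : ChartVar pr o.1 => pt l v) k)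
      (CommRingCat.ofHom (blowMap pr o.1 ι T (pt l) k)) := by
    refine isRat_blowChart (H.isRat o) ?_
    exact congrArg CommRingCat.ofHom (blowMap_comp_blowSubst hTo hinj (pt l) k)
  exact hπ.exists_isChart_blow (E.isClosed_diff _) ((E.mem_iff _).mpr ⟨l, rfl⟩) (E.ideal l) ha hx hxp

include C H hTo hπ hinj in
lemma exists_compact_blow [Finite σ] [Finite Λ] (l : Λ) (k : ChartVar pr o.1) :
    ∃ K : Set X, IsCompact K ∧ ∀ 𝔭 : Ideal (MvPolynomial (ChartVar pr o.1) ℂ), 𝔭.IsPrime →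
      MvPolynomial.X k ∈ 𝔭 → ∃ x ∈ K, Centered (blowMap pr o.1 ι T (pt l) k) x 𝔭 := by
  have := C.isOpenImmersion o
  obtain ⟨K, hK, h⟩ := hπ.exists_isCompact_blow (c := fun v : ChartVar pr o.1 => pt l v) (k := k)
    (a := CommRingCat.ofHom (blowMap pr o.1 ι T (pt l) k))
    (E.isClosed_diff _) ((E.mem_iff _).mpr ⟨l, rfl⟩) (E.ideal l) (E.isMaximal l) (H.isRat o) hinj
    (congrArg CommRingCat.ofHom (blowMap_comp_blowSubst hTo hinj (pt l) k))
  refine ⟨K, hK, fun 𝔭 h𝔭 hk => ?_⟩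
  obtain ⟨x, hxK, hx, hmem, hvan⟩ := h ⟨𝔭, h𝔭⟩ hk
  obtain ⟨U, g, hxU, hU⟩ := E.exists_isChart_blow C H hTo hπ hinj l k hmem hx
  obtain ⟨𝔮, -, h𝔮⟩ := hU.exists_centered hxU
  have e : 𝔮 = 𝔭 := by
    ext r
    rw [← h𝔮.van]
    exact hvan r
  exact ⟨x, hxK, e ▸ h𝔮⟩

omit [SeparatesDomains Y] E in
include C H in
lemma blowMap_mem {d : σ → ℂ} {k : ChartVar pr o.1} {x : X} (hk : T k - ι (d k) ∈ ringAt x)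
    (h : IsBlowFin ι T d k x) (r : MvPolynomial (ChartVar pr o.1) ℂ) :
    blowMap pr o.1 ι T d k r ∈ ringAt x := by
  change r ∈ (ringAt x).comap (blowMap pr o.1 ι T d k)
  induction r using MvPolynomial.induction_on with
  | C b =>
    rw [Subring.mem_comap, blowMap_C]
    exact H.const_mem C b x
  | add p q hp hq => exact add_mem hp hq
  | mul_X p v hp =>
    refine mul_mem hp ?_
    rw [Subring.mem_comap]
    by_cases hv : v = k
    · rw [hv, blowMap_X_self]
      exact hk
    · rw [blowMap_X_of_ne _ _ fun e => hv (Subtype.ext e)]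
      exact h v

include C H hTo hπ hinj in
lemma atlas [Finite σ] [Finite Λ] : Atlas pr o.1 ι T pt where
  pr_o := o.2
  T_ne := H.ne_zero
  T_o := hTo
  pt_o := E.one
  pt_inj := E.inj
  two := E.two
  const := H.const_mem C
  exists_fin x := by
    obtain ⟨κ, hκ⟩ := C.cover (π x)
    exact ⟨κ.1, κ.2, (H.isFin_iff C κ x).mpr hκ⟩
  chart κ x hκ hfin hat := by
    have := C.isOpenImmersion ⟨κ, hκ⟩
    refine hπ.exists_isChart_offCentre (H.isRat ⟨κ, hκ⟩) ((H.isFin_iff C ⟨κ, hκ⟩ x).mp hfin) ?_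
    rw [E.mem_iff]
    rintro ⟨l, hl⟩
    exact hat l ((E.isAt_iff C H hTo l x).mpr hl)
  exists_blowFin l x hat := by
    have := C.isOpenImmersion o
    have hx := (E.isAt_iff C H hTo l x).mp hat
    obtain ⟨β, hβ, hβ'⟩ := (H.isRat o).exists_stalk ⟨_, hx.symm⟩
    -- The coordinate difference that generates the exceptional ideal at x selects the chart.
    obtain ⟨m, hm⟩ := hπ.exists_dvd (E.isClosed_diff _) ((E.mem_iff _).mpr ⟨l, rfl⟩) (E.ideal l)
      hx hβ'
    have hβ (v : ChartVar pr o.1) :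
        stalkToK x (β (MvPolynomial.X v - MvPolynomial.C (pt l v))) = T v - ι (pt l v) := by
      rw [← chartMap_sub hTo]
      exact congrArg (fun f => f.hom (MvPolynomial.X v - MvPolynomial.C (pt l v))) hβ
    refine ⟨m, m.2, fun v => ?_⟩
    by_cases hv : v = o.1 (pr v)
    · rw [hv, hTo, E.one, map_one, sub_self, zero_div]
      exact zero_mem _
    · obtain ⟨w, hw⟩ := hm ⟨v, hv⟩
      have h1 := congrArg (stalkToK x) hw
      rw [map_mul, hβ, hβ] at h1
      rw [h1, mul_div_cancel_left₀ _ (sub_ne_zero' hTo hinj m _)]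
      exact algebraMap_mem_ringAt w
  blow l k x hk hat hfin :=
    E.exists_isChart_blow C H hTo hπ hinj l ⟨k, hk⟩
      (blowMap_mem C H (k := ⟨k, hk⟩) (idealAt_subset (hat k)) hfin)
      ((E.isAt_iff C H hTo l x).mp hat)
  point κ 𝔭 hκ h𝔭 h := by
    have := C.isOpenImmersion ⟨κ, hκ⟩
    have hq := E.notMem_of_coord C (κ := ⟨κ, hκ⟩) (q := ⟨𝔭, h𝔭⟩) h
    have : IsNoetherianRing (CommRingCat.of (MvPolynomial (ChartVar pr κ) ℂ)) :=
      inferInstanceAs (IsNoetherianRing (MvPolynomial (ChartVar pr κ) ℂ))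
    obtain ⟨K, -, hK⟩ := hπ.exists_isCompact_offCentre (c ⟨κ, hκ⟩)
    obtain ⟨x, -, hx⟩ := hK _ hq
    exact ⟨x, centered_chartMap C H hπ hx hq⟩
  blow_point l k 𝔭 hk h𝔭 hmem := by
    obtain ⟨K, -, hK⟩ := E.exists_compact_blow C H hTo hπ hinj l ⟨k, hk⟩
    obtain ⟨x, -, hx⟩ := hK 𝔭 h𝔭 hmem
    exact ⟨x, hx⟩
  ext _ _ := hπ.eq_of_ringAt_eq

-- Finitely many compact sets contain points with every possible centre. A point of X shares its
-- local ring with one of these, and is equal to it by `Atlas.ext`.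
include E C H hTo hπ hinj in
lemma compactSpace [Finite J] [Finite σ] [Finite Λ] : CompactSpace X := by
  have hoff (κ : Choice pr) : ∃ K : Set X, IsCompact K ∧ ∀ q, c κ q ∉ Z → ∃ x ∈ K, π x = c κ q := by
    have := C.isOpenImmersion κ
    have : IsNoetherianRing (CommRingCat.of (MvPolynomial (ChartVar pr κ.1) ℂ)) :=
      inferInstanceAs (IsNoetherianRing (MvPolynomial (ChartVar pr κ.1) ℂ))
    exact hπ.exists_isCompact_offCentre (c κ)
  choose K hK hKx using hoff
  choose K' hK' hKx' using fun l => E.exists_compact_blow C H hTo hπ hinj l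
  have A := E.atlas C H hTo hπ hinj
  refine ⟨?_⟩
  have e : (Set.univ : Set X) = (⋃ κ, K κ) ∪ ⋃ lk : Λ × ChartVar pr o.1, K' lk.1 lk.2 := by
    refine (Set.eq_univ_of_forall fun x => ?_).symm
    by_cases hx : π x ∈ Z
    · obtain ⟨l, hl⟩ := (E.mem_iff _).mp hx
      have hat := (E.isAt_iff C H hTo l x).mpr hl
      obtain ⟨k, hk, hfin⟩ := A.exists_blowFin l x hat
      obtain ⟨U, g, hxU, hU⟩ := A.blow l k x hk hat hfin
      obtain ⟨𝔭, -, h𝔭⟩ := hU.exists_centered hxU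
      obtain ⟨y, hy, hy'⟩ := hKx' l ⟨k, hk⟩ 𝔭 h𝔭.prime (by
        rw [← h𝔭.van, blowMap_X_self]
        exact hat k)
      rw [A.ext x y (h𝔭.ringAt_eq hy')]
      exact Or.inr (Set.mem_iUnion.mpr ⟨(l, ⟨k, hk⟩), hy⟩)
    · obtain ⟨κ, q, hq⟩ := C.cover (π x)
      obtain ⟨y, hy, hy'⟩ := hKx κ q (hq ▸ hx)
      rw [A.ext x y ((centered_chartMap C H hπ hq.symm (hq ▸ hx)).ringAt_eq
        (centered_chartMap C H hπ hy' (hq ▸ hx)))]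
      exact Or.inl (Set.mem_iUnion.mpr ⟨κ, hy⟩)
  rw [e]
  exact (isCompact_iUnion hK).union (isCompact_iUnion fun lk => hK' lk.1 lk.2)

end IsCentre

end ProductAtlas


/-! ### Identifying the proper transform -/

section ProperTransform

lemma constants_eq {X : Scheme.{0}} [IsIntegral X] (s : X ⟶ Spec (.of ℂ))
    {a : .of ℂ ⟶ X.functionField} (h : Spec.map a = genericMap X ≫ s) (z : ℂ) :
    (show X.functionField from algebraMap ℂ (FunctionField s) z) = a z := by
  have h1 := congrArg (fun f => (Scheme.ΓSpecIso (.of ℂ)).inv ≫ Scheme.Hom.appTop f ≫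
    (Scheme.ΓSpecIso X.functionField).hom) h
  have h2 := congrArg (fun f => f.hom z) h1
  simp only [Scheme.Hom.comp_appTop, Scheme.fromSpecStalk_appTop, Category.assoc] at h2
  rw [Scheme.ΓSpecIso_naturality, Iso.inv_hom_id_assoc] at h2
  refine Eq.trans ?_ h2.symm
  change _ = (Scheme.ΓSpecIso X.functionField).hom ((Spec X.functionField).presheaf.map _
    ((Scheme.ΓSpecIso X.functionField).inv (X.presheaf.germ ⊤ (genericPoint X) trivial
      (constants s z))))
  rw [show (homOfLE le_top : (_ : (Spec X.functionField).Opens) ⟶ ⊤).op = 𝟙 _ from rfl,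
    CategoryTheory.Functor.map_id, CommRingCat.id_apply, ← CommRingCat.comp_apply, Iso.inv_hom_id]
  rfl

variable {J σ Λ : Type} {one : σ} {X Y Phat : Scheme.{0}} [IsIntegral X] [IsIntegral Phat]
  [SeparatesDomains Y] {π : X ⟶ Y} {pr : σ → J} {s : Y ⟶ Spec (.of ℂ)}
  {c : ∀ κ : Choice pr, ChartSpec pr κ.1 ⟶ Y} {o : J → Rest one} {ho : ∀ j, pr (o j) = j}
  {Z : Closeds Y} {P : Λ → ChartSpec pr (under o)} {pt : Λ → σ → ℂ}

lemma coord_notMem_span (o : J → Rest one) {v : σ} (h : v ≠ one) :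
    coord pr (under o) v ∉ Ideal.span {coord pr (under o) one} := by
  rw [Ideal.mem_span_singleton, coord_of_ne (one_ne_under o _)]
  by_cases hv : v = under o (pr v)
  · rw [coord_of_eq hv]
    exact fun hd => MvPolynomial.X_prime.not_isUnit (isUnit_of_dvd_one hd)
  · rw [coord_of_ne hv, MvPolynomial.X_dvd_X]
    exact fun e => h (congrArg Subtype.val e).symm

/-- What has to be shown is that the generic point of the closed subscheme is the point x of the
chart o centred at the ideal of the coordinate `one`; its local description then follows from the
atlas of X. -/
theorem eulerChow_of_charts (C : IsProductCharts pr s c) [Fintype J] [Finite σ] [Fintype Λ]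
    (E : IsCentre c ⟨under o, ho⟩ Z P pt) (hone : ∀ l, pt l one = 0)
    (htwo : ∀ _ : Λ, ∃ v w : Rest one, v ≠ w ∧ v ≠ o (pr v) ∧ w ≠ o (pr w))
    (hJ : ∀ j, ∃ v : Rest one, pr v = j ∧ v ≠ o j) {H : Set Y}
    (hH : ∀ κ q, c κ q ∈ H ↔ coord pr κ.1 one ∈ q.asIdeal)
    (hπ : IsBlowup π (Scheme.IdealSheafData.vanishingIdeal Z)) (i : Phat ⟶ X)
    [IsClosedImmersion i] (hi : Set.range i = closure (π ⁻¹' (H \ Z))) :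
    let sX : X ⟶ Spec (.of ℂ) := π ≫ s
    let sP : Phat ⟶ Spec (.of ℂ) := i ≫ sX
    (∀ D : CartierDivisor X, FiniteDimensional ℂ (H0 sX D)) ∧
    (∀ D : CartierDivisor Phat, FiniteDimensional ℂ (H0 sP D)) ∧
    Function.Bijective (Pic.pullback i) ∧
    ∃ (F₀ : CartierDivisor X) (F : effMonoid X) (L : AddSubmonoid (Pic X))
      (e : effMonoid Phat →+ effMonoid X),
      IsDivisorOf F₀ i.ker ∧ (F : Pic X) = Pic.mk F₀ ∧
      (L : Set (Pic X)) = {D | h0 sX (D - F) < h0 sX D} ∧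
      L.map (Pic.pullback i) = effMonoid Phat ∧
      Function.Injective e ∧ (∀ D, Pic.pullback i (e D : Pic X) = D) ∧
      (∀ D : effMonoid X, D ∈ Set.range e ↔ (D : Pic X) ∈ L) ∧
      (∀ D ∈ L, D ∈ effMonoid X) ∧
      conv (tpow 0 - tpow F) (EulerChow.eulerChow sX) =
        Function.extend e (EulerChow.eulerChow sP) 0 ∧
      ∀ D ∈ L, (h0 sP (Pic.pullback i D) : ℤ) = h0 sX D - h0 sX (D - F) := by
  intro sX sP
  have := C.isOpenImmersion ⟨under o, ho⟩
  obtain ⟨ι, T, hR, hTo, hinj⟩ := C.exists_isRatCoord hπ ⟨under o, ho⟩ E.bot_notMem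
  have A := E.atlas C hR hTo hπ hinj
  have hcompact := E.compactSpace C hR hTo hπ hinj
  have hprime := prime_coord (pr := pr) (one_ne_under o (pr one))
  obtain ⟨x, hx⟩ := A.exists_point_of_prime hprime
  have hxo := A.isFin_of_centered hx
  have hxZ : π x ∉ Z := by
    rw [E.mem_iff]
    rintro ⟨l, hl⟩
    exact A.not_isAt_of_centered hprime hx l ((E.isAt_iff C hR hTo l x).mpr hl)
  have hxH : π x ∈ H := by
    obtain ⟨q, hq⟩ := (hR.isFin_iff C ⟨under o, ho⟩ x).mp hxo
    rw [← hq, hH, ← (IsCentre.centered_chartMap C hR hπ hq.symm (hq ▸ hxZ)).van, hx.van]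
    exact Ideal.mem_span_singleton_self _
  -- In any chart at y the coordinate `one` vanishes. The point x lies in that chart too, since the
  -- other coordinates are units at x, and its prime there is generated by `one`.
  have hspec (y : X) (hy : y ∈ π ⁻¹' (H \ Z)) : x ⤳ y := by
    obtain ⟨κ, q, hq⟩ := C.cover (π y)
    have hqone : coord pr κ.1 one ∈ q.asIdeal := by
      rw [← hH, hq]
      exact hy.1
    have hyc := IsCentre.centered_chartMap C hR hπ hq.symm (hq ▸ hy.2)
    have hκ : one ≠ κ.1 (pr one) := fun e => by
      rw [coord_of_eq e] at hqone
      exact hyc.prime.ne_top ((Ideal.eq_top_iff_one _).mpr hqone)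
    have hfin : IsFin pr T κ.1 x := by
      refine A.isFin_of_notMem κ.2 hxo fun j => ?_
      have h1 := chartMap_coord (pr := pr) (κ := under o) (ι := ι) hR.ne_zero (κ.1 j)
      rw [κ.2] at h1
      rw [← h1, hx.van]
      refine coord_notMem_span o fun e => hκ ?_
      rw [← e, κ.2]
    obtain ⟨q', hq'⟩ := (hR.isFin_iff C κ x).mp hfin
    have hxc := IsCentre.centered_chartMap C hR hπ hq'.symm (hq' ▸ hxZ)
    have hqone' : coord pr κ.1 one ∈ q'.asIdeal := by
      rw [← hH, hq']
      exact hxH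
    refine hπ.specializes (hxc.ringAt_le hyc ?_)
    rw [hxc.eq_span (A.chartMap_injective κ.2) (hx.isPrimeDiv hinj hprime) (prime_coord hκ) hqone']
    exact (Ideal.span_singleton_le_iff_mem _).mpr hqone
  -- Both points are generic in the same closed set: x lies in the image of i, and this image is
  -- contained in the closure of x.
  have hgen : i (genericPoint Phat) = x := by
    have h1 : x ∈ Set.range i := by
      rw [hi]
      exact subset_closure ⟨hxH, hxZ⟩
    obtain ⟨z, hz⟩ := h1
    have h2 : i (genericPoint Phat) ⤳ x := hz ▸ specializes_generic i z
    have h3 : i (genericPoint Phat) ∈ closure {x} := by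
      have h4 : i (genericPoint Phat) ∈ closure (π ⁻¹' (H \ Z)) := hi ▸ ⟨_, rfl⟩
      exact closure_minimal (fun y hy => (hspec y hy).mem_closure) isClosed_closure h4
    exact (h2.antisymm (specializes_iff_mem_closure.mpr h3)).eq
  have hι (z : ℂ) : (show X.functionField from algebraMap ℂ (FunctionField sX) z) = ι z := by
    refine constants_eq sX (a := CommRingCat.ofHom ι) ?_ z
    have h1 : CommRingCat.ofHom MvPolynomial.C ≫ CommRingCat.ofHom (chartMap pr (under o) ι T) =
        CommRingCat.ofHom ι := by
      ext b
      exact chartMap_C b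
    refine (congrArg Spec.map h1).symm.trans ?_
    have h2 := congrArg (· ≫ s) (hR.isRat ⟨under o, ho⟩)
    simp only [Category.assoc] at h2
    rw [C.const] at h2
    rw [Spec.map_comp]
    exact h2
  have hT' (v : Rest one) : ∃ g, Res i (T v) g := by
    refine Res.exists_of_mem ?_
    rw [hgen]
    have := hxo v
    rwa [hTo, div_one] at this
  choose T' hT' using hT'
  have W : IsTransform i pr o ι T pt (algebraMap ℂ (FunctionField sP)) T' :=
    { atlas := A
      pt_one := hone
      two := htwo
      gen := hgen ▸ hx
      res_const := fun b => hι b ▸ Res.const sX b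
      res_T := hT' }
  exact W.eulerChow sX hι hJ

end ProperTransform


/-! ### Charts of a product from charts of the factors -/

section ProductOfCharts

variable {J : Type} {τ : J → Type}

/-- The coordinate in the factor `j` of a choice of one coordinate in each factor. -/
def component (κ : Choice (Sigma.fst : (Σ j, τ j) → J)) (j : J) : τ j := κ.2 j ▸ (κ.1 j).2

lemma mk_component (κ : Choice (Sigma.fst : (Σ j, τ j) → J)) (j : J) : ⟨j, component κ j⟩ = κ.1 j :=
  Sigma.ext (κ.2 j).symm (by simp [component])

/-- The component of a choice, as a choice for one factor. -/
abbrev single {τ : Type} (k : τ) : Choice (fun _ : τ => ()) := ⟨fun _ => k, fun _ => rfl⟩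

/-- The coordinate ring of a chart of a factor, in that of a chart of the product. -/
def inclFactor (κ : Choice (Sigma.fst : (Σ j, τ j) → J)) (j : J) :
    MvPolynomial (ChartVar (fun _ : τ j => ()) (single (component κ j)).1) ℂ →+*
      MvPolynomial (ChartVar (Sigma.fst : (Σ j, τ j) → J) κ.1) ℂ :=
  (MvPolynomial.rename fun v => ⟨⟨j, v.1⟩, fun e => v.2
    (eq_of_heq (Sigma.mk.inj (e.trans (mk_component κ j).symm)).2)⟩).toRingHom

lemma inclFactor_coord (κ : Choice (Sigma.fst : (Σ j, τ j) → J)) (j : J) (v : τ j) :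
    inclFactor κ j (coord _ _ v) = coord Sigma.fst κ.1 ⟨j, v⟩ := by
  by_cases h : v = component κ j
  · rw [coord_of_eq h, map_one, coord_of_eq]
    exact (congrArg (Sigma.mk j) h).trans (mk_component κ j)
  · rw [coord_of_ne h, coord_of_ne]
    exact MvPolynomial.rename_X _ _

lemma inclFactor_C (κ : Choice (Sigma.fst : (Σ j, τ j) → J)) (j : J) (b : ℂ) :
    inclFactor κ j (MvPolynomial.C b) = MvPolynomial.C b :=
  MvPolynomial.rename_C _ _

lemma map_inclFactor_comp (κ : Choice (Sigma.fst : (Σ j, τ j) → J)) (j : J) :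
    Spec.map (CommRingCat.ofHom (inclFactor κ j)) ≫
      Spec.map (CommRingCat.ofHom MvPolynomial.C) = Spec.map (CommRingCat.ofHom MvPolynomial.C) := by
  rw [← Spec.map_comp, ← CommRingCat.ofHom_comp]
  congr 2
  exact RingHom.ext fun b => inclFactor_C κ j b

lemma exists_eq_toSpecΓ_comp {T : Scheme.{0}} {A : CommRingCat.{0}} (g : T ⟶ Spec A) :
    ∃ γ : A ⟶ Γ(T, ⊤), g = T.toSpecΓ ≫ Spec.map γ :=
  let ⟨γ, h⟩ := (ΓSpec.adjunction.homEquiv T (.op A)).surjective g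
  ⟨γ.unop, h.symm⟩

lemma toSpecΓ_comp_injective {T : Scheme.{0}} {A : CommRingCat.{0}} {γ γ' : A ⟶ Γ(T, ⊤)}
    (h : T.toSpecΓ ≫ Spec.map γ = T.toSpecΓ ≫ Spec.map γ') : γ = γ' := by
  exact (ΓSpec.adjunction.homEquiv T (.op A)).injective (a₁ := γ.op) (a₂ := γ'.op) h |> Quiver.Hom.op_inj

variable {T : Scheme.{0}} {κ : Choice (Sigma.fst : (Σ j, τ j) → J)}

lemma chartSpec_hom_ext [Nonempty J] {u v : T ⟶ ChartSpec (Sigma.fst : (Σ j, τ j) → J) κ.1}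
    (h : ∀ j, u ≫ Spec.map (CommRingCat.ofHom (inclFactor κ j)) =
      v ≫ Spec.map (CommRingCat.ofHom (inclFactor κ j))) : u = v := by
  obtain ⟨γ, rfl⟩ := exists_eq_toSpecΓ_comp u
  obtain ⟨δ, rfl⟩ := exists_eq_toSpecΓ_comp v
  have h1 (j : J) : CommRingCat.ofHom (inclFactor κ j) ≫ γ = CommRingCat.ofHom (inclFactor κ j) ≫ δ := by
    refine toSpecΓ_comp_injective ?_
    simpa only [Spec.map_comp, Category.assoc] using h j
  have h2 (j : J) (a) : γ (inclFactor κ j a) = δ (inclFactor κ j a) := congrArg (fun f => f.hom a) (h1 j)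
  congr 2
  ext1
  refine MvPolynomial.ringHom_ext (fun b => ?_) fun v => ?_
  -- Constants are compared through any one factor; this is where a nonempty index set is needed.
  · rw [← inclFactor_C κ (Classical.arbitrary J)]
    exact h2 _ _
  · have := h2 v.1.1 (coord _ _ v.1.2)
    rwa [inclFactor_coord, coord_of_ne v.2] at this

/-- The polynomial ring in all affine coordinates is the coproduct of those of the factors over ℂ,
so compatible morphisms to the factors combine. -/
lemma exists_chartSpec_lift [Nonempty J]
    (g : ∀ j, T ⟶ ChartSpec (fun _ : τ j => ()) (single (component κ j)).1)
    {t : T ⟶ Spec (.of ℂ)} (hg : ∀ j, g j ≫ Spec.map (CommRingCat.ofHom MvPolynomial.C) = t) :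
    ∃ d : T ⟶ ChartSpec (Sigma.fst : (Σ j, τ j) → J) κ.1,
      ∀ j, d ≫ Spec.map (CommRingCat.ofHom (inclFactor κ j)) = g j := by
  choose γ hγ using fun j => exists_eq_toSpecΓ_comp (g j)
  obtain ⟨ε, rfl⟩ := exists_eq_toSpecΓ_comp t
  have hε (j : J) (b : ℂ) : γ j (MvPolynomial.C b) = ε b := by
    have : CommRingCat.ofHom MvPolynomial.C ≫ γ j = ε := toSpecΓ_comp_injective (by
      rw [Spec.map_comp, ← hg j, hγ, Category.assoc])
    exact congrArg (fun f => f.hom b) this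
  let G : MvPolynomial (ChartVar (Sigma.fst : (Σ j, τ j) → J) κ.1) ℂ →+* Γ(T, ⊤) :=
    MvPolynomial.eval₂Hom ε.hom fun v => γ v.1.1 (coord _ _ v.1.2)
  refine ⟨T.toSpecΓ ≫ Spec.map (CommRingCat.ofHom G), fun j => ?_⟩
  rw [Category.assoc, ← Spec.map_comp, hγ]
  congr 2
  ext1
  refine MvPolynomial.ringHom_ext (fun b => ?_) fun v => ?_
  · refine Eq.trans ?_ (hε j b).symm
    change G (inclFactor κ j _) = _
    rw [inclFactor_C]
    exact MvPolynomial.eval₂_C _ _ _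
  · have hv : v.1 ≠ component κ j := v.2
    have : (⟨j, v.1⟩ : Σ j, τ j) ≠ κ.1 j := fun e => hv
      (eq_of_heq (Sigma.mk.inj (e.trans (mk_component κ j).symm)).2)
    change G (inclFactor κ j _) = γ j _
    rw [← coord_of_ne (pr := fun _ : τ j => ()) (κ := (single (component κ j)).1) v.2, inclFactor_coord,
      coord_of_ne this]
    exact MvPolynomial.eval₂_X _ _ _

variable {Q : J → Over (Spec (.of ℂ))} [HasProduct Q]

lemma prod_hom_ext [Nonempty J] {u v : T ⟶ (∏ᶜ Q).left}
    (h : ∀ j, u ≫ (Pi.π Q j).left = v ≫ (Pi.π Q j).left) : u = v := by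
  have hs : u ≫ (∏ᶜ Q).hom = v ≫ (∏ᶜ Q).hom := by
    rw [← Over.w (Pi.π Q (Classical.arbitrary J)), ← Category.assoc, ← Category.assoc, h]
  have : (Over.homMk u rfl : Over.mk (u ≫ (∏ᶜ Q).hom) ⟶ ∏ᶜ Q) = Over.homMk v hs.symm := by
    refine Pi.hom_ext _ _ fun j => ?_
    ext1
    exact h j
  exact congrArg CommaMorphism.left this

instance [Nonempty J] [∀ j, SeparatesDomains (Q j).left] : SeparatesDomains (∏ᶜ Q).left where
  eq_of_injective φ hφ u v h := prod_hom_ext fun j =>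
    SeparatesDomains.eq_of_injective φ hφ _ _ (by rw [← Category.assoc, h, Category.assoc])

variable {p : ∀ j (κ : Choice (fun _ : τ j => ())), ChartSpec (fun _ : τ j => ()) κ.1 ⟶ (Q j).left}
  (D : ∀ j, IsProductCharts (fun _ : τ j => ()) (Q j).hom (p j))
include D

/-- The product of charts of the factors. -/
def prodChart (κ : Choice (Sigma.fst : (Σ j, τ j) → J)) :
    ChartSpec (Sigma.fst : (Σ j, τ j) → J) κ.1 ⟶ (∏ᶜ Q).left :=
  (Pi.lift fun j => (Over.homMk (Spec.map (CommRingCat.ofHom (inclFactor κ j)) ≫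
      p j (single (component κ j))) (by
    change _ = Spec.map (CommRingCat.ofHom MvPolynomial.C)
    rw [Category.assoc, (D j).const, map_inclFactor_comp]) :
    Over.mk (Spec.map (CommRingCat.ofHom MvPolynomial.C)) ⟶ Q j)).left

lemma prodChart_π (κ : Choice (Sigma.fst : (Σ j, τ j) → J)) (j : J) :
    prodChart D κ ≫ (Pi.π Q j).left =
      Spec.map (CommRingCat.ofHom (inclFactor κ j)) ≫ p j (single (component κ j)) := by
  rw [prodChart, ← Over.comp_left, Pi.lift_π]
  rfl

lemma prodChart_π_apply (κ : Choice (Sigma.fst : (Σ j, τ j) → J)) (j : J)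
    (q : ChartSpec (Sigma.fst : (Σ j, τ j) → J) κ.1) :
    (Pi.π Q j).left (prodChart D κ q) =
      p j (single (component κ j)) (Spec.map (CommRingCat.ofHom (inclFactor κ j)) q) := by
  rw [← Scheme.Hom.comp_apply, prodChart_π, Scheme.Hom.comp_apply]

/-- The chart is identified with the intersection W of the preimages of the charts of the factors:
both represent families of morphisms to these charts over ℂ. Finiteness of J makes W open. -/
lemma isOpenImmersion_prodChart [Finite J] [Nonempty J]
    (κ : Choice (Sigma.fst : (Σ j, τ j) → J)) :
    IsOpenImmersion (prodChart D κ) ∧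
      ∀ y, (∀ j, (Pi.π Q j).left y ∈ Set.range (p j (single (component κ j)))) →
        y ∈ Set.range (prodChart D κ) := by
  have hop j := (D j).isOpenImmersion (single (component κ j))
  let W : (∏ᶜ Q).left.Opens :=
    ⟨⋂ j, (Pi.π Q j).left ⁻¹' Set.range (p j (single (component κ j))), isOpen_iInter_of_finite fun j =>
      (p j (single (component κ j))).isOpenEmbedding.isOpen_range.preimage (Pi.π Q j).left.continuous⟩
  have hW (j : J) : Set.range (W.ι ≫ (Pi.π Q j).left) ⊆ Set.range (p j (single (component κ j))) := by
    rintro _ ⟨y, rfl⟩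
    rw [Scheme.Hom.comp_apply]
    exact Set.mem_iInter.mp y.2 j
  obtain ⟨d, hd⟩ := exists_chartSpec_lift
    (fun j => IsOpenImmersion.lift (p j (single (component κ j))) (W.ι ≫ (Pi.π Q j).left) (hW j))
    (t := W.ι ≫ (∏ᶜ Q).hom) fun j => by
      rw [← (D j).const, ← Category.assoc, IsOpenImmersion.lift_fac, Category.assoc, Over.w]
  have hd' : d ≫ prodChart D κ = W.ι := prod_hom_ext fun j => by
    rw [Category.assoc, prodChart_π, ← Category.assoc, hd, IsOpenImmersion.lift_fac]
  have hr : Set.range (prodChart D κ) ⊆ Set.range W.ι := by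
    rw [Scheme.Opens.range_ι]
    rintro _ ⟨q, rfl⟩
    refine Set.mem_iInter.mpr fun j => ?_
    rw [Set.mem_preimage, prodChart_π_apply]
    exact ⟨_, rfl⟩
  let e := IsOpenImmersion.lift W.ι (prodChart D κ) hr
  have he : e ≫ W.ι = prodChart D κ := IsOpenImmersion.lift_fac _ _ _
  have hiso : IsIso e := by
    refine ⟨d, chartSpec_hom_ext fun j => ?_, ?_⟩
    · rw [Category.assoc, hd, ← cancel_mono (p j (single (component κ j))), Category.assoc,
        IsOpenImmersion.lift_fac, ← Category.assoc, he, prodChart_π, Category.id_comp]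
    · rw [← cancel_mono W.ι, Category.assoc, he, hd', Category.id_comp]
  refine ⟨he ▸ inferInstance, fun y hy => ?_⟩
  let w : W.toScheme := ⟨y, Set.mem_iInter.mpr hy⟩
  exact ⟨d w, (Scheme.Hom.comp_apply _ _ _).symm.trans (congrArg (fun f => f w) hd')⟩

theorem isProductCharts_prod [Finite J] [Nonempty J] :
    IsProductCharts (Sigma.fst : (Σ j, τ j) → J) (∏ᶜ Q).hom (prodChart D) where
  isOpenImmersion κ := (isOpenImmersion_prodChart D κ).1
  cover y := by
    choose κ hκ using fun j => (D j).cover ((Pi.π Q j).left y)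
    exact ⟨⟨fun j => ⟨j, (κ j).1 ()⟩, fun _ => rfl⟩,
      (isOpenImmersion_prodChart D ⟨fun j => ⟨j, (κ j).1 ()⟩, fun _ => rfl⟩).2 y hκ⟩
  const κ := Over.w (Pi.lift _)
  ratio κ κ' {K} hK f f' h := by
    rintro ⟨j, v⟩
    have := (D j).ratio (single (component κ j)) (single (component κ' j)) hK
      (CommRingCat.ofHom (inclFactor κ j) ≫ f) (CommRingCat.ofHom (inclFactor κ' j) ≫ f') (by
        rw [Spec.map_comp, Spec.map_comp, Category.assoc, Category.assoc, ← prodChart_π D,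
          ← prodChart_π D, ← Category.assoc, h, Category.assoc]) v
    rw [← mk_component κ j, ← inclFactor_coord, ← inclFactor_coord, ← inclFactor_coord]
    exact this
  mem_range κ κ' q h := by
    refine (isOpenImmersion_prodChart D κ).2 _ fun j => ?_
    rw [prodChart_π_apply]
    refine (D j).mem_range _ _ _ fun _ hj => h j ?_
    rw [← mk_component κ j, ← inclFactor_coord]
    exact hj

end ProductOfCharts

end
end EulerChow

namespace EulerChow
open AlgebraicGeometry CategoryTheory Limits TopologicalSpace HomogeneousLocalization
noncomputable section

/-! ### Linear forms and homogeneous polynomials -/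

section LinearForms

variable {r : ℕ}

lemma linearForm_induction {p : grading r 1 → Prop}
    (X : ∀ i, p ⟨MvPolynomial.X i, MvPolynomial.isHomogeneous_X _ i⟩) (zero : p 0)
    (add : ∀ v w, p v → p w → p (v + w)) (smul : ∀ (a : ℂ) w, p w → p (a • w)) (w) : p w := by
  obtain ⟨w, hw⟩ := w
  have hw' := hw
  rw [grading, MvPolynomial.homogeneousSubmodule_one_eq_span_X] at hw'
  have : ∃ h, p ⟨w, h⟩ := by
    induction hw' using Submodule.span_induction with
    | mem x hx =>
      obtain ⟨i, rfl⟩ := hx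
      exact ⟨_, X i⟩
    | zero => exact ⟨zero_mem _, zero⟩
    | add x y hx hy h1 h2 =>
      rw [← MvPolynomial.homogeneousSubmodule_one_eq_span_X] at hx hy
      obtain ⟨a, ha⟩ := h1 hx
      obtain ⟨b, hb⟩ := h2 hy
      exact ⟨add_mem a b, add _ _ ha hb⟩
    | smul c x hx h1 =>
      rw [← MvPolynomial.homogeneousSubmodule_one_eq_span_X] at hx
      obtain ⟨a, ha⟩ := h1 hx
      exact ⟨Submodule.smul_mem _ c a, smul _ _ ha⟩
  exact this.2

variable {B : Type} [CommRing B] [Algebra ℂ B]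

/-- The homomorphism on the polynomial ring that extends a linear map on the linear forms. -/
def formHom (φ : grading r 1 →ₗ[ℂ] B) : MvPolynomial (Fin (r + 1)) ℂ →ₐ[ℂ] B :=
  MvPolynomial.aeval fun i => φ ⟨MvPolynomial.X i, MvPolynomial.isHomogeneous_X _ i⟩

lemma formHom_apply (φ : grading r 1 →ₗ[ℂ] B) (w : grading r 1) : formHom φ w.1 = φ w := by
  induction w using linearForm_induction with
  | X i => exact MvPolynomial.aeval_X _ i
  | zero => rw [map_zero, ZeroMemClass.coe_zero, map_zero]
  | add v w hv hw => rw [map_add, Submodule.coe_add, map_add, hv, hw]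
  | smul a w hw => rw [map_smul, Submodule.coe_smul, map_smul, hw]

variable {R : Type} [CommRing R] {τ : Type} (b : Module.Basis τ ℂ (grading r 1))
include b

/-- Forms of degree n are sums of products of n linear forms, so a factor c on the basis of linear
forms becomes cⁿ. -/
lemma mul_pow_eq_of_homogeneous {f g : MvPolynomial (Fin (r + 1)) ℂ →+* R} {c : R}
    (hC : ∀ z, f (MvPolynomial.C z) = g (MvPolynomial.C z)) (h : ∀ v, f (b v) * c = g (b v)) {n : ℕ}
    {a : MvPolynomial (Fin (r + 1)) ℂ} (ha : a ∈ grading r n) : f a * c ^ n = g a := by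
  have h1 (w : grading r 1) : f w * c = g w := by
    induction b.mem_span w using Submodule.span_induction with
    | mem x hx =>
      obtain ⟨v, rfl⟩ := hx
      exact h v
    | zero => rw [ZeroMemClass.coe_zero, map_zero, map_zero, zero_mul]
    | add x y _ _ hx hy => rw [Submodule.coe_add, map_add, map_add, add_mul, hx, hy]
    | smul z x _ hx =>
      rw [Submodule.coe_smul, MvPolynomial.smul_eq_C_mul, map_mul, map_mul, mul_assoc, hx, hC]
  rw [grading, ← MvPolynomial.homogeneousSubmodule_one_pow] at ha
  induction ha using Submodule.pow_induction_on_left' with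
  | algebraMap z => rw [pow_zero, mul_one]; exact hC z
  | add x y n _ _ hx hy => rw [map_add, map_add, add_mul, hx, hy]
  | mem_mul m hm n x _ hx =>
    rw [map_mul, map_mul, ← hx, ← h1 ⟨m, hm⟩, Nat.succ_eq_add_one]
    ring

lemma mem_of_basis_mem {I : Ideal (MvPolynomial (Fin (r + 1)) ℂ)} (h : ∀ v, (b v).1 ∈ I)
    (w : grading r 1) : w.1 ∈ I := by
  induction b.mem_span w using Submodule.span_induction with
  | mem x hx =>
    obtain ⟨v, rfl⟩ := hx
    exact h v
  | zero => exact zero_mem _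
  | add x y _ _ hx hy => exact add_mem hx hy
  | smul z x _ hx =>
    rw [Submodule.coe_smul, MvPolynomial.smul_eq_C_mul]
    exact I.mul_mem_left _ hx

end LinearForms

/-! ### Charts of projective space for a basis of linear forms -/

section ProjectiveCharts

variable {r : ℕ}

/-- An injective ring map induces a dominant morphism of spectra, and morphisms from a reduced
scheme to a separated one are determined on a dense image. -/
instance : SeparatesDomains (Proj (grading r)) where
  eq_of_injective {R S} _ φ hφ u v h := by
    have : IsDominant (Spec.map φ) := ⟨by
      change DenseRange (PrimeSpectrum.comap φ.hom)
      rw [PrimeSpectrum.denseRange_comap_iff_ker_le_nilRadical,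
        (RingHom.injective_iff_ker_eq_bot _).mp hφ]
      exact bot_le⟩
    exact ext_of_isDominant (Spec.map φ) h

lemma exists_linearForm_notMem (x : Proj (grading r)) :
    ∃ i, (MvPolynomial.X i : MvPolynomial (Fin (r + 1)) ℂ) ∉ x.asHomogeneousIdeal := by
  have h := Proj.iSup_basicOpen_eq_top' (grading r)
    (fun i => (MvPolynomial.X i : MvPolynomial (Fin (r + 1)) ℂ))
    (fun i => ⟨1, MvPolynomial.isHomogeneous_X _ i⟩) (by
      refine top_le_iff.mp fun a _ => ?_
      induction a using MvPolynomial.induction_on with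
      | C z => exact Subalgebra.algebraMap_mem _ (⟨_, MvPolynomial.isHomogeneous_C _ z⟩ : grading r 0)
      | add p q hp hq => exact add_mem (hp trivial) (hq trivial)
      | mul_X p i hp => exact mul_mem (hp trivial) (Algebra.subset_adjoin ⟨i, rfl⟩))
  exact Opens.mem_iSup.mp (h.ge (Set.mem_univ x))

variable {τ : Type} (b : Module.Basis τ ℂ (grading r 1)) (κ : Unit → τ)

/-- Dehomogenization of polynomials. -/
def dehomog : MvPolynomial (Fin (r + 1)) ℂ →ₐ[ℂ] MvPolynomial (ChartVar (fun _ : τ => ()) κ) ℂ :=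
  formHom (b.constr ℂ (coord (fun _ : τ => ()) κ))

lemma dehomog_basis (v : τ) : dehomog b κ (b v) = coord (fun _ : τ => ()) κ v := by
  rw [dehomog, formHom_apply, Module.Basis.constr_basis]

lemma dehomog_self : dehomog b κ (b (κ ())) = 1 := by
  rw [dehomog_basis, coord_of_eq rfl]

/-- Rehomogenizing in the fraction field, by substituting quotients of basis forms and multiplying
by a power of the chosen form, recovers a. -/
lemma dehomog_injOn {n : ℕ} {a : MvPolynomial (Fin (r + 1)) ℂ} (ha : a ∈ grading r n)
    (h : dehomog b κ a = 0) : a = 0 := by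
  let F := FractionRing (MvPolynomial (Fin (r + 1)) ℂ)
  let ε := algebraMap (MvPolynomial (Fin (r + 1)) ℂ) F
  have hε : Function.Injective ε := IsFractionRing.injective _ _
  have hk : ε (b (κ ())) ≠ 0 := (map_ne_zero_iff _ hε).mpr fun h0 =>
    b.ne_zero _ (Subtype.ext h0)
  let χ : MvPolynomial (ChartVar (fun _ : τ => ()) κ) ℂ →+* F :=
    MvPolynomial.eval₂Hom (ε.comp MvPolynomial.C) fun v => ε (b v) / ε (b (κ ()))
  have := mul_pow_eq_of_homogeneous b (f := χ.comp (dehomog b κ).toRingHom) (g := ε)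
    (c := ε (b (κ ()))) (fun z => by
      change χ (dehomog b κ (algebraMap ℂ _ z)) = _
      rw [AlgHom.commutes]
      exact MvPolynomial.eval₂_C _ _ _) (fun v => by
      change χ (dehomog b κ (b v)) * _ = _
      rw [dehomog_basis]
      by_cases hv : v = κ ()
      · rw [coord_of_eq hv, map_one, one_mul, hv]
      · rw [coord_of_ne hv, show χ (MvPolynomial.X _) = _ from MvPolynomial.eval₂_X _ _ _,
          div_mul_cancel₀ _ hk]) ha
  change χ (dehomog b κ a) * _ = _ at this
  rw [h, map_zero, zero_mul, eq_comm] at this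
  exact (map_eq_zero_iff _ hε).mp this

lemma isUnit_dehomog : IsUnit ((dehomog b κ).toRingHom (b (κ ())).1) :=
  (congrArg IsUnit (dehomog_self b κ)).mpr isUnit_one

/-- The functions on a standard open set of projective space, as polynomials. -/
def awayToPoly : Away (grading r) (b (κ ())).1 →+*
    MvPolynomial (ChartVar (fun _ : τ => ()) κ) ℂ :=
  (IsLocalization.Away.lift (S := Localization.Away (b (κ ())).1) (b (κ ())).1
    (g := (dehomog b κ).toRingHom)
    (isUnit_dehomog b κ)).comp (algebraMap _ _)

lemma awayToPoly_mk (n : ℕ) (a : MvPolynomial (Fin (r + 1)) ℂ) (ha : a ∈ grading r (n • 1)) :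
    awayToPoly b κ (Away.mk (grading r) (b (κ ())).2 n a ha) = dehomog b κ a := by
  have h1 : algebraMap _ (Localization.Away (b (κ ())).1) ((b (κ ())).1 ^ n) *
      (Away.mk (grading r) (b (κ ())).2 n a ha).val = algebraMap _ _ a := by
    rw [Away.val_mk, Localization.mk_eq_mk']
    exact IsLocalization.mk'_spec' _ a (⟨_, n, rfl⟩ : Submonoid.powers (b (κ ())).1)
  have h2 := congrArg (IsLocalization.Away.lift (S := Localization.Away (b (κ ())).1) (b (κ ())).1
    (g := (dehomog b κ).toRingHom) (isUnit_dehomog b κ)) h1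
  rw [map_mul, IsLocalization.Away.lift_eq, IsLocalization.Away.lift_eq, map_pow] at h2
  have h3 : (dehomog b κ).toRingHom (b (κ ())).1 = 1 := dehomog_self b κ
  rw [h3, one_pow, one_mul] at h2
  rw [awayToPoly, RingHom.comp_apply, HomogeneousLocalization.algebraMap_apply]
  exact h2

lemma awayToPoly_const (z : ℂ) :
    awayToPoly b κ (fromZeroRingHom (grading r) _ (algebraMap ℂ (grading r 0) z)) =
      MvPolynomial.C z := by
  have h : fromZeroRingHom (grading r) _ (algebraMap ℂ (grading r 0) z) =
      Away.mk (grading r) (b (κ ())).2 0 (MvPolynomial.C z)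
        ((zero_smul ℕ 1).symm ▸ MvPolynomial.isHomogeneous_C _ z) := by
    refine HomogeneousLocalization.val_injective _ ?_
    rw [Away.val_mk]
    change Localization.mk _ _ = _
    congr 1
  rw [h, awayToPoly_mk]
  exact (dehomog b κ).commutes z

lemma awayToPoly_bijective : Function.Bijective (awayToPoly b κ) := by
  constructor
  · refine (injective_iff_map_eq_zero _).mpr fun x hx => ?_
    obtain ⟨n, a, ha, rfl⟩ := Away.mk_surjective (grading r) (b (κ ())).2 x
    rw [awayToPoly_mk] at hx
    obtain rfl := dehomog_injOn b κ ha hx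
    refine HomogeneousLocalization.val_injective _ ?_
    rw [Away.val_mk, Localization.mk_zero, HomogeneousLocalization.val_zero]
  · intro a
    change a ∈ (awayToPoly b κ).range
    induction a using MvPolynomial.induction_on with
    | C z => exact ⟨_, awayToPoly_const b κ z⟩
    | add p q hp hq => exact add_mem hp hq
    | mul_X p v hp =>
      refine mul_mem hp ⟨Away.mk (grading r) (b (κ ())).2 1 (b v) (b v).2, ?_⟩
      rw [awayToPoly_mk, dehomog_basis, coord_of_ne v.2]

instance : IsIso (CommRingCat.ofHom (awayToPoly b κ)) :=
  (ConcreteCategory.isIso_iff_bijective _).mpr (awayToPoly_bijective b κ)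

/-- A standard chart of projective space. -/
def projChart : ChartSpec (fun _ : τ => ()) κ ⟶ Proj (grading r) :=
  Spec.map (CommRingCat.ofHom (awayToPoly b κ)) ≫
    Proj.awayι (grading r) (b (κ ())).1 (b (κ ())).2 one_pos

instance : IsOpenImmersion (projChart b κ) :=
  inferInstanceAs (IsOpenImmersion (_ ≫ _))

lemma mem_range_projChart (x : Proj (grading r)) :
    x ∈ Set.range (projChart b κ) ↔ (b (κ ())).1 ∉ x.asHomogeneousIdeal := by
  change x ∈ (Spec.map (CommRingCat.ofHom (awayToPoly b κ)) ≫
    Proj.awayι (grading r) (b (κ ())).1 (b (κ ())).2 one_pos).opensRange ↔ _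
  rw [Scheme.Hom.opensRange_comp_of_isIso, Proj.opensRange_awayι]
  exact Iff.rfl

lemma mem_projChart_iff (v : τ) (q : ChartSpec (fun _ : τ => ()) κ) :
    (b v).1 ∈ (projChart b κ q).asHomogeneousIdeal ↔ coord (fun _ : τ => ()) κ v ∈ q.asIdeal := by
  rw [← not_iff_not]
  change projChart b κ q ∈ Proj.basicOpen (grading r) (b v).1 ↔ _
  rw [projChart, Scheme.Hom.comp_apply]
  change Spec.map (CommRingCat.ofHom (awayToPoly b κ)) q ∈
    Proj.awayι (grading r) (b (κ ())).1 (b (κ ())).2 one_pos ⁻¹ᵁ Proj.basicOpen (grading r) (b v).1 ↔ _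
  rw [Proj.awayι_preimage_basicOpen _ _ _ (b v).2 one_pos]
  change ¬ (awayToPoly b κ (Away.mk _ _ 1 ((b v).1 ^ 1) _) ∈ q.asIdeal) ↔ _
  rw [awayToPoly_mk, pow_one, dehomog_basis]

/-- The two maps together factor through the overlap of the charts, the spectrum of the degree-zero
localization at the product of the two forms, where the relation is the cancellation of fractions.
-/
lemma projChart_ratio (κ' : Unit → τ) {K : CommRingCat.{0}}
    (f : .of (MvPolynomial (ChartVar (fun _ : τ => ()) κ) ℂ) ⟶ K)
    (f' : .of (MvPolynomial (ChartVar (fun _ : τ => ()) κ') ℂ) ⟶ K)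
    (h : Spec.map f ≫ projChart b κ = Spec.map f' ≫ projChart b κ') (v : τ) :
    f (coord (fun _ : τ => ()) κ v) * f' (coord (fun _ : τ => ()) κ' (κ ())) =
      f' (coord (fun _ : τ => ()) κ' v) := by
  have hd := (b (κ ())).2
  have hd' := (b (κ' ())).2
  have hx : (b (κ ())).1 * (b (κ' ())).1 = (b (κ ())).1 * (b (κ' ())).1 := rfl
  rw [projChart, projChart, ← Category.assoc, ← Category.assoc] at h
  let m := pullback.lift _ _ h ≫
    (Proj.pullbackAwayιIso (grading r) hd one_pos hd' one_pos hx).hom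
  let g := Spec.preimage m
  have e1 : CommRingCat.ofHom (awayMap (grading r) hd' hx) ≫ g =
      CommRingCat.ofHom (awayToPoly b κ) ≫ f := by
    refine Spec.map_injective ?_
    rw [Spec.map_comp, Spec.map_preimage, Category.assoc,
      Proj.pullbackAwayιIso_hom_SpecMap_awayMap_left, pullback.lift_fst, Spec.map_comp]
  have e2 : CommRingCat.ofHom (awayMap (grading r) hd (hx.trans (mul_comm _ _))) ≫ g =
      CommRingCat.ofHom (awayToPoly b κ') ≫ f' := by
    refine Spec.map_injective ?_
    rw [Spec.map_comp, Spec.map_preimage, Category.assoc,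
      Proj.pullbackAwayιIso_hom_SpecMap_awayMap_right, pullback.lift_snd, Spec.map_comp]
  have e1' (w : τ) : g (awayMap (grading r) hd' hx (Away.mk _ hd 1 (b w).1 (b w).2)) =
      f (coord (fun _ : τ => ()) κ w) := by
    rw [← dehomog_basis b κ, ← awayToPoly_mk b κ 1 (b w).1 (b w).2]
    exact congrArg (fun f => f.hom (Away.mk _ hd 1 (b w).1 (b w).2)) e1
  have e2' (w : τ) : g (awayMap (grading r) hd (hx.trans (mul_comm _ _))
      (Away.mk _ hd' 1 (b w).1 (b w).2)) = f' (coord (fun _ : τ => ()) κ' w) := by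
    rw [← dehomog_basis b κ', ← awayToPoly_mk b κ' 1 (b w).1 (b w).2]
    exact congrArg (fun f => f.hom (Away.mk _ hd' 1 (b w).1 (b w).2)) e2
  rw [← e1', ← e2', ← e2', ← map_mul]
  congr 1
  refine HomogeneousLocalization.val_injective _ ?_
  rw [HomogeneousLocalization.val_mul, awayMap_mk, awayMap_mk, awayMap_mk, Away.val_mk, Away.val_mk,
    Away.val_mk, Localization.mk_mul, Localization.mk_eq_mk_iff, Localization.r_iff_exists]
  refine ⟨1, ?_⟩
  simp only [OneMemClass.coe_one, Submonoid.coe_mul]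
  ring

instance : SeparatesDomains (projectiveSpace r).left :=
  inferInstanceAs (SeparatesDomains (Proj (grading r)))

theorem isProductCharts_projChart :
    IsProductCharts (fun _ : τ => ()) (projectiveSpace r).hom fun κ => projChart b κ.1 where
  isOpenImmersion κ := inferInstanceAs (IsOpenImmersion (projChart b κ.1))
  cover x := by
    change Proj (grading r) at x
    by_contra! h
    replace h (v : τ) : (b v).1 ∈ x.asHomogeneousIdeal := by
      by_contra hv
      exact h (single v) ((mem_range_projChart b (single v).1 x).mpr hv)
    obtain ⟨i, hi⟩ := exists_linearForm_notMem x
    refine hi (mem_of_basis_mem b (I := x.asHomogeneousIdeal.toIdeal) h ⟨_, MvPolynomial.isHomogeneous_X _ i⟩)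
  const κ := by
    change (Spec.map _ ≫ Proj.awayι (grading r) (b (κ.1 ())).1 (b (κ.1 ())).2 one_pos) ≫
      Proj.toSpecZero (grading r) ≫ _ = _
    rw [Category.assoc, Proj.awayι_toSpecZero_assoc, ← Spec.map_comp, ← Spec.map_comp]
    congr 1
    ext1
    exact RingHom.ext fun z => awayToPoly_const b κ.1 z
  ratio κ κ' _ _ f f' h v := projChart_ratio b κ.1 κ'.1 f f' h v
  mem_range κ κ' q h := (mem_range_projChart b κ.1 (projChart b κ'.1 q)).mpr
    ((mem_projChart_iff b κ'.1 (κ.1 ()) q).not.mpr (h ()))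

end ProjectiveCharts


/-! ### Choosing bases of linear forms -/

section Bases

variable {r : ℕ}

lemma span_linearForm_X : (⊤ : Submodule ℂ (grading r 1)) ≤ Submodule.span ℂ (Set.range fun i =>
    (⟨MvPolynomial.X i, MvPolynomial.isHomogeneous_X _ i⟩ : grading r 1)) := fun w _ => by
  induction w using linearForm_induction with
  | X i => exact Submodule.subset_span ⟨i, rfl⟩
  | zero => exact zero_mem _
  | add v w hv hw => exact add_mem (hv trivial) (hw trivial)
  | smul a w hw => exact Submodule.smul_mem _ a (hw trivial)

lemma linearIndependent_linearForm_X : LinearIndependent ℂ fun i =>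
    (⟨MvPolynomial.X i, MvPolynomial.isHomogeneous_X _ i⟩ : grading r 1) :=
  LinearIndependent.of_comp (grading r 1).subtype (MvPolynomial.linearIndependent_X _ _)

instance : FiniteDimensional ℂ (grading r 1) :=
  Module.Finite.of_basis (Module.Basis.mk linearIndependent_linearForm_X span_linearForm_X)

lemma finrank_linearForm : Module.finrank ℂ (grading r 1) = r + 1 := by
  rw [Module.finrank_eq_card_basis (Module.Basis.mk linearIndependent_linearForm_X span_linearForm_X),
    Fintype.card_fin]

/-- The linear forms that vanish at a point. -/
def formsAt (x : Proj (grading r)) : Submodule ℂ (grading r 1) :=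
  (x.asHomogeneousIdeal.toIdeal.restrictScalars ℂ).comap (grading r 1).subtype

lemma mem_formsAt {x : Proj (grading r)} {w : grading r 1} :
    w ∈ formsAt x ↔ w.1 ∈ x.asHomogeneousIdeal := Iff.rfl

lemma formsAt_ne_top (x : Proj (grading r)) : formsAt x ≠ ⊤ := fun h => by
  obtain ⟨i, hi⟩ := exists_linearForm_notMem x
  exact hi (mem_formsAt.mp (h ▸ Submodule.mem_top :
    (⟨MvPolynomial.X i, MvPolynomial.isHomogeneous_X _ i⟩ : grading r 1) ∈ formsAt x))

/-- Over the infinite field ℂ the linear forms are not a finite union of proper subspaces. A form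
outside the line of l and outside the forms vanishing at each given point is independent of l, and
the pair extends to a basis. -/
lemma exists_basis_linearForm (hr : 1 ≤ r) {l : grading r 1} (hl : l ≠ 0)
    {S : Set (Proj (grading r))} (hS : S.Finite) :
    ∃ (τ : Type) (_ : Fintype τ) (b : Module.Basis τ ℂ (grading r 1)) (u e : τ),
      u ≠ e ∧ b e = l ∧ ∀ x ∈ S, (b u).1 ∉ x.asHomogeneousIdeal := by
  have hsp : Submodule.span ℂ {l} ≠ ⊤ := fun h => by
    have := finrank_span_singleton (K := ℂ) hl
    rw [h, finrank_top, finrank_linearForm] at this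
    omega
  have hfin : (insert (Submodule.span ℂ {l}) (formsAt '' S)).Finite := (hS.image _).insert _
  have h1 := Subspace.biUnion_ne_univ_of_top_notMem (s := hfin.toFinset) (by
    rw [Set.Finite.mem_toFinset]
    rintro (h | ⟨x, -, h⟩)
    · exact hsp h.symm
    · exact formsAt_ne_top x h)
  obtain ⟨w, hw⟩ := (Set.ne_univ_iff_exists_notMem _).mp h1
  simp only [Set.Finite.mem_toFinset, Set.mem_iUnion, exists_prop, not_exists, not_and] at hw
  have hwl := hw _ (Set.mem_insert _ _)
  have hind : LinearIndepOn ℂ id (insert w {l}) :=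
    (LinearIndepOn.singleton (v := id) hl).id_insert hwl
  let b := Module.Basis.extend hind
  have hsub := Module.Basis.subset_extend hind
  have : Finite (hind.extend (Set.subset_univ _)) := Module.Finite.finite_basis b
  refine ⟨_, Fintype.ofFinite _, b, ⟨w, hsub (Set.mem_insert _ _)⟩,
    ⟨l, hsub (Set.mem_insert_of_mem _ rfl)⟩, fun h => hwl ?_, Module.Basis.extend_apply_self hind _,
    fun x hx => ?_⟩
  · rw [show w = l from congrArg Subtype.val h]
    exact Submodule.mem_span_singleton_self l
  · rw [show b _ = w from Module.Basis.extend_apply_self hind _]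
    exact hw _ (Set.mem_insert_of_mem _ ⟨x, hx, rfl⟩)

lemma exists_ne_ne {τ : Type} [Fintype τ] (h : 3 ≤ Fintype.card τ) (u e : τ) :
    ∃ v, v ≠ u ∧ v ≠ e := by
  classical
  obtain ⟨v, -, hv⟩ := Finset.exists_mem_notMem_of_card_lt_card (s := {u, e}) (t := Finset.univ)
    (Finset.card_le_two.trans_lt h)
  exact ⟨v, by simpa using hv⟩

lemma exists_pair_ne_ne {τ : Type} [Fintype τ] (h : 4 ≤ Fintype.card τ) (u e : τ) :
    ∃ v w, v ≠ w ∧ (v ≠ u ∧ v ≠ e) ∧ w ≠ u ∧ w ≠ e := by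
  classical
  obtain ⟨v, hv⟩ := exists_ne_ne (by omega) u e
  obtain ⟨w, -, hw⟩ := Finset.exists_mem_notMem_of_card_lt_card (s := {u, e, v}) (t := Finset.univ)
    (Finset.card_le_three.trans_lt h)
  simp only [Finset.mem_insert, Finset.mem_singleton, not_or] at hw
  exact ⟨v, w, Ne.symm hw.2.2, hv, hw.1, hw.2.1⟩

end Bases

/-! ### Closed points and their coordinates -/

section Points

variable {σ : Type}

lemma vanishingIdeal_singleton (x : σ → ℂ) : MvPolynomial.vanishingIdeal ℂ {x} =
    Ideal.span (Set.range fun v => MvPolynomial.X v - MvPolynomial.C (x v)) := by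
  refine le_antisymm (fun f hf => ?_) (Ideal.span_le.mpr ?_)
  · have h (f : MvPolynomial σ ℂ) : f - MvPolynomial.C (MvPolynomial.aeval x f) ∈
        Ideal.span (Set.range fun v => MvPolynomial.X v - MvPolynomial.C (x v)) := by
      rw [← Ideal.Quotient.eq]
      have e : (Ideal.Quotient.mk (Ideal.span (Set.range fun v =>
          MvPolynomial.X v - MvPolynomial.C (x v)))) = ((Ideal.Quotient.mk _).comp
          MvPolynomial.C).comp (MvPolynomial.aeval x : MvPolynomial σ ℂ →ₐ[ℂ] ℂ).toRingHom := by
        refine MvPolynomial.ringHom_ext (fun z => ?_) fun v => ?_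
        · simp
        · refine (Ideal.Quotient.eq.mpr (Ideal.subset_span (α := MvPolynomial σ ℂ)
            (Set.mem_range_self v))).trans ?_
          simp
      exact congrArg (fun g => g f) e
    have := h f
    rwa [(MvPolynomial.mem_vanishingIdeal_singleton_iff x f).mp hf, map_zero, sub_zero] at this
  · rintro _ ⟨v, rfl⟩
    rw [SetLike.mem_coe, MvPolynomial.mem_vanishingIdeal_singleton_iff]
    simp

/-- Closedness makes the prime maximal, and the Nullstellensatz over ℂ gives the coordinates. -/
lemma exists_asIdeal_eq_vanishingIdeal [Finite σ] {Y : Scheme.{0}}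
    {c : Spec (.of (MvPolynomial σ ℂ)) ⟶ Y} [IsOpenImmersion c] {q : Spec (.of (MvPolynomial σ ℂ))}
    (h : IsClosed {c q}) : ∃ x : σ → ℂ, q.asIdeal = MvPolynomial.vanishingIdeal ℂ {x} := by
  refine MvPolynomial.eq_vanishingIdeal_singleton_of_isMaximal ℂ
    ((PrimeSpectrum.isClosed_singleton_iff_isMaximal q).mp ?_)
  have h := h.preimage c.continuous
  rwa [← Set.image_singleton, Set.preimage_image_eq _ c.isOpenEmbedding.injective] at h

/-- Closed points of a chart form a centre. -/
lemma exists_isCentre {J σ : Type} [Finite σ] {Y : Scheme.{0}} {pr : σ → J} {s : Y ⟶ Spec (.of ℂ)}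
    {c : ∀ κ : Choice pr, ChartSpec pr κ.1 ⟶ Y} (C : IsProductCharts pr s c) (o : Choice pr)
    (Z : Closeds Y) (hclosed : ∀ y ∈ Z, IsClosed {y}) (ho : ∀ y ∈ Z, y ∈ Set.range (c o))
    (two : ∀ _ : Z, ∃ v w, v ≠ w ∧ v ≠ o.1 (pr v) ∧ w ≠ o.1 (pr w)) :
    ∃ (P : Z → ChartSpec pr o.1) (pt : Z → σ → ℂ), IsCentre c o Z P pt ∧
      (∀ l, c o (P l) = l) ∧ ∀ l v, coord pr o.1 v ∈ (P l).asIdeal → pt l v = 0 := by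
  have := C.isOpenImmersion o
  choose P hP using fun l : Z => ho l.1 l.2
  choose x hx using fun l : Z =>
    exists_asIdeal_eq_vanishingIdeal (c := c o) (q := P l) ((hP l).symm ▸ hclosed l.1 l.2)
  have hX (l : Z) (v : ChartVar pr o.1) :
      MvPolynomial.aeval (x l) (coord pr o.1 v.1) = x l v := by
    rw [coord_of_ne v.2, MvPolynomial.aeval_X]
  refine ⟨P, fun l v => MvPolynomial.aeval (x l) (coord pr o.1 v),
    { mem_iff := fun y => ⟨fun hy => ⟨⟨y, hy⟩, (hP ⟨y, hy⟩).symm⟩, ?_⟩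
      closed := fun l => (hP l).symm ▸ hclosed l.1 l.2
      ideal := fun l => ?_
      one := fun l j => ?_
      inj := fun l l' h => ?_
      two := two }, hP, fun l v h => ?_⟩
  · rintro ⟨l, rfl⟩
    exact (hP l).symm ▸ l.2
  · simp only [hX]
    rw [hx, vanishingIdeal_singleton]
  · rw [coord_of_eq (by rw [o.2]), map_one]
  · have h1 : x l = x l' := funext fun v => by
      rw [← hX, ← hX]
      exact congrFun h v.1
    refine Subtype.ext ?_
    rw [← hP, ← hP]
    congr 1
    exact PrimeSpectrum.ext (by rw [hx, hx, h1])
  · rw [hx] at h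
    exact (MvPolynomial.mem_vanishingIdeal_singleton_iff _ _).mp h

end Points


/-! ### The product of projective spaces -/

section ProductOfProjectiveSpaces

variable {p : ℕ} {r : Fin p → ℕ} {τ : Fin p → Type}
  (b : ∀ j, Module.Basis (τ j) ℂ (grading (r j) 1))

lemma isProductCharts_factor (j : Fin p) :
    IsProductCharts (fun _ : τ j => ()) (projectiveSpace (r j)).hom
      fun κ => projChart (b j) κ.1 :=
  isProductCharts_projChart (b j)

/-- A chart of the product of projective spaces. -/
abbrev prodProjChart (κ : Choice (Sigma.fst : (Σ j, τ j) → Fin p)) :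
    ChartSpec (Sigma.fst : (Σ j, τ j) → Fin p) κ.1 ⟶ (prodProj r).left :=
  prodChart (isProductCharts_factor b) κ

lemma isProductCharts_prodProj (j₀ : Fin p) :
    IsProductCharts (Sigma.fst : (Σ j, τ j) → Fin p) (prodProj r).hom (prodProjChart b) :=
  have : Nonempty (Fin p) := ⟨j₀⟩
  isProductCharts_prod (isProductCharts_factor b)

lemma prodProjChart_mem_iff (κ : Choice (Sigma.fst : (Σ j, τ j) → Fin p)) (j : Fin p) (v : τ j)
    (q : ChartSpec (Sigma.fst : (Σ j, τ j) → Fin p) κ.1) :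
    prodProjection r j (prodProjChart b κ q) ∈ vanishingLocus (b j v).1 ↔
      coord Sigma.fst κ.1 ⟨j, v⟩ ∈ q.asIdeal := by
  rw [← inclFactor_coord]
  refine Iff.trans ?_ (mem_projChart_iff (b j) (single (component κ j)).1 v
    (Spec.map (CommRingCat.ofHom (inclFactor κ j)) q))
  exact Iff.of_eq (congrArg (· ∈ vanishingLocus (b j v).1)
    (prodChart_π_apply (isProductCharts_factor b) κ j q))

lemma mem_range_prodProjChart (j₀ : Fin p) (κ : Choice (Sigma.fst : (Σ j, τ j) → Fin p))
    {y : (prodProj r).left}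
    (h : ∀ j, (show Proj (grading (r j)) from prodProjection r j y) ∈
      Set.range (projChart (b j) (single (component κ j)).1)) :
    y ∈ Set.range (prodProjChart b κ) :=
  have : Nonempty (Fin p) := ⟨j₀⟩
  (isOpenImmersion_prodChart (isProductCharts_factor b) κ).2 y h

end ProductOfProjectiveSpaces

/-- Only in the factor j₀ is the form `e j` significant; in the others an arbitrary nonzero form is
prescribed, so that all factors are treated alike. -/
lemma exists_bases {p : ℕ} {r : Fin p → ℕ} (hr : ∀ j, 2 ≤ r j) (j₀ : Fin p)
    {l : MvPolynomial (Fin (r j₀ + 1)) ℂ} (hl : l.IsHomogeneous 1) (hl0 : l ≠ 0)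
    {S : Set (prodProj r).left} (hS : S.Finite) :
    ∃ (τ : Fin p → Type) (_ : ∀ j, Fintype (τ j))
      (b : ∀ j, Module.Basis (τ j) ℂ (grading (r j) 1)) (u e : ∀ j, τ j),
      (∀ j, u j ≠ e j) ∧ (b j₀ (e j₀)).1 = l ∧
      ∀ y ∈ S, ∀ j, prodProjection r j y ∉ vanishingLocus (b j (u j)).1 := by
  classical
  let L : ∀ j, grading (r j) 1 := Function.update
    (fun j => ⟨MvPolynomial.X 0, MvPolynomial.isHomogeneous_X _ 0⟩) j₀ ⟨l, hl⟩
  have hL (j : Fin p) : L j ≠ 0 := by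
    by_cases hj : j = j₀
    · subst hj
      rw [show L j = ⟨l, hl⟩ from Function.update_self _ _ _]
      exact fun h => hl0 (congrArg Subtype.val h)
    · rw [show L j = _ from Function.update_of_ne hj _ _]
      exact fun h => MvPolynomial.X_ne_zero (R := ℂ) (0 : Fin (r j + 1)) (congrArg Subtype.val h)
  choose τ hτ b u e hue hbe hu using fun j => exists_basis_linearForm
    ((Nat.le_succ 1).trans (hr j)) (hL j) (hS.image (prodProjection r j))
  refine ⟨τ, hτ, b, u, e, hue, ?_, fun y hy j => hu j _ ⟨y, hy, rfl⟩⟩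
  rw [hbe, show L j₀ = ⟨l, hl⟩ from Function.update_self _ _ _]

end
end EulerChow


open AlgebraicGeometry CategoryTheory TopologicalSpace EulerChow in
theorem proposition3p6
    -- the product of projective spaces and the pull-back `P` of a hyperplane
    {p : ℕ} (r : Fin p → ℕ) (hr : ∀ j, 2 ≤ r j) (j₀ : Fin p)
    (l : MvPolynomial (Fin (r j₀ + 1)) ℂ) (hl : l.IsHomogeneous 1) (hl0 : l ≠ 0)
    (P : Set (prodProj r).left) (hP : P = prodProjection r j₀ ⁻¹' vanishingLocus l)
    -- the finite set of points on `P`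
    (Λ : Closeds (prodProj r).left) (hΛ : (Λ : Set (prodProj r).left).Finite)
    (hΛclosed : ∀ y ∈ Λ, IsClosed {y}) (hΛP : (Λ : Set (prodProj r).left) ⊆ P)
    (hdim : (Λ : Set (prodProj r).left).Nonempty → 3 ≤ ∑ j, r j)
    -- the blow-up and the proper transform of `P`
    (X : Scheme.{0}) [IsIntegral X] (π : X ⟶ (prodProj r).left)
    (hπ : IsBlowup π (Scheme.IdealSheafData.vanishingIdeal Λ))
    (Phat : Scheme.{0}) [IsIntegral Phat] (i : Phat ⟶ X) [IsClosedImmersion i]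
    (hi : Set.range i = closure (π ⁻¹' (P \ Λ))) :
    let sX : X ⟶ Spec (.of ℂ) := π ≫ (prodProj r).hom
    let sP : Phat ⟶ Spec (.of ℂ) := i ≫ sX
    -- all spaces of sections are finite-dimensional
    (∀ D : CartierDivisor X, FiniteDimensional ℂ (H0 sX D)) ∧
    (∀ D : CartierDivisor Phat, FiniteDimensional ℂ (H0 sP D)) ∧
    -- `i^*` is an isomorphism of Picard groups
    Function.Bijective (Pic.pullback i) ∧
    -- `F` is the class of the proper transform as a divisor on `X`, and `L` is the monoid `L_F`
    ∃ (F₀ : CartierDivisor X) (F : effMonoid X) (L : AddSubmonoid (Pic X))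
      (e : effMonoid Phat →+ effMonoid X),
      IsDivisorOf F₀ i.ker ∧ (F : Pic X) = Pic.mk F₀ ∧
      (L : Set (Pic X)) = {D | h0 sX (D - F) < h0 sX D} ∧
      -- `i^*` maps `L` isomorphically onto the effective monoid of the proper transform,
      -- and `e` is the inverse isomorphism, followed by the inclusion of `L`
      L.map (Pic.pullback i) = effMonoid Phat ∧
      Function.Injective e ∧ (∀ D, Pic.pullback i (e D : Pic X) = D) ∧
      (∀ D : effMonoid X, D ∈ Set.range e ↔ (D : Pic X) ∈ L) ∧
      (∀ D ∈ L, D ∈ effMonoid X) ∧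
      -- the identity of series, along `e`
      conv (tpow 0 - tpow F) (eulerChow sX) = Function.extend e (eulerChow sP) 0 ∧
      ∀ D ∈ L, (h0 sP (Pic.pullback i D) : ℤ) = h0 sX D - h0 sX (D - F) := by
  obtain ⟨τ, _, b, u, e, hue, hbe, hu⟩ := exists_bases hr j₀ hl hl0 hΛ
  have hne : Nonempty (Fin p) := ⟨j₀⟩
  have hcard (j : Fin p) : Fintype.card (τ j) = r j + 1 := by
    rw [← Module.finrank_eq_card_basis (b j), finrank_linearForm]
  have hone (j : Fin p) {v : τ j} (hv : v ≠ e j) :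
      (⟨j, v⟩ : Σ j, τ j) ≠ ⟨j₀, e j₀⟩ := fun h => by
    obtain rfl := congrArg Sigma.fst h
    exact hv (eq_of_heq (Sigma.mk.inj h).2)
  let o : Fin p → Rest (⟨j₀, e j₀⟩ : Σ j, τ j) := fun j => ⟨⟨j, u j⟩, hone j (hue j)⟩
  have ho (j : Fin p) : (o j).1.1 = j := rfl
  have hoj {j : Fin p} {v : τ j} (hv : v ≠ u j) (hv' : v ≠ e j) :
      (⟨⟨j, v⟩, hone j hv'⟩ : Rest (⟨j₀, e j₀⟩ : Σ j, τ j)) ≠ o j := fun h =>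
    hv (eq_of_heq (Sigma.mk.inj (congrArg Subtype.val h)).2)
  -- There are r_j + 1 ≥ 3 basis forms, so one remains besides `u j` and `e j`; it provides the
  -- hyperplane at infinity of each factor on the proper transform.
  have hJ (j : Fin p) : ∃ v : Rest (⟨j₀, e j₀⟩ : Σ j, τ j), v.1.1 = j ∧ v ≠ o j := by
    obtain ⟨v, hv, hv'⟩ := exists_ne_ne (by rw [hcard]; have := hr j; omega) (u j) (e j)
    exact ⟨⟨⟨j, v⟩, hone j hv'⟩, rfl, hoj hv hv'⟩
  -- Two affine coordinates on P: taken from different factors if there are several. With a single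
  -- factor the dimension hypothesis gives r ≥ 3, hence four basis forms.
  have htwo (y : Λ) : ∃ v w : Rest (⟨j₀, e j₀⟩ : Σ j, τ j),
      v ≠ w ∧ v ≠ o v.1.1 ∧ w ≠ o w.1.1 := by
    by_cases hp : ∃ j, j ≠ j₀
    · obtain ⟨j, hj⟩ := hp
      obtain ⟨v, hv, hv'⟩ := hJ j
      obtain ⟨w, hw, hw'⟩ := hJ j₀
      exact ⟨v, w, fun h => hj (by rw [← hv, h, hw]), hv.symm ▸ hv', hw.symm ▸ hw'⟩
    · push Not at hp
      have h3 := hdim ⟨y.1, y.2⟩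
      rw [Fintype.sum_eq_single j₀ fun j hj => absurd (hp j) hj] at h3
      obtain ⟨v, w, hvw, ⟨hv, hv'⟩, hw, hw'⟩ :=
        exists_pair_ne_ne (by rw [hcard]; omega) (u j₀) (e j₀)
      exact ⟨⟨⟨j₀, v⟩, hone j₀ hv'⟩, ⟨⟨j₀, w⟩, hone j₀ hw'⟩, fun h =>
        hvw (eq_of_heq (Sigma.mk.inj (congrArg Subtype.val h)).2), hoj hv hv', hoj hw hw'⟩
  let κ : Choice (Sigma.fst : (Σ j, τ j) → Fin p) := ⟨under o, ho⟩
  have C := isProductCharts_prodProj b j₀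
  have hH (κ : Choice (Sigma.fst : (Σ j, τ j) → Fin p)) (q) :
      prodProjChart b κ q ∈ P ↔ coord Sigma.fst κ.1 ⟨j₀, e j₀⟩ ∈ q.asIdeal := by
    rw [hP, ← prodProjChart_mem_iff, hbe]
    rfl
  have : Fintype Λ := hΛ.fintype
  obtain ⟨q, pt, E, hq, hpt⟩ := exists_isCentre C κ Λ hΛclosed (fun y hy => by
    refine mem_range_prodProjChart b j₀ κ fun j => ?_
    exact (mem_range_projChart (b j) _ _).mpr (hu y hy j)) fun y => by
    obtain ⟨v, w, hvw, hv, hw⟩ := htwo y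
    exact ⟨v, w, fun h => hvw (Subtype.ext h), fun h => hv (Subtype.ext h),
      fun h => hw (Subtype.ext h)⟩
  have : SeparatesDomains (prodProj r).left :=
    inferInstanceAs (SeparatesDomains (Limits.piObj fun j => projectiveSpace (r j)).left)
  -- Since Λ lies on P, the coordinate given by l vanishes at every centre.
  exact eulerChow_of_charts (ho := ho) C E
    (fun y => hpt y _ ((hH κ (q y)).mp (hq y ▸ hΛP y.2))) htwo hJ hH hπ i hi
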